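/- **Notation.** Fix $n$. For $x\in\mathbb R^n$ let $\langle x\rangle=(1+|x|^2)^{1/2}$. For $m,\mu\in\mathbb R$, $S^{m,\mu}=S^{m,\mu}(\mathbb R^{2n})$ is the space of $a\in C^\infty(\mathbb R^n\times\mathbb R^n)$ such that for all multi-indices $\alpha,\beta$ there is $C_{\alpha\beta}$ with $|\partial_x^\alpha\partial_\xi^\beta a(x,\xi)|\le C_{\alpha\beta}\langle x\rangle^{m-|\alpha|}\langle\xi\rangle^{\mu-|\beta|}$ for all $x,\xi$; a family is bounded in $S^{m,\mu}$ if all its members satisfy these bounds with the same constants $C_{\alpha\beta}$. The class $\mathcal P$ of SG phase functions consists of the real-valued $\varphi\in S^{1,1}$ with $\langle\varphi'_x(x,\xi)\rangle\asymp\langle\xi\rangle$ and $\langle\varphi'_\xi(x,\xi)\rangle\asymp\langle x\rangle$ as $|(x,\xi)|\to\infty$. For $r>0$ and $\tau\in[0,1)$, $\mathcal P_r(\tau)$ is the set of $\varphi\in\mathcal P$ such that $|\det\varphi''_{x\xi}(x,\xi)|\ge r$ for all $(x,\xi)$ and $J(x,\xi):=\varphi(x,\xi)-x\cdot\xi$ satisfies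 $$|\partial_x^\alpha\partial_\xi^\beta J(x,\xi)|\le\tau\,\langle x\rangle^{1-|\alpha|}\langle\xi\rangle^{1-|\beta|}\qquad\text{for } |\alpha+\beta|\le 2,\ x,\xi\in\mathbb R^n.$$ For $u\in\mathcal S(\mathbb R^n)$, with $\hat u(\xi)=\int e^{-ix\cdot\xi}u(x)\,dx$, put $$(\mathrm{Op}_\varphi(a)u)(x)=(2\pi)^{-n}\int e^{i\varphi(x,\xi)}a(x,\xi)\hat u(\xi)\,d\xi,\qquad(\mathrm{Op}^*_\varphi(a)u)(x)=(2\pi)^{-n}\int\Big(\int e^{i(x\cdot\xi-\varphi(y,\xi))}\,\overline{a(y,\xi)}\,u(y)\,dy\Big)d\xi,$$ and $I_\varphi=\mathrm{Op}_\varphi(1)$, $I_\varphi^*=\mathrm{Op}_\varphi^*(1)$. If for every $(x,\xi)$ the system $Y=\varphi'_{1,\xi}(x,N)$, $N=\varphi'_{2,x}(Y,\xi)$ has a unique solution $(Y,N)=(Y,N)(x,\xi)$, the multi-product of $\varphi_1,\varphi_2$ is well defined, and it is $$(\varphi_1\#\varphi_2)(x,\xi)=\varphi_1(x,N)-Y\cdot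 N+\varphi_2(Y,\xi).$$ **Theorem 4.2.** For every $n$ there is $\tau\in(0,\tfrac14]$, depending only on $n$, such that the following holds for every $r>0$. 1. Let $\varphi_j\in\mathcal P_r(\tau_j)$, $j=1,2$, with $\tau_1,\tau_2\ge0$ and $\tau_1+\tau_2\le\tau$. Then $\varphi_1\#\varphi_2$ is well defined and belongs to $\mathcal P$, the operators $I_{\varphi_j}$, $I^*_{\varphi_j}$ ($j=1,2$) map $\mathcal S(\mathbb R^n)$ into itself, and there exists $p\in S^{0,0}$ such that, on $\mathcal S(\mathbb R^n)$, $$I_{\varphi_1}\circ I_{\varphi_2}=\mathrm{Op}_{\varphi_1\#\varphi_2}(p),\qquad I^*_{\varphi_2}\circ I^*_{\varphi_1}=\mathrm{Op}^*_{\varphi_1\#\varphi_2}(p).\tag{$*$}$$ 2. Let $\{\varphi_{1s}\}$, $\{\varphi_{2s}\}$ be families with $\varphi_{js}\in\mathcal P_r(\tau_{js})$, $\tau_{js}\ge0$ and $\tau_{1s}+\tau_{2s}\le\tau$ for every $s$, such that the families $J_{js}(x,\xi)=\varphi_{js}(x,\xi)-x\cdot\xi$ are bounded in $S^{1,1}$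 for $j=1,2$. Then every family $\{p_s\}\subset S^{0,0}$ such that $p_s$ satisfies $(*)$ for $\varphi_{1s},\varphi_{2s}$ for each $s$ is bounded in $S^{0,0}$. -/

import Mathlib

open scoped ContDiff SchwartzMap
open MeasureTheory

noncomputable section

/-- The base space `ℝⁿ` with its Euclidean norm, inner product and Lebesgue measure. -/
abbrev SGSpace (n : ℕ) : Type := EuclideanSpace ℝ (Fin n)

/-- The Japanese bracket `⟨x⟩ = (1 + |x|²)^(1/2)`. -/
def japaneseBracket {n : ℕ} (x : SGSpace n) : ℝ := Real.sqrt (1 + ‖x‖ ^ 2)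

/-- The mixed partial derivative `∂_{x_{i 0}} ⋯ ∂_{x_{i (k-1)}} ∂_{ξ_{j 0}} ⋯ ∂_{ξ_{j (l-1)}} a`
of a function `a` of `z = (x, ξ)`. As `i` and `j` vary, these are all the derivatives
`∂_x^α ∂_ξ^β a` with multi-indices of length `|α| = k` and `|β| = l`. -/
def mixedPartial {n : ℕ} {F : Type*} [NormedAddCommGroup F] [NormedSpace ℝ F]
    (a : SGSpace n × SGSpace n → F) {k l : ℕ} (i : Fin k → Fin n) (j : Fin l → Fin n)
    (z : SGSpace n × SGSpace n) : F :=
  iteratedFDeriv ℝ (k + l) a z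
    (Fin.append (fun s => ((EuclideanSpace.single (i s) (1 : ℝ) : SGSpace n), (0 : SGSpace n)))
      (fun t => ((0 : SGSpace n), (EuclideanSpace.single (j t) (1 : ℝ) : SGSpace n))))

/-- For all `|α| = k`, `|β| = l` and all `x, ξ`:
`|∂_x^α ∂_ξ^β a(x, ξ)| ≤ C ⟨x⟩^(m - |α|) ⟨ξ⟩^(μ - |β|)`. -/
def SGBound {n : ℕ} {F : Type*} [NormedAddCommGroup F] [NormedSpace ℝ F]
    (m μ : ℝ) (k l : ℕ) (C : ℝ) (a : SGSpace n × SGSpace n → F) : Prop :=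
  ∀ (i : Fin k → Fin n) (j : Fin l → Fin n) (x ξ : SGSpace n),
    ‖mixedPartial a i j (x, ξ)‖ ≤
      C * japaneseBracket x ^ (m - (k : ℝ)) * japaneseBracket ξ ^ (μ - (l : ℝ))

/-- The class `S^{m,μ}(ℝ²ⁿ)` of SG symbols. -/
structure SGSymbol {n : ℕ} {F : Type*} [NormedAddCommGroup F] [NormedSpace ℝ F]
    (m μ : ℝ) (a : SGSpace n × SGSpace n → F) : Prop where
  smooth : ContDiff ℝ ∞ a
  bound : ∀ k l : ℕ, ∃ C : ℝ, SGBound m μ k l C a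

/-- Bounded families in the Fréchet space `S^{m,μ}(ℝ²ⁿ)`: every seminorm is bounded uniformly
over the family. -/
structure SGBoundedFamily {n : ℕ} {F : Type*} [NormedAddCommGroup F] [NormedSpace ℝ F]
    {ι : Type*} (m μ : ℝ) (a : ι → SGSpace n × SGSpace n → F) : Prop where
  smooth : ∀ s, ContDiff ℝ ∞ (a s)
  bound : ∀ k l : ℕ, ∃ C : ℝ, ∀ s, SGBound m μ k l C (a s)

/-- `φ'_x(x, ξ)`, the gradient in the first variable. -/
def gradX {n : ℕ} (φ : SGSpace n × SGSpace n → ℝ) (z : SGSpace n × SGSpace n) : SGSpace n :=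
  gradient (fun y => φ (y, z.2)) z.1

/-- `φ'_ξ(x, ξ)`, the gradient in the second variable. -/
def gradXi {n : ℕ} (φ : SGSpace n × SGSpace n → ℝ) (z : SGSpace n × SGSpace n) : SGSpace n :=
  gradient (fun η => φ (z.1, η)) z.2

/-- The class `𝒫` of SG phase functions: `φ ∈ S^{1,1}` is real valued and
`⟨φ'_x(x, ξ)⟩ ≍ ⟨ξ⟩`, `⟨φ'_ξ(x, ξ)⟩ ≍ ⟨x⟩` as `|(x, ξ)| → ∞`. -/
structure SGPhase {n : ℕ} (φ : SGSpace n × SGSpace n → ℝ) : Prop where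
  symbol : SGSymbol 1 1 φ
  gradX_theta : Asymptotics.IsTheta (Filter.cocompact (SGSpace n × SGSpace n))
    (fun z => japaneseBracket (gradX φ z)) (fun z => japaneseBracket z.2)
  gradXi_theta : Asymptotics.IsTheta (Filter.cocompact (SGSpace n × SGSpace n))
    (fun z => japaneseBracket (gradXi φ z)) (fun z => japaneseBracket z.1)

/-- `J(x, ξ) = φ(x, ξ) - x · ξ`. -/
def phasePerturbation {n : ℕ} (φ : SGSpace n × SGSpace n → ℝ) :
    SGSpace n × SGSpace n → ℝ :=
  fun z => φ z - inner ℝ z.1 z.2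

/-- The class `𝒫_r(τ)` of regular SG phase functions (for `r > 0` and `0 ≤ τ < 1`). -/
structure SGRegularPhase {n : ℕ} (r τ : ℝ) (φ : SGSpace n × SGSpace n → ℝ) : Prop where
  phase : SGPhase φ
  det_ge : ∀ z, r ≤ |(Matrix.of fun i j : Fin n => mixedPartial φ ![i] ![j] z).det|
  small : ∀ k l : ℕ, k + l ≤ 2 → SGBound 1 1 k l τ (phasePerturbation φ)

/-- `w = (Y, N)` solves the critical point system `Y = φ₁'_ξ(x, N)`, `N = φ₂'_x(Y, ξ)`. -/
def IsSharpCriticalPoint {n : ℕ} (φ₁ φ₂ : SGSpace n × SGSpace n → ℝ)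
    (z w : SGSpace n × SGSpace n) : Prop :=
  w.1 = gradXi φ₁ (z.1, w.2) ∧ w.2 = gradX φ₂ (w.1, z.2)

/-- The multi-product `φ₁ # φ₂` is well defined: for each `(x, ξ)` the critical point system has
exactly one solution. -/
def SharpWellDefined {n : ℕ} (φ₁ φ₂ : SGSpace n × SGSpace n → ℝ) : Prop :=
  ∀ z, ∃! w, IsSharpCriticalPoint φ₁ φ₂ z w

/-- The multi-product
`(φ₁ # φ₂)(x, ξ) = φ₁(x, N) - Y · N + φ₂(Y, ξ)`, where `(Y, N)` is the critical point. It is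
meaningful only when `SharpWellDefined φ₁ φ₂` holds. -/
def sharp {n : ℕ} (φ₁ φ₂ : SGSpace n × SGSpace n → ℝ) : SGSpace n × SGSpace n → ℝ :=
  fun z =>
    let w := Classical.epsilon (IsSharpCriticalPoint φ₁ φ₂ z)
    φ₁ (z.1, w.2) - inner ℝ w.1 w.2 + φ₂ (w.1, z.2)

/-- `û(ξ) = ∫ e^{-i x·ξ} u(x) dx`. -/
def fourierHat {n : ℕ} (u : SGSpace n → ℂ) (ξ : SGSpace n) : ℂ :=
  ∫ x, Complex.exp (-(Complex.I * ((inner ℝ x ξ : ℝ) : ℂ))) * u x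

/-- The type I operator
`(Op_φ(a) u)(x) = (2π)^{-n} ∫ e^{i φ(x, ξ)} a(x, ξ) û(ξ) dξ`. -/
def fioI {n : ℕ} (φ : SGSpace n × SGSpace n → ℝ) (a : SGSpace n × SGSpace n → ℂ)
    (u : SGSpace n → ℂ) (x : SGSpace n) : ℂ :=
  ((2 * Real.pi : ℝ) : ℂ)⁻¹ ^ n *
    ∫ ξ, Complex.exp (Complex.I * (φ (x, ξ) : ℂ)) * a (x, ξ) * fourierHat u ξ

/-- The type II operator
`(Op*_φ(a) u)(x) = (2π)^{-n} ∫ ∫ e^{i (x·ξ - φ(y, ξ))} conj(a(y, ξ)) u(y) dy dξ`,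
the iterated integral in the order shown. -/
def fioII {n : ℕ} (φ : SGSpace n × SGSpace n → ℝ) (a : SGSpace n × SGSpace n → ℂ)
    (u : SGSpace n → ℂ) (x : SGSpace n) : ℂ :=
  ((2 * Real.pi : ℝ) : ℂ)⁻¹ ^ n *
    ∫ ξ, ∫ y, Complex.exp (Complex.I * ((inner ℝ x ξ - φ (y, ξ) : ℝ) : ℂ)) *
      (starRingEnd ℂ) (a (y, ξ)) * u y

/-- `I_φ = Op_φ(1)`. -/
def fioOneI {n : ℕ} (φ : SGSpace n × SGSpace n → ℝ) : (SGSpace n → ℂ) → SGSpace n → ℂ :=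
  fioI φ (fun _ => 1)

/-- `I*_φ = Op*_φ(1)`. -/
def fioOneII {n : ℕ} (φ : SGSpace n × SGSpace n → ℝ) : (SGSpace n → ℂ) → SGSpace n → ℂ :=
  fioII φ (fun _ => 1)

/-- The operator `T` maps the Schwartz space `𝒮(ℝⁿ)` into itself. -/
def MapsSchwartz {n : ℕ} (T : (SGSpace n → ℂ) → SGSpace n → ℂ) : Prop :=
  ∀ u : 𝓢(SGSpace n, ℂ), ∃ v : 𝓢(SGSpace n, ℂ), (v : SGSpace n → ℂ) = T u

/-- `p ∈ S^{0,0}` satisfies `I_{φ₁} ∘ I_{φ₂} = Op_{φ₁ # φ₂}(p)` and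
`I*_{φ₂} ∘ I*_{φ₁} = Op*_{φ₁ # φ₂}(p)`, as operators on `𝒮(ℝⁿ)`. -/
structure IsCompositionSymbol {n : ℕ} (φ₁ φ₂ : SGSpace n × SGSpace n → ℝ)
    (p : SGSpace n × SGSpace n → ℂ) : Prop where
  symbol : SGSymbol 0 0 p
  typeI : ∀ u : 𝓢(SGSpace n, ℂ), fioOneI φ₁ (fioOneI φ₂ u) = fioI (sharp φ₁ φ₂) p u
  typeII : ∀ u : 𝓢(SGSpace n, ℂ), fioOneII φ₂ (fioOneII φ₁ u) = fioII (sharp φ₁ φ₂) p u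

end

noncomputable section

/-! Write z = (x, ξ), w = (y, η) and J_j(x, ξ) = φ_j(x, ξ) − x·ξ. Applied to û(ξ), the composition
I_{φ₁} ∘ I_{φ₂} has as kernel the oscillatory integral over w of exp i(φ₁(x, η) − y·η + φ₂(y, ξ)).
Its stationary points in w solve the critical point system, and its stationary value is φ₁ # φ₂. So
the composition is formally Op_{φ₁#φ₂}(p), where p(z) is (2π)^{-n} times the integral over w of exp
i(phase at w − stationary value). What has to be shown is that this integral makes sense and is a
symbol of order (0, 0), with bounds that depend only on the bounds for J₁, J₂ in S^{1,1}.

All estimates are made in the affine charts σ ↦ (x + ⟨x⟩σ₁, ξ + ⟨ξ⟩σ₂). A function is in S^{m,μ}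
exactly when its pull-backs have all derivatives at σ = 0 bounded by ⟨x⟩^m⟨ξ⟩^μ, uniformly in the
base point (`sgBoundedFamily_iff`). Divided by λ = ⟨x⟩⟨ξ⟩, the pulled back J_j are bounded with all
derivatives, and their first and pure second derivatives are small. Therefore the critical point is
the fixed point of a 1/16-contraction (`NearPair.existsUnique`), depends smoothly on z, and has
uniformly bounded derivatives in the charts because these solve linear fixed point equations
(`sb_critChart`). This gives φ₁ # φ₂ − x·ξ ∈ S^{1,1} (`sgBoundedFamily_sharpPert`) and, as its
gradient is small, φ₁ # φ₂ ∈ 𝒫 (`sgPhase_sharp`).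

To define p, a compactly supported regulariser is inserted and the w-space is cut into four zones,
according to whether y is near x at scale ⟨x⟩ and whether η is near ξ at scale ⟨ξ⟩. Where η is far,
the y-gradient of the phase is at least of size ⟨ξ⟩ + |η − ξ|; where y is far, the η-gradient is at
least of size ⟨x⟩ + |y − x|. In the near-near zone, coordinates centred at the critical point and
shrunk by λ^{-1/2} have total Jacobian one, and make the phase a function of at most quadratic
growth whose gradient grows exactly linearly. In each zone enough integrations by parts give an
absolutely convergent integral, with K derivatives in σ under control and uniformly in the
regularisation (`exists_isZoneRep`). Removing the regulariser by dominated convergence yields p ∈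
S^{0,0}, uniformly over families (`sgBoundedFamily_compSymbol`).

On the operator side, integration by parts shows that type I and type II operators preserve 𝒮
(`DecayPhase.exists_schwartz`). Evaluating one regularised integral in two orders identifies the
composition (`fioOneI_comp`), and the type II identity follows by taking adjoints (`fioOneII_comp`).
Since û ranges over all of 𝒮, the type I identity determines p (`symbol_eq_of_fioI_eq`); hence every
family satisfying the identities is the constructed one, which is bounded. -/

/-- `SB K w pt f`: the derivatives up to order `K` of the functions `f j` at the points `pt j` are
bounded by a constant times the weights `w j`, uniformly in `j`. -/
def SB {J : Type*} {E F : Type} [NormedAddCommGroup E] [NormedSpace ℝ E] [NormedAddCommGroup F]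
    [NormedSpace ℝ F] (K : ℕ) (w : J → ℝ) (pt : J → E) (f : J → E → F) : Prop :=
  (∀ j, 0 ≤ w j) ∧ ∃ C : ℝ, 0 ≤ C ∧ ∀ j, ∀ k ≤ K, ‖iteratedFDeriv ℝ k (f j) (pt j)‖ ≤ C * w j

/-! ### Calculus of uniform derivative bounds at prescribed points -/

namespace SB

variable {J : Type*} {E F G H : Type} [NormedAddCommGroup E] [NormedSpace ℝ E]
  [NormedAddCommGroup F] [NormedSpace ℝ F] [NormedAddCommGroup G] [NormedSpace ℝ G]
  [NormedAddCommGroup H] [NormedSpace ℝ H]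
  {K : ℕ} {w w' : J → ℝ} {pt : J → E} {f g : J → E → F}

theorem mono_order {K' : ℕ} (h : SB K w pt f) (hK : K' ≤ K) : SB K' w pt f := by
  obtain ⟨hw, C, hC, hb⟩ := h
  exact ⟨hw, C, hC, fun j k hk => hb j k (hk.trans hK)⟩

theorem mono_weight (h : SB K w pt f) (hw' : ∀ j, 0 ≤ w' j) (A : ℝ) (hA : 0 ≤ A)
    (hle : ∀ j, w j ≤ A * w' j) : SB K w' pt f := by
  obtain ⟨hw, C, hC, hb⟩ := h
  refine ⟨hw', C * A, by positivity, fun j k hk => (hb j k hk).trans ?_⟩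
  rw [mul_assoc]
  exact mul_le_mul_of_nonneg_left (hle j) hC

theorem mono_weight' (h : SB K w pt f) (hle : ∀ j, w j ≤ w' j) : SB K w' pt f :=
  h.mono_weight (fun j => (h.1 j).trans (hle j)) 1 zero_le_one (fun j => by simpa using hle j)

theorem congr_eventually (h : SB K w pt f) (hfg : ∀ j, f j =ᶠ[nhds (pt j)] g j) :
    SB K w pt g := by
  obtain ⟨hw, C, hC, hb⟩ := h
  refine ⟨hw, C, hC, fun j k hk => ?_⟩
  rw [← ((hfg j).iteratedFDeriv ℝ k).eq_of_nhds]
  exact hb j k hk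

theorem reindex {J' : Type*} (h : SB K w pt f) (e : J' → J) :
    SB K (fun j => w (e j)) (fun j => pt (e j)) (fun j => f (e j)) := by
  obtain ⟨hw, C, hC, hb⟩ := h
  exact ⟨fun j => hw _, C, hC, fun j k hk => hb _ k hk⟩

/-- Serves to split the indices according to whether the point lies in the support of a cutoff; off
the support `zero_fun` applies. -/
theorem of_cases (p : J → Prop)
    (h1 : SB K (fun j : {j // p j} => w j) (fun j => pt j) (fun j => f j))
    (h2 : SB K (fun j : {j // ¬ p j} => w j) (fun j => pt j) (fun j => f j)) :
    SB K w pt f := by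
  obtain ⟨hw, C, hC, hb⟩ := h1
  obtain ⟨hw', C', hC', hb'⟩ := h2
  have hw0 : ∀ j, 0 ≤ w j := fun j => by
    by_cases hj : p j
    · exact hw ⟨j, hj⟩
    · exact hw' ⟨j, hj⟩
  refine ⟨hw0, C + C', by positivity, fun j k hk => ?_⟩
  by_cases hj : p j
  · exact (hb ⟨j, hj⟩ k hk).trans (mul_le_mul_of_nonneg_right (by linarith) (hw0 j))
  · exact (hb' ⟨j, hj⟩ k hk).trans (mul_le_mul_of_nonneg_right (by linarith) (hw0 j))

theorem zero_fun (hw : ∀ j, 0 ≤ w j) (hf : ∀ j, f j =ᶠ[nhds (pt j)] fun _ => 0) :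
    SB K w pt f := by
  refine ⟨hw, 0, le_rfl, fun j k _ => ?_⟩
  rw [((hf j).iteratedFDeriv ℝ k).eq_of_nhds]
  simp

theorem bilin (B : F →L[ℝ] G →L[ℝ] H) {f : J → E → F} {g : J → E → G}
    (hf : ∀ j, ContDiff ℝ ∞ (f j)) (hg : ∀ j, ContDiff ℝ ∞ (g j))
    (h : SB K w pt f) (h' : SB K w' pt g) :
    SB K (fun j => w j * w' j) pt (fun j z => B (f j z) (g j z)) := by
  obtain ⟨hw, C, hC, hb⟩ := h
  obtain ⟨hw', C', hC', hb'⟩ := h'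
  refine ⟨fun j => mul_nonneg (hw j) (hw' j), ‖B‖ * (2 ^ K * (C * C')), by positivity,
    fun j k hk => ?_⟩
  have h1 := B.norm_iteratedFDeriv_le_of_bilinear (hf j) (hg j) (pt j) (n := k)
    (by exact_mod_cast le_top)
  refine h1.trans ?_
  rw [mul_assoc]
  refine mul_le_mul_of_nonneg_left ?_ (norm_nonneg B)
  calc _ ≤ ∑ i ∈ Finset.range (k + 1), (k.choose i : ℝ) * (C * w j * (C' * w' j)) := by
        refine Finset.sum_le_sum fun i hi => ?_
        rw [mul_assoc]
        have hi' : i ≤ k := Nat.lt_succ_iff.mp (Finset.mem_range.mp hi)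
        refine mul_le_mul_of_nonneg_left ?_ (Nat.cast_nonneg _)
        exact mul_le_mul (hb j i (hi'.trans hk)) (hb' j _ ((Nat.sub_le _ _).trans hk))
          (norm_nonneg _) (mul_nonneg hC (hw j))
    _ = 2 ^ k * (C * C' * (w j * w' j)) := by
        rw [← Finset.sum_mul]
        have : ∑ i ∈ Finset.range (k + 1), (k.choose i : ℝ) = 2 ^ k := by
          exact_mod_cast Nat.sum_range_choose k
        rw [this]; ring
    _ ≤ 2 ^ K * (C * C' * (w j * w' j)) := by
        refine mul_le_mul_of_nonneg_right (pow_le_pow_right₀ one_le_two hk) ?_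
        have := hw j; have := hw' j; positivity
    _ = _ := by ring

theorem clm (L : J → F →L[ℝ] G) {A : ℝ} (hL : ∀ j, ‖L j‖ ≤ A) (hf : ∀ j, ContDiff ℝ ∞ (f j))
    (h : SB K w pt f) : SB K w pt (fun j z => L j (f j z)) := by
  obtain ⟨hw, C, hC, hb⟩ := h
  refine ⟨hw, |A| * C, by positivity, fun j k hk => ?_⟩
  have h1 := (L j).norm_iteratedFDeriv_comp_left (n := k) ((hf j).contDiffAt (x := pt j))
    (by exact_mod_cast le_top)
  refine h1.trans ?_
  rw [mul_assoc]
  exact mul_le_mul ((hL j).trans (le_abs_self _)) (hb j k hk) (norm_nonneg _) (abs_nonneg _)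

theorem clm' (L : F →L[ℝ] G) (hf : ∀ j, ContDiff ℝ ∞ (f j))
    (h : SB K w pt f) : SB K w pt (fun j z => L (f j z)) :=
  clm (fun _ => L) (fun _ => le_rfl) hf h

theorem add (hf : ∀ j, ContDiff ℝ ∞ (f j)) (hg : ∀ j, ContDiff ℝ ∞ (g j))
    (h : SB K w pt f) (h' : SB K w pt g) : SB K w pt (fun j z => f j z + g j z) := by
  obtain ⟨hw, C, hC, hb⟩ := h
  obtain ⟨-, C', hC', hb'⟩ := h'
  refine ⟨hw, C + C', by positivity, fun j k hk => ?_⟩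
  have : iteratedFDeriv ℝ k (fun z => f j z + g j z) (pt j)
      = iteratedFDeriv ℝ k (f j) (pt j) + iteratedFDeriv ℝ k (g j) (pt j) :=
    iteratedFDeriv_add_apply (((hf j).of_le (by exact_mod_cast le_top)).contDiffAt)
      (((hg j).of_le (by exact_mod_cast le_top)).contDiffAt)
  rw [this, add_mul]
  exact (norm_add_le _ _).trans (add_le_add (hb j k hk) (hb' j k hk))

theorem neg (h : SB K w pt f) : SB K w pt (fun j z => - f j z) := by
  obtain ⟨hw, C, hC, hb⟩ := h
  refine ⟨hw, C, hC, fun j k hk => ?_⟩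
  have : (fun z => - f j z) = - f j := rfl
  beta_reduce
  rw [this, iteratedFDeriv_neg_apply, norm_neg]
  exact hb j k hk

theorem sub (hf : ∀ j, ContDiff ℝ ∞ (f j)) (hg : ∀ j, ContDiff ℝ ∞ (g j))
    (h : SB K w pt f) (h' : SB K w pt g) : SB K w pt (fun j z => f j z - g j z) := by
  simp only [sub_eq_add_neg]
  exact h.add hf (fun j => (hg j).neg) h'.neg

theorem sum {L : Type*} (s : Finset L) {f : L → J → E → F} (hw : ∀ j, 0 ≤ w j)
    (hf : ∀ l j, ContDiff ℝ ∞ (f l j)) (h : ∀ l, SB K w pt (f l)) :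
    SB K w pt (fun j z => ∑ l ∈ s, f l j z) := by
  classical
  induction s using Finset.induction_on with
  | empty => exact zero_fun hw (fun j => by simp)
  | insert a s ha ih =>
    simp only [Finset.sum_insert ha]
    exact (h a).add (hf a) (fun j => ContDiff.sum fun l _ => hf l j) ih

/-- The induction principle behind most later bounds: the derivative is again a family of functions,
with values in another normed space. -/
theorem succ_iff : SB (K + 1) w pt f ↔ SB 0 w pt f ∧ SB K w pt (fun j => fderiv ℝ (f j)) := by
  constructor
  · rintro ⟨hw, C, hC, hb⟩
    refine ⟨⟨hw, C, hC, fun j k hk => hb j k (by omega)⟩, hw, C, hC, fun j k hk => ?_⟩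
    rw [norm_iteratedFDeriv_fderiv]
    exact hb j _ (by omega)
  · rintro ⟨⟨hw, C, hC, hb⟩, -, C', hC', hb'⟩
    refine ⟨hw, C + C', by positivity, fun j k hk => ?_⟩
    rcases k with _ | k
    · exact (hb j 0 le_rfl).trans (mul_le_mul_of_nonneg_right (by linarith) (hw j))
    · rw [← norm_iteratedFDeriv_fderiv]
      exact (hb' j k (by omega)).trans (mul_le_mul_of_nonneg_right (by linarith) (hw j))

theorem fderiv (h : SB (K + 1) w pt f) : SB K w pt (fun j => fderiv ℝ (f j)) := (succ_iff.1 h).2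

theorem zero_iff : SB 0 w pt f ↔
    (∀ j, 0 ≤ w j) ∧ ∃ C : ℝ, 0 ≤ C ∧ ∀ j, ‖f j (pt j)‖ ≤ C * w j := by
  refine and_congr Iff.rfl (exists_congr fun C => and_congr Iff.rfl ⟨fun h j => ?_, fun h j k hk => ?_⟩)
  · simpa using h j 0 le_rfl
  · obtain rfl : k = 0 := by omega
    simpa using h j

theorem const {c : J → F} {A : ℝ} (hA : 0 ≤ A) (hw : ∀ j, 0 ≤ w j) (hc : ∀ j, ‖c j‖ ≤ A * w j) :
    SB K w pt (fun j _ => c j) := by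
  refine ⟨hw, A, hA, fun j k _ => ?_⟩
  rcases k with _ | k
  · simpa using hc j
  · rw [iteratedFDeriv_const_of_ne (by omega)]
    simpa using mul_nonneg hA (hw j)

theorem affine {f : J → E → F} (L : J → E →L[ℝ] F) {A : ℝ} (hA : 0 ≤ A) (hw : ∀ j, 0 ≤ w j)
    (hf : ∀ j z, HasFDerivAt (f j) (L j) z)
    (hv : ∀ j, ‖f j (pt j)‖ ≤ A * w j) (hL : ∀ j, ‖L j‖ ≤ A * w j) : SB K w pt f := by
  -- Order `K + 1` is proved and then lowered, so that `succ_iff` applies for `K = 0` as well; the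
  -- derivative is constant, so value and linear part decide.
  refine SB.mono_order (succ_iff.2 ⟨zero_iff.2 ⟨hw, A, hA, hv⟩, ?_⟩) (Nat.le_succ K)
  have : (fun j => _root_.fderiv ℝ (f j)) = fun j _ => L j := by
    funext j z; exact (hf j z).fderiv
  rw [this]
  exact const hA hw hL

/-- By the Faà di Bruno formula a derivative of order at most `K` contains at most `K` factors that
are derivatives of `g`, each costing one `h`. -/
theorem comp {f : J → F → G} {g : J → E → F} {h : J → ℝ} (hf : ∀ j, ContDiff ℝ ∞ (f j))
    (hg : ∀ j, ContDiff ℝ ∞ (g j)) (h1 : ∀ j, 1 ≤ h j)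
    (Hf : SB K w (fun j => g j (pt j)) f) (Hg : SB K h pt (fun j => _root_.fderiv ℝ (g j))) :
    SB K (fun j => w j * h j ^ K) pt (fun j z => f j (g j z)) := by
  obtain ⟨hw, C, hC, hb⟩ := Hf
  obtain ⟨-, C', hC', hb'⟩ := Hg
  have h0 : ∀ j, 0 ≤ h j := fun j => zero_le_one.trans (h1 j)
  refine ⟨fun j => mul_nonneg (hw j) (pow_nonneg (h0 j) _),
    K.factorial * C * (1 + C') ^ K, by positivity, fun j k hk => ?_⟩
  -- The composition estimate wants the `i`-th derivative of `g` below `D ^ i`. Enlarging `C'` to `1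
  -- + C'` makes `D ≥ 1`, so that a bound by `D` suffices for every `i ≥ 1`.
  have hD1 : 1 ≤ (1 + C') * h j := by nlinarith [h1 j, mul_nonneg hC' (h0 j)]
  have := norm_iteratedFDeriv_comp_le (hf j) (hg j) (n := k) (by exact_mod_cast le_top) (pt j)
    (C := C * w j) (D := (1 + C') * h j) (fun i hi => hb j i (hi.trans hk)) (fun i hi1 hik => by
      obtain ⟨i, rfl⟩ := Nat.exists_eq_add_of_le' hi1
      rw [← norm_iteratedFDeriv_fderiv]
      refine (hb' j i (by omega)).trans ?_
      refine le_trans (mul_le_mul_of_nonneg_right (by linarith : C' ≤ 1 + C') (h0 j)) ?_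
      exact le_self_pow₀ hD1 (by omega))
  refine this.trans ?_
  have hfac : (k.factorial : ℝ) ≤ K.factorial := by exact_mod_cast Nat.factorial_le hk
  have hpow : ((1 + C') * h j) ^ k ≤ ((1 + C') * h j) ^ K := pow_le_pow_right₀ hD1 hk
  have hwj := hw j
  calc (k.factorial : ℝ) * (C * w j) * ((1 + C') * h j) ^ k
      ≤ K.factorial * (C * w j) * ((1 + C') * h j) ^ K := by
        refine mul_le_mul (mul_le_mul_of_nonneg_right hfac (by positivity)) hpow ?_ (by positivity)
        exact pow_nonneg (zero_le_one.trans hD1) _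
    _ = _ := by rw [mul_pow]; ring

theorem comp_one {f : J → F → G} {g : J → E → F} (hf : ∀ j, ContDiff ℝ ∞ (f j))
    (hg : ∀ j, ContDiff ℝ ∞ (g j)) (Hf : SB K w (fun j => g j (pt j)) f)
    (Hg : SB K (fun _ => 1) pt (fun j => _root_.fderiv ℝ (g j))) :
    SB K w pt (fun j z => f j (g j z)) := by
  simpa using comp hf hg (h := fun _ => 1) (fun _ => le_rfl) Hf Hg

theorem mul {𝕜 : Type} [RCLike 𝕜] {f g : J → E → 𝕜}
    (hf : ∀ j, ContDiff ℝ ∞ (f j)) (hg : ∀ j, ContDiff ℝ ∞ (g j))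
    (h : SB K w pt f) (h' : SB K w' pt g) :
    SB K (fun j => w j * w' j) pt (fun j z => f j z * g j z) := by
  exact bilin (ContinuousLinearMap.mul ℝ 𝕜) hf hg h h'

theorem smul {f : J → E → ℝ} {g : J → E → F}
    (hf : ∀ j, ContDiff ℝ ∞ (f j)) (hg : ∀ j, ContDiff ℝ ∞ (g j))
    (h : SB K w pt f) (h' : SB K w' pt g) :
    SB K (fun j => w j * w' j) pt (fun j z => f j z • g j z) :=
  bilin (ContinuousLinearMap.lsmul ℝ ℝ) hf hg h h'

theorem prodMk {f : J → E → F} {g : J → E → G}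
    (hf : ∀ j, ContDiff ℝ ∞ (f j)) (hg : ∀ j, ContDiff ℝ ∞ (g j))
    (h : SB K w pt f) (h' : SB K w pt g) :
    SB K w pt (fun j z => (f j z, g j z)) := by
  have h1 := add (fun j => (ContinuousLinearMap.inl ℝ F G).contDiff.comp (hf j))
    (fun j => (ContinuousLinearMap.inr ℝ F G).contDiff.comp (hg j))
    (h.clm' (ContinuousLinearMap.inl ℝ F G) hf) (h'.clm' (ContinuousLinearMap.inr ℝ F G) hg)
  simpa using h1

/-- The derivative of 1/q is −q⁻²·q', of weight m⁻²·m = m⁻¹ again; so the weight is reproduced at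
every order. -/
theorem inv {q : J → E → ℝ} {m : J → ℝ} (hq : ∀ j, ContDiff ℝ ∞ (q j)) (hq0 : ∀ j z, q j z ≠ 0)
    {c : ℝ} (hc : 0 < c) (hm : ∀ j, 0 < m j) (hlow : ∀ j, c * m j ≤ |q j (pt j)|)
    (h : SB K m pt q) : SB K (fun j => (m j)⁻¹) pt (fun j z => (q j z)⁻¹) := by
  have hi : ∀ j, ContDiff ℝ ∞ (fun z => (q j z)⁻¹) := fun j => (hq j).inv (hq0 j)
  have hbase : SB 0 (fun j => (m j)⁻¹) pt (fun j z => (q j z)⁻¹) := by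
    refine zero_iff.2 ⟨fun j => (inv_pos.2 (hm j)).le, c⁻¹, (inv_pos.2 hc).le, fun j => ?_⟩
    rw [norm_inv, Real.norm_eq_abs, ← mul_inv]
    exact inv_anti₀ (mul_pos hc (hm j)) (hlow j)
  induction K with
  | zero => exact hbase
  | succ K ih =>
    have ih' := ih (h.mono_order (Nat.le_succ K))
    refine succ_iff.2 ⟨hbase, ?_⟩
    have h2 := ((ih'.mul hi hi ih').smul (fun j => (hi j).mul (hi j))
      (fun j => (hq j).fderiv_right (m := ∞) (by simp)) h.fderiv).neg
    have heq : (fun j z => -(((q j z)⁻¹ * (q j z)⁻¹) • _root_.fderiv ℝ (q j) z))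
        = fun j => _root_.fderiv ℝ (fun z => (q j z)⁻¹) := by
      funext j z
      have hd : HasFDerivAt (q j) (_root_.fderiv ℝ (q j) z) z :=
        ((hq j).differentiable (by simp) z).hasFDerivAt
      have := (hasFDerivAt_inv (hq0 j z)).comp z hd
      rw [show (fun z => (q j z)⁻¹) = (fun x : ℝ => x⁻¹) ∘ q j from rfl, this.fderiv]
      ext v
      simp [pow_two]
      ring
    rw [heq] at h2
    refine h2.mono_weight' fun j => le_of_eq ?_
    field_simp [(hm j).ne']

/-- Every derivative of exp(iΘ) brings down one more factor Θ', of size `h`; lower orders are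
covered since `1 ≤ h`. -/
theorem cexp {Θ : J → E → ℝ} {h : J → ℝ} (hΘ : ∀ j, ContDiff ℝ ∞ (Θ j)) (h1 : ∀ j, 1 ≤ h j)
    (H : SB K h pt Θ) :
    SB K (fun j => h j ^ K) pt (fun j z => Complex.exp (Complex.I * (Θ j z : ℂ))) := by
  have h0 : ∀ j, 0 ≤ h j := fun j => zero_le_one.trans (h1 j)
  have hi : ∀ j, ContDiff ℝ ∞ (fun z => Complex.exp (Complex.I * (Θ j z : ℂ))) := fun j =>
    (contDiff_const.mul (Complex.ofRealCLM.contDiff.comp (hΘ j))).cexp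
  have hbase : ∀ K, SB 0 (fun j => h j ^ K) pt
      (fun j z => Complex.exp (Complex.I * (Θ j z : ℂ))) := fun K => by
    refine zero_iff.2 ⟨fun j => pow_nonneg (h0 j) _, 1, zero_le_one, fun j => ?_⟩
    rw [mul_comm, Complex.norm_exp_ofReal_mul_I, one_mul]
    exact one_le_pow₀ (h1 j)
  induction K with
  | zero => exact hbase 0
  | succ K ih =>
    have ih' := ih (H.mono_order (Nat.le_succ K))
    refine succ_iff.2 ⟨hbase _, ?_⟩
    -- The real bilinear map sending (c, ℓ) to v ↦ i c ℓ(v).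
    let B : ℂ →L[ℝ] (E →L[ℝ] ℝ) →L[ℝ] (E →L[ℝ] ℂ) :=
      ((ContinuousLinearMap.compL ℝ E ℝ ℂ).comp
        (ContinuousLinearMap.toSpanSingletonCLE (𝕜 := ℝ) (E := ℂ)).toContinuousLinearMap).comp
        (ContinuousLinearMap.mul ℝ ℂ Complex.I)
    have h2 := ih'.bilin B hi (fun j => (hΘ j).fderiv_right (m := ∞) (by simp)) H.fderiv
    have heq : (fun j z => B (Complex.exp (Complex.I * (Θ j z : ℂ))) (_root_.fderiv ℝ (Θ j) z))
        = fun j => _root_.fderiv ℝ (fun z => Complex.exp (Complex.I * (Θ j z : ℂ))) := by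
      funext j z
      have hd : HasFDerivAt (Θ j) (_root_.fderiv ℝ (Θ j) z) z :=
        ((hΘ j).differentiable (by simp) z).hasFDerivAt
      have hd2 := ((Complex.ofRealCLM.hasFDerivAt.comp z hd).const_mul Complex.I).cexp
      refine Eq.symm (Eq.trans (HasFDerivAt.fderiv (f' := _) hd2) ?_)
      ext v
      simp [B]
      ring
    rw [heq] at h2
    exact h2.mono_weight' fun j => le_of_eq (pow_succ _ _).symm

end SB

/-! ### Directional derivatives along constant fields -/

/-- The directional derivative of `f` along the constant vector field `v`. -/
def dirD {E F : Type} [NormedAddCommGroup E] [NormedSpace ℝ E] [NormedAddCommGroup F]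
    [NormedSpace ℝ F] (v : E) (f : E → F) (z : E) : F := fderiv ℝ f z v

theorem ContDiff.dirD {E F : Type} [NormedAddCommGroup E] [NormedSpace ℝ E] [NormedAddCommGroup F]
    [NormedSpace ℝ F] {f : E → F} (hf : ContDiff ℝ ∞ f) (v : E) : ContDiff ℝ ∞ (dirD v f) :=
  (hf.fderiv_right (m := ∞) (by simp)).clm_apply contDiff_const

theorem dirD_comm {E F : Type} [NormedAddCommGroup E] [NormedSpace ℝ E] [NormedAddCommGroup F]
    [NormedSpace ℝ F] {f : E → F} (hf : ContDiff ℝ ∞ f) (v u : E) :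
    dirD v (dirD u f) = dirD u (dirD v f) := by
  funext z
  have hsym := (hf.contDiffAt (x := z)).isSymmSndFDerivAt (by
    rw [minSmoothness_of_isRCLikeNormedField]; exact WithTop.coe_le_coe.2 (le_top : (2 : ℕ∞) ≤ ⊤))
  have hd : DifferentiableAt ℝ (fderiv ℝ f) z :=
    (hf.fderiv_right (m := ∞) (by simp)).differentiable (by simp) z
  have e : ∀ u : E, HasFDerivAt (dirD u f) _ z := fun u =>
    hd.hasFDerivAt.clm_apply (hasFDerivAt_const u z)
  rw [dirD, (e u).fderiv, dirD, (e v).fderiv]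
  simpa using hsym v u

theorem Filter.EventuallyEq.dirD {E F : Type} [NormedAddCommGroup E] [NormedSpace ℝ E]
    [NormedAddCommGroup F] [NormedSpace ℝ F] {f g : E → F} {z : E} (h : f =ᶠ[nhds z] g) (v : E) :
    dirD v f =ᶠ[nhds z] dirD v g := by
  filter_upwards [h.fderiv (𝕜 := ℝ)] with y hy
  rw [_root_.dirD, _root_.dirD, hy]

namespace SB
variable {J : Type*} {E V F : Type} [NormedAddCommGroup E] [NormedSpace ℝ E]
  [NormedAddCommGroup F] [NormedSpace ℝ F] [NormedAddCommGroup V] [NormedSpace ℝ V]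

theorem dirD {K : ℕ} {w : J → ℝ} {pt : J → E} {f : J → E → F}
    (hf : ∀ j, ContDiff ℝ ∞ (f j)) (h : SB (K + 1) w pt f) (v : E) :
    SB K w pt (fun j => dirD v (f j)) :=
  h.fderiv.clm' (ContinuousLinearMap.apply ℝ F v) (fun j => (hf j).fderiv_right (m := ∞) (by simp))

theorem fderiv_of_dirD {ι : Type} [Fintype ι] [FiniteDimensional ℝ E] (b : Module.Basis ι ℝ E)
    {K : ℕ} {w : J → ℝ} {pt : J → E} {f : J → E → F}
    (hf : ∀ j, ContDiff ℝ ∞ (f j)) (hw : ∀ j, 0 ≤ w j)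
    (h : ∀ i, SB K w pt (fun j => _root_.dirD (b i) (f j))) :
    SB K w pt (fun j => _root_.fderiv ℝ (f j)) := by
  let L : ι → F →L[ℝ] E →L[ℝ] F := fun i =>
    ContinuousLinearMap.smulRightL ℝ E F (LinearMap.toContinuousLinearMap (b.coord i))
  have h1 : ∀ i, SB K w pt (fun j z => L i (_root_.dirD (b i) (f j) z)) := fun i =>
    (h i).clm' (L i) (fun j => (hf j).dirD _)
  have h2 := SB.sum Finset.univ hw (fun i j => (L i).contDiff.comp ((hf j).dirD _)) h1
  refine h2.congr_eventually fun j => Filter.Eventually.of_forall fun z => ?_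
  refine ContinuousLinearMap.ext fun v => ?_
  conv_rhs => rw [← b.sum_repr v, map_sum]
  simp [L, _root_.dirD]

/-- A function vanishing for `v = 0` is controlled by its `v`-derivatives along segments. -/
theorem of_dirD_snd {ι ι' : Type} [Fintype ι] [Fintype ι'] [FiniteDimensional ℝ E]
    [FiniteDimensional ℝ V] (b : Module.Basis ι ℝ E) (b' : Module.Basis ι' ℝ V) {K : ℕ} :
    ∀ {w : J → ℝ} {pt : J → E × V} {f : J → E × V → F},
    (∀ j, 0 ≤ w j) → (∀ j, ContDiff ℝ ∞ (f j)) → (∀ j σ, f j (σ, 0) = 0) →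
    (∀ l, SB K (fun j : J × Set.Icc (0 : ℝ) 1 => w j.1)
      (fun j => ((pt j.1).1, (j.2 : ℝ) • (pt j.1).2))
      (fun j => _root_.dirD ((0, b' l) : E × V) (f j.1))) →
    SB K (fun j => w j * (1 + ‖(pt j).2‖)) pt f := by
  induction K with
  | zero =>
    intro w pt f hw hf h0 h
    choose hw0 C hC hb using h
    let N : ι' → ℝ := fun l => ‖LinearMap.toContinuousLinearMap (b'.coord l)‖
    refine zero_iff.2 ⟨fun j => mul_nonneg (hw j) (by positivity), ∑ l, N l * C l,
      Finset.sum_nonneg fun l _ => mul_nonneg (norm_nonneg _) (hC l), fun j => ?_⟩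
    have hder : ∀ t ∈ Set.Icc (0 : ℝ) 1, HasDerivWithinAt
        (fun t : ℝ => f j ((pt j).1, t • (pt j).2))
        (_root_.fderiv ℝ (f j) ((pt j).1, t • (pt j).2) (0, (pt j).2)) (Set.Icc 0 1) t := by
      intro t ht
      have h1 : HasDerivAt (fun t : ℝ => ((pt j).1, t • (pt j).2)) ((0 : E), (pt j).2) t := by
        refine (hasDerivAt_const t _).prodMk ?_
        simpa using (hasDerivAt_id t).smul_const (pt j).2
      have h2 := ((hf j).differentiable (by simp) ((pt j).1, t • (pt j).2)).hasFDerivAt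
      exact (h2.comp_hasDerivAt t h1).hasDerivWithinAt
    -- Mean value inequality on the segment from (σ, 0), where `f` vanishes, to (σ, v); the
    -- derivative is expanded in the basis `b'`.
    have := norm_image_sub_le_of_norm_deriv_le_segment_01' hder
      (C := (∑ l, N l * C l) * (w j * ‖(pt j).2‖))
      (fun t ht => by
        have h3 : ∀ l, ‖_root_.fderiv ℝ (f j) ((pt j).1, t • (pt j).2) (0, b' l)‖ ≤ C l * w j :=
          fun l => by
            have := hb l (j, ⟨t, Set.Ico_subset_Icc_self ht⟩) 0 le_rfl
            rwa [norm_iteratedFDeriv_zero] at this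
        have h4 : ((0 : E), (pt j).2) = ∑ l, b'.repr (pt j).2 l • ((0 : E), b' l) := by
          have h5 := congrArg (ContinuousLinearMap.inr ℝ E V) (b'.sum_repr (pt j).2)
          rw [map_sum] at h5
          simpa using h5.symm
        rw [h4, map_sum, Finset.sum_mul]
        refine (norm_sum_le _ _).trans (Finset.sum_le_sum fun l _ => ?_)
        rw [map_smul, norm_smul]
        have h6 : ‖b'.repr (pt j).2 l‖ ≤ N l * ‖(pt j).2‖ :=
          (LinearMap.toContinuousLinearMap (b'.coord l)).le_opNorm (pt j).2
        calc _ ≤ (N l * ‖(pt j).2‖) * (C l * w j) :=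
              mul_le_mul h6 (h3 l) (norm_nonneg _) (mul_nonneg (norm_nonneg _) (norm_nonneg _))
          _ = _ := by ring)
    simp only [one_smul, zero_smul, h0, sub_zero, Prod.mk.eta] at this
    refine this.trans ?_
    have h7 : 0 ≤ ∑ l, N l * C l :=
      Finset.sum_nonneg fun l _ => mul_nonneg (norm_nonneg _) (hC l)
    exact mul_le_mul_of_nonneg_left
      (mul_le_mul_of_nonneg_left (by linarith) (hw j)) h7
  | succ K ih =>
    intro w pt f hw hf h0 h
    have hbase := ih hw hf h0 (fun l => (h l).mono_order (Nat.le_succ K))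
    refine succ_iff.2 ⟨hbase.mono_order (Nat.zero_le K), ?_⟩
    refine fderiv_of_dirD (b.prod b') hf hbase.1 ?_
    -- A derivative along `E` still vanishes for v = 0, and its `V`-derivatives are controlled
    -- because the two directions commute, so the induction applies to it. A derivative along `V` is
    -- the hypothesis at the endpoint 1 of the segment.
    rintro (i | l)
    · simp only [Module.Basis.prod_apply]
      refine ih hw (fun j => (hf j).dirD _) (fun j σ => ?_) (fun l => ?_)
      · have h1 : HasFDerivAt (fun σ : E => f j (σ, 0)) _ σ :=
          (((hf j).differentiable (by simp) (σ, 0)).hasFDerivAt).comp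
            (f := fun σ : E => (σ, (0 : V))) σ (hasFDerivAt_prodMk_left σ (0 : V))
        have h3 : (fun σ : E => f j (σ, 0)) = fun _ => 0 := funext (h0 j)
        rw [h3] at h1
        have h4 := congrArg (fun L => L (b i)) (h1.unique (hasFDerivAt_const _ _))
        simpa [_root_.dirD] using h4
      · have h4 := SB.dirD (J := J × Set.Icc (0 : ℝ) 1)
          (f := fun j => _root_.dirD ((0, b' l) : E × V) (f j.1))
          (fun j => (hf j.1).dirD _) (h l) ((b i, 0) : E × V)
        refine h4.congr_eventually fun j => Filter.Eventually.of_forall fun z => ?_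
        exact congrFun (dirD_comm (hf j.1) _ _) z
    · have h5 := ((h l).mono_order (Nat.le_succ K)).reindex
        (fun j : J => (j, (⟨1, by simp⟩ : Set.Icc (0 : ℝ) 1)))
      simp only [one_smul, Prod.mk.eta] at h5
      have h6 := h5.mono_weight' (w' := fun j => w j * (1 + ‖(pt j).2‖)) fun j => by
        nlinarith [norm_nonneg (pt j).2, hw j]
      simpa using h6

end SB

/-! ### Parameter integrals -/

/-- Differentiation under the integral sign with uniform bounds for the derivatives. -/
theorem param_integral {E V : Type} [NormedAddCommGroup E] [NormedSpace ℝ E]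
    [NormedAddCommGroup V] [NormedSpace ℝ V] [FiniteDimensional ℝ E] [FiniteDimensional ℝ V]
    [MeasurableSpace V] [BorelSpace V] (μ : Measure V) {U : Set E} (hU : IsOpen U) {g : V → ℝ}
    (hg : Integrable g μ) (K : ℕ) :
    ∀ {F : Type} [NormedAddCommGroup F] [NormedSpace ℝ F] [CompleteSpace F] {f : E × V → F},
    ContDiff ℝ ∞ f →
    (∀ k ≤ K, ∀ σ ∈ U, ∀ v, ‖iteratedFDeriv ℝ k f (σ, v)‖ ≤ g v) →
    ContDiffOn ℝ K (fun σ => ∫ v, f (σ, v) ∂μ) U ∧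
      ∀ k ≤ K, ∀ σ ∈ U, ‖iteratedFDeriv ℝ k (fun σ => ∫ v, f (σ, v) ∂μ) σ‖ ≤ ∫ v, g v ∂μ := by
  have key0 : ∀ {F : Type} [NormedAddCommGroup F] [NormedSpace ℝ F] {f : E × V → F},
      ContDiff ℝ ∞ f → (∀ σ ∈ U, ∀ v, ‖f (σ, v)‖ ≤ g v) → ∀ σ ∈ U,
      Integrable (fun v => f (σ, v)) μ := by
    intro F _ _ f hf hb σ hσ
    refine hg.mono' ?_ (Filter.Eventually.of_forall (hb σ hσ))
    exact (hf.continuous.comp (Continuous.prodMk_right σ)).aestronglyMeasurable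
  induction K with
  | zero =>
    intro F _ _ _ f hf hb
    have hb0 : ∀ σ ∈ U, ∀ v, ‖f (σ, v)‖ ≤ g v := fun σ hσ v => by simpa using hb 0 le_rfl σ hσ v
    constructor
    · simp only [Nat.cast_zero]
      rw [contDiffOn_zero]
      refine continuousOn_of_dominated (bound := g) (fun σ hσ => (key0 hf hb0 σ hσ).1) (fun σ hσ =>
        Filter.Eventually.of_forall (hb0 σ hσ)) hg (Filter.Eventually.of_forall fun v =>
          (hf.continuous.comp (Continuous.prodMk_left v)).continuousOn)
    · intro k hk σ hσ
      obtain rfl : k = 0 := by omega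
      rw [norm_iteratedFDeriv_zero]
      exact norm_integral_le_of_norm_le hg (Filter.Eventually.of_forall (hb0 σ hσ))
  | succ K ih =>
    intro F _ _ _ f hf hb
    have hb0 : ∀ σ ∈ U, ∀ v, ‖f (σ, v)‖ ≤ g v := fun σ hσ v => by
      simpa using hb 0 (Nat.zero_le _) σ hσ v
    -- The partial derivative in σ takes values in `E →L[ℝ] F`; this is why the induction quantifies
    -- over the target space.
    let f' : E × V → E →L[ℝ] F := fun z => (fderiv ℝ f z).comp (ContinuousLinearMap.inl ℝ E V)
    have hf' : ContDiff ℝ ∞ f' :=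
      (hf.fderiv_right (m := ∞) (by simp)).clm_comp contDiff_const
    have hb' : ∀ k ≤ K, ∀ σ ∈ U, ∀ v, ‖iteratedFDeriv ℝ k f' (σ, v)‖ ≤ g v := by
      intro k hk σ hσ v
      have h1 := ((ContinuousLinearMap.compL ℝ E (E × V) F).flip
        (ContinuousLinearMap.inl ℝ E V)).norm_iteratedFDeriv_comp_left (n := k) (N := ∞)
        ((hf.fderiv_right (m := ∞) (by simp)).contDiffAt (x := (σ, v))) (by exact_mod_cast le_top)
      refine h1.trans ?_
      rw [norm_iteratedFDeriv_fderiv]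
      refine le_trans ?_ (hb (k + 1) (by omega) σ hσ v)
      refine mul_le_of_le_one_left (norm_nonneg _) ?_
      refine ContinuousLinearMap.opNorm_le_bound _ zero_le_one fun L => ?_
      rw [one_mul]
      refine ContinuousLinearMap.opNorm_le_bound _ (norm_nonneg _) fun x => ?_
      simpa using L.le_opNorm (x, 0)
    obtain ⟨ih1, ih2⟩ := ih hf' hb'
    have hder : ∀ σ ∈ U, HasFDerivAt (fun σ => ∫ v, f (σ, v) ∂μ) (∫ v, f' (σ, v) ∂μ) σ := by
      intro σ hσ
      refine hasFDerivAt_integral_of_dominated_of_fderiv_le (s := U) (bound := g)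
        (F' := fun σ v => f' (σ, v)) (hU.mem_nhds hσ) ?_ (key0 hf hb0 σ hσ) ?_ ?_ hg ?_
      · exact Filter.Eventually.of_forall fun σ' =>
          (hf.continuous.comp (Continuous.prodMk_right σ')).aestronglyMeasurable
      · exact (hf'.continuous.comp (Continuous.prodMk_right σ)).aestronglyMeasurable
      · exact Filter.Eventually.of_forall fun v σ' hσ' => by
          simpa using hb' 0 (Nat.zero_le _) σ' hσ' v
      · refine Filter.Eventually.of_forall fun v σ' _ => ?_
        have h2 := (hf.differentiable (by simp) (σ', v)).hasFDerivAt
        exact h2.comp (f := fun σ : E => (σ, v)) σ' (hasFDerivAt_prodMk_left σ' v)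
    constructor
    · have : ((K + 1 : ℕ) : WithTop ℕ∞) = (K : WithTop ℕ∞) + 1 := by push_cast; rfl
      rw [this, contDiffOn_succ_iff_fderiv_of_isOpen hU]
      refine ⟨fun σ hσ => (hder σ hσ).differentiableAt.differentiableWithinAt, by simp, ?_⟩
      exact ih1.congr fun σ hσ => (hder σ hσ).fderiv
    · intro k hk σ hσ
      rcases k with _ | k
      · rw [norm_iteratedFDeriv_zero]
        exact norm_integral_le_of_norm_le hg (Filter.Eventually.of_forall (hb0 σ hσ))
      · rw [← norm_iteratedFDeriv_fderiv]
        have : fderiv ℝ (fun σ => ∫ v, f (σ, v) ∂μ) =ᶠ[nhds σ] fun σ => ∫ v, f' (σ, v) ∂μ :=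
          Filter.eventually_of_mem (hU.mem_nhds hσ) fun σ' hσ' => (hder σ' hσ').fderiv
        rw [(this.iteratedFDeriv ℝ k).eq_of_nhds]
        exact ih2 k (by omega) σ hσ

/-! ### Iterated derivatives along lists of vectors -/

section ListD
variable {E F : Type} [NormedAddCommGroup E] [NormedSpace ℝ E] [NormedAddCommGroup F]
  [NormedSpace ℝ F]

/-- Iterated directional derivatives along a list of vectors. -/
def listD : List E → (E → F) → E → F
  | [], f => f
  | v :: l, f => dirD v (listD l f)

theorem ContDiff.listD {f : E → F} (hf : ContDiff ℝ ∞ f) (l : List E) :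
    ContDiff ℝ ∞ (listD l f) := by
  induction l with
  | nil => exact hf
  | cons v l ih => exact ih.dirD v

theorem listD_append (l l' : List E) (f : E → F) : listD (l ++ l') f = listD l (listD l' f) := by
  induction l with
  | nil => rfl
  | cons v l ih => simp only [List.cons_append, listD, ih]

theorem listD_perm {f : E → F} (hf : ContDiff ℝ ∞ f) {l l' : List E} (h : l.Perm l') :
    listD l f = listD l' f := by
  induction h with
  | nil => rfl
  | cons v _ ih => simp only [listD, ih]
  | swap v u l => exact dirD_comm (hf.listD l) u v
  | trans _ _ ih ih' => exact ih.trans ih'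

theorem iteratedFDeriv_apply_eq_listD {f : E → F} (hf : ContDiff ℝ ∞ f) {k : ℕ} (v : Fin k → E)
    (z : E) : iteratedFDeriv ℝ k f z v = listD (List.ofFn v) f z := by
  induction k generalizing z with
  | zero => simp [listD]
  | succ k ih =>
    rw [iteratedFDeriv_succ_apply_left, List.ofFn_succ]
    have hd : DifferentiableAt ℝ (iteratedFDeriv ℝ k f) z :=
      (hf.differentiable_iteratedFDeriv (m := k) (by exact_mod_cast ENat.natCast_lt_top k)) z
    have h1 : HasFDerivAt (fun z => iteratedFDeriv ℝ k f z (Fin.tail v)) _ z :=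
      ((ContinuousMultilinearMap.apply ℝ (fun _ : Fin k => E) F (Fin.tail v)).hasFDerivAt).comp z
        hd.hasFDerivAt
    have h2 : (fun z => iteratedFDeriv ℝ k f z (Fin.tail v))
        = listD (List.ofFn fun i => v i.succ) f := funext fun z => ih (Fin.tail v) z
    rw [h2] at h1
    simp only [listD, dirD]
    rw [h1.fderiv]
    rfl

theorem SB.of_listD {J : Type*} {ι : Type} [Fintype ι] [FiniteDimensional ℝ E]
    (b : Module.Basis ι ℝ E) {K : ℕ} {w : J → ℝ} {pt : J → E} :
    ∀ {f : J → E → F}, (∀ j, ContDiff ℝ ∞ (f j)) → (∀ j, 0 ≤ w j) →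
    (∀ l : List ι, ∃ C : ℝ, 0 ≤ C ∧ ∀ j, ‖listD (l.map b) (f j) (pt j)‖ ≤ C * w j) →
    SB K w pt f := by
  induction K with
  | zero =>
    intro f _ hw h
    exact SB.zero_iff.2 ⟨hw, h []⟩
  | succ K ih =>
    intro f hf hw h
    refine SB.succ_iff.2 ⟨SB.zero_iff.2 ⟨hw, h []⟩, SB.fderiv_of_dirD b hf hw fun i => ?_⟩
    refine ih (fun j => (hf j).dirD _) hw fun l => ?_
    obtain ⟨C, hC, hb⟩ := h (l ++ [i])
    refine ⟨C, hC, fun j => ?_⟩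
    have := hb j
    rwa [List.map_append, listD_append] at this

end ListD

/-! ### Elementary properties of the Japanese bracket -/

section Bracket
variable {n : ℕ}

theorem one_le_jb (x : SGSpace n) : 1 ≤ japaneseBracket x := by
  rw [japaneseBracket, Real.one_le_sqrt]; nlinarith [sq_nonneg ‖x‖]

theorem jb_pos (x : SGSpace n) : 0 < japaneseBracket x := zero_lt_one.trans_le (one_le_jb x)

theorem norm_le_jb (x : SGSpace n) : ‖x‖ ≤ japaneseBracket x :=
  Real.le_sqrt_of_sq_le (by linarith)

theorem jb_le (x : SGSpace n) : japaneseBracket x ≤ 1 + ‖x‖ := by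
  rw [japaneseBracket, Real.sqrt_le_left (by positivity)]
  nlinarith [norm_nonneg x]

/-- The bracket is the norm of (1, x), hence 1-Lipschitz. All comparisons of weights at different
points rest on this. -/
theorem jb_le_add (x y : SGSpace n) : japaneseBracket x ≤ japaneseBracket y + ‖x - y‖ := by
  have hy := Real.sq_sqrt (show 0 ≤ 1 + ‖y‖ ^ 2 by positivity)
  have h1 : ‖x‖ ≤ ‖y‖ + ‖x - y‖ := by
    have := norm_add_le y (x - y); simpa using this
  have h2 := norm_le_jb y
  have h3 := one_le_jb y
  rw [japaneseBracket, Real.sqrt_le_left (by positivity)]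
  unfold japaneseBracket at *
  nlinarith [norm_nonneg x, norm_nonneg y, norm_nonneg (x - y)]

end Bracket

/-! ### Symbol estimates as estimates for affinely rescaled functions -/

section Scaling
variable {n : ℕ} {F : Type} [NormedAddCommGroup F] [NormedSpace ℝ F]

/-- The coordinate vectors of the phase space. -/
def coordVec (n : ℕ) : Fin n ⊕ Fin n → SGSpace n × SGSpace n :=
  Sum.elim (fun i => (EuclideanSpace.single i (1 : ℝ), 0)) (fun i => (0, EuclideanSpace.single i 1))

/-- The coordinate basis of the phase space. -/
def coordBasis (n : ℕ) : Module.Basis (Fin n ⊕ Fin n) ℝ (SGSpace n × SGSpace n) :=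
  (EuclideanSpace.basisFun (Fin n) ℝ).toBasis.prod (EuclideanSpace.basisFun (Fin n) ℝ).toBasis

theorem coordBasis_apply (i : Fin n ⊕ Fin n) : coordBasis n i = coordVec n i := by
  rcases i with i | i <;> simp [coordBasis, coordVec]

theorem mixedPartial_eq_listD {a : SGSpace n × SGSpace n → F} (ha : ContDiff ℝ ∞ a) {k l : ℕ}
    (i : Fin k → Fin n) (j : Fin l → Fin n) (z : SGSpace n × SGSpace n) :
    mixedPartial a i j z = listD ((List.ofFn fun t => Sum.inl (i t)).map (coordVec n) ++
      (List.ofFn fun t => Sum.inr (j t)).map (coordVec n)) a z := by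
  rw [mixedPartial, iteratedFDeriv_apply_eq_listD ha, List.ofFn_fin_append, List.map_ofFn,
    List.map_ofFn]
  rfl

/-- `mixedPartial` puts the x-vectors before the ξ-vectors. As derivatives of smooth functions
commute, any word in the coordinate vectors may be sorted into this shape. -/
theorem exists_perm_inl_inr (l : List (Fin n ⊕ Fin n)) :
    ∃ (k k' : ℕ) (i : Fin k → Fin n) (j : Fin k' → Fin n),
      l.Perm ((List.ofFn fun t => Sum.inl (i t)) ++ (List.ofFn fun t => Sum.inr (j t))) := by
  induction l with
  | nil => exact ⟨0, 0, Fin.elim0, Fin.elim0, by simp⟩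
  | cons a l ih =>
    obtain ⟨k, k', i, j, h⟩ := ih
    rcases a with a | a
    · refine ⟨k + 1, k', Fin.cons a i, j, ?_⟩
      simpa [List.ofFn_succ] using h
    · refine ⟨k, k' + 1, i, Fin.cons a j, ?_⟩
      rw [List.ofFn_succ]
      simp only [Fin.cons_zero, Fin.cons_succ]
      exact (List.Perm.cons _ h).trans List.perm_middle.symm

/-- The numbers of derivatives in the first and in the second variable. -/
def cntX (l : List (Fin n ⊕ Fin n)) : ℕ := l.countP Sum.isLeft
/-- The numbers of derivatives in the first and in the second variable. -/
def cntXi (l : List (Fin n ⊕ Fin n)) : ℕ := l.countP Sum.isRight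

theorem cntX_sorted {k k' : ℕ} (i : Fin k → Fin n) (j : Fin k' → Fin n) :
    cntX ((List.ofFn fun t => Sum.inl (i t)) ++ (List.ofFn fun t => Sum.inr (j t))) = k := by
  have h1 : (List.ofFn fun t => (Sum.inl (i t) : Fin n ⊕ Fin n)).countP Sum.isLeft = k := by
    rw [List.countP_eq_length.2]
    · simp
    · intro a ha; obtain ⟨t, rfl⟩ := (List.mem_ofFn' _ _).1 ha; rfl
  have h2 : (List.ofFn fun t => (Sum.inr (j t) : Fin n ⊕ Fin n)).countP Sum.isLeft = 0 := by
    rw [List.countP_eq_zero]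
    intro a ha; obtain ⟨t, rfl⟩ := (List.mem_ofFn' _ _).1 ha; simp
  rw [cntX, List.countP_append, h1, h2, add_zero]

theorem cntXi_sorted {k k' : ℕ} (i : Fin k → Fin n) (j : Fin k' → Fin n) :
    cntXi ((List.ofFn fun t => Sum.inl (i t)) ++ (List.ofFn fun t => Sum.inr (j t))) = k' := by
  have h1 : (List.ofFn fun t => (Sum.inr (j t) : Fin n ⊕ Fin n)).countP Sum.isRight = k' := by
    rw [List.countP_eq_length.2]
    · simp
    · intro a ha; obtain ⟨t, rfl⟩ := (List.mem_ofFn' _ _).1 ha; rfl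
  have h2 : (List.ofFn fun t => (Sum.inl (i t) : Fin n ⊕ Fin n)).countP Sum.isRight = 0 := by
    rw [List.countP_eq_zero]
    intro a ha; obtain ⟨t, rfl⟩ := (List.mem_ofFn' _ _).1 ha; simp
  rw [cntXi, List.countP_append, h1, h2, zero_add]

/-- Words in the coordinate vectors can be extended letter by letter, which the sorted form of
`mixedPartial` does not allow; this makes derivatives of symbols symbols. -/
theorem listD_bound_iff {m μ : ℝ} {ι : Type*} {a : ι → SGSpace n × SGSpace n → F}
    (ha : ∀ s, ContDiff ℝ ∞ (a s)) :
    (∀ k l : ℕ, ∃ C : ℝ, ∀ s, SGBound m μ k l C (a s)) ↔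
    ∀ l : List (Fin n ⊕ Fin n), ∃ C : ℝ, ∀ s x ξ, ‖listD (l.map (coordVec n)) (a s) (x, ξ)‖ ≤
      C * japaneseBracket x ^ (m - (cntX l : ℝ)) * japaneseBracket ξ ^ (μ - (cntXi l : ℝ)) := by
  constructor
  · intro h l
    obtain ⟨k, k', i, j, hp⟩ := exists_perm_inl_inr l
    obtain ⟨C, hC⟩ := h k k'
    refine ⟨C, fun s x ξ => ?_⟩
    have h1 : cntX l = k := (hp.countP_eq _).trans (cntX_sorted i j)
    have h2 : cntXi l = k' := (hp.countP_eq _).trans (cntXi_sorted i j)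
    have h3 := hC s i j x ξ
    rw [mixedPartial_eq_listD (ha s), ← List.map_append,
      ← listD_perm (ha s) (hp.map (coordVec n))] at h3
    rwa [h1, h2]
  · intro h k k'
    have : ∃ C : (Fin k → Fin n) → (Fin k' → Fin n) → ℝ, ∀ i j s x ξ,
        ‖mixedPartial (a s) i j (x, ξ)‖ ≤
        C i j * japaneseBracket x ^ (m - (k : ℝ)) * japaneseBracket ξ ^ (μ - (k' : ℝ)) := by
      choose C hC using h
      refine ⟨fun i j => C ((List.ofFn fun t => Sum.inl (i t)) ++ (List.ofFn fun t => Sum.inr (j t))),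
        fun i j s x ξ => ?_⟩
      have := hC ((List.ofFn fun t => Sum.inl (i t)) ++ (List.ofFn fun t => Sum.inr (j t))) s x ξ
      rw [cntX_sorted, cntXi_sorted, List.map_append] at this
      rwa [mixedPartial_eq_listD (ha s)]
    obtain ⟨C, hC⟩ := this
    -- `SGBound` asks for one constant for all choices of coordinates; there are finitely many, so
    -- the sum works.
    refine ⟨∑ i, ∑ j, |C i j|, fun s i j x ξ => (hC i j s x ξ).trans ?_⟩
    have hx := Real.rpow_nonneg (jb_pos x).le (m - (k : ℝ))
    have hξ := Real.rpow_nonneg (jb_pos ξ).le (μ - (k' : ℝ))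
    refine mul_le_mul_of_nonneg_right (mul_le_mul_of_nonneg_right ?_ hx) hξ
    calc C i j ≤ |C i j| := le_abs_self _
      _ ≤ ∑ j, |C i j| := Finset.single_le_sum (f := fun j => |C i j|)
          (fun _ _ => abs_nonneg _) (Finset.mem_univ j)
      _ ≤ _ := Finset.single_le_sum (f := fun i => ∑ j, |C i j|)
          (fun _ _ => Finset.sum_nonneg fun _ _ => abs_nonneg _) (Finset.mem_univ i)

theorem SGBoundedFamily.listD_bound {m μ : ℝ} {ι : Type*} {a : ι → SGSpace n × SGSpace n → F}
    (ha : SGBoundedFamily m μ a) (l : List (Fin n ⊕ Fin n)) : ∃ C : ℝ, 0 ≤ C ∧ ∀ s x ξ,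
      ‖listD (l.map (coordVec n)) (a s) (x, ξ)‖ ≤
      C * japaneseBracket x ^ (m - (cntX l : ℝ)) * japaneseBracket ξ ^ (μ - (cntXi l : ℝ)) := by
  obtain ⟨C, hC⟩ := (listD_bound_iff ha.smooth).1 ha.bound l
  refine ⟨|C|, abs_nonneg _, fun s x ξ => (hC s x ξ).trans ?_⟩
  have hx := Real.rpow_nonneg (jb_pos x).le (m - (cntX l : ℝ))
  have hξ := Real.rpow_nonneg (jb_pos ξ).le (μ - (cntXi l : ℝ))
  exact mul_le_mul_of_nonneg_right (mul_le_mul_of_nonneg_right (le_abs_self _) hx) hξ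

theorem SGBoundedFamily.dirD {m μ : ℝ} {ι : Type*} {a : ι → SGSpace n × SGSpace n → F}
    (ha : SGBoundedFamily m μ a) (i : Fin n ⊕ Fin n) :
    SGBoundedFamily (m - cntX [i]) (μ - cntXi [i]) (fun s => dirD (coordVec n i) (a s)) := by
  refine ⟨fun s => (ha.smooth s).dirD _, (listD_bound_iff fun s => (ha.smooth s).dirD _).2 ?_⟩
  intro l
  obtain ⟨C, -, hC⟩ := ha.listD_bound (l ++ [i])
  refine ⟨C, fun s x ξ => ?_⟩
  have := hC s x ξ
  rw [List.map_append, listD_append] at this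
  have h1 : ((cntX (l ++ [i]) : ℕ) : ℝ) = cntX [i] + cntX l := by
    simp only [cntX, List.countP_append]; push_cast; ring
  have h2 : ((cntXi (l ++ [i]) : ℕ) : ℝ) = cntXi [i] + cntXi l := by
    simp only [cntXi, List.countP_append]; push_cast; ring
  rw [h1, h2, ← sub_sub, ← sub_sub] at this
  exact this

/-- The affine scaling `σ ↦ (x₀ + r σ₁, ξ₀ + ρ σ₂)` of the phase space. -/
def scal (z : SGSpace n × SGSpace n) (r ρ : ℝ) (σ : SGSpace n × SGSpace n) :
    SGSpace n × SGSpace n := (z.1 + r • σ.1, z.2 + ρ • σ.2)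

theorem scal_zero (z : SGSpace n × SGSpace n) (r ρ : ℝ) : scal z r ρ 0 = z := by simp [scal]

/-- The linear part of `scal`. -/
def scalL (n : ℕ) (r ρ : ℝ) : SGSpace n × SGSpace n →L[ℝ] SGSpace n × SGSpace n :=
  ((r • ContinuousLinearMap.fst ℝ _ _).prod (ρ • ContinuousLinearMap.snd ℝ _ _))

theorem hasFDerivAt_scal (z : SGSpace n × SGSpace n) (r ρ : ℝ) (σ : SGSpace n × SGSpace n) :
    HasFDerivAt (scal z r ρ) (scalL n r ρ) σ := by
  have h := (scalL n r ρ).hasFDerivAt (x := σ) |>.const_add z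
  exact h.congr_of_eventuallyEq (Filter.Eventually.of_forall fun σ => by
    simp [scal, scalL, Prod.ext_iff])

theorem contDiff_scal (z : SGSpace n × SGSpace n) (r ρ : ℝ) : ContDiff ℝ ∞ (scal z r ρ) := by
  have h : scal z r ρ = fun σ => z + scalL n r ρ σ := by
    funext σ; simp [scal, scalL, Prod.ext_iff]
  rw [h]
  exact contDiff_const.add (scalL n r ρ).contDiff

theorem listD_comp_scal {a : SGSpace n × SGSpace n → F} (ha : ContDiff ℝ ∞ a)
    (z : SGSpace n × SGSpace n) (r ρ : ℝ) (l : List (Fin n ⊕ Fin n)) :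
    listD (l.map (coordVec n)) (fun σ => a (scal z r ρ σ)) =
      fun σ => (r ^ cntX l * ρ ^ cntXi l) • listD (l.map (coordVec n)) a (scal z r ρ σ) := by
  induction l with
  | nil => funext σ; simp [listD, cntX, cntXi]
  | cons i l ih =>
    simp only [List.map_cons, listD, ih]
    funext σ
    have hd : HasFDerivAt (fun σ => listD (l.map (coordVec n)) a (scal z r ρ σ)) _ σ :=
      (((ha.listD _).differentiable (by simp) _).hasFDerivAt).comp σ (hasFDerivAt_scal z r ρ σ)
    have hd2 := hd.const_smul (r ^ cntX l * ρ ^ cntXi l)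
    rw [dirD]
    refine (congrArg (fun L => L (coordVec n i)) (HasFDerivAt.fderiv (f' := _) hd2)).trans ?_
    rcases i with i | i
    · have h1 : scalL n r ρ (coordVec n (Sum.inl i)) = r • coordVec n (Sum.inl i) := by
        simp [scalL, coordVec]
      have h2 : cntX (Sum.inl i :: l) = cntX l + 1 := List.countP_cons_of_pos rfl
      have h3 : cntXi (Sum.inl i :: l) = cntXi l := by simp [cntXi]
      rw [h2, h3]
      simp only [smul_apply, ContinuousLinearMap.comp_apply, h1, map_smul,
        smul_smul, dirD]
      congr 1; ring
    · have h1 : scalL n r ρ (coordVec n (Sum.inr i)) = ρ • coordVec n (Sum.inr i) := by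
        simp [scalL, coordVec]
      have h2 : cntX (Sum.inr i :: l) = cntX l := by simp [cntX]
      have h3 : cntXi (Sum.inr i :: l) = cntXi l + 1 := List.countP_cons_of_pos rfl
      rw [h2, h3]
      simp only [smul_apply, ContinuousLinearMap.comp_apply, h1, map_smul,
        smul_smul, dirD]
      congr 1; ring

/-- Rescaled symbols are bounded by the symbol weight at the point of evaluation. -/
theorem SGBoundedFamily.sb_scal {m μ : ℝ} {ι J : Type*} {a : ι → SGSpace n × SGSpace n → F}
    (ha : SGBoundedFamily m μ a) (K : ℕ) (s : J → ι) (z : J → SGSpace n × SGSpace n)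
    (r ρ : J → ℝ) (pt : J → SGSpace n × SGSpace n) {A : ℝ}
    (hr0 : ∀ j, 0 ≤ r j) (hρ0 : ∀ j, 0 ≤ ρ j)
    (hr : ∀ j, r j ≤ A * japaneseBracket (scal (z j) (r j) (ρ j) (pt j)).1)
    (hρ : ∀ j, ρ j ≤ A * japaneseBracket (scal (z j) (r j) (ρ j) (pt j)).2) :
    SB K (fun j => japaneseBracket (scal (z j) (r j) (ρ j) (pt j)).1 ^ m *
      japaneseBracket (scal (z j) (r j) (ρ j) (pt j)).2 ^ μ) pt
      (fun j σ => a (s j) (scal (z j) (r j) (ρ j) σ)) := by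
  refine SB.of_listD (coordBasis n) (fun j => (ha.smooth _).comp (contDiff_scal _ _ _))
    (fun j => by have := jb_pos (scal (z j) (r j) (ρ j) (pt j)).1
                 have := jb_pos (scal (z j) (r j) (ρ j) (pt j)).2; positivity) fun l => ?_
  obtain ⟨C, hC, hb⟩ := ha.listD_bound l
  refine ⟨C * |A| ^ cntX l * |A| ^ cntXi l, by positivity, fun j => ?_⟩
  have he : l.map (coordBasis n) = l.map (coordVec n) :=
    List.map_congr_left fun i _ => coordBasis_apply i
  rw [he, listD_comp_scal (ha.smooth _), norm_smul]
  set y := scal (z j) (r j) (ρ j) (pt j) with hy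
  have hx := jb_pos y.1
  have hξ := jb_pos y.2
  have h1 := hb (s j) y.1 y.2
  rw [Real.rpow_sub hx, Real.rpow_sub hξ, Real.rpow_natCast, Real.rpow_natCast] at h1
  -- The chain rule produces powers of the scales. A scale that is at most a multiple of the bracket
  -- at the evaluation point is absorbed by the bracket which the symbol gains per derivative.
  have h2 : r j ^ cntX l ≤ |A| ^ cntX l * japaneseBracket y.1 ^ cntX l := by
    rw [← mul_pow]
    exact pow_le_pow_left₀ (hr0 j)
      ((hr j).trans (mul_le_mul_of_nonneg_right (le_abs_self A) hx.le)) _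
  have h3 : ρ j ^ cntXi l ≤ |A| ^ cntXi l * japaneseBracket y.2 ^ cntXi l := by
    rw [← mul_pow]
    exact pow_le_pow_left₀ (hρ0 j)
      ((hρ j).trans (mul_le_mul_of_nonneg_right (le_abs_self A) hξ.le)) _
  have hr0' := hr0 j
  have hρ0' := hρ0 j
  rw [Real.norm_of_nonneg (by positivity)]
  calc _ ≤ (|A| ^ cntX l * japaneseBracket y.1 ^ cntX l) *
        (|A| ^ cntXi l * japaneseBracket y.2 ^ cntXi l) *
        (C * (japaneseBracket y.1 ^ m / japaneseBracket y.1 ^ cntX l) *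
          (japaneseBracket y.2 ^ μ / japaneseBracket y.2 ^ cntXi l)) := by
        gcongr
    _ = _ := by field_simp

/-- Symbol estimates follow from bounds of the rescaled functions at the origin. -/
theorem SGBoundedFamily.of_sb_scal {m μ : ℝ} {ι : Type*} {a : ι → SGSpace n × SGSpace n → F}
    (ha : ∀ s, ContDiff ℝ ∞ (a s))
    (h : ∀ K, SB K (fun j : ι × (SGSpace n × SGSpace n) =>
        japaneseBracket j.2.1 ^ m * japaneseBracket j.2.2 ^ μ) (fun _ => 0)
      (fun j σ => a j.1 (scal j.2 (japaneseBracket j.2.1) (japaneseBracket j.2.2) σ))) :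
    SGBoundedFamily m μ a := by
  refine ⟨ha, fun k l => ?_⟩
  obtain ⟨-, C, hC, hb⟩ := h (k + l)
  refine ⟨C, fun s i j x ξ => ?_⟩
  have hx := jb_pos x
  have hξ := jb_pos ξ
  have h1 := hb (s, (x, ξ)) (k + l) le_rfl
  have hsm : ContDiff ℝ ∞ (fun σ => a s (scal (x, ξ) (japaneseBracket x) (japaneseBracket ξ) σ)) :=
    (ha s).comp (contDiff_scal _ _ _)
  have h2 := mixedPartial_eq_listD hsm i j 0
  rw [← List.map_append, listD_comp_scal (ha s), cntX_sorted, cntXi_sorted, List.map_append] at h2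
  simp only [scal_zero] at h2
  rw [← mixedPartial_eq_listD (ha s)] at h2
  have h3 : ‖mixedPartial (fun σ => a s (scal (x, ξ) (japaneseBracket x) (japaneseBracket ξ) σ))
      i j 0‖ ≤ C * (japaneseBracket x ^ m * japaneseBracket ξ ^ μ) := by
    -- The coordinate vectors have norm at most one, so a mixed partial derivative is bounded by the
    -- norm of the full derivative.
    refine (ContinuousMultilinearMap.le_opNorm _ _).trans (le_trans ?_ h1)
    refine mul_le_of_le_one_right (norm_nonneg _) (Finset.prod_le_one (fun _ _ => norm_nonneg _) ?_)
    intro t _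
    refine Fin.addCases (fun t => ?_) (fun t => ?_) t
    · simp [Fin.append_left, Prod.norm_def]
    · simp [Fin.append_right, Prod.norm_def]
  rw [h2, norm_smul, Real.norm_of_nonneg (by positivity)] at h3
  rw [Real.rpow_sub hx, Real.rpow_sub hξ, Real.rpow_natCast, Real.rpow_natCast]
  have h4 : C * (japaneseBracket x ^ m / japaneseBracket x ^ k) *
      (japaneseBracket ξ ^ μ / japaneseBracket ξ ^ l) =
      C * (japaneseBracket x ^ m * japaneseBracket ξ ^ μ) /
        (japaneseBracket x ^ k * japaneseBracket ξ ^ l) := by field_simp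
  rw [h4, le_div_iff₀ (by positivity), mul_comm]
  exact h3

end Scaling

/-! ### Integration by parts in oscillatory integrals -/

section OscillatoryIBP
variable {E V : Type} [NormedAddCommGroup E] [NormedSpace ℝ E] [NormedAddCommGroup V]
  [NormedSpace ℝ V] {L : Type} [Fintype L]

/-- The derivative of the phase along `e` in the integration variable. -/
def phG (Θ : E × V → ℝ) (e : V) : E × V → ℝ := dirD ((0, e) : E × V) Θ

/-- `1 + ∑ (∂_{e l} Θ)²`. -/
def phQ (Θ : E × V → ℝ) (e : L → V) (z : E × V) : ℝ := 1 + ∑ l, phG Θ (e l) z * phG Θ (e l) z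

/-- The transpose of the first order operator reproducing `exp (iΘ)`. -/
def oscLT (Θ : E × V → ℝ) (e : L → V) (b : E × V → ℂ) (z : E × V) : ℂ :=
  (phQ Θ e z)⁻¹ • b z + Complex.I *
    ∑ l, dirD ((0, e l) : E × V) (fun z => (phG Θ (e l) z * (phQ Θ e z)⁻¹) • b z) z

theorem one_le_phQ (Θ : E × V → ℝ) (e : L → V) (z : E × V) : 1 ≤ phQ Θ e z := by
  have : 0 ≤ ∑ l, phG Θ (e l) z * phG Θ (e l) z :=
    Finset.sum_nonneg fun l _ => mul_self_nonneg _
  rw [phQ]; linarith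

theorem phQ_ne_zero (Θ : E × V → ℝ) (e : L → V) (z : E × V) : phQ Θ e z ≠ 0 :=
  (zero_lt_one.trans_le (one_le_phQ Θ e z)).ne'

variable {Θ : E × V → ℝ} {e : L → V} {b b' : E × V → ℂ}

theorem contDiff_phG (hΘ : ContDiff ℝ ∞ Θ) (v : V) : ContDiff ℝ ∞ (phG Θ v) := hΘ.dirD _

theorem contDiff_phQ (hΘ : ContDiff ℝ ∞ Θ) : ContDiff ℝ ∞ (phQ Θ e) :=
  contDiff_const.add (ContDiff.sum fun _ _ => (contDiff_phG hΘ _).mul (contDiff_phG hΘ _))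

theorem contDiff_phQ_inv (hΘ : ContDiff ℝ ∞ Θ) : ContDiff ℝ ∞ (fun z => (phQ Θ e z)⁻¹) :=
  (contDiff_phQ hΘ).inv (phQ_ne_zero Θ e)

theorem contDiff_phGQ (hΘ : ContDiff ℝ ∞ Θ) (hb : ContDiff ℝ ∞ b) (l : L) :
    ContDiff ℝ ∞ (fun z => (phG Θ (e l) z * (phQ Θ e z)⁻¹) • b z) :=
  ((contDiff_phG hΘ _).mul (contDiff_phQ_inv hΘ)).smul hb

theorem contDiff_oscLT (hΘ : ContDiff ℝ ∞ Θ) (hb : ContDiff ℝ ∞ b) :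
    ContDiff ℝ ∞ (oscLT Θ e b) :=
  ((contDiff_phQ_inv hΘ).smul hb).add
    (contDiff_const.mul (ContDiff.sum fun l _ => (contDiff_phGQ hΘ hb l).dirD _))

theorem contDiff_oscLT_iterate (hΘ : ContDiff ℝ ∞ Θ) (hb : ContDiff ℝ ∞ b) (M : ℕ) :
    ContDiff ℝ ∞ ((oscLT Θ e)^[M] b) := by
  induction M with
  | zero => exact hb
  | succ M ih => rw [Function.iterate_succ_apply']; exact contDiff_oscLT hΘ ih

theorem oscLT_congr {z : E × V} (h : b =ᶠ[nhds z] b') :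
    oscLT Θ e b =ᶠ[nhds z] oscLT Θ e b' := by
  have h1 : ∀ l, dirD ((0, e l) : E × V) (fun z => (phG Θ (e l) z * (phQ Θ e z)⁻¹) • b z)
      =ᶠ[nhds z] dirD ((0, e l) : E × V) (fun z => (phG Θ (e l) z * (phQ Θ e z)⁻¹) • b' z) := by
    intro l
    refine Filter.EventuallyEq.dirD ?_ _
    filter_upwards [h] with y hy
    rw [hy]
  filter_upwards [h, Filter.eventually_all.2 h1] with y hy hy1
  simp only [oscLT, hy, hy1]

theorem oscLT_iterate_congr {z : E × V} (h : b =ᶠ[nhds z] b') (M : ℕ) :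
    (oscLT Θ e)^[M] b =ᶠ[nhds z] (oscLT Θ e)^[M] b' := by
  induction M with
  | zero => exact h
  | succ M ih => rw [Function.iterate_succ_apply', Function.iterate_succ_apply']
                 exact oscLT_congr ih

theorem oscLT_zero : oscLT Θ e (fun _ => 0) = fun _ => 0 := by
  funext z
  simp [oscLT, dirD]

theorem oscLT_iterate_zero (M : ℕ) : (oscLT Θ e)^[M] (fun _ => 0) = fun _ => 0 := by
  induction M with
  | zero => rfl
  | succ M ih => rw [Function.iterate_succ_apply', ih, oscLT_zero]

theorem oscLT_iterate_eq_zero {z : E × V} (h : b =ᶠ[nhds z] fun _ => 0) (M : ℕ) :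
    (oscLT Θ e)^[M] b =ᶠ[nhds z] fun _ => 0 := by
  have := oscLT_iterate_congr (Θ := Θ) (e := e) h M
  rwa [oscLT_iterate_zero] at this

theorem SB.phQ_inv {J : Type*} {K : ℕ} {g : J → ℝ} {pt : J → E × V} {Θ : J → E × V → ℝ}
    (hΘ : ∀ j, ContDiff ℝ ∞ (Θ j)) (hg1 : ∀ j, 1 ≤ g j) {c : ℝ} (hc : 0 < c)
    (hQ : ∀ j, c * g j ^ 2 ≤ phQ (Θ j) e (pt j))
    (hG : ∀ l, SB K g pt (fun j => phG (Θ j) (e l))) :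
    SB K (fun j => (g j ^ 2)⁻¹) pt (fun j z => (phQ (Θ j) e z)⁻¹) := by
  have hg0 : ∀ j, 0 < g j := fun j => zero_lt_one.trans_le (hg1 j)
  have hQs : SB K (fun j => g j ^ 2) pt (fun j => phQ (Θ j) e) := by
    refine SB.add (fun _ => contDiff_const) (fun j => ContDiff.sum fun l _ =>
      (contDiff_phG (hΘ j) _).mul (contDiff_phG (hΘ j) _)) ?_ ?_
    · exact SB.const zero_le_one (fun j => by positivity) fun j => by
        rw [norm_one, one_mul]; exact one_le_pow₀ (hg1 j)
    · refine SB.sum _ (fun j => by positivity) (fun l j =>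
        (contDiff_phG (hΘ j) _).mul (contDiff_phG (hΘ j) _)) fun l => ?_
      refine ((hG l).mul (fun j => contDiff_phG (hΘ j) _) (fun j => contDiff_phG (hΘ j) _)
        (hG l)).mono_weight' fun j => le_of_eq (sq _).symm
  exact SB.inv (fun j => contDiff_phQ (hΘ j)) (fun j => phQ_ne_zero _ _) hc
    (fun j => by have := hg0 j; positivity) (fun j => (hQ j).trans (le_abs_self _)) hQs

theorem SB.phGQ {J : Type*} {K : ℕ} {g m : J → ℝ} {pt : J → E × V} {Θ : J → E × V → ℝ}
    {b : J → E × V → ℂ} (hΘ : ∀ j, ContDiff ℝ ∞ (Θ j)) (hb : ∀ j, ContDiff ℝ ∞ (b j))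
    (hg1 : ∀ j, 1 ≤ g j) {c : ℝ} (hc : 0 < c) (hQ : ∀ j, c * g j ^ 2 ≤ phQ (Θ j) e (pt j))
    (hG : ∀ l, SB K g pt (fun j => phG (Θ j) (e l))) (hm : SB K m pt b) (l : L) :
    SB K (fun j => m j / g j) pt
      (fun j z => (phG (Θ j) (e l) z * (phQ (Θ j) e z)⁻¹) • b j z) := by
  refine (((hG l).mul (fun j => contDiff_phG (hΘ j) _) (fun j => contDiff_phQ_inv (hΘ j))
    (SB.phQ_inv hΘ hg1 hc hQ hG)).smul
    (fun j => (contDiff_phG (hΘ j) _).mul (contDiff_phQ_inv (hΘ j))) hb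
    hm).mono_weight' fun j => le_of_eq ?_
  have := (zero_lt_one.trans_le (hg1 j)).ne'
  field_simp

/-- With gradient of size g and Q comparable to g², both 1/Q and G/Q are at most of size 1/g, and
differentiation does not change these weights. So each application gains 1/g at the price of one
order of differentiability. -/
theorem SB.oscLT {J : Type*} {K : ℕ} {g m : J → ℝ} {pt : J → E × V} {Θ : J → E × V → ℝ}
    {b : J → E × V → ℂ} (hΘ : ∀ j, ContDiff ℝ ∞ (Θ j)) (hb : ∀ j, ContDiff ℝ ∞ (b j))
    (hg1 : ∀ j, 1 ≤ g j) {c : ℝ} (hc : 0 < c) (hQ : ∀ j, c * g j ^ 2 ≤ phQ (Θ j) e (pt j))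
    (hG : ∀ l, SB (K + 1) g pt (fun j => phG (Θ j) (e l))) (hm : SB (K + 1) m pt b) :
    SB K (fun j => m j / g j) pt (fun j => oscLT (Θ j) e (b j)) := by
  have hg0 : ∀ j, 0 < g j := fun j => zero_lt_one.trans_le (hg1 j)
  have hw : ∀ j, 0 ≤ m j / g j := fun j => div_nonneg (hm.1 j) (hg0 j).le
  refine SB.add (fun j => (contDiff_phQ_inv (hΘ j)).smul (hb j)) (fun j => contDiff_const.mul
    (ContDiff.sum fun l _ => (contDiff_phGQ (hΘ j) (hb j) l).dirD _)) ?_ ?_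
  · refine (((SB.phQ_inv hΘ hg1 hc hQ hG).smul (fun j => contDiff_phQ_inv (hΘ j)) hb
      hm).mono_order (Nat.le_succ K)).mono_weight' fun j => ?_
    rw [div_eq_mul_inv, mul_comm]
    refine mul_le_mul_of_nonneg_left (inv_anti₀ (hg0 j) ?_) (hm.1 j)
    exact le_self_pow₀ (hg1 j) two_ne_zero
  · refine SB.clm' (ContinuousLinearMap.mul ℝ ℂ Complex.I)
      (fun j => ContDiff.sum fun l _ => (contDiff_phGQ (hΘ j) (hb j) l).dirD _) ?_
    exact SB.sum _ hw (fun l j => (contDiff_phGQ (hΘ j) (hb j) l).dirD _) fun l =>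
      SB.dirD (fun j => contDiff_phGQ (hΘ j) (hb j) l) (SB.phGQ hΘ hb hg1 hc hQ hG hm l) _

theorem SB.oscLT_iterate {J : Type*} {g m : J → ℝ} {pt : J → E × V} {Θ : J → E × V → ℝ}
    {b : J → E × V → ℂ} (hΘ : ∀ j, ContDiff ℝ ∞ (Θ j)) (hb : ∀ j, ContDiff ℝ ∞ (b j))
    (hg1 : ∀ j, 1 ≤ g j) {c : ℝ} (hc : 0 < c) (hQ : ∀ j, c * g j ^ 2 ≤ phQ (Θ j) e (pt j))
    (hG : ∀ K l, SB K g pt (fun j => phG (Θ j) (e l))) (hm : ∀ K, SB K m pt b) (M : ℕ) :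
    ∀ K, SB K (fun j => m j / g j ^ M) pt (fun j => (_root_.oscLT (Θ j) e)^[M] (b j)) := by
  induction M with
  | zero => intro K; simpa using hm K
  | succ M ih =>
    intro K
    have := SB.oscLT hΘ (fun j => contDiff_oscLT_iterate (hΘ j) (hb j) M) hg1 hc hQ
      (fun l => hG (K + 1) l) (ih (K + 1))
    simp only [Function.iterate_succ_apply']
    refine this.mono_weight' fun j => le_of_eq ?_
    rw [pow_succ, div_div]

theorem hasFDerivAt_snd_section {F : Type} [NormedAddCommGroup F] [NormedSpace ℝ F]
    {f : E × V → F} (hf : ContDiff ℝ ∞ f) (σ : E) (v : V) :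
    HasFDerivAt (fun v => f (σ, v)) ((fderiv ℝ f (σ, v)).comp (ContinuousLinearMap.inr ℝ E V)) v :=
  ((hf.differentiable (by simp) (σ, v)).hasFDerivAt).comp (f := fun v : V => (σ, v)) v
    (hasFDerivAt_prodMk_right σ v)

theorem fderiv_snd_section {F : Type} [NormedAddCommGroup F] [NormedSpace ℝ F]
    {f : E × V → F} (hf : ContDiff ℝ ∞ f) (σ : E) (v w : V) :
    fderiv ℝ (fun v => f (σ, v)) v w = dirD ((0, w) : E × V) f (σ, v) := by
  rw [(hasFDerivAt_snd_section hf σ v).fderiv]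
  simp [dirD]

theorem contDiff_cexp (hΘ : ContDiff ℝ ∞ Θ) :
    ContDiff ℝ ∞ (fun z => Complex.exp (Complex.I * (Θ z : ℂ))) :=
  (contDiff_const.mul (Complex.ofRealCLM.contDiff.comp hΘ)).cexp

theorem dirD_cexp (hΘ : ContDiff ℝ ∞ Θ) (v : V) (z : E × V) :
    dirD ((0, v) : E × V) (fun z => Complex.exp (Complex.I * (Θ z : ℂ))) z
      = Complex.exp (Complex.I * (Θ z : ℂ)) * (Complex.I * (phG Θ v z : ℂ)) := by
  have hd := (hΘ.differentiable (by simp) z).hasFDerivAt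
  have hd2 := ((Complex.ofRealCLM.hasFDerivAt.comp z hd).const_mul Complex.I).cexp
  rw [dirD]
  refine (congrArg (fun L => L ((0, v) : E × V)) (HasFDerivAt.fderiv (f' := _) hd2)).trans ?_
  simp [phG, dirD]

theorem norm_cexp_I_mul (t : ℝ) : ‖Complex.exp (Complex.I * (t : ℂ))‖ = 1 := by
  rw [mul_comm, Complex.norm_exp_ofReal_mul_I]

variable [FiniteDimensional ℝ V] [MeasurableSpace V] [BorelSpace V] {μ : Measure V}
  [μ.IsAddHaarMeasure]

/-- With G_l = ∂_lΘ and Q = 1 + ΣG_l², one has 1 = 1/Q + ΣG_l·G_l/Q and G_l e^{iΘ} = −i∂_l e^{iΘ};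
moving ∂_l to the amplitude gives the transposed operator. The summand 1 in Q avoids any singularity
where the gradient vanishes. -/
theorem integral_oscLT (hΘ : ContDiff ℝ ∞ Θ) (hb : ContDiff ℝ ∞ b) (σ : E)
    (hi : Integrable (fun v => b (σ, v)) μ)
    (hi' : ∀ l, Integrable (fun v =>
      dirD ((0, e l) : E × V) (fun z => (phG Θ (e l) z * (phQ Θ e z)⁻¹) • b z) (σ, v)) μ) :
    ∫ v, Complex.exp (Complex.I * (Θ (σ, v) : ℂ)) * b (σ, v) ∂μ =
      ∫ v, Complex.exp (Complex.I * (Θ (σ, v) : ℂ)) * oscLT Θ e b (σ, v) ∂μ := by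
  have hcont : ∀ {F : Type} [NormedAddCommGroup F] [NormedSpace ℝ F] {f : E × V → F},
      ContDiff ℝ ∞ f → AEStronglyMeasurable (fun v => f (σ, v)) μ := fun hf =>
    (hf.continuous.comp (Continuous.prodMk_right σ)).aestronglyMeasurable
  have hex := contDiff_cexp hΘ
  have hexb : ∀ {f : V → ℂ}, Integrable f μ → Integrable (fun v =>
      Complex.exp (Complex.I * (Θ (σ, v) : ℂ)) * f v) μ := fun hf =>
    hf.bdd_mul (c := 1) (hcont hex) (Filter.Eventually.of_forall fun v => (norm_cexp_I_mul _).le)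
  have hQi1 : ∀ z, |(phQ Θ e z)⁻¹| ≤ 1 := fun z => by
    rw [abs_inv]
    exact inv_le_one_of_one_le₀ ((one_le_phQ Θ e z).trans (le_abs_self _))
  have hGle : ∀ l z, phG Θ (e l) z * phG Θ (e l) z ≤ phQ Θ e z - 1 := fun l z => by
    have := Finset.single_le_sum (f := fun l => phG Θ (e l) z * phG Θ (e l) z)
      (fun _ _ => mul_self_nonneg _) (Finset.mem_univ l)
    rw [phQ]; linarith
  have hGG : ∀ l z, |phG Θ (e l) z * (phG Θ (e l) z * (phQ Θ e z)⁻¹)| ≤ 1 := fun l z => by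
    have h1 := one_le_phQ Θ e z
    rw [← mul_assoc, abs_mul, abs_inv, abs_of_nonneg (mul_self_nonneg _),
      abs_of_pos (zero_lt_one.trans_le h1), ← div_eq_mul_inv, div_le_one (zero_lt_one.trans_le h1)]
    linarith [hGle l z]
  have hG1 : ∀ l z, |phG Θ (e l) z * (phQ Θ e z)⁻¹| ≤ 1 := fun l z => by
    have h1 := one_le_phQ Θ e z
    rw [abs_mul, abs_inv, abs_of_pos (zero_lt_one.trans_le h1), ← div_eq_mul_inv,
      div_le_one (zero_lt_one.trans_le h1)]
    have h2 := hGle l z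
    rw [← abs_mul_abs_self] at h2
    nlinarith [abs_nonneg (phG Θ (e l) z)]
  have hsmul : ∀ {f : E × V → ℝ}, ContDiff ℝ ∞ f → (∀ z, |f z| ≤ 1) →
      Integrable (fun v => f (σ, v) • b (σ, v)) μ := fun hf hf1 =>
    hi.bdd_smul (C := 1) (hcont hf) (Filter.Eventually.of_forall fun v => hf1 _)
  have hGQ := contDiff_phGQ (e := e) hΘ hb
  have hibp : ∀ l, ∫ v, Complex.exp (Complex.I * (Θ (σ, v) : ℂ)) *
      dirD ((0, e l) : E × V) (fun z => (phG Θ (e l) z * (phQ Θ e z)⁻¹) • b z) (σ, v) ∂μ =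
      -∫ v, Complex.exp (Complex.I * (Θ (σ, v) : ℂ)) * (Complex.I *
        ((phG Θ (e l) (σ, v) * (phG Θ (e l) (σ, v) * (phQ Θ e (σ, v))⁻¹)) • b (σ, v))) ∂μ := by
    intro l
    have h1 : ∀ v, fderiv ℝ (fun v => Complex.exp (Complex.I * (Θ (σ, v) : ℂ))) v (e l) *
        ((phG Θ (e l) (σ, v) * (phQ Θ e (σ, v))⁻¹) • b (σ, v)) =
        Complex.exp (Complex.I * (Θ (σ, v) : ℂ)) * (Complex.I *
        ((phG Θ (e l) (σ, v) * (phG Θ (e l) (σ, v) * (phQ Θ e (σ, v))⁻¹)) • b (σ, v))) := by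
      intro v
      rw [fderiv_snd_section hex, dirD_cexp hΘ]
      simp only [Complex.real_smul]; push_cast; ring
    have h2 : ∀ v, fderiv ℝ (fun v => (phG Θ (e l) (σ, v) * (phQ Θ e (σ, v))⁻¹) • b (σ, v)) v (e l)
        = dirD ((0, e l) : E × V) (fun z => (phG Θ (e l) z * (phQ Θ e z)⁻¹) • b z) (σ, v) :=
      fun v => fderiv_snd_section (hGQ l) σ v (e l)
    have := integral_mul_fderiv_eq_neg_fderiv_mul_of_integrable (μ := μ) (v := e l)
      (f := fun v => Complex.exp (Complex.I * (Θ (σ, v) : ℂ)))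
      (g := fun v => (phG Θ (e l) (σ, v) * (phQ Θ e (σ, v))⁻¹) • b (σ, v)) ?_ ?_ ?_
      (fun v _ => (hasFDerivAt_snd_section hex σ v).differentiableAt)
      (fun v _ => (hasFDerivAt_snd_section (hGQ l) σ v).differentiableAt)
    · simpa only [h1, h2] using this
    · simp only [h1]
      refine hexb (Integrable.const_mul (hsmul (f := fun z => phG Θ (e l) z * (phG Θ (e l) z *
        (phQ Θ e z)⁻¹)) ?_ (hGG l)) _)
      exact (contDiff_phG hΘ _).mul ((contDiff_phG hΘ _).mul (contDiff_phQ_inv hΘ))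
    · simp only [h2]
      exact hexb (hi' l)
    · exact hexb (hsmul (f := fun z => phG Θ (e l) z * (phQ Θ e z)⁻¹)
        ((contDiff_phG hΘ _).mul (contDiff_phQ_inv hΘ)) (hG1 l))
  have i1 : Integrable (fun v => Complex.exp (Complex.I * (Θ (σ, v) : ℂ)) *
      ((phQ Θ e (σ, v))⁻¹ • b (σ, v))) μ :=
    hexb (hsmul (f := fun z => (phQ Θ e z)⁻¹) (contDiff_phQ_inv hΘ) hQi1)
  have i2 : ∀ l, Integrable (fun v => Complex.exp (Complex.I * (Θ (σ, v) : ℂ)) *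
      ((phG Θ (e l) (σ, v) * (phG Θ (e l) (σ, v) * (phQ Θ e (σ, v))⁻¹)) • b (σ, v))) μ := fun l =>
    hexb (hsmul (f := fun z => phG Θ (e l) z * (phG Θ (e l) z * (phQ Θ e z)⁻¹))
      ((contDiff_phG hΘ _).mul ((contDiff_phG hΘ _).mul (contDiff_phQ_inv hΘ))) (hGG l))
  have hR : ∀ v, Complex.exp (Complex.I * (Θ (σ, v) : ℂ)) * oscLT Θ e b (σ, v) =
      Complex.exp (Complex.I * (Θ (σ, v) : ℂ)) * ((phQ Θ e (σ, v))⁻¹ • b (σ, v)) +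
      ∑ l, Complex.I * (Complex.exp (Complex.I * (Θ (σ, v) : ℂ)) *
      dirD ((0, e l) : E × V) (fun z => (phG Θ (e l) z * (phQ Θ e z)⁻¹) • b z) (σ, v)) := by
    intro v
    rw [oscLT, mul_add]
    congr 1
    rw [← Finset.mul_sum, ← Finset.mul_sum]; ring
  -- The decomposition of unity by Q, applied to the untransformed integrand.
  have hLft : ∀ v, Complex.exp (Complex.I * (Θ (σ, v) : ℂ)) * b (σ, v) =
      Complex.exp (Complex.I * (Θ (σ, v) : ℂ)) * ((phQ Θ e (σ, v))⁻¹ • b (σ, v)) +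
      ∑ l, Complex.exp (Complex.I * (Θ (σ, v) : ℂ)) *
      ((phG Θ (e l) (σ, v) * (phG Θ (e l) (σ, v) * (phQ Θ e (σ, v))⁻¹)) • b (σ, v)) := by
    intro v
    rw [← Finset.mul_sum, ← Finset.sum_smul, ← mul_add, ← add_smul]
    have : (phQ Θ e (σ, v))⁻¹ + ∑ l, phG Θ (e l) (σ, v) * (phG Θ (e l) (σ, v) *
        (phQ Θ e (σ, v))⁻¹) = 1 := by
      simp only [← mul_assoc, ← Finset.sum_mul]
      rw [← one_add_mul]
      exact mul_inv_cancel₀ (phQ_ne_zero Θ e _)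
    rw [this, one_smul]
  simp only [hR, hLft]
  rw [integral_add i1 (integrable_finsetSum _ fun l _ => i2 l),
    integral_add i1 (integrable_finsetSum _ fun l _ => (hexb (hi' l)).const_mul _),
    integral_finsetSum _ (fun l _ => i2 l),
    integral_finsetSum _ (fun l _ => (hexb (hi' l)).const_mul _)]
  congr 1
  refine Finset.sum_congr rfl fun l _ => ?_
  rw [integral_const_mul, hibp l]
  rw [← integral_neg, ← integral_const_mul]
  refine integral_congr_ae (Filter.Eventually.of_forall fun v => ?_)
  simp only
  linear_combination (Complex.exp (Complex.I * (Θ (σ, v) : ℂ)) *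
      ((phG Θ (e l) (σ, v) * (phG Θ (e l) (σ, v) * (phQ Θ e (σ, v))⁻¹)) • b (σ, v))) * Complex.I_sq

/-- `b (σ', ·)` is supported in a fixed compact set for `σ'` near `σ`. -/
def LocCompactSupp (b : E × V → ℂ) (σ : E) : Prop :=
  ∃ U : Set E, IsOpen U ∧ σ ∈ U ∧ ∃ C : Set V, IsCompact C ∧ ∀ σ' ∈ U, ∀ v ∉ C, b (σ', v) = 0

theorem LocCompactSupp.eventually_zero {U : Set E} (hU : IsOpen U) {C : Set V} (hC : IsCompact C)
    (h : ∀ σ' ∈ U, ∀ v ∉ C, b (σ', v) = 0) {σ : E} (hσ : σ ∈ U) {v : V} (hv : v ∉ C) :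
    b =ᶠ[nhds (σ, v)] fun _ => 0 := by
  have : U ×ˢ Cᶜ ∈ nhds (σ, v) := prod_mem_nhds (hU.mem_nhds hσ) (hC.isClosed.isOpen_compl.mem_nhds hv)
  filter_upwards [this] with z hz
  exact h z.1 hz.1 z.2 hz.2

/-- The amplitude vanishes on an open subset of `E × V`, not only on one fibre, so its germ there is
zero and stays zero under differentiation. -/
theorem LocCompactSupp.oscLT {σ : E} (h : LocCompactSupp b σ) :
    LocCompactSupp (oscLT Θ e b) σ := by
  obtain ⟨U, hU, hσ, C, hC, h⟩ := h
  refine ⟨U, hU, hσ, C, hC, fun σ' hσ' v hv => ?_⟩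
  exact (oscLT_iterate_eq_zero (LocCompactSupp.eventually_zero hU hC h hσ' hv) 1).eq_of_nhds

theorem LocCompactSupp.integrable {σ : E} (h : LocCompactSupp b σ) (hb : ContDiff ℝ ∞ b) :
    Integrable (fun v => b (σ, v)) μ := by
  obtain ⟨U, hU, hσ, C, hC, h⟩ := h
  refine (hb.continuous.comp (Continuous.prodMk_right σ)).integrable_of_hasCompactSupport ?_
  exact HasCompactSupport.intro hC fun v hv => h σ hσ v hv

theorem integral_oscLT_iterate (hΘ : ContDiff ℝ ∞ Θ) (hb : ContDiff ℝ ∞ b) {σ : E}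
    (h : LocCompactSupp b σ) (M : ℕ) :
    ∫ v, Complex.exp (Complex.I * (Θ (σ, v) : ℂ)) * b (σ, v) ∂μ =
      ∫ v, Complex.exp (Complex.I * (Θ (σ, v) : ℂ)) * (oscLT Θ e)^[M] b (σ, v) ∂μ := by
  have key : LocCompactSupp ((_root_.oscLT Θ e)^[M] b) σ ∧
      ∫ v, Complex.exp (Complex.I * (Θ (σ, v) : ℂ)) * b (σ, v) ∂μ =
      ∫ v, Complex.exp (Complex.I * (Θ (σ, v) : ℂ)) * (_root_.oscLT Θ e)^[M] b (σ, v) ∂μ := by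
    induction M with
    | zero => exact ⟨h, rfl⟩
    | succ M ih =>
      obtain ⟨ih1, ih2⟩ := ih
      have hbM := contDiff_oscLT_iterate (e := e) hΘ hb M
      rw [Function.iterate_succ_apply']
      refine ⟨ih1.oscLT, ih2.trans (integral_oscLT hΘ hbM σ (ih1.integrable hbM) fun l => ?_)⟩
      refine LocCompactSupp.integrable ?_ ((contDiff_phGQ hΘ hbM l).dirD _)
      obtain ⟨U, hU, hσ, C, hC, h⟩ := ih1
      refine ⟨U, hU, hσ, C, hC, fun σ' hσ' v hv => ?_⟩
      have h0 := LocCompactSupp.eventually_zero hU hC h hσ' hv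
      have h1 : (fun z => (phG Θ (e l) z * (phQ Θ e z)⁻¹) • (_root_.oscLT Θ e)^[M] b z)
          =ᶠ[nhds (σ', v)] fun _ => 0 := by
        filter_upwards [h0] with z hz
        rw [hz, smul_zero]
      rw [(h1.dirD _).eq_of_nhds]
      simp [dirD]
  exact key.2

end OscillatoryIBP

/-! ### Gradients in coordinates -/

section Gradients
variable {n : ℕ}

/-- The vector of partial derivatives in the first variable. -/
def gr1 (a : SGSpace n × SGSpace n → ℝ) (z : SGSpace n × SGSpace n) : SGSpace n :=
  ∑ i, dirD (coordVec n (Sum.inl i)) a z • EuclideanSpace.single i (1 : ℝ)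

/-- The vector of partial derivatives in the second variable. -/
def gr2 (a : SGSpace n × SGSpace n → ℝ) (z : SGSpace n × SGSpace n) : SGSpace n :=
  ∑ i, dirD (coordVec n (Sum.inr i)) a z • EuclideanSpace.single i (1 : ℝ)

variable {a : SGSpace n × SGSpace n → ℝ}

theorem ContDiff.gr1 (ha : ContDiff ℝ ∞ a) : ContDiff ℝ ∞ (gr1 a) :=
  ContDiff.sum fun _ _ => (ha.dirD _).smul contDiff_const

theorem ContDiff.gr2 (ha : ContDiff ℝ ∞ a) : ContDiff ℝ ∞ (gr2 a) :=
  ContDiff.sum fun _ _ => (ha.dirD _).smul contDiff_const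

theorem sum_coord_smul (v : SGSpace n) : ∑ i, v i • EuclideanSpace.single i (1 : ℝ) = v := by
  simpa using (EuclideanSpace.basisFun (Fin n) ℝ).sum_repr v

theorem gr1_apply (z : SGSpace n × SGSpace n) (i : Fin n) :
    gr1 a z i = dirD (coordVec n (Sum.inl i)) a z := by
  simp [gr1, Finset.sum_apply, Pi.single_apply]

theorem gr2_apply (z : SGSpace n × SGSpace n) (i : Fin n) :
    gr2 a z i = dirD (coordVec n (Sum.inr i)) a z := by
  simp [gr2, Finset.sum_apply, Pi.single_apply]

theorem inner_gr1 (z : SGSpace n × SGSpace n) (v : SGSpace n) :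
    inner ℝ (gr1 a z) v = fderiv ℝ a z (v, 0) := by
  have h : (v, (0 : SGSpace n)) = ∑ i, v i • coordVec n (Sum.inl i) := by
    have := congrArg (ContinuousLinearMap.inl ℝ (SGSpace n) (SGSpace n)) (sum_coord_smul v)
    rw [map_sum] at this
    simpa [coordVec] using this.symm
  rw [h, map_sum, gr1, sum_inner]
  refine Finset.sum_congr rfl fun i _ => ?_
  rw [map_smul, inner_smul_left, EuclideanSpace.inner_single_left]
  simp [dirD, mul_comm]

theorem inner_gr2 (z : SGSpace n × SGSpace n) (v : SGSpace n) :
    inner ℝ (gr2 a z) v = fderiv ℝ a z (0, v) := by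
  have h : ((0 : SGSpace n), v) = ∑ i, v i • coordVec n (Sum.inr i) := by
    have := congrArg (ContinuousLinearMap.inr ℝ (SGSpace n) (SGSpace n)) (sum_coord_smul v)
    rw [map_sum] at this
    simpa [coordVec] using this.symm
  rw [h, map_sum, gr2, sum_inner]
  refine Finset.sum_congr rfl fun i _ => ?_
  rw [map_smul, inner_smul_left, EuclideanSpace.inner_single_left]
  simp [dirD, mul_comm]

theorem gradX_eq_gr1 (ha : ContDiff ℝ ∞ a) (z : SGSpace n × SGSpace n) : gradX a z = gr1 a z := by
  refine ext_inner_right ℝ fun v => ?_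
  rw [inner_gr1, gradX, gradient, InnerProductSpace.toDual_symm_apply]
  have h1 : HasFDerivAt (fun y => a (y, z.2)) _ z.1 :=
    ((ha.differentiable (by simp) (z.1, z.2)).hasFDerivAt).comp
      (f := fun y : SGSpace n => (y, z.2)) z.1 (hasFDerivAt_prodMk_left z.1 z.2)
  rw [h1.fderiv]
  simp

theorem gradXi_eq_gr2 (ha : ContDiff ℝ ∞ a) (z : SGSpace n × SGSpace n) :
    gradXi a z = gr2 a z := by
  refine ext_inner_right ℝ fun v => ?_
  rw [inner_gr2, gradXi, gradient, InnerProductSpace.toDual_symm_apply]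
  have h1 : HasFDerivAt (fun y => a (z.1, y)) _ z.2 :=
    ((ha.differentiable (by simp) (z.1, z.2)).hasFDerivAt).comp
      (f := fun y : SGSpace n => (z.1, y)) z.2 (hasFDerivAt_prodMk_right z.1 z.2)
  rw [h1.fderiv]
  simp

theorem norm_coord_sum_le (c : Fin n → ℝ) {B : ℝ} (hc : ∀ i, |c i| ≤ B) :
    ‖∑ i, c i • (EuclideanSpace.single i (1 : ℝ) : SGSpace n)‖ ≤ n * B := by
  refine (norm_sum_le _ _).trans ?_
  calc ∑ i, ‖c i • (EuclideanSpace.single i (1 : ℝ) : SGSpace n)‖ ≤ ∑ _i : Fin n, B := by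
        refine Finset.sum_le_sum fun i _ => ?_
        simpa [norm_smul] using hc i
    _ = n * B := by simp

theorem norm_gr1_le {z : SGSpace n × SGSpace n} {B : ℝ}
    (h : ∀ i, |dirD (coordVec n (Sum.inl i)) a z| ≤ B) : ‖gr1 a z‖ ≤ n * B :=
  norm_coord_sum_le _ h

theorem norm_gr2_le {z : SGSpace n × SGSpace n} {B : ℝ}
    (h : ∀ i, |dirD (coordVec n (Sum.inr i)) a z| ≤ B) : ‖gr2 a z‖ ≤ n * B :=
  norm_coord_sum_le _ h

/-- Passing from entries to norms costs a factor `n` for gradients and another one for their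
derivatives; together they account for the `(n + 1) ^ 2` in the smallness threshold. -/
theorem norm_fderiv_coord_le {f : SGSpace n → ℝ} {z : SGSpace n} {B : ℝ} (hB : 0 ≤ B)
    (h : ∀ i, |fderiv ℝ f z (EuclideanSpace.single i 1)| ≤ B) : ‖fderiv ℝ f z‖ ≤ n * B := by
  refine ContinuousLinearMap.opNorm_le_bound _ (by positivity) fun v => ?_
  conv_lhs => rw [← sum_coord_smul v, map_sum]
  refine (norm_sum_le _ _).trans ?_
  calc ∑ i, ‖fderiv ℝ f z (v i • EuclideanSpace.single i 1)‖ ≤ ∑ _i : Fin n, B * ‖v‖ := by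
        refine Finset.sum_le_sum fun i _ => ?_
        rw [map_smul, norm_smul, mul_comm]
        exact mul_le_mul (h i) (PiLp.norm_apply_le v i) (norm_nonneg _) hB
    _ = n * B * ‖v‖ := by simp [mul_assoc]

/-- Lipschitz estimate for the second gradient in the second variable on a convex set. -/
theorem norm_gr2_sub_le (ha : ContDiff ℝ ∞ a) (s : SGSpace n) {D : Set (SGSpace n)}
    (hD : Convex ℝ D) {B : ℝ} (hB : 0 ≤ B) (h : ∀ η ∈ D, ∀ i j,
      |dirD (coordVec n (Sum.inr j)) (dirD (coordVec n (Sum.inr i)) a) (s, η)| ≤ B)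
    {η η' : SGSpace n} (hη : η ∈ D) (hη' : η' ∈ D) :
    ‖gr2 a (s, η) - gr2 a (s, η')‖ ≤ n * (n * B * ‖η - η'‖) := by
  rw [gr2, gr2, ← Finset.sum_sub_distrib]
  simp only [← sub_smul]
  refine norm_coord_sum_le _ fun i => ?_
  have hd : ∀ η, HasFDerivAt (fun η => dirD (coordVec n (Sum.inr i)) a (s, η)) _ η := fun η =>
    hasFDerivAt_snd_section (ha.dirD (coordVec n (Sum.inr i))) s η
  refine Convex.norm_image_sub_le_of_norm_hasFDerivWithin_le
    (f := fun η => dirD (coordVec n (Sum.inr i)) a (s, η))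
    (fun η _ => (hd η).hasFDerivWithinAt) (fun η hη => ?_) hD hη' hη
  rw [← (hd η).fderiv]
  refine norm_fderiv_coord_le hB fun j => ?_
  rw [fderiv_snd_section (ha.dirD _)]
  exact h η hη i j

/-- Lipschitz estimate for the first gradient in the first variable on a convex set. -/
theorem norm_gr1_sub_le (ha : ContDiff ℝ ∞ a) (t : SGSpace n) {D : Set (SGSpace n)}
    (hD : Convex ℝ D) {B : ℝ} (hB : 0 ≤ B) (h : ∀ y ∈ D, ∀ i j,
      |dirD (coordVec n (Sum.inl j)) (dirD (coordVec n (Sum.inl i)) a) (y, t)| ≤ B)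
    {y y' : SGSpace n} (hy : y ∈ D) (hy' : y' ∈ D) :
    ‖gr1 a (y, t) - gr1 a (y', t)‖ ≤ n * (n * B * ‖y - y'‖) := by
  rw [gr1, gr1, ← Finset.sum_sub_distrib]
  simp only [← sub_smul]
  refine norm_coord_sum_le _ fun i => ?_
  have hd : ∀ y, HasFDerivAt (fun y => dirD (coordVec n (Sum.inl i)) a (y, t)) _ y := fun y =>
    (((ha.dirD (coordVec n (Sum.inl i))).differentiable (by simp) (y, t)).hasFDerivAt).comp
      (f := fun y : SGSpace n => (y, t)) y (hasFDerivAt_prodMk_left y t)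
  refine Convex.norm_image_sub_le_of_norm_hasFDerivWithin_le
    (f := fun y => dirD (coordVec n (Sum.inl i)) a (y, t))
    (fun y _ => (hd y).hasFDerivWithinAt) (fun y hy => ?_) hD hy' hy
  rw [← (hd y).fderiv]
  refine norm_fderiv_coord_le hB fun j => ?_
  rw [(hd y).fderiv]
  simpa [dirD, coordVec] using h y hy i j

end Gradients

/-! ### The critical point system as a contraction -/

section NearPair
variable {n : ℕ}

/-- Smallness of a pair of rescaled phase perturbations, which makes the rescaled critical point
system a contraction. -/
structure NearPair (a b : SGSpace n × SGSpace n → ℝ) : Prop where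
  sma : ContDiff ℝ ∞ a
  smb : ContDiff ℝ ∞ b
  grada : ∀ z, ‖gr2 a z‖ ≤ (1 + ‖z.1‖) / 64
  gradb : ∀ z, ‖gr1 b z‖ ≤ (1 + ‖z.2‖) / 64
  lipa : ∀ s η η' : SGSpace n, ‖s‖ ≤ 1 / 4 → ‖η‖ ≤ 1 / 4 → ‖η'‖ ≤ 1 / 4 →
    ‖gr2 a (s, η) - gr2 a (s, η')‖ ≤ 1 / 16 * ‖η - η'‖
  lipb : ∀ t y y' : SGSpace n, ‖t‖ ≤ 1 / 4 → ‖y‖ ≤ 1 / 4 → ‖y'‖ ≤ 1 / 4 →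
    ‖gr1 b (y, t) - gr1 b (y', t)‖ ≤ 1 / 16 * ‖y - y'‖

/-- The fixed point map of the rescaled critical point system. -/
def critMap (a b : SGSpace n × SGSpace n → ℝ)
    (z : (SGSpace n × SGSpace n) × (SGSpace n × SGSpace n)) : SGSpace n × SGSpace n :=
  (z.1.1 + gr2 a (z.1.1, z.2.2), z.1.2 + gr1 b (z.2.1, z.1.2))

variable {a b : SGSpace n × SGSpace n → ℝ}

theorem contDiff_critMap (ha : ContDiff ℝ ∞ a) (hb : ContDiff ℝ ∞ b) :
    ContDiff ℝ ∞ (critMap a b) := by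
  have h1 := ha.gr2
  have h2 := hb.gr1
  unfold critMap
  fun_prop

theorem NearPair.contDiff_critMap (h : NearPair a b) : ContDiff ℝ ∞ (critMap a b) :=
  _root_.contDiff_critMap h.sma h.smb

theorem NearPair.lip (h : NearPair a b) {σ w w' : SGSpace n × SGSpace n} (hσ : ‖σ‖ ≤ 1 / 4)
    (hw : ‖w‖ ≤ 1 / 4) (hw' : ‖w'‖ ≤ 1 / 4) :
    ‖critMap a b (σ, w) - critMap a b (σ, w')‖ ≤ 1 / 16 * ‖w - w'‖ := by
  have e1 := h.lipa σ.1 w.2 w'.2 ((norm_fst_le σ).trans hσ) ((norm_snd_le w).trans hw)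
    ((norm_snd_le w').trans hw')
  have e2 := h.lipb σ.2 w.1 w'.1 ((norm_snd_le σ).trans hσ) ((norm_fst_le w).trans hw)
    ((norm_fst_le w').trans hw')
  have n1 : ‖w.1 - w'.1‖ ≤ ‖w - w'‖ := norm_fst_le (w - w')
  have n2 : ‖w.2 - w'.2‖ ≤ ‖w - w'‖ := norm_snd_le (w - w')
  rw [Prod.norm_def]
  simp only [critMap, Prod.fst_sub, Prod.snd_sub, add_sub_add_left_eq_sub]
  exact max_le (by linarith) (by linarith)

/-- The bound holds for every w: the ξ-gradient of `a` is controlled by x alone and the x-gradient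
of `b` by ξ alone. -/
theorem NearPair.norm_critMap_sub_le (h : NearPair a b) {σ : SGSpace n × SGSpace n}
    (hσ : ‖σ‖ ≤ 1 / 32) (w : SGSpace n × SGSpace n) : ‖critMap a b (σ, w) - σ‖ ≤ 1 / 32 := by
  have e1 := h.grada (σ.1, w.2)
  have e2 := h.gradb (w.1, σ.2)
  have n1 := (norm_fst_le σ).trans hσ
  have n2 := (norm_snd_le σ).trans hσ
  simp only at e1 e2
  rw [Prod.norm_def]
  simp only [critMap, Prod.fst_sub, Prod.snd_sub, add_sub_cancel_left]
  exact max_le (by linarith) (by linarith)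

theorem NearPair.norm_critMap_le (h : NearPair a b) {σ : SGSpace n × SGSpace n}
    (hσ : ‖σ‖ ≤ 1 / 32) (w : SGSpace n × SGSpace n) : ‖critMap a b (σ, w)‖ ≤ 1 / 16 := by
  have h1 := h.norm_critMap_sub_le hσ w
  have h2 := norm_add_le (critMap a b (σ, w) - σ) σ
  rw [sub_add_cancel] at h2
  linarith

/-- Banach's fixed point theorem in the ball of radius 1/4. All values of the map lie within radius
1/16, so any solution whatsoever is in the ball and uniqueness is global. -/
theorem NearPair.existsUnique (h : NearPair a b) {σ : SGSpace n × SGSpace n}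
    (hσ : ‖σ‖ ≤ 1 / 32) : ∃! w, w = critMap a b (σ, w) := by
  have hσ4 : ‖σ‖ ≤ 1 / 4 := hσ.trans (by norm_num)
  have hmaps : Set.MapsTo (fun w => critMap a b (σ, w)) (Metric.closedBall 0 (1 / 4))
      (Metric.closedBall 0 (1 / 4)) := by
    intro w _
    rw [mem_closedBall_zero_iff]
    exact (h.norm_critMap_le hσ w).trans (by norm_num)
  have hc : ContractingWith (1 / 16) (Set.MapsTo.restrict _ _ _ hmaps) := by
    refine ⟨by rw [← NNReal.coe_lt_coe]; norm_num, LipschitzWith.of_dist_le_mul fun w w' => ?_⟩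
    have := h.lip hσ4 (mem_closedBall_zero_iff.1 w.2) (mem_closedBall_zero_iff.1 w'.2)
    rw [← dist_eq_norm, ← dist_eq_norm] at this
    simpa [Subtype.dist_eq] using this
  obtain ⟨w, _, hfix, -⟩ := hc.exists_fixedPoint' (Metric.isClosed_closedBall.isComplete) hmaps
    (x := 0) (by simp) (edist_ne_top _ _)
  refine ⟨w, hfix.symm, fun w' hw' => ?_⟩
  have b1 : ‖w‖ ≤ 1 / 4 := by
    rw [← hfix]; exact (h.norm_critMap_le hσ w).trans (by norm_num)
  have b2 : ‖w'‖ ≤ 1 / 4 := by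
    rw [hw']; exact (h.norm_critMap_le hσ w').trans (by norm_num)
  have := h.lip hσ4 b2 b1
  have hfix' : critMap a b (σ, w) = w := hfix
  have hw'' : w' = critMap a b (σ, w') := hw'
  rw [← hw'', hfix'] at this
  have h3 := norm_nonneg (w' - w)
  exact sub_eq_zero.1 (norm_eq_zero.1 (by linarith))

theorem NearPair.norm_fderiv_le (h : NearPair a b) {σ w : SGSpace n × SGSpace n}
    (hσ : ‖σ‖ ≤ 1 / 4) (hw : ‖w‖ < 1 / 4) :
    ‖(fderiv ℝ (critMap a b) (σ, w)).comp (ContinuousLinearMap.inr ℝ _ _)‖ ≤ 1 / 16 := by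
  rw [← (hasFDerivAt_snd_section h.contDiff_critMap σ w).fderiv]
  refine norm_fderiv_le_of_lip' ℝ (by norm_num) ?_
  have : ∀ᶠ w' in nhds w, ‖w'‖ < 1 / 4 := continuous_norm.continuousAt.eventually_lt
    continuousAt_const hw
  filter_upwards [this] with w' hw'
  exact h.lip hσ hw'.le hw.le

/-- Implicit function theorem for w − critMap(σ, w): its w-derivative is the identity minus an
operator of norm at most 1/16, hence invertible. Uniqueness of the fixed point identifies the
implicit function with `W`. -/
theorem NearPair.contDiffAt (h : NearPair a b) {W : SGSpace n × SGSpace n → SGSpace n × SGSpace n}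
    (hW : ∀ σ, ‖σ‖ ≤ 1 / 32 → W σ = critMap a b (σ, W σ)) : ContDiffAt ℝ ∞ W 0 := by
  let f : (SGSpace n × SGSpace n) × (SGSpace n × SGSpace n) → SGSpace n × SGSpace n :=
    fun z => z.2 - critMap a b z
  have hf : ContDiff ℝ ∞ f := contDiff_snd.sub h.contDiff_critMap
  have h0 : ‖(0 : SGSpace n × SGSpace n)‖ ≤ 1 / 32 := by simp
  have hW0 : ‖W 0‖ < 1 / 4 := by
    rw [hW 0 h0]; exact (h.norm_critMap_le h0 _).trans_lt (by norm_num)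
  have hinv : (fderiv ℝ f (0, W 0) ∘SL ContinuousLinearMap.inr ℝ _ _).IsInvertible := by
    have e : fderiv ℝ f (0, W 0) ∘SL ContinuousLinearMap.inr ℝ _ _ =
        1 - (fderiv ℝ (critMap a b) (0, W 0)).comp (ContinuousLinearMap.inr ℝ _ _) := by
      have : HasFDerivAt f _ (0, W 0) := (hasFDerivAt_snd).sub
        (h.contDiff_critMap.differentiable (by simp) (0, W 0)).hasFDerivAt
      rw [this.fderiv]
      ext v <;> simp
    have hn := h.norm_fderiv_le (σ := 0) (by simp) hW0
    obtain ⟨u, hu⟩ := isUnit_one_sub_of_norm_lt_one (hn.trans_lt (by norm_num))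
    rw [e, ← hu]
    exact ⟨ContinuousLinearEquiv.unitsEquiv ℝ _ u, rfl⟩
  have hcd : ContDiffAt ℝ ∞ f (0, W 0) := hf.contDiffAt
  have hcdi := hcd.contDiffAt_implicitFunction (by simp) hinv
  refine hcdi.congr_of_eventuallyEq ?_
  have hzero : f (0, W 0) = 0 := sub_eq_zero.2 (hW 0 h0)
  have hev := hcd.eventually_apply_implicitFunction (by simp) hinv
  have hnear : ∀ᶠ σ : SGSpace n × SGSpace n in nhds 0, ‖σ‖ < 1 / 32 :=
    continuous_norm.continuousAt.eventually_lt continuousAt_const (by simp)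
  filter_upwards [hev, hnear] with σ h1 h2
  rw [hzero] at h1
  obtain ⟨w, -, hu⟩ := h.existsUnique h2.le
  rw [hu _ (hW σ h2.le), ← hu _ (sub_eq_zero.1 h1)]

end NearPair

/-! ### Bounds for compositions and for linear fixed point equations -/

namespace SB

/-- Composition with a family whose derivatives are bounded, without loss of an order. -/
theorem comp_succ {J : Type*} {E F G : Type} [NormedAddCommGroup E] [NormedSpace ℝ E]
    [NormedAddCommGroup F] [NormedSpace ℝ F] [NormedAddCommGroup G] [NormedSpace ℝ G]
    {K : ℕ} {w : J → ℝ} {pt : J → E} {f : J → F → G} {g : J → E → F}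
    (hf : ∀ j, ContDiff ℝ ∞ (f j)) (hg : ∀ j, ContDiff ℝ ∞ (g j))
    (Hf : SB (K + 1) w (fun j => g j (pt j)) f)
    (Hg : SB K (fun _ => 1) pt (fun j => _root_.fderiv ℝ (g j))) :
    SB (K + 1) w pt (fun j z => f j (g j z)) := by
  obtain ⟨hw, C, hC, hb⟩ := Hf
  obtain ⟨-, C', hC', hb'⟩ := Hg
  refine ⟨hw, (K + 1).factorial * C * (1 + C') ^ (K + 1), by positivity, fun j k hk => ?_⟩
  have h := norm_iteratedFDeriv_comp_le (n := k) (N := ∞) (hf j) (hg j) (by exact_mod_cast le_top)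
    (pt j) (C := C * w j) (D := 1 + C') (fun i hi => hb j i (hi.trans hk)) (fun i h1 hi => ?_)
  · refine h.trans ?_
    have h1 : (k.factorial : ℝ) ≤ (K + 1).factorial := by exact_mod_cast Nat.factorial_le hk
    have h2 : (1 + C') ^ k ≤ (1 + C') ^ (K + 1) := pow_le_pow_right₀ (by linarith) hk
    have h3 := mul_nonneg hC (hw j)
    calc (k.factorial : ℝ) * (C * w j) * (1 + C') ^ k
        ≤ (K + 1).factorial * (C * w j) * (1 + C') ^ (K + 1) := by gcongr
      _ = _ := by ring
  · obtain ⟨i, rfl⟩ : ∃ i', i = i' + 1 := ⟨i - 1, by omega⟩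
    rw [← norm_iteratedFDeriv_fderiv]
    have h1 := hb' j i (by omega)
    refine (h1.trans (by linarith)).trans (le_self_pow₀ (a := 1 + C') (by linarith) (by omega))

/-- Bounds for the solutions of a uniformly contracting linear fixed point equation. -/
theorem of_linear_fixed {J : Type*} {ι E V F : Type} [NormedAddCommGroup E] [NormedSpace ℝ E]
    [NormedAddCommGroup V] [NormedSpace ℝ V] [NormedAddCommGroup F] [NormedSpace ℝ F]
    [Fintype ι] [FiniteDimensional ℝ E] (b : Module.Basis ι ℝ E) (L : F →L[ℝ] V)
    {pt : J → E} {A : J → E → V →L[ℝ] F} (hA : ∀ j, ContDiff ℝ ∞ (A j))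
    (hA1 : ∀ j v, ‖A j (pt j) (L v)‖ ≤ 1 / 2 * ‖v‖) :
    ∀ (K : ℕ) {u c : J → E → F}, SB K (fun _ => 1) pt A → (∀ j, ContDiff ℝ ∞ (u j)) →
    (∀ j, ContDiff ℝ ∞ (c j)) → (∀ j z, u j z = A j z (L (u j z)) + c j z) →
    SB K (fun _ => 1) pt c → SB K (fun _ => 1) pt u := by
  have hbase : ∀ {u c : J → E → F}, (∀ j z, u j z = A j z (L (u j z)) + c j z) →
      SB 0 (fun _ => 1) pt c → SB 0 (fun _ => 1) pt u := by
    intro u c he hc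
    obtain ⟨h0, C, hC, hb⟩ := zero_iff.1 hc
    -- From |u| ≤ |u|/2 + |c|.
    refine zero_iff.2 ⟨h0, 2 * C, by positivity, fun j => ?_⟩
    have h1 := norm_add_le (A j (pt j) (L (u j (pt j)))) (c j (pt j))
    rw [← he] at h1
    have h2 := hA1 j (u j (pt j))
    have h3 := hb j
    linarith
  intro K
  induction K with
  | zero => intro u c _ _ _ he hc; exact hbase he hc
  | succ K ih =>
    intro u c hAK hu hcs he hc
    refine succ_iff.2 ⟨hbase he (hc.mono_order (Nat.zero_le _)),
      fderiv_of_dirD b hu (fun _ => zero_le_one) fun i => ?_⟩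
    have huK := ih (hAK.mono_order (Nat.le_succ K)) hu hcs he (hc.mono_order (Nat.le_succ K))
    have hAd : ∀ j, ContDiff ℝ ∞ (_root_.dirD (b i) (A j)) := fun j => (hA j).dirD _
    have hLu : ∀ j, ContDiff ℝ ∞ (fun z => L (u j z)) := fun j => L.contDiff.comp (hu j)
    have s1 : ∀ j, ContDiff ℝ ∞ (fun z => _root_.dirD (b i) (A j) z (L (u j z))) := fun j =>
      (hAd j).clm_apply (hLu j)
    -- Differentiating u = A(Lu) + c along a basis vector gives an equation for ∂u with the same A
    -- and L and the source (∂A)(Lu) + ∂c, which involves u only to the order already treated.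
    refine ih (u := fun j => _root_.dirD (b i) (u j))
      (c := fun j z => _root_.dirD (b i) (A j) z (L (u j z)) + _root_.dirD (b i) (c j) z)
      (hAK.mono_order (Nat.le_succ K)) (fun j => (hu j).dirD _)
      (fun j => (s1 j).add ((hcs j).dirD _)) (fun j z => ?_) ?_
    · have e : u j = fun z => A j z (L (u j z)) + c j z := funext (he j)
      have d1 := ((hA j).differentiable (by simp) z).hasFDerivAt
      have d2 := ((hu j).differentiable (by simp) z).hasFDerivAt
      have d3 := ((hcs j).differentiable (by simp) z).hasFDerivAt
      have h := ((d1.clm_apply (L.hasFDerivAt.comp z d2)).add d3).fderiv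
      have h' : _root_.fderiv ℝ (u j) z = _root_.fderiv ℝ (fun z => A j z (L (u j z)) + c j z) z :=
        congrArg (fun f => _root_.fderiv ℝ f z) e
      have h4 := congrArg (fun T : E →L[ℝ] F => T (b i)) (h'.trans h)
      simp only [add_apply, ContinuousLinearMap.comp_apply,
        ContinuousLinearMap.flip_apply] at h4
      simp only [_root_.dirD]
      refine h4.trans ?_
      rw [add_assoc]
      rfl
    · refine add s1 (fun j => (hcs j).dirD _) ?_ (hc.dirD hcs (b i))
      simpa using bilin (ContinuousLinearMap.id ℝ (V →L[ℝ] F)) hAd hLu (hAK.dirD hA (b i))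
        (huK.clm' L hu)

end SB

/-! ### Charts adapted to the SG weights, and small perturbations -/

section Rescaling
variable {n : ℕ}

/-- The affine chart around `z` adapted to the SG calculus. -/
def chart (z σ : SGSpace n × SGSpace n) : SGSpace n × SGSpace n :=
  scal z (japaneseBracket z.1) (japaneseBracket z.2) σ

/-- The inverse of `chart z`. -/
def chartInv (z w : SGSpace n × SGSpace n) : SGSpace n × SGSpace n :=
  ((japaneseBracket z.1)⁻¹ • (w.1 - z.1), (japaneseBracket z.2)⁻¹ • (w.2 - z.2))

/-- The weight `⟨x⟩⟨ξ⟩` at `z = (x, ξ)`. -/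
def lam (z : SGSpace n × SGSpace n) : ℝ := japaneseBracket z.1 * japaneseBracket z.2

theorem one_le_lam (z : SGSpace n × SGSpace n) : 1 ≤ lam z :=
  one_le_mul_of_one_le_of_one_le (one_le_jb _) (one_le_jb _)

theorem lam_pos (z : SGSpace n × SGSpace n) : 0 < lam z := zero_lt_one.trans_le (one_le_lam z)

theorem chart_zero (z : SGSpace n × SGSpace n) : chart z 0 = z := scal_zero _ _ _

theorem contDiff_chart (z : SGSpace n × SGSpace n) : ContDiff ℝ ∞ (chart z) := contDiff_scal _ _ _

theorem contDiff_chartInv (z : SGSpace n × SGSpace n) : ContDiff ℝ ∞ (chartInv z) := by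
  unfold chartInv; fun_prop

theorem chart_chartInv (z w : SGSpace n × SGSpace n) : chart z (chartInv z w) = w := by
  have h1 := (jb_pos z.1).ne'
  have h2 := (jb_pos z.2).ne'
  ext i <;> simp [chart, chartInv, scal, h1, h2]

theorem chartInv_chart (z w : SGSpace n × SGSpace n) : chartInv z (chart z w) = w := by
  have h1 := (jb_pos z.1).ne'
  have h2 := (jb_pos z.2).ne'
  ext i <;> simp [chart, chartInv, scal, h1, h2]

theorem chart_injective (z : SGSpace n × SGSpace n) : Function.Injective (chart z) :=
  (Function.LeftInverse.injective (chartInv_chart z))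

theorem jb_add_smul_le (x s : SGSpace n) :
    japaneseBracket (x + japaneseBracket x • s) ≤ japaneseBracket x * (1 + ‖s‖) := by
  have h := jb_le_add (x + japaneseBracket x • s) x
  rw [add_sub_cancel_left, norm_smul, Real.norm_of_nonneg (jb_pos x).le] at h
  linarith

theorem le_jb_add_smul (x s : SGSpace n) :
    japaneseBracket x * (1 - ‖s‖) ≤ japaneseBracket (x + japaneseBracket x • s) := by
  have h := jb_le_add x (x + japaneseBracket x • s)
  rw [sub_add_cancel_left, norm_neg, norm_smul, Real.norm_of_nonneg (jb_pos x).le] at h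
  linarith

/-- The rescaling of a symbol of order `(1, 1)` around `z`. -/
def resc (a : SGSpace n × SGSpace n → ℝ) (z σ : SGSpace n × SGSpace n) : ℝ :=
  (lam z)⁻¹ * a (chart z σ)

variable {a a' : SGSpace n × SGSpace n → ℝ}

theorem ContDiff.resc (ha : ContDiff ℝ ∞ a) (z : SGSpace n × SGSpace n) :
    ContDiff ℝ ∞ (resc a z) := contDiff_const.mul (ha.comp (contDiff_chart z))

theorem listD_const_mul {E : Type} [NormedAddCommGroup E] [NormedSpace ℝ E] {f : E → ℝ}
    (hf : ContDiff ℝ ∞ f) (c : ℝ) (l : List E) :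
    listD l (fun z => c * f z) = fun z => c * listD l f z := by
  induction l with
  | nil => rfl
  | cons v l ih =>
    funext z
    change fderiv ℝ (listD l (fun z => c * f z)) z v = c * fderiv ℝ (listD l f) z v
    rw [ih, fderiv_const_mul ((hf.listD l).differentiable (by simp) z)]
    rfl

theorem listD_resc (ha : ContDiff ℝ ∞ a) (z : SGSpace n × SGSpace n) (l : List (Fin n ⊕ Fin n)) :
    listD (l.map (coordVec n)) (resc a z) = fun σ => (lam z)⁻¹ *
      ((japaneseBracket z.1 ^ cntX l * japaneseBracket z.2 ^ cntXi l) *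
        listD (l.map (coordVec n)) a (chart z σ)) := by
  have h := listD_const_mul (f := fun σ => a (chart z σ)) (ha.comp (contDiff_chart z)) (lam z)⁻¹
    (l.map (coordVec n))
  refine h.trans ?_
  have h2 := listD_comp_scal ha z (japaneseBracket z.1) (japaneseBracket z.2) l
  funext σ
  exact congrArg (fun f => (lam z)⁻¹ * f σ) h2

theorem gr1_resc (ha : ContDiff ℝ ∞ a) (z σ : SGSpace n × SGSpace n) :
    gr1 (resc a z) σ = (japaneseBracket z.2)⁻¹ • gr1 a (chart z σ) := by
  ext i
  rw [PiLp.smul_apply, gr1_apply, gr1_apply]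
  have h := congrFun (listD_resc ha z [Sum.inl i]) σ
  refine h.trans ?_
  have h1 := (jb_pos z.1).ne'
  have h2 := (jb_pos z.2).ne'
  simp only [cntX, cntXi, lam]
  simp [listD]
  field_simp

theorem gr2_resc (ha : ContDiff ℝ ∞ a) (z σ : SGSpace n × SGSpace n) :
    gr2 (resc a z) σ = (japaneseBracket z.1)⁻¹ • gr2 a (chart z σ) := by
  ext i
  rw [PiLp.smul_apply, gr2_apply, gr2_apply]
  have h := congrFun (listD_resc ha z [Sum.inr i]) σ
  refine h.trans ?_
  have h1 := (jb_pos z.1).ne'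
  have h2 := (jb_pos z.2).ne'
  simp only [cntX, cntXi, lam]
  simp [listD]
  field_simp

/-- Smallness of the first and of the pure second derivatives of a phase perturbation. -/
structure SmallPert (a : SGSpace n × SGSpace n → ℝ) : Prop where
  smooth : ContDiff ℝ ∞ a
  d1 : ∀ z, ‖gr1 a z‖ ≤ japaneseBracket z.2 / 64
  d2 : ∀ z, ‖gr2 a z‖ ≤ japaneseBracket z.1 / 64
  d11 : ∀ z i j, |dirD (coordVec n (Sum.inl j)) (dirD (coordVec n (Sum.inl i)) a) z| ≤
    1 / (64 * (n + 1) ^ 2) * ((japaneseBracket z.1)⁻¹ * japaneseBracket z.2)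
  d22 : ∀ z i j, |dirD (coordVec n (Sum.inr j)) (dirD (coordVec n (Sum.inr i)) a) z| ≤
    1 / (64 * (n + 1) ^ 2) * (japaneseBracket z.1 * (japaneseBracket z.2)⁻¹)

theorem SmallPert.of_sgBound {τ : ℝ} (ha : ContDiff ℝ ∞ a) (hτ : τ ≤ 1 / (64 * (n + 1) ^ 2))
    (h : ∀ k l : ℕ, k + l ≤ 2 → SGBound 1 1 k l τ a) : SmallPert a := by
  have hn : (0 : ℝ) < (n : ℝ) + 1 := by positivity
  have key1 : ∀ t : ℝ, 0 ≤ t → (n : ℝ) * (τ * t) ≤ t / 64 := fun t ht => by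
    -- One factor `n` comes from bounding a gradient by its entries; `n ≤ (n + 1) ^ 2` leaves 1/64.
    have h1 : (n : ℝ) * τ ≤ 1 / 64 := by
      have h2 : (n : ℝ) * τ ≤ n * (1 / (64 * (n + 1) ^ 2)) := by gcongr
      refine h2.trans ?_
      rw [mul_one_div, div_le_div_iff₀ (by positivity) (by norm_num)]
      have h3 : (0 : ℝ) ≤ n := n.cast_nonneg
      nlinarith
    nlinarith
  refine ⟨ha, fun z => (norm_gr1_le (B := τ * japaneseBracket z.2) fun i => ?_).trans
    (key1 _ (jb_pos _).le), fun z => (norm_gr2_le (B := τ * japaneseBracket z.1) fun i => ?_).trans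
    (key1 _ (jb_pos _).le), fun z i j => ?_, fun z i j => ?_⟩
  · have h1 := h 1 0 (by norm_num) ![i] ![] z.1 z.2
    rw [mixedPartial_eq_listD ha] at h1
    simpa [listD] using h1
  · have h1 := h 0 1 (by norm_num) ![] ![i] z.1 z.2
    rw [mixedPartial_eq_listD ha] at h1
    simpa [listD] using h1
  · have h1 := h 2 0 (by norm_num) ![j, i] ![] z.1 z.2
    rw [mixedPartial_eq_listD ha] at h1
    have e : (1 : ℝ) - (2 : ℕ) = -1 := by norm_num
    rw [e, Real.rpow_neg_one, mul_assoc] at h1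
    have h2 : |dirD (coordVec n (Sum.inl j)) (dirD (coordVec n (Sum.inl i)) a) z| ≤
      τ * ((japaneseBracket z.1)⁻¹ * japaneseBracket z.2) := by simpa [listD] using h1
    have h3 := jb_pos z.1
    have h4 := jb_pos z.2
    exact h2.trans (mul_le_mul_of_nonneg_right hτ (by positivity))
  · have h1 := h 0 2 (by norm_num) ![] ![j, i] z.1 z.2
    rw [mixedPartial_eq_listD ha] at h1
    have e : (1 : ℝ) - (2 : ℕ) = -1 := by norm_num
    rw [e, Real.rpow_neg_one, mul_assoc] at h1
    have h2 : |dirD (coordVec n (Sum.inr j)) (dirD (coordVec n (Sum.inr i)) a) z| ≤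
      τ * (japaneseBracket z.1 * (japaneseBracket z.2)⁻¹) := by simpa [listD] using h1
    have h3 := jb_pos z.1
    have h4 := jb_pos z.2
    exact h2.trans (mul_le_mul_of_nonneg_right hτ (by positivity))

/-- Two factors `n` from entries to norms, and the factor 2 of `inv_mul_ratio_le`, still leave less
than 1/16. -/
theorem lipschitz_const_aux {d : ℝ} (hd : 0 ≤ d) :
    (n : ℝ) * (n * (1 / (64 * (n + 1) ^ 2) * 2) * d) ≤ 1 / 16 * d := by
  have hn : (0 : ℝ) ≤ n := n.cast_nonneg
  have h1 : (n : ℝ) * (n * (1 / (64 * (n + 1) ^ 2) * 2)) ≤ 1 / 16 := by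
    have e : (n : ℝ) * (n * (1 / (64 * (n + 1) ^ 2) * 2)) = 2 * n ^ 2 / (64 * (n + 1) ^ 2) := by
      field_simp
    rw [e, div_le_div_iff₀ (by positivity) (by norm_num)]
    nlinarith
  calc _ = (n : ℝ) * (n * (1 / (64 * (n + 1) ^ 2) * 2)) * d := by ring
    _ ≤ _ := mul_le_mul_of_nonneg_right h1 hd

/-- Over a chart ball of radius 1/4 the brackets change at most by the factors 5/4 and 3/4, and
(5/4)/(3/4) = 5/3 is below 2. -/
theorem inv_mul_ratio_le {X Ξ x ξ T τ : ℝ} (hX : 0 < X) (hΞ : 0 < Ξ) (hτ : 0 ≤ τ)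
    (hx : x ≤ X * (1 + 1 / 4)) (hξ : Ξ * (1 - 1 / 4) ≤ ξ) (hx0 : 0 < x)
    (hT : |T| ≤ τ * (x * ξ⁻¹)) : |(X * Ξ)⁻¹ * (Ξ ^ 2 * T)| ≤ τ * 2 := by
  have hξ0 : 0 < ξ := lt_of_lt_of_le (by positivity) hξ
  rw [abs_mul, abs_mul, abs_of_pos (by positivity : 0 < (X * Ξ)⁻¹), abs_of_pos (by positivity : 0 < Ξ ^ 2)]
  have h1 : (X * Ξ)⁻¹ * (Ξ ^ 2 * |T|) ≤ (X * Ξ)⁻¹ * (Ξ ^ 2 * (τ * (x * ξ⁻¹))) := by gcongr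
  refine h1.trans ?_
  have e : (X * Ξ)⁻¹ * (Ξ ^ 2 * (τ * (x * ξ⁻¹))) = τ * ((x * Ξ) / (X * ξ)) := by field_simp
  rw [e]
  refine mul_le_mul_of_nonneg_left ?_ hτ
  rw [div_le_iff₀ (by positivity)]
  nlinarith [mul_pos hX hΞ]

/-- `critMap` depends on w = (y, η) only through the ξ-gradient of `a` at (x, η) and the x-gradient
of `b` at (y, ξ). So the contraction uses pure second derivatives only, with the weights of `d22`
and `d11`. -/
theorem SmallPert.nearPair (ha : SmallPert a) (ha' : SmallPert a') (z : SGSpace n × SGSpace n) :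
    NearPair (resc a z) (resc a' z) where
  sma := ha.smooth.resc z
  smb := ha'.smooth.resc z
  grada σ := by
    rw [gr2_resc ha.smooth, norm_smul, norm_inv, Real.norm_of_nonneg (jb_pos _).le,
      inv_mul_le_iff₀ (jb_pos _)]
    have h1 := ha.d2 (chart z σ)
    have h2 := jb_add_smul_le z.1 σ.1
    exact h1.trans ((div_le_div_of_nonneg_right h2 (by norm_num)).trans_eq (by ring))
  gradb σ := by
    rw [gr1_resc ha'.smooth, norm_smul, norm_inv, Real.norm_of_nonneg (jb_pos _).le,
      inv_mul_le_iff₀ (jb_pos _)]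
    have h1 := ha'.d1 (chart z σ)
    have h2 := jb_add_smul_le z.2 σ.2
    exact h1.trans ((div_le_div_of_nonneg_right h2 (by norm_num)).trans_eq (by ring))
  lipa s η η' hs hη hη' := by
    refine (norm_gr2_sub_le (ha.smooth.resc z) s (convex_closedBall 0 (1 / 4))
      (B := 1 / (64 * (n + 1) ^ 2) * 2) (by positivity) (fun η hη i j => ?_)
      (mem_closedBall_zero_iff.2 hη) (mem_closedBall_zero_iff.2 hη')).trans
      (lipschitz_const_aux (norm_nonneg _))
    have h := congrFun (listD_resc ha.smooth z [Sum.inr j, Sum.inr i]) (s, η)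
    have h' : dirD (coordVec n (Sum.inr j)) (dirD (coordVec n (Sum.inr i)) (resc a z)) (s, η) =
        (japaneseBracket z.1 * japaneseBracket z.2)⁻¹ * (japaneseBracket z.2 ^ 2 *
        dirD (coordVec n (Sum.inr j)) (dirD (coordVec n (Sum.inr i)) a) (chart z (s, η))) := by
      refine h.trans ?_
      rw [show cntX [(Sum.inr j : Fin n ⊕ Fin n), Sum.inr i] = 0 from rfl,
        show cntXi [(Sum.inr j : Fin n ⊕ Fin n), Sum.inr i] = 2 from rfl, pow_zero, one_mul]
      rfl
    rw [h']
    have hη := mem_closedBall_zero_iff.1 hη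
    refine inv_mul_ratio_le (jb_pos _) (jb_pos _) (by positivity) ?_ ?_ (jb_pos _)
      (ha.d22 (chart z (s, η)) i j)
    · exact (jb_add_smul_le z.1 s).trans (mul_le_mul_of_nonneg_left (by linarith) (jb_pos _).le)
    · exact (mul_le_mul_of_nonneg_left (by linarith) (jb_pos _).le).trans (le_jb_add_smul z.2 η)
  lipb t y y' ht hy hy' := by
    refine (norm_gr1_sub_le (ha'.smooth.resc z) t (convex_closedBall 0 (1 / 4))
      (B := 1 / (64 * (n + 1) ^ 2) * 2) (by positivity) (fun y hy i j => ?_)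
      (mem_closedBall_zero_iff.2 hy) (mem_closedBall_zero_iff.2 hy')).trans
      (lipschitz_const_aux (norm_nonneg _))
    have h := congrFun (listD_resc ha'.smooth z [Sum.inl j, Sum.inl i]) (y, t)
    have h' : dirD (coordVec n (Sum.inl j)) (dirD (coordVec n (Sum.inl i)) (resc a' z)) (y, t) =
        (japaneseBracket z.2 * japaneseBracket z.1)⁻¹ * (japaneseBracket z.1 ^ 2 *
        dirD (coordVec n (Sum.inl j)) (dirD (coordVec n (Sum.inl i)) a') (chart z (y, t))) := by
      refine h.trans ?_
      rw [mul_comm (japaneseBracket z.2),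
        show cntX [(Sum.inl j : Fin n ⊕ Fin n), Sum.inl i] = 2 from rfl,
        show cntXi [(Sum.inl j : Fin n ⊕ Fin n), Sum.inl i] = 0 from rfl, pow_zero, mul_one]
      rfl
    rw [h']
    have hy := mem_closedBall_zero_iff.1 hy
    refine inv_mul_ratio_le (jb_pos _) (jb_pos _) (by positivity) ?_ ?_ (jb_pos _)
      ((ha'.d11 (chart z (y, t)) i j).trans_eq (by rw [mul_comm (japaneseBracket _)⁻¹]))
    · exact (jb_add_smul_le z.2 t).trans (mul_le_mul_of_nonneg_left (by linarith) (jb_pos _).le)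
    · exact (mul_le_mul_of_nonneg_left (by linarith) (jb_pos _).le).trans (le_jb_add_smul z.1 y)

end Rescaling

/-! ### The critical point and the multi-product phase -/

section CriticalPoint
variable {n : ℕ} {a b : SGSpace n × SGSpace n → ℝ}

/-- The solution of the critical point system of a pair of phase perturbations. -/
def critPt (a b : SGSpace n × SGSpace n → ℝ) (z : SGSpace n × SGSpace n) : SGSpace n × SGSpace n :=
  Classical.epsilon fun w => w = critMap a b (z, w)

/-- Dividing the perturbations by λ makes their gradients scale like the chart itself, so the
critical point system is transported unchanged and can be solved near the origin of a chart. -/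
theorem critMap_chart (ha : ContDiff ℝ ∞ a) (hb : ContDiff ℝ ∞ b)
    (z σ w : SGSpace n × SGSpace n) :
    critMap a b (chart z σ, chart z w) = chart z (critMap (resc a z) (resc b z) (σ, w)) := by
  have h1 := (jb_pos z.1).ne'
  have h2 := (jb_pos z.2).ne'
  simp only [critMap, gr1_resc hb, gr2_resc ha]
  simp [chart, scal, smul_smul, h1, h2, add_assoc]

theorem exists_unique_critPt (ha : SmallPert a) (hb : SmallPert b) (z : SGSpace n × SGSpace n) :
    ∃! w, w = critMap a b (z, w) := by
  obtain ⟨w, hw, hu⟩ := (ha.nearPair hb z).existsUnique (σ := 0) (by simp)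
  have key : ∀ w, chart z w = critMap a b (z, chart z w) ↔
      w = critMap (resc a z) (resc b z) (0, w) := fun w => by
    have h := critMap_chart ha.smooth hb.smooth z 0 w
    rw [chart_zero] at h
    rw [h, (chart_injective z).eq_iff]
  refine ⟨chart z w, (key w).2 hw, fun w' hw' => ?_⟩
  rw [← chart_chartInv z w'] at hw' ⊢
  rw [hu _ ((key _).1 hw')]

theorem critPt_spec (ha : SmallPert a) (hb : SmallPert b) (z : SGSpace n × SGSpace n) :
    critPt a b z = critMap a b (z, critPt a b z) :=
  Classical.epsilon_spec (exists_unique_critPt ha hb z).exists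

/-- The critical point in the chart around `z`. -/
def critChart (a b : SGSpace n × SGSpace n → ℝ) (z σ : SGSpace n × SGSpace n) :
    SGSpace n × SGSpace n := chartInv z (critPt a b (chart z σ))

theorem chart_critChart (z σ : SGSpace n × SGSpace n) :
    chart z (critChart a b z σ) = critPt a b (chart z σ) := chart_chartInv _ _

theorem critChart_spec (ha : SmallPert a) (hb : SmallPert b) (z σ : SGSpace n × SGSpace n) :
    critChart a b z σ = critMap (resc a z) (resc b z) (σ, critChart a b z σ) := by
  apply chart_injective z
  rw [← critMap_chart ha.smooth hb.smooth, chart_critChart]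
  exact critPt_spec ha hb _

theorem contDiff_critPt (ha : SmallPert a) (hb : SmallPert b) : ContDiff ℝ ∞ (critPt a b) := by
  rw [contDiff_iff_contDiffAt]
  intro z
  have h := (ha.nearPair hb z).contDiffAt (W := critChart a b z)
    fun σ _ => critChart_spec ha hb z σ
  have h1 : critPt a b = fun w => chart z (critChart a b z (chartInv z w)) := by
    funext w
    rw [chart_critChart, chart_chartInv]
  rw [h1]
  have h0 : chartInv z z = 0 := by simp [chartInv]
  have h2 : ContDiffAt ℝ ∞ (fun w => critChart a b z (chartInv z w)) z :=
    ContDiffAt.comp (g := critChart a b z) z (by rw [h0]; exact h)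
      (contDiff_chartInv z).contDiffAt
  exact (contDiff_chart z).contDiffAt.comp z h2

theorem contDiff_critChart (ha : SmallPert a) (hb : SmallPert b) (z : SGSpace n × SGSpace n) :
    ContDiff ℝ ∞ (critChart a b z) :=
  (contDiff_chartInv z).comp ((contDiff_critPt ha hb).comp (contDiff_chart z))

theorem norm_critChart_le (ha : SmallPert a) (hb : SmallPert b) (z : SGSpace n × SGSpace n)
    {σ : SGSpace n × SGSpace n} (hσ : ‖σ‖ ≤ 1 / 32) : ‖critChart a b z σ‖ ≤ 1 / 16 := by
  rw [critChart_spec ha hb z σ]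
  exact (ha.nearPair hb z).norm_critMap_le hσ _

theorem isSharpCriticalPoint_iff {φ₁ φ₂ : SGSpace n × SGSpace n → ℝ} (h1 : ContDiff ℝ ∞ φ₁)
    (h2 : ContDiff ℝ ∞ φ₂) (z w : SGSpace n × SGSpace n) : IsSharpCriticalPoint φ₁ φ₂ z w ↔
      w = critMap (phasePerturbation φ₁) (phasePerturbation φ₂) (z, w) := by
  have e1 : ∀ z, gr2 (phasePerturbation φ₁) z = gr2 φ₁ z - z.1 := fun z => by
    refine ext_inner_right ℝ fun v => ?_
    have hd : HasFDerivAt (fun z : SGSpace n × SGSpace n => inner ℝ z.1 z.2) _ z :=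
      hasFDerivAt_fst.inner ℝ hasFDerivAt_snd
    have h : HasFDerivAt (phasePerturbation φ₁) _ z :=
      ((h1.differentiable (by simp) z).hasFDerivAt).sub hd
    rw [inner_sub_left, inner_gr2, inner_gr2, h.fderiv]
    simp [fderivInnerCLM_apply]
  have e2 : ∀ z, gr1 (phasePerturbation φ₂) z = gr1 φ₂ z - z.2 := fun z => by
    refine ext_inner_right ℝ fun v => ?_
    have hd : HasFDerivAt (fun z : SGSpace n × SGSpace n => inner ℝ z.1 z.2) _ z :=
      hasFDerivAt_fst.inner ℝ hasFDerivAt_snd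
    have h : HasFDerivAt (phasePerturbation φ₂) _ z :=
      ((h2.differentiable (by simp) z).hasFDerivAt).sub hd
    rw [inner_sub_left, inner_gr1, inner_gr1, h.fderiv]
    simp [fderivInnerCLM_apply, real_inner_comm]
  rw [IsSharpCriticalPoint, gradXi_eq_gr2 h1, gradX_eq_gr1 h2, critMap, Prod.ext_iff]
  simp [e1, e2]

/-- The phase of the composition, minus `x · ξ`, as a function of `((x, ξ), (y, η))`. -/
def statPh (a b : SGSpace n × SGSpace n → ℝ)
    (q : (SGSpace n × SGSpace n) × (SGSpace n × SGSpace n)) : ℝ :=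
  a (q.1.1, q.2.2) + b (q.2.1, q.1.2) - inner ℝ (q.2.1 - q.1.1) (q.2.2 - q.1.2)

/-- The perturbation of the multi-product phase. -/
def sharpPert (a b : SGSpace n × SGSpace n → ℝ) (z : SGSpace n × SGSpace n) : ℝ :=
  statPh a b (z, critPt a b z)

theorem contDiff_statPh (ha : ContDiff ℝ ∞ a) (hb : ContDiff ℝ ∞ b) :
    ContDiff ℝ ∞ (statPh a b) := by
  have h1 : ContDiff ℝ ∞
      (fun q : (SGSpace n × SGSpace n) × (SGSpace n × SGSpace n) => a (q.1.1, q.2.2)) :=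
    ha.comp (by fun_prop)
  have h2 : ContDiff ℝ ∞
      (fun q : (SGSpace n × SGSpace n) × (SGSpace n × SGSpace n) => b (q.2.1, q.1.2)) :=
    hb.comp (by fun_prop)
  exact (h1.add h2).sub (ContDiff.inner ℝ (by fun_prop) (by fun_prop))

theorem contDiff_sharpPert (ha : SmallPert a) (hb : SmallPert b) :
    ContDiff ℝ ∞ (sharpPert a b) :=
  (contDiff_statPh ha.smooth hb.smooth).comp (contDiff_id.prodMk (contDiff_critPt ha hb))

/-- The pairing of the two differences scales by ⟨x⟩⟨ξ⟩ = λ, which is exactly the normalisation in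
`resc`. -/
theorem statPh_chart (z σ w : SGSpace n × SGSpace n) :
    statPh a b (chart z σ, chart z w) = lam z * statPh (resc a z) (resc b z) (σ, w) := by
  have h1 := (jb_pos z.1).ne'
  have h2 := (jb_pos z.2).ne'
  have e1 : (chart z w).1 - (chart z σ).1 = japaneseBracket z.1 • (w.1 - σ.1) := by
    simp [chart, scal, smul_sub]
  have e2 : (chart z w).2 - (chart z σ).2 = japaneseBracket z.2 • (w.2 - σ.2) := by
    simp [chart, scal, smul_sub]
  simp only [statPh, e1, e2, resc, inner_smul_left, inner_smul_right, lam]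
  simp only [chart, scal, conj_trivial]
  field_simp

theorem sharp_eq {φ₁ φ₂ : SGSpace n × SGSpace n → ℝ} (h1 : ContDiff ℝ ∞ φ₁)
    (h2 : ContDiff ℝ ∞ φ₂) (z : SGSpace n × SGSpace n) : sharp φ₁ φ₂ z =
      inner ℝ z.1 z.2 + sharpPert (phasePerturbation φ₁) (phasePerturbation φ₂) z := by
  -- `sharp` and `critPt` both select by `Classical.epsilon`; equality of the two predicates forces
  -- the same selection.
  have e : IsSharpCriticalPoint φ₁ φ₂ z =
      fun w => w = critMap (phasePerturbation φ₁) (phasePerturbation φ₂) (z, w) :=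
    funext fun w => propext (isSharpCriticalPoint_iff h1 h2 z w)
  simp only [sharp, e, sharpPert, statPh]
  change _ = _ + (phasePerturbation φ₁ _ + phasePerturbation φ₂ _ - _)
  simp only [phasePerturbation, inner_sub_left, inner_sub_right]
  simp only [critPt]
  ring

/-- In the w-variables the derivative is the defect critMap − w with its two components exchanged.
This gives stationarity at the critical point, and lower bounds for the gradient away from it. -/
theorem hasFDerivAt_statPh (ha : ContDiff ℝ ∞ a) (hb : ContDiff ℝ ∞ b)
    (q v : (SGSpace n × SGSpace n) × (SGSpace n × SGSpace n)) :
    fderiv ℝ (statPh a b) q v =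
      inner ℝ (q.2.2 - q.1.2 + gr1 a (q.1.1, q.2.2)) v.1.1 +
      inner ℝ (q.2.1 - q.1.1 + gr2 b (q.2.1, q.1.2)) v.1.2 +
      inner ℝ ((critMap a b q - q.2).2) v.2.1 + inner ℝ ((critMap a b q - q.2).1) v.2.2 := by
  have p11 : HasFDerivAt (fun q : (SGSpace n × SGSpace n) × (SGSpace n × SGSpace n) =>
      q.1.1) _ q := (hasFDerivAt_fst (𝕜 := ℝ) (p := q)).fst
  have p12 : HasFDerivAt (fun q : (SGSpace n × SGSpace n) × (SGSpace n × SGSpace n) =>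
      q.1.2) _ q := (hasFDerivAt_fst (𝕜 := ℝ) (p := q)).snd
  have p21 : HasFDerivAt (fun q : (SGSpace n × SGSpace n) × (SGSpace n × SGSpace n) =>
      q.2.1) _ q := (hasFDerivAt_snd (𝕜 := ℝ) (p := q)).fst
  have p22 : HasFDerivAt (fun q : (SGSpace n × SGSpace n) × (SGSpace n × SGSpace n) =>
      q.2.2) _ q := (hasFDerivAt_snd (𝕜 := ℝ) (p := q)).snd
  have d1 : HasFDerivAt (fun q : (SGSpace n × SGSpace n) × (SGSpace n × SGSpace n) =>
      a (q.1.1, q.2.2)) _ q :=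
    HasFDerivAt.comp (g := a) q (ha.differentiable (by simp) (q.1.1, q.2.2)).hasFDerivAt
      (p11.prodMk p22)
  have d2 : HasFDerivAt (fun q : (SGSpace n × SGSpace n) × (SGSpace n × SGSpace n) =>
      b (q.2.1, q.1.2)) _ q :=
    HasFDerivAt.comp (g := b) q (hb.differentiable (by simp) (q.2.1, q.1.2)).hasFDerivAt
      (p21.prodMk p12)
  have d3 : HasFDerivAt (fun q : (SGSpace n × SGSpace n) × (SGSpace n × SGSpace n) =>
      (inner ℝ (q.2.1 - q.1.1) (q.2.2 - q.1.2) : ℝ)) _ q :=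
    (p21.sub p11).inner ℝ (p22.sub p12)
  have d : HasFDerivAt (statPh a b) _ q := (d1.add d2).sub d3
  have s1 : ∀ (z : SGSpace n × SGSpace n) v, fderiv ℝ a z v =
      inner ℝ (gr1 a z) v.1 + inner ℝ (gr2 a z) v.2 := fun z v => by
    rw [inner_gr1, inner_gr2, ← map_add]; simp
  have s2 : ∀ (z : SGSpace n × SGSpace n) v, fderiv ℝ b z v =
      inner ℝ (gr1 b z) v.1 + inner ℝ (gr2 b z) v.2 := fun z v => by
    rw [inner_gr1, inner_gr2, ← map_add]; simp
  rw [d.fderiv]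
  simp [fderivInnerCLM_apply, s1, s2, critMap, inner_add_left, inner_sub_left, inner_sub_right]
  simp only [real_inner_comm]
  ring

/-- The envelope identity. -/
theorem fderiv_sharpPert (ha : SmallPert a) (hb : SmallPert b) (z v : SGSpace n × SGSpace n) :
    fderiv ℝ (sharpPert a b) z v =
      inner ℝ ((critPt a b z).2 - z.2 + gr1 a (z.1, (critPt a b z).2)) v.1 +
      inner ℝ ((critPt a b z).1 - z.1 + gr2 b ((critPt a b z).1, z.2)) v.2 := by
  have d1 := ((contDiff_critPt ha hb).differentiable (by simp) z).hasFDerivAt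
  have d : HasFDerivAt (sharpPert a b) _ z :=
    (((contDiff_statPh ha.smooth hb.smooth).differentiable (by simp)
      (z, critPt a b z)).hasFDerivAt).comp z ((hasFDerivAt_id z).prodMk d1)
  rw [d.fderiv, ContinuousLinearMap.comp_apply, hasFDerivAt_statPh ha.smooth hb.smooth]
  simp [← critPt_spec ha hb z]

theorem gr1_sharpPert (ha : SmallPert a) (hb : SmallPert b) (z : SGSpace n × SGSpace n) :
    gr1 (sharpPert a b) z = (critPt a b z).2 - z.2 + gr1 a (z.1, (critPt a b z).2) := by
  refine ext_inner_right ℝ fun v => ?_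
  rw [inner_gr1, fderiv_sharpPert ha hb]
  simp

theorem gr2_sharpPert (ha : SmallPert a) (hb : SmallPert b) (z : SGSpace n × SGSpace n) :
    gr2 (sharpPert a b) z = (critPt a b z).1 - z.1 + gr2 b ((critPt a b z).1, z.2) := by
  refine ext_inner_right ℝ fun v => ?_
  rw [inner_gr2, fderiv_sharpPert ha hb]
  simp

theorem norm_critPt_sub_fst_le (ha : SmallPert a) (hb : SmallPert b) (z : SGSpace n × SGSpace n) :
    ‖(critPt a b z).1 - z.1‖ ≤ japaneseBracket z.1 / 64 := by
  have h := congrArg Prod.fst (critPt_spec ha hb z)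
  have h' : (critPt a b z).1 = z.1 + gr2 a (z.1, (critPt a b z).2) := h
  rw [h', add_sub_cancel_left]
  exact ha.d2 _

theorem norm_critPt_sub_snd_le (ha : SmallPert a) (hb : SmallPert b) (z : SGSpace n × SGSpace n) :
    ‖(critPt a b z).2 - z.2‖ ≤ japaneseBracket z.2 / 64 := by
  have h := congrArg Prod.snd (critPt_spec ha hb z)
  have h' : (critPt a b z).2 = z.2 + gr1 b ((critPt a b z).1, z.2) := h
  rw [h', add_sub_cancel_left]
  exact hb.d1 _

/-- The critical point is displaced by at most ⟨ξ⟩/64, and the gradient of `a` there is at most (1 +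
1/64)⟨ξ⟩/64; the sum stays below ⟨ξ⟩/16. -/
theorem norm_gr1_sharpPert_le (ha : SmallPert a) (hb : SmallPert b) (z : SGSpace n × SGSpace n) :
    ‖gr1 (sharpPert a b) z‖ ≤ japaneseBracket z.2 / 16 := by
  rw [gr1_sharpPert ha hb]
  have h1 := norm_critPt_sub_snd_le ha hb z
  have h2 := ha.d1 (z.1, (critPt a b z).2)
  have h3 := jb_le_add (critPt a b z).2 z.2
  have h4 := jb_pos z.2
  simp only at h2
  exact (norm_add_le _ _).trans (by linarith)

theorem norm_gr2_sharpPert_le (ha : SmallPert a) (hb : SmallPert b) (z : SGSpace n × SGSpace n) :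
    ‖gr2 (sharpPert a b) z‖ ≤ japaneseBracket z.1 / 16 := by
  rw [gr2_sharpPert ha hb]
  have h1 := norm_critPt_sub_fst_le ha hb z
  have h2 := hb.d2 ((critPt a b z).1, z.2)
  have h3 := jb_le_add (critPt a b z).1 z.1
  have h4 := jb_pos z.1
  simp only at h2
  exact (norm_add_le _ _).trans (by linarith)

end CriticalPoint

/-! ### Compositions with bounded and with linear maps -/

namespace SB
variable {J : Type*} {E F G : Type} [NormedAddCommGroup E] [NormedSpace ℝ E]
  [NormedAddCommGroup F] [NormedSpace ℝ F] [NormedAddCommGroup G] [NormedSpace ℝ G]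
  {K : ℕ} {w : J → ℝ} {pt : J → E}

theorem comp_bounded {f : J → F → G} {g : J → E → F} (hf : ∀ j, ContDiff ℝ ∞ (f j))
    (hg : ∀ j, ContDiff ℝ ∞ (g j)) (Hf : SB K w (fun j => g j (pt j)) f)
    (Hg : SB K (fun _ => 1) pt g) : SB K w pt (fun j z => f j (g j z)) := by
  cases K with
  | zero =>
    obtain ⟨hw, C, hC, hb⟩ := zero_iff.1 Hf
    exact zero_iff.2 ⟨hw, C, hC, hb⟩
  | succ K => exact comp_succ hf hg Hf Hg.fderiv

theorem comp_clm {f : J → F → G} (T : E →L[ℝ] F) (hf : ∀ j, ContDiff ℝ ∞ (f j))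
    (Hf : SB K w (fun j => T (pt j)) f) : SB K w pt (fun j z => f j (T z)) := by
  refine comp_one (g := fun _ => T) hf (fun _ => T.contDiff) Hf ?_
  have : (fun _ : J => _root_.fderiv ℝ (T : E → F)) = fun _ _ => T := by
    funext j z; exact T.fderiv
  rw [this]
  exact const (norm_nonneg T) (fun _ => zero_le_one) (fun _ => by simp)

theorem clm_of_bounded (T : E →L[ℝ] F) {A : ℝ} (hA : ∀ j, ‖pt j‖ ≤ A) :
    SB K (fun _ : J => (1 : ℝ)) pt (fun _ z => T z) := by
  refine affine (fun _ => T) (A := ‖T‖ * |A| + ‖T‖) (by positivity) (fun _ => zero_le_one)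
    (fun _ z => T.hasFDerivAt) (fun j => ?_) (fun j => ?_)
  · have h1 := T.le_opNorm (pt j)
    have h2 : ‖T‖ * ‖pt j‖ ≤ ‖T‖ * |A| :=
      mul_le_mul_of_nonneg_left ((hA j).trans (le_abs_self A)) (norm_nonneg T)
    linarith [norm_nonneg T]
  · linarith [norm_nonneg T, mul_nonneg (norm_nonneg T) (abs_nonneg A)]

theorem const_mul {f : J → E → ℝ} {c w' : J → ℝ} (hf : ∀ j, ContDiff ℝ ∞ (f j)) (h : SB K w pt f)
    (hc : ∀ j, |c j| ≤ w' j) : SB K (fun j => w' j * w j) pt (fun j z => c j * f j z) :=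
  mul (f := fun j _ => c j) (fun _ => contDiff_const) hf
    (const (A := 1) zero_le_one (fun j => (abs_nonneg _).trans (hc j))
      (fun j => by simpa using hc j)) h

end SB

/-! ### Uniform bounds for the critical point and the multi-product phase -/

section CriticalPointBounds
variable {n : ℕ} {ι J : Type*} {a b : ι → SGSpace n × SGSpace n → ℝ}
  {s : J → ι} {z : J → SGSpace n × SGSpace n}

theorem sb_gr1 {K : ℕ} {w : J → ℝ} {pt : J → SGSpace n × SGSpace n}
    {f : J → SGSpace n × SGSpace n → ℝ} (hf : ∀ j, ContDiff ℝ ∞ (f j)) (h : SB (K + 1) w pt f) :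
    SB K w pt (fun j => gr1 (f j)) :=
  SB.sum _ h.1 (fun _ j => ((hf j).dirD _).smul contDiff_const) fun i =>
    (h.dirD hf (coordVec n (Sum.inl i))).clm'
      ((ContinuousLinearMap.id ℝ ℝ).smulRight (EuclideanSpace.single i (1 : ℝ)))
      fun j => (hf j).dirD _

theorem sb_gr2 {K : ℕ} {w : J → ℝ} {pt : J → SGSpace n × SGSpace n}
    {f : J → SGSpace n × SGSpace n → ℝ} (hf : ∀ j, ContDiff ℝ ∞ (f j)) (h : SB (K + 1) w pt f) :
    SB K w pt (fun j => gr2 (f j)) :=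
  SB.sum _ h.1 (fun _ j => ((hf j).dirD _).smul contDiff_const) fun i =>
    (h.dirD hf (coordVec n (Sum.inr i))).clm'
      ((ContinuousLinearMap.id ℝ ℝ).smulRight (EuclideanSpace.single i (1 : ℝ)))
      fun j => (hf j).dirD _

/-- Brackets over a chart ball of radius 1/4 are comparable to those at the centre, so dividing by λ
removes the weight of order (1, 1). -/
theorem SGBoundedFamily.sb_resc (Ba : SGBoundedFamily 1 1 a) (K : ℕ) (s : J → ι)
    (z : J → SGSpace n × SGSpace n) {pt : J → SGSpace n × SGSpace n} (hpt : ∀ j, ‖pt j‖ ≤ 1 / 4) :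
    SB K (fun _ => 1) pt (fun j => resc (a (s j)) (z j)) := by
  have hx : ∀ x t : SGSpace n, ‖t‖ ≤ 1 / 4 →
      japaneseBracket x ≤ 4 / 3 * japaneseBracket (x + japaneseBracket x • t) := fun x t ht => by
    have h1 := le_jb_add_smul x t
    have h2 : japaneseBracket x * (1 - 1 / 4) ≤ japaneseBracket x * (1 - ‖t‖) :=
      mul_le_mul_of_nonneg_left (by linarith) (jb_pos x).le
    linarith
  have hx' : ∀ x t : SGSpace n, ‖t‖ ≤ 1 / 4 →
      japaneseBracket (x + japaneseBracket x • t) ≤ 2 * japaneseBracket x := fun x t ht => by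
    have h1 := jb_add_smul_le x t
    have h2 : japaneseBracket x * (1 + ‖t‖) ≤ japaneseBracket x * 2 :=
      mul_le_mul_of_nonneg_left (by linarith) (jb_pos x).le
    linarith
  have p1 : ∀ j, ‖(pt j).1‖ ≤ 1 / 4 := fun j => (norm_fst_le _).trans (hpt j)
  have p2 : ∀ j, ‖(pt j).2‖ ≤ 1 / 4 := fun j => (norm_snd_le _).trans (hpt j)
  have h := Ba.sb_scal K s z (fun j => japaneseBracket (z j).1) (fun j => japaneseBracket (z j).2)
    pt (A := 4 / 3) (fun j => (jb_pos _).le) (fun j => (jb_pos _).le)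
    (fun j => hx _ _ (p1 j)) (fun j => hx _ _ (p2 j))
  have h2 := h.const_mul (c := fun j => (lam (z j))⁻¹) (w' := fun j => (lam (z j))⁻¹)
    (fun j => (Ba.smooth _).comp (contDiff_scal _ _ _))
    (fun j => (abs_of_pos (inv_pos.2 (lam_pos _))).le)
  refine h2.mono_weight (fun _ => zero_le_one) 4 (by norm_num) fun j => ?_
  simp only [Real.rpow_one, scal]
  rw [inv_mul_le_iff₀ (lam_pos _), lam]
  have e1 := hx' (z j).1 _ (p1 j)
  have e2 := hx' (z j).2 _ (p2 j)
  have e3 := jb_pos ((z j).1 + japaneseBracket (z j).1 • (pt j).1)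
  have e4 := jb_pos (z j).1
  have e5 := jb_pos (z j).2
  calc _ ≤ (2 * japaneseBracket (z j).1) * (2 * japaneseBracket (z j).2) := by
        gcongr; exact (jb_pos _).le
    _ = _ := by ring

theorem norm_pair_le {E F : Type} [SeminormedAddCommGroup E] [SeminormedAddCommGroup F] {x : E}
    {y : F} {r : ℝ} (hx : ‖x‖ ≤ r) (hy : ‖y‖ ≤ r) : ‖(x, y)‖ ≤ r := by
  rw [Prod.norm_def]; exact max_le hx hy

/-- The selection of the first and of the last of the four variables. -/
def projOut (n : ℕ) : (SGSpace n × SGSpace n) × (SGSpace n × SGSpace n) →L[ℝ]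
    SGSpace n × SGSpace n :=
  ((ContinuousLinearMap.fst ℝ _ _).comp (ContinuousLinearMap.fst ℝ _ _)).prod
    ((ContinuousLinearMap.snd ℝ _ _).comp (ContinuousLinearMap.snd ℝ _ _))

/-- The selection of the third and of the second of the four variables. -/
def projIn (n : ℕ) : (SGSpace n × SGSpace n) × (SGSpace n × SGSpace n) →L[ℝ]
    SGSpace n × SGSpace n :=
  ((ContinuousLinearMap.fst ℝ _ _).comp (ContinuousLinearMap.snd ℝ _ _)).prod
    ((ContinuousLinearMap.snd ℝ _ _).comp (ContinuousLinearMap.fst ℝ _ _))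

theorem norm_projOut_le {q : (SGSpace n × SGSpace n) × (SGSpace n × SGSpace n)} {r : ℝ}
    (h : ‖q‖ ≤ r) : ‖projOut n q‖ ≤ r :=
  norm_pair_le ((norm_fst_le _).trans ((norm_fst_le _).trans h))
    ((norm_snd_le _).trans ((norm_snd_le _).trans h))

theorem norm_projIn_le {q : (SGSpace n × SGSpace n) × (SGSpace n × SGSpace n)} {r : ℝ}
    (h : ‖q‖ ≤ r) : ‖projIn n q‖ ≤ r :=
  norm_pair_le ((norm_fst_le _).trans ((norm_snd_le _).trans h))
    ((norm_snd_le _).trans ((norm_fst_le _).trans h))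

theorem sb_statPh_resc (Ba : SGBoundedFamily 1 1 a) (Bb : SGBoundedFamily 1 1 b) (K : ℕ)
    (s : J → ι) (z : J → SGSpace n × SGSpace n)
    {pt : J → (SGSpace n × SGSpace n) × (SGSpace n × SGSpace n)} (hpt : ∀ j, ‖pt j‖ ≤ 1 / 4) :
    SB K (fun _ => 1) pt (fun j => statPh (resc (a (s j)) (z j)) (resc (b (s j)) (z j))) := by
  have ca : ∀ j, ContDiff ℝ ∞ (resc (a (s j)) (z j)) := fun j => (Ba.smooth _).resc _
  have cb : ∀ j, ContDiff ℝ ∞ (resc (b (s j)) (z j)) := fun j => (Bb.smooth _).resc _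
  have h1 := SB.comp_clm (projOut n) ca
    (Ba.sb_resc K s z (pt := fun j => projOut n (pt j)) fun j => norm_projOut_le (hpt j))
  have h2 := SB.comp_clm (projIn n) cb
    (Bb.sb_resc K s z (pt := fun j => projIn n (pt j)) fun j => norm_projIn_le (hpt j))
  let D : (SGSpace n × SGSpace n) × (SGSpace n × SGSpace n) →L[ℝ] SGSpace n × SGSpace n :=
    ContinuousLinearMap.snd ℝ _ _ - ContinuousLinearMap.fst ℝ _ _
  have h3 := SB.clm_of_bounded (K := K) ((ContinuousLinearMap.fst ℝ _ _).comp D) hpt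
  have h4 := SB.clm_of_bounded (K := K) ((ContinuousLinearMap.snd ℝ _ _).comp D) hpt
  have h5 := h3.bilin (innerSL ℝ) (fun _ => ContinuousLinearMap.contDiff _)
    (fun _ => ContinuousLinearMap.contDiff _) h4
  simp only [mul_one] at h5
  have c1 : ∀ j, ContDiff ℝ ∞ (fun q => resc (a (s j)) (z j) (projOut n q)) := fun j =>
    (ca j).comp (projOut n).contDiff
  have c2 : ∀ j, ContDiff ℝ ∞ (fun q => resc (b (s j)) (z j) (projIn n q)) := fun j =>
    (cb j).comp (projIn n).contDiff
  refine SB.sub (fun j => (c1 j).add (c2 j)) (fun j => ?_) (h1.add c1 c2 h2) h5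
  exact ContDiff.inner ℝ (by fun_prop) (by fun_prop)

theorem sb_critMap_resc (Ba : SGBoundedFamily 1 1 a) (Bb : SGBoundedFamily 1 1 b) (K : ℕ)
    (s : J → ι) (z : J → SGSpace n × SGSpace n)
    {pt : J → (SGSpace n × SGSpace n) × (SGSpace n × SGSpace n)} (hpt : ∀ j, ‖pt j‖ ≤ 1 / 4) :
    SB K (fun _ => 1) pt (fun j => critMap (resc (a (s j)) (z j)) (resc (b (s j)) (z j))) := by
  have ca : ∀ j, ContDiff ℝ ∞ (resc (a (s j)) (z j)) := fun j => (Ba.smooth _).resc _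
  have cb : ∀ j, ContDiff ℝ ∞ (resc (b (s j)) (z j)) := fun j => (Bb.smooth _).resc _
  have h1 := SB.comp_clm (projOut n) (fun j => (ca j).gr2)
    (sb_gr2 ca (Ba.sb_resc (K + 1) s z (pt := fun j => projOut n (pt j))
      fun j => norm_projOut_le (hpt j)))
  have h2 := SB.comp_clm (projIn n) (fun j => (cb j).gr1)
    (sb_gr1 cb (Bb.sb_resc (K + 1) s z (pt := fun j => projIn n (pt j))
      fun j => norm_projIn_le (hpt j)))
  have c1 : ∀ j, ContDiff ℝ ∞ (fun q => gr2 (resc (a (s j)) (z j)) (projOut n q)) := fun j =>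
    (ca j).gr2.comp (projOut n).contDiff
  have c2 : ∀ j, ContDiff ℝ ∞ (fun q => gr1 (resc (b (s j)) (z j)) (projIn n q)) := fun j =>
    (cb j).gr1.comp (projIn n).contDiff
  have h3 := SB.clm_of_bounded (K := K)
    (ContinuousLinearMap.fst ℝ (SGSpace n × SGSpace n) (SGSpace n × SGSpace n)) hpt
  have e : (fun j => critMap (resc (a (s j)) (z j)) (resc (b (s j)) (z j))) = fun j q =>
      ContinuousLinearMap.fst ℝ (SGSpace n × SGSpace n) (SGSpace n × SGSpace n) q +
      (gr2 (resc (a (s j)) (z j)) (projOut n q), gr1 (resc (b (s j)) (z j)) (projIn n q)) := by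
    funext j q
    rfl
  rw [e]
  exact h3.add (fun _ => ContinuousLinearMap.contDiff _) (fun j => (c1 j).prodMk (c2 j))
    (h1.prodMk c1 c2 h2)

theorem norm_graph_critChart_le (ha : ∀ i, SmallPert (a i)) (hb : ∀ i, SmallPert (b i)) (i : ι)
    (z : SGSpace n × SGSpace n) {σ : SGSpace n × SGSpace n} (hσ : ‖σ‖ ≤ 1 / 32) :
    ‖(σ, critChart (a i) (b i) z σ)‖ ≤ 1 / 4 :=
  norm_pair_le (by linarith) (by linarith [norm_critChart_le (ha i) (hb i) z hσ])

/-- Bootstrap: a bound of order `K` for the critical point W bounds the differential of `critMap`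
along the graph of W to order `K`. The derivatives of W solve a linear fixed point equation with
this differential as coefficient, of norm at most 1/16 in the w-directions, so they are bounded to
order `K` too. -/
theorem sb_critChart (ha : ∀ i, SmallPert (a i)) (hb : ∀ i, SmallPert (b i))
    (Ba : SGBoundedFamily 1 1 a) (Bb : SGBoundedFamily 1 1 b) (s : J → ι)
    (z : J → SGSpace n × SGSpace n) {pt : J → SGSpace n × SGSpace n}
    (hpt : ∀ j, ‖pt j‖ ≤ 1 / 32) :
    ∀ K, SB K (fun _ => 1) pt (fun j => critChart (a (s j)) (b (s j)) (z j)) := by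
  intro K
  have hbase : SB 0 (fun _ => 1) pt (fun j => critChart (a (s j)) (b (s j)) (z j)) :=
    SB.zero_iff.2 ⟨fun _ => zero_le_one, 1 / 16, by norm_num, fun j => by
      simpa using norm_critChart_le (ha (s j)) (hb (s j)) (z j) (hpt j)⟩
  induction K with
  | zero => exact hbase
  | succ K ih =>
    refine SB.succ_iff.2 ⟨hbase, ?_⟩
    have cW : ∀ j, ContDiff ℝ ∞ (critChart (a (s j)) (b (s j)) (z j)) := fun j =>
      contDiff_critChart (ha _) (hb _) _
    have cg : ∀ j, ContDiff ℝ ∞ (fun σ => (σ, critChart (a (s j)) (b (s j)) (z j) σ)) := fun j =>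
      contDiff_id.prodMk (cW j)
    have cH : ∀ j, ContDiff ℝ ∞ (critMap (resc (a (s j)) (z j)) (resc (b (s j)) (z j))) := fun j =>
      contDiff_critMap ((ha _).smooth.resc _) ((hb _).smooth.resc _)
    have cH' : ∀ j, ContDiff ℝ ∞
        (fderiv ℝ (critMap (resc (a (s j)) (z j)) (resc (b (s j)) (z j)))) := fun j =>
      (cH j).fderiv_right (by simp)
    have hH := (sb_critMap_resc Ba Bb (K + 1) s z fun j =>
      norm_graph_critChart_le ha hb (s j) (z j) (hpt j)).fderiv
    have hid := SB.clm_of_bounded (K := K) (ContinuousLinearMap.id ℝ (SGSpace n × SGSpace n)) hpt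
    have hA := SB.comp_bounded cH' cg hH
      (hid.prodMk (fun _ => contDiff_id) cW ih)
    have cA : ∀ j, ContDiff ℝ ∞
        (fun σ => fderiv ℝ (critMap (resc (a (s j)) (z j)) (resc (b (s j)) (z j)))
          (σ, critChart (a (s j)) (b (s j)) (z j) σ)) := fun j => (cH' j).comp (cg j)
    refine SB.fderiv_of_dirD (coordBasis n) cW (fun _ => zero_le_one) fun i => ?_
    refine SB.of_linear_fixed (coordBasis n)
      (ContinuousLinearMap.inr ℝ (SGSpace n × SGSpace n) (SGSpace n × SGSpace n)) cA
      (fun j v => ?_) K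
      (c := fun j σ => fderiv ℝ (critMap (resc (a (s j)) (z j)) (resc (b (s j)) (z j)))
          (σ, critChart (a (s j)) (b (s j)) (z j) σ) (coordBasis n i, 0)) hA
      (fun j => (cW j).dirD _) (fun j => (cA j).clm_apply contDiff_const) (fun j σ => ?_) ?_
    · have h1 := ((ha (s j)).nearPair (hb (s j)) (z j)).norm_fderiv_le (σ := pt j)
        (w := critChart (a (s j)) (b (s j)) (z j) (pt j)) (by linarith [hpt j])
        (by linarith [norm_critChart_le (ha (s j)) (hb (s j)) (z j) (hpt j)])
      have h2 := ((fderiv ℝ (critMap (resc (a (s j)) (z j)) (resc (b (s j)) (z j)))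
        (pt j, critChart (a (s j)) (b (s j)) (z j) (pt j))).comp
        (ContinuousLinearMap.inr ℝ _ _)).le_of_opNorm_le h1 v
      exact h2.trans (mul_le_mul_of_nonneg_right (by norm_num) (norm_nonneg v))
    · have e : critChart (a (s j)) (b (s j)) (z j) =
          fun σ => critMap (resc (a (s j)) (z j)) (resc (b (s j)) (z j))
            (σ, critChart (a (s j)) (b (s j)) (z j) σ) :=
        funext fun σ => critChart_spec (ha _) (hb _) _ σ
      have d1 := ((cW j).differentiable (by simp) σ).hasFDerivAt
      have d2 := ((cH j).differentiable (by simp)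
        (σ, critChart (a (s j)) (b (s j)) (z j) σ)).hasFDerivAt
      have h := (HasFDerivAt.comp
        (f := fun σ => (σ, critChart (a (s j)) (b (s j)) (z j) σ)) σ d2
        ((hasFDerivAt_id σ).prodMk d1)).fderiv
      have h' := (congrArg (fun f => fderiv ℝ f σ) e).trans h
      have h4 := congrArg (fun T : SGSpace n × SGSpace n →L[ℝ] SGSpace n × SGSpace n =>
        T (coordBasis n i)) h'
      refine h4.trans ?_
      simp only [ContinuousLinearMap.comp_apply, ContinuousLinearMap.inr_apply]
      rw [← map_add]
      simp [dirD]
    · exact hA.clm' (ContinuousLinearMap.apply ℝ (SGSpace n × SGSpace n)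
        ((coordBasis n i, 0) : (SGSpace n × SGSpace n) × (SGSpace n × SGSpace n))) cA

/-- In the chart the function is λ times the rescaled phase on the graph of the critical point, that
is, ⟨x⟩⟨ξ⟩ times something bounded with all derivatives. -/
theorem sgBoundedFamily_sharpPert (ha : ∀ i, SmallPert (a i)) (hb : ∀ i, SmallPert (b i))
    (Ba : SGBoundedFamily 1 1 a) (Bb : SGBoundedFamily 1 1 b) :
    SGBoundedFamily 1 1 (fun i => sharpPert (a i) (b i)) := by
  refine SGBoundedFamily.of_sb_scal (fun i => contDiff_sharpPert (ha i) (hb i)) fun K => ?_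
  let s : ι × (SGSpace n × SGSpace n) → ι := Prod.fst
  let z : ι × (SGSpace n × SGSpace n) → SGSpace n × SGSpace n := Prod.snd
  have hpt : ∀ j : ι × (SGSpace n × SGSpace n), ‖(0 : SGSpace n × SGSpace n)‖ ≤ 1 / 32 :=
    fun _ => by simp
  have cS : ∀ j, ContDiff ℝ ∞ (statPh (resc (a (s j)) (z j)) (resc (b (s j)) (z j))) := fun j =>
    contDiff_statPh ((ha _).smooth.resc _) ((hb _).smooth.resc _)
  have cg : ∀ j, ContDiff ℝ ∞ (fun σ => (σ, critChart (a (s j)) (b (s j)) (z j) σ)) := fun j =>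
    contDiff_id.prodMk (contDiff_critChart (ha _) (hb _) _)
  have hid := SB.clm_of_bounded (K := K) (ContinuousLinearMap.id ℝ (SGSpace n × SGSpace n)) hpt
  have h := SB.comp_bounded cS cg (sb_statPh_resc Ba Bb K s z fun j =>
      norm_graph_critChart_le ha hb (s j) (z j) (hpt j))
    (hid.prodMk (fun _ => contDiff_id)
      (fun j => contDiff_critChart (ha _) (hb _) _) (sb_critChart ha hb Ba Bb s z hpt K))
  have h2 := h.const_mul (c := fun j => lam (z j)) (w' := fun j => lam (z j))
    (fun j => (cS j).comp (cg j)) (fun j => (abs_of_pos (lam_pos _)).le)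
  simp only [mul_one] at h2
  simp only [Real.rpow_one]
  have e : (fun (j : ι × (SGSpace n × SGSpace n)) σ => sharpPert (a j.1) (b j.1)
      (scal j.2 (japaneseBracket j.2.1) (japaneseBracket j.2.2) σ)) = fun j σ => lam (z j) *
      statPh (resc (a (s j)) (z j)) (resc (b (s j)) (z j))
        (σ, critChart (a (s j)) (b (s j)) (z j) σ) := by
    funext j σ
    rw [← statPh_chart, chart_critChart]
    rfl
  rw [e]
  exact h2

end CriticalPointBounds

/-! ### Symbol classes through charts -/

section SymbolAlgebra
variable {n : ℕ} {F : Type} [NormedAddCommGroup F] [NormedSpace ℝ F] {m μ : ℝ} {ι : Type*}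

/-- Turns every statement on symbols into one on derivatives at the origins of charts, where the
`SB` calculus applies. -/
theorem sgBoundedFamily_iff {a : ι → SGSpace n × SGSpace n → F} :
    SGBoundedFamily m μ a ↔ (∀ s, ContDiff ℝ ∞ (a s)) ∧
      ∀ K, SB K (fun j : ι × (SGSpace n × SGSpace n) =>
        japaneseBracket j.2.1 ^ m * japaneseBracket j.2.2 ^ μ) (fun _ => 0)
        (fun j σ => a j.1 (chart j.2 σ)) := by
  refine ⟨fun h => ⟨h.smooth, fun K => ?_⟩, fun h => SGBoundedFamily.of_sb_scal h.1 h.2⟩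
  have h1 := h.sb_scal (J := ι × (SGSpace n × SGSpace n)) K Prod.fst Prod.snd
    (fun j => japaneseBracket j.2.1) (fun j => japaneseBracket j.2.2) (fun _ => 0) (A := 1)
    (fun j => (jb_pos _).le) (fun j => (jb_pos _).le)
    (fun j => by rw [scal_zero, one_mul]) (fun j => by rw [scal_zero, one_mul])
  simp only [scal_zero] at h1
  exact h1

theorem SGBoundedFamily.add {a b : ι → SGSpace n × SGSpace n → F} (ha : SGBoundedFamily m μ a)
    (hb : SGBoundedFamily m μ b) : SGBoundedFamily m μ (fun s z => a s z + b s z) := by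
  have h1 := sgBoundedFamily_iff.1 ha
  have h2 := sgBoundedFamily_iff.1 hb
  exact sgBoundedFamily_iff.2 ⟨fun s => (h1.1 s).add (h2.1 s), fun K =>
    (h1.2 K).add (fun j => (h1.1 _).comp (contDiff_chart _))
      (fun j => (h2.1 _).comp (contDiff_chart _)) (h2.2 K)⟩

theorem SGBoundedFamily.neg {a : ι → SGSpace n × SGSpace n → F} (ha : SGBoundedFamily m μ a) :
    SGBoundedFamily m μ (fun s z => - a s z) := by
  have h1 := sgBoundedFamily_iff.1 ha
  exact sgBoundedFamily_iff.2 ⟨fun s => (h1.1 s).neg, fun K => (h1.2 K).neg⟩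

theorem SGBoundedFamily.sgSymbol {a : ι → SGSpace n × SGSpace n → F} (ha : SGBoundedFamily m μ a)
    (s : ι) : SGSymbol m μ (a s) :=
  ⟨ha.smooth s, fun k l => (ha.bound k l).imp fun _ h => h s⟩

theorem SGSymbol.sgBoundedFamily {a : SGSpace n × SGSpace n → F} (ha : SGSymbol m μ a)
    (ι : Type*) : SGBoundedFamily m μ (fun _ : ι => a) :=
  ⟨fun _ => ha.smooth, fun k l => (ha.bound k l).imp fun _ h _ => h⟩

theorem sgBoundedFamily_inner (n : ℕ) (ι : Type*) :
    SGBoundedFamily 1 1 (fun (_ : ι) (z : SGSpace n × SGSpace n) => (inner ℝ z.1 z.2 : ℝ)) := by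
  have hs : ContDiff ℝ ∞ (fun z : SGSpace n × SGSpace n => (inner ℝ z.1 z.2 : ℝ)) :=
    contDiff_fst.inner ℝ contDiff_snd
  refine sgBoundedFamily_iff.2 ⟨fun _ => hs, fun K => ?_⟩
  simp only [Real.rpow_one]
  have d : ∀ (z σ : SGSpace n × SGSpace n), HasFDerivAt (chart z) (scalL n _ _) σ := fun z σ =>
    hasFDerivAt_scal z _ _ σ
  have c := fun z : SGSpace n × SGSpace n => contDiff_chart z
  have h1 : SB K (fun j : ι × (SGSpace n × SGSpace n) => japaneseBracket j.2.1) (fun _ => 0)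
      (fun j σ => (chart j.2 σ).1) := by
    refine SB.affine _ zero_le_one (fun j => (jb_pos _).le) (fun j σ => (d j.2 σ).fst)
      (fun j => ?_) fun j => ?_
    · rw [chart_zero, one_mul]; exact norm_le_jb _
    · refine ContinuousLinearMap.opNorm_le_bound _ (by simpa using (jb_pos _).le) fun v => ?_
      simp only [ContinuousLinearMap.comp_apply, scalL]
      simp [norm_smul, abs_of_pos (jb_pos _)]
      exact mul_le_mul_of_nonneg_left (le_max_left _ _) (jb_pos _).le
  have h2 : SB K (fun j : ι × (SGSpace n × SGSpace n) => japaneseBracket j.2.2) (fun _ => 0)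
      (fun j σ => (chart j.2 σ).2) := by
    refine SB.affine _ zero_le_one (fun j => (jb_pos _).le) (fun j σ => (d j.2 σ).snd)
      (fun j => ?_) fun j => ?_
    · rw [chart_zero, one_mul]; exact norm_le_jb _
    · refine ContinuousLinearMap.opNorm_le_bound _ (by simpa using (jb_pos _).le) fun v => ?_
      simp only [ContinuousLinearMap.comp_apply, scalL]
      simp [norm_smul, abs_of_pos (jb_pos _)]
      exact mul_le_mul_of_nonneg_left (le_max_right _ _) (jb_pos _).le
  have c1 : ∀ j : ι × (SGSpace n × SGSpace n), ContDiff ℝ ∞ (fun σ => (chart j.2 σ).1) := fun j =>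
    contDiff_fst.comp (c _)
  have c2 : ∀ j : ι × (SGSpace n × SGSpace n), ContDiff ℝ ∞ (fun σ => (chart j.2 σ).2) := fun j =>
    contDiff_snd.comp (c _)
  have h3 := h1.bilin (innerSL ℝ) c1 c2 h2
  exact h3.congr_eventually fun j => Filter.Eventually.of_forall fun σ => rfl

end SymbolAlgebra

/-! ### The multi-product is an SG phase -/

section Phases
variable {n : ℕ} {φ φ₁ φ₂ : SGSpace n × SGSpace n → ℝ}

theorem SGSymbol.phasePerturbation (h : SGSymbol 1 1 φ) : SGSymbol 1 1 (phasePerturbation φ) := by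
  have h1 := (h.sgBoundedFamily Unit).add (sgBoundedFamily_inner n Unit).neg
  have h2 := h1.sgSymbol ()
  simp only [← sub_eq_add_neg] at h2
  exact h2

theorem SGRegularPhase.smallPert {r τ : ℝ} (h : SGRegularPhase r τ φ)
    (hτ : τ ≤ 1 / (64 * (n + 1) ^ 2)) : SmallPert (phasePerturbation φ) :=
  SmallPert.of_sgBound h.phase.symbol.phasePerturbation.smooth hτ h.small

theorem isTheta_of_norm_sub_le {l : Filter (SGSpace n × SGSpace n)}
    {f g : SGSpace n × SGSpace n → SGSpace n}
    (h : ∀ z, ‖f z - g z‖ ≤ japaneseBracket (g z) / 16) :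
    Asymptotics.IsTheta l (fun z => japaneseBracket (f z)) (fun z => japaneseBracket (g z)) := by
  refine ⟨Asymptotics.IsBigO.of_bound 2 (Filter.Eventually.of_forall fun z => ?_),
    Asymptotics.IsBigO.of_bound 2 (Filter.Eventually.of_forall fun z => ?_)⟩
  · rw [Real.norm_of_nonneg (jb_pos _).le, Real.norm_of_nonneg (jb_pos _).le]
    linarith [jb_le_add (f z) (g z), h z, jb_pos (g z)]
  · rw [Real.norm_of_nonneg (jb_pos _).le, Real.norm_of_nonneg (jb_pos _).le]
    have h1 := h z
    rw [norm_sub_rev] at h1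
    linarith [jb_le_add (g z) (f z), jb_pos (g z)]

theorem sgPhase_sharp (s1 : SmallPert (phasePerturbation φ₁))
    (s2 : SmallPert (phasePerturbation φ₂)) (h1 : SGSymbol 1 1 φ₁) (h2 : SGSymbol 1 1 φ₂) :
    SharpWellDefined φ₁ φ₂ ∧ SGPhase (sharp φ₁ φ₂) := by
  have hs : sharp φ₁ φ₂ = fun z : SGSpace n × SGSpace n =>
      inner ℝ z.1 z.2 + sharpPert (phasePerturbation φ₁) (phasePerturbation φ₂) z :=
    funext fun z => sharp_eq h1.smooth h2.smooth z
  have hsym : SGSymbol 1 1 (sharp φ₁ φ₂) := by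
    rw [hs]
    exact ((sgBoundedFamily_inner n Unit).add (sgBoundedFamily_sharpPert (fun _ => s1)
      (fun _ => s2) (h1.phasePerturbation.sgBoundedFamily Unit)
      (h2.phasePerturbation.sgBoundedFamily Unit))).sgSymbol ()
  have hd : ∀ z v, fderiv ℝ (sharp φ₁ φ₂) z v =
      (inner ℝ z.1 v.2 : ℝ) + inner ℝ z.2 v.1 +
      fderiv ℝ (sharpPert (phasePerturbation φ₁) (phasePerturbation φ₂)) z v := fun z v => by
    have d1 : HasFDerivAt (fun z : SGSpace n × SGSpace n => (inner ℝ z.1 z.2 : ℝ)) _ z :=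
      hasFDerivAt_fst.inner ℝ hasFDerivAt_snd
    have d2 := ((contDiff_sharpPert s1 s2).differentiable (by simp) z).hasFDerivAt
    have d := d1.add d2
    rw [hs]
    refine (congrArg (fun T : SGSpace n × SGSpace n →L[ℝ] ℝ => T v) d.fderiv).trans ?_
    simp [fderivInnerCLM_apply, real_inner_comm]
  refine ⟨fun z => ?_, hsym, isTheta_of_norm_sub_le fun z => ?_,
    isTheta_of_norm_sub_le fun z => ?_⟩
  · simpa only [isSharpCriticalPoint_iff h1.smooth h2.smooth] using exists_unique_critPt s1 s2 z
  · rw [gradX_eq_gr1 hsym.smooth]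
    have e : gr1 (sharp φ₁ φ₂) z =
        z.2 + gr1 (sharpPert (phasePerturbation φ₁) (phasePerturbation φ₂)) z := by
      refine ext_inner_right ℝ fun v => ?_
      rw [inner_gr1, hd, inner_add_left, inner_gr1]
      simp
    rw [e, add_sub_cancel_left]
    exact norm_gr1_sharpPert_le s1 s2 z
  · rw [gradXi_eq_gr2 hsym.smooth]
    have e : gr2 (sharp φ₁ φ₂) z =
        z.1 + gr2 (sharpPert (phasePerturbation φ₁) (phasePerturbation φ₂)) z := by
      refine ext_inner_right ℝ fun v => ?_
      rw [inner_gr2, hd, inner_add_left, inner_gr2]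
      simp
    rw [e, add_sub_cancel_left]
    exact norm_gr2_sharpPert_le s1 s2 z

end Phases

/-- Phase space `ℝⁿ × ℝⁿ`. -/
abbrev PhSpace (n : ℕ) : Type := SGSpace n × SGSpace n

theorem SB.of_hasCompactSupport {J : Type*} {E F : Type} [NormedAddCommGroup E] [NormedSpace ℝ E]
    [NormedAddCommGroup F] [NormedSpace ℝ F] {f : E → F} (hf : ContDiff ℝ ∞ f)
    (hs : HasCompactSupport f) (K : ℕ) (pt : J → E) :
    SB K (fun _ => 1) pt (fun _ => f) := by
  have h : ∀ k, ∃ C, ∀ x, ‖iteratedFDeriv ℝ k f x‖ ≤ C := fun k =>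
    (hs.iteratedFDeriv k).exists_bound_of_continuous
      (hf.continuous_iteratedFDeriv (by exact_mod_cast le_top))
  choose C hC using h
  refine ⟨fun _ => zero_le_one, ∑ k ∈ Finset.range (K + 1), |C k|,
    Finset.sum_nonneg fun _ _ => abs_nonneg _, fun j k hk => ?_⟩
  rw [mul_one]
  refine (hC k _).trans ((le_abs_self _).trans ?_)
  exact Finset.single_le_sum (f := fun k => |C k|) (fun _ _ => abs_nonneg _)
    (Finset.mem_range.2 (by omega))

theorem SB.comp_affine {J : Type*} {E F G : Type} [NormedAddCommGroup E] [NormedSpace ℝ E]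
    [NormedAddCommGroup F] [NormedSpace ℝ F] [NormedAddCommGroup G] [NormedSpace ℝ G] {K : ℕ}
    {w : J → ℝ} {pt : J → E} {f : J → F → G} {g : J → E → F} {L : J → E →L[ℝ] F} {A : ℝ}
    (hf : ∀ j, ContDiff ℝ ∞ (f j)) (Hf : SB K w (fun j => g j (pt j)) f)
    (hg : ∀ j z, HasFDerivAt (g j) (L j) z) (hL : ∀ j, ‖L j‖ ≤ A) :
    SB K w pt (fun j z => f j (g j z)) := by
  have e : (fun j => _root_.fderiv ℝ (g j)) = fun j _ => L j := by
    funext j z; exact (hg j z).fderiv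
  have hc : ∀ j, ContDiff ℝ ∞ (g j) := fun j => by
    have hd : Differentiable ℝ (g j) := fun z => (hg j z).differentiableAt
    refine contDiff_infty_iff_fderiv.2 ⟨hd, ?_⟩
    have : _root_.fderiv ℝ (g j) = fun _ => L j := congrFun e j
    rw [this]
    exact contDiff_const
  refine SB.comp_one hf hc Hf ?_
  rw [e]
  exact SB.const (abs_nonneg A) (fun _ => zero_le_one)
    (fun j => by simpa using (hL j).trans (le_abs_self A))

/-! ### Regularisers and change of variables -/

section Cutoffs
variable {n : ℕ}

/-- The bump function used as a regulariser. -/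
def regBump (n : ℕ) : ContDiffBump (0 : SGSpace n) := ⟨1, 2, one_pos, one_lt_two⟩

/-- The bump function used for localisation. -/
def cutBump (n : ℕ) : ContDiffBump (0 : SGSpace n) :=
  ⟨1 / 8, 1 / 4, by norm_num, by norm_num⟩

/-- The regulariser with parameters `t`. -/
def regul (t : ℝ × ℝ) (w : PhSpace n) : ℝ := regBump n (t.1 • w.1) * regBump n (t.2 • w.2)

theorem contDiff_regul (t : ℝ × ℝ) : ContDiff ℝ ∞ (regul (n := n) t) := by
  have h : ContDiff ℝ ∞ (regBump n) := (regBump n).contDiff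
  exact (h.comp (by fun_prop)).mul (h.comp (by fun_prop))

/-- Equality of germs is needed, because integration by parts differentiates the amplitude: at a
fixed point the resulting integrand is then eventually independent of t. -/
theorem regul_eventually_one (w : PhSpace n) : ∃ δ > 0, ∀ t : ℝ × ℝ, |t.1| < δ → |t.2| < δ →
    regul t =ᶠ[nhds w] fun _ => 1 := by
  refine ⟨(1 + ‖w‖)⁻¹, by positivity, fun t h1 h2 => ?_⟩
  have key : ∀ (τ : ℝ) (x : SGSpace n), |τ| < (1 + ‖w‖)⁻¹ → ‖x‖ < 1 + ‖w‖ →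
      regBump n (τ • x) = 1 := fun τ x hτ hx => by
    refine (regBump n).one_of_mem_closedBall ?_
    rw [mem_closedBall_zero_iff, norm_smul, Real.norm_eq_abs]
    change |τ| * ‖x‖ ≤ 1
    calc |τ| * ‖x‖ ≤ (1 + ‖w‖)⁻¹ * (1 + ‖w‖) := by gcongr
      _ = 1 := inv_mul_cancel₀ (by positivity)
  have : ∀ᶠ w' : PhSpace n in nhds w, ‖w'‖ < 1 + ‖w‖ :=
    continuous_norm.continuousAt.eventually_lt continuousAt_const (by linarith)
  filter_upwards [this] with w' hw'
  rw [regul, key _ _ h1 ((norm_fst_le _).trans_lt hw'), key _ _ h2 ((norm_snd_le _).trans_lt hw'),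
    one_mul]

theorem regul_eq_zero {t : ℝ × ℝ} (h1 : 0 < t.1) (h2 : 0 < t.2) {w : PhSpace n}
    (hw : 2 / t.1 + 2 / t.2 ≤ ‖w‖) : regul t w = 0 := by
  have key : ∀ (τ : ℝ) (x : SGSpace n), 0 < τ → 2 / τ ≤ ‖x‖ → regBump n (τ • x) = 0 :=
      fun τ x hτ hx => by
    refine (regBump n).zero_of_le_dist ?_
    rw [dist_zero_right, norm_smul, Real.norm_of_nonneg hτ.le, ← div_le_iff₀' hτ]
    exact hx
  have p1 : 0 < 2 / t.1 := by positivity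
  have p2 : 0 < 2 / t.2 := by positivity
  rw [regul]
  rcases max_cases ‖w.1‖ ‖w.2‖ with h | h
  · rw [key t.1 w.1 h1 (by rw [Prod.norm_def, h.1] at hw; linarith), zero_mul]
  · rw [key t.2 w.2 h2 (by rw [Prod.norm_def, h.1] at hw; linarith), mul_zero]

/-- Where the centre has norm at most 2 the slope is at most 3. Elsewhere the bump vanishes near the
point, so an arbitrarily large slope is harmless. -/
theorem sb_regBump_affine {J : Type*} (K : ℕ) (T : PhSpace n →L[ℝ] SGSpace n) (y : J → SGSpace n)
    (l : J → ℝ) (hl : ∀ j, |l j| ≤ 1 + ‖y j‖) :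
    SB K (fun _ => 1) (fun _ => (0 : PhSpace n)) (fun j σ => regBump n (y j + l j • T σ)) := by
  have hc : ContDiff ℝ ∞ (regBump n) := (regBump n).contDiff
  refine SB.of_cases (fun j => ‖y j‖ ≤ 2) ?_ ?_
  · refine SB.comp_affine (J := {j // ‖y j‖ ≤ 2}) (f := fun _ => regBump n)
      (g := fun j σ => y j.1 + l j.1 • T σ) (L := fun j => l j.1 • T) (A := 3 * ‖T‖)
      (fun _ => hc) (SB.of_hasCompactSupport hc (regBump n).hasCompactSupport K _)
      (fun j σ => ((T.hasFDerivAt (x := σ)).const_smul (l j.1)).const_add (y j.1)) fun j => ?_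
    rw [norm_smul, Real.norm_eq_abs]
    exact mul_le_mul_of_nonneg_right (by linarith [hl j.1, j.2]) (norm_nonneg _)
  · refine SB.zero_fun (fun _ => zero_le_one) fun j => ?_
    have h1 : 2 < ‖y j.1‖ := not_le.1 j.2
    have h2 : ContinuousAt (fun σ : PhSpace n => ‖y j.1 + l j.1 • T σ‖) 0 := by fun_prop
    have h3 := h2.eventually (lt_mem_nhds (a := 2) (by simpa using h1))
    filter_upwards [h3] with σ hσ
    refine (regBump n).zero_of_le_dist ?_
    rw [dist_zero_right]
    exact hσ.le

/-- As τ⟨x⟩ ≤ 1 + |τx| for τ in [0, 1], dilating the bump does no harm to bounds of order zero, even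
as τ tends to zero. This uniformity makes all later estimates independent of the regularisation. -/
theorem sgBoundedFamily_regul (n : ℕ) :
    SGBoundedFamily 0 0 (fun t : Set.Icc (0 : ℝ × ℝ) 1 => regul (n := n) t) := by
  refine sgBoundedFamily_iff.2 ⟨fun t => contDiff_regul _, fun K => ?_⟩
  have hc : ContDiff ℝ ∞ (regBump n) := (regBump n).contDiff
  have hl : ∀ (τ : ℝ) (x : SGSpace n), 0 ≤ τ → τ ≤ 1 →
      |τ * japaneseBracket x| ≤ 1 + ‖τ • x‖ := fun τ x h0 h1 => by
    have h2 := jb_pos x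
    rw [abs_of_nonneg (by positivity), norm_smul, Real.norm_of_nonneg h0]
    have h3 := mul_le_mul_of_nonneg_left (jb_le x) h0
    linarith
  have h1 := sb_regBump_affine (J := Set.Icc (0 : ℝ × ℝ) 1 × PhSpace n) (n := n) K
    (ContinuousLinearMap.fst ℝ _ _) (fun j => j.1.1.1 • j.2.1)
    (fun j => j.1.1.1 * japaneseBracket j.2.1) (fun j => hl _ _ j.1.2.1.1 j.1.2.2.1)
  have h2 := sb_regBump_affine (J := Set.Icc (0 : ℝ × ℝ) 1 × PhSpace n) (n := n) K
    (ContinuousLinearMap.snd ℝ _ _) (fun j => j.1.1.2 • j.2.2)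
    (fun j => j.1.1.2 * japaneseBracket j.2.2) (fun j => hl _ _ j.1.2.1.2 j.1.2.2.2)
  have h := h1.mul (𝕜 := ℝ) (fun j => hc.comp (by fun_prop)) (fun j => hc.comp (by fun_prop)) h2
  simp only [Real.rpow_zero, mul_one] at h ⊢
  refine h.congr_eventually fun j => Filter.Eventually.of_forall fun σ => ?_
  simp [regul, chart, scal, smul_add, mul_smul]

instance (n : ℕ) : (volume : Measure (PhSpace n)).IsAddHaarMeasure :=
  inferInstanceAs (Measure.prod (volume : Measure (SGSpace n)) volume).IsAddHaarMeasure

theorem integral_comp_scal {F : Type} [NormedAddCommGroup F] [NormedSpace ℝ F] (z : PhSpace n)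
    {r ρ : ℝ} (hr : 0 < r) (hρ : 0 < ρ) (f : PhSpace n → F) :
    ∫ v, (r * ρ) ^ n • f (scal z r ρ v) = ∫ w, f w := by
  have h0 : ∀ v, scal z r ρ v = z + (r • v.1, ρ • v.2) := fun v => rfl
  let e : PhSpace n ≃ₜ PhSpace n :=
    (Homeomorph.smul (Units.mk0 r hr.ne')).prodCongr (Homeomorph.smul (Units.mk0 ρ hρ.ne'))
  have he : ∀ v, e v = (r • v.1, ρ • v.2) := fun v => rfl
  have hmap : Measure.map e volume =
      (ENNReal.ofReal |(r ^ n)⁻¹| * ENNReal.ofReal |(ρ ^ n)⁻¹|) • (volume : Measure (PhSpace n)) := by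
    have h1 : (e : PhSpace n → PhSpace n) = Prod.map (r • ·) (ρ • ·) := rfl
    rw [h1, Measure.volume_eq_prod, ← Measure.map_prod_map _ _ (by fun_prop) (by fun_prop),
      Measure.map_addHaar_smul _ hr.ne', Measure.map_addHaar_smul _ hρ.ne', Measure.prod_smul_left,
      Measure.prod_smul_right, smul_smul]
    simp
  have h2 : ∫ v, f (z + e v) = ((r ^ n)⁻¹ * (ρ ^ n)⁻¹) • ∫ w, f w := by
    have h3 := e.measurableEmbedding.integral_map (μ := volume) (fun w => f (z + w))
    rw [← h3, hmap, integral_smul_measure, integral_add_left_eq_self (fun w => f w)]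
    rw [← ENNReal.ofReal_mul (abs_nonneg _), ENNReal.toReal_ofReal (by positivity),
      abs_of_pos (by positivity), abs_of_pos (by positivity)]
  simp only [h0, ← he]
  rw [integral_smul, h2, smul_smul, mul_pow]
  have := pow_pos hr n
  have := pow_pos hρ n
  rw [← mul_inv, mul_inv_cancel₀ (by positivity), one_smul]

end Cutoffs

/-! ### Integrands after repeated integration by parts -/

section OscIntegrand
variable {E V L L' : Type} [NormedAddCommGroup E] [NormedSpace ℝ E] [NormedAddCommGroup V]
  [NormedSpace ℝ V] [Fintype L] [Fintype L']

/-- The oscillating integrand after `M` and `M'` integrations by parts along `e` and `e'`. -/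
def oscInt (Θ : E × V → ℝ) (e : L → V) (e' : L' → V) (M M' : ℕ) (b : E × V → ℂ) (q : E × V) : ℂ :=
  Complex.exp (Complex.I * (Θ q : ℂ)) * (oscLT Θ e')^[M'] ((oscLT Θ e)^[M] b) q

variable {Θ : E × V → ℝ} {e : L → V} {e' : L' → V} {b b' : E × V → ℂ} {M M' : ℕ}

theorem contDiff_oscInt (hΘ : ContDiff ℝ ∞ Θ) (hb : ContDiff ℝ ∞ b) :
    ContDiff ℝ ∞ (oscInt Θ e e' M M' b) :=
  (contDiff_cexp hΘ).mul (contDiff_oscLT_iterate hΘ (contDiff_oscLT_iterate hΘ hb M) M')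

theorem oscInt_congr {q : E × V} (h : b =ᶠ[nhds q] b') :
    oscInt Θ e e' M M' b =ᶠ[nhds q] oscInt Θ e e' M M' b' := by
  filter_upwards [oscLT_iterate_congr (Θ := Θ) (e := e')
    (oscLT_iterate_congr (Θ := Θ) (e := e) h M) M'] with x hx
  rw [oscInt, hx, oscInt]

theorem oscInt_eq_zero {q : E × V} (h : b =ᶠ[nhds q] fun _ => 0) :
    oscInt Θ e e' M M' b =ᶠ[nhds q] fun _ => 0 := by
  filter_upwards [oscLT_iterate_eq_zero (Θ := Θ) (e := e')
    (oscLT_iterate_eq_zero (Θ := Θ) (e := e) h M) M'] with x hx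
  rw [oscInt, hx, mul_zero]

theorem LocCompactSupp.oscLT_iterate [FiniteDimensional ℝ V] [MeasurableSpace V]
    [BorelSpace V] {σ : E} (h : LocCompactSupp b σ) (M : ℕ) :
    LocCompactSupp ((_root_.oscLT Θ e)^[M] b) σ := by
  induction M with
  | zero => exact h
  | succ M ih => rw [Function.iterate_succ_apply']; exact ih.oscLT

theorem integral_oscInt [FiniteDimensional ℝ V] [MeasureSpace V] [BorelSpace V]
    [(volume : Measure V).IsAddHaarMeasure] (hΘ : ContDiff ℝ ∞ Θ) (hb : ContDiff ℝ ∞ b) {σ : E}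
    (h : LocCompactSupp b σ) :
    ∫ v, oscInt Θ e e' M M' b (σ, v) = ∫ v, Complex.exp (Complex.I * (Θ (σ, v) : ℂ)) * b (σ, v) := by
  rw [integral_oscLT_iterate (e := e) hΘ hb h M, integral_oscLT_iterate (e := e') hΘ
    (contDiff_oscLT_iterate hΘ hb M) (h.oscLT_iterate M) M']
  rfl

/-- Bookkeeping: the amplitude has size `m`, the integrations by parts gain g^{-M} and g'^{-M'}, and
`K` derivatives of the exponential cost h^K. All this is needed only on `D`; off `D` the integrand
vanishes near the point. -/
theorem SB.oscInt {J : Type*} {pt : J → E × V} {Θ : J → E × V → ℝ} {b : J → E × V → ℂ}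
    {m g g' h w : J → ℝ} {e : L → V} {e' : L' → V} (D : J → Prop) (M M' K : ℕ)
    (hΘ : ∀ j, ContDiff ℝ ∞ (Θ j)) (hb : ∀ j, ContDiff ℝ ∞ (b j))
    (hw0 : ∀ j, 0 ≤ w j)
    (hoff : ∀ j, ¬ D j → b j =ᶠ[nhds (pt j)] fun _ => 0)
    (hg1 : ∀ j, D j → 1 ≤ g j) (hg1' : ∀ j, D j → 1 ≤ g' j) (hh : ∀ j, D j → 1 ≤ h j)
    {c c' A : ℝ} (hc : 0 < c) (hc' : 0 < c') (hA : 0 ≤ A)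
    (hQ : ∀ j, D j → c * g j ^ 2 ≤ phQ (Θ j) e (pt j))
    (hQ' : ∀ j, D j → c' * g' j ^ 2 ≤ phQ (Θ j) e' (pt j))
    (hG : ∀ K l, SB K (fun j : {j // D j} => g j) (fun j => pt j) (fun j => phG (Θ j) (e l)))
    (hG' : ∀ K l, SB K (fun j : {j // D j} => g' j) (fun j => pt j) (fun j => phG (Θ j) (e' l)))
    (hm : ∀ K, SB K (fun j : {j // D j} => m j) (fun j => pt j) (fun j => b j))
    (hΘh : SB K (fun j : {j // D j} => h j) (fun j => pt j) (fun j => Θ j))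
    (hw : ∀ j, D j → h j ^ K * (m j / g j ^ M / g' j ^ M') ≤ A * w j) :
    SB K w pt (fun j => _root_.oscInt (Θ j) e e' M M' (b j)) := by
  refine SB.of_cases D ?_ (SB.zero_fun (fun j => hw0 j) fun j => oscInt_eq_zero (hoff j.1 j.2))
  have hΘ' : ∀ j : {j // D j}, ContDiff ℝ ∞ (Θ j) := fun j => hΘ _
  have hb' : ∀ j : {j // D j}, ContDiff ℝ ∞ (b j) := fun j => hb _
  have h1 := SB.oscLT_iterate hΘ' hb' (fun j => hg1 j.1 j.2) hc (fun j => hQ j.1 j.2) hG hm M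
  have hb1 : ∀ j : {j // D j}, ContDiff ℝ ∞ ((_root_.oscLT (Θ j) e)^[M] (b j)) := fun j =>
    contDiff_oscLT_iterate (hΘ _) (hb _) M
  have h2 := SB.oscLT_iterate hΘ' hb1 (fun j => hg1' j.1 j.2) hc' (fun j => hQ' j.1 j.2) hG' h1 M'
  have h3 := SB.cexp hΘ' (fun j => hh j.1 j.2) hΘh
  have h4 := h3.mul (fun j => contDiff_cexp (hΘ' j))
    (fun j => contDiff_oscLT_iterate (hΘ' j) (hb1 j) M') (h2 K)
  exact h4.mono_weight (fun j => hw0 j.1) A hA fun j => hw j.1 j.2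

end OscIntegrand

/-! ### Zone coordinates for the composition integral -/

section Zones
variable {n : ℕ} {a b : PhSpace n → ℝ}

/-- A family of affine coordinates in the integration variables, with moving centre `B`. -/
def zoneMap (B : PhSpace n → PhSpace n) (r ρ : ℝ) (q : PhSpace n × PhSpace n) : PhSpace n :=
  scal (B q.1) r ρ q.2

/-- The phase of the composition in the coordinates `zoneMap`. -/
def zonePh (a b : PhSpace n → ℝ) (z : PhSpace n) (B : PhSpace n → PhSpace n) (r ρ : ℝ)
    (q : PhSpace n × PhSpace n) : ℝ :=
  statPh a b (chart z q.1, zoneMap B r ρ q) - sharpPert a b (chart z q.1)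

/-- The amplitude with cutoff `c` in the coordinates `zoneMap`. -/
def zoneAmp (c : PhSpace n → ℝ) (B : PhSpace n → PhSpace n) (r ρ : ℝ) (t : ℝ × ℝ)
    (q : PhSpace n × PhSpace n) : ℂ :=
  (((r * ρ) ^ n * (c (zoneMap B r ρ q) * regul t (zoneMap B r ρ q)) : ℝ) : ℂ)

variable {z : PhSpace n} {B : PhSpace n → PhSpace n} {r ρ : ℝ} {c : PhSpace n → ℝ} {t : ℝ × ℝ}

theorem contDiff_zoneMap (hB : ContDiff ℝ ∞ B) : ContDiff ℝ ∞ (zoneMap B r ρ) := by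
  unfold zoneMap scal; fun_prop

theorem contDiff_zonePh (ha : SmallPert a) (hb : SmallPert b) (hB : ContDiff ℝ ∞ B) :
    ContDiff ℝ ∞ (zonePh a b z B r ρ) := by
  have h1 : ContDiff ℝ ∞ (fun q : PhSpace n × PhSpace n => chart z q.1) :=
    (contDiff_chart z).comp contDiff_fst
  exact ((contDiff_statPh ha.smooth hb.smooth).comp (h1.prodMk (contDiff_zoneMap hB))).sub
    ((contDiff_sharpPert ha hb).comp h1)

theorem contDiff_zoneAmp (hc : ContDiff ℝ ∞ c) (hB : ContDiff ℝ ∞ B) :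
    ContDiff ℝ ∞ (zoneAmp c B r ρ t) :=
  Complex.ofRealCLM.contDiff.comp (contDiff_const.mul ((hc.comp (contDiff_zoneMap hB)).mul
    ((contDiff_regul t).comp (contDiff_zoneMap hB))))

theorem locCompactSupp_zoneAmp (hB : ContDiff ℝ ∞ B) (hr : 0 < r) (hρ : 0 < ρ) (h1 : 0 < t.1)
    (h2 : 0 < t.2) (σ : PhSpace n) : LocCompactSupp (zoneAmp c B r ρ t) σ := by
  have hm : 0 < min r ρ := lt_min hr hρ
  refine ⟨{σ' | ‖B σ'‖ < ‖B σ‖ + 1}, isOpen_lt hB.continuous.norm continuous_const, by simp,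
    Metric.closedBall 0 ((2 / t.1 + 2 / t.2 + (‖B σ‖ + 1)) / min r ρ),
    isCompact_closedBall _ _, fun σ' hσ' v hv => ?_⟩
  have hz : regul t (zoneMap B r ρ (σ', v)) = 0 := by
    refine regul_eq_zero h1 h2 ?_
    rw [mem_closedBall_zero_iff, not_le, div_lt_iff₀' hm] at hv
    have e : zoneMap B r ρ (σ', v) = B σ' - (-(r • v.1, ρ • v.2)) := by
      rw [sub_neg_eq_add]; rfl
    have h3 : min r ρ * ‖v‖ ≤ ‖(r • v.1, ρ • v.2)‖ := by
      rw [Prod.norm_def, Prod.norm_def, norm_smul, norm_smul, Real.norm_of_nonneg hr.le,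
        Real.norm_of_nonneg hρ.le]
      rcases max_cases ‖v.1‖ ‖v.2‖ with h | h <;> rw [h.1]
      · exact (mul_le_mul_of_nonneg_right (min_le_left _ _) (norm_nonneg _)).trans (le_max_left _ _)
      · exact (mul_le_mul_of_nonneg_right (min_le_right _ _) (norm_nonneg _)).trans
          (le_max_right _ _)
    have h4 := norm_sub_norm_le (-(r • v.1, ρ • v.2)) (B σ')
    rw [norm_neg, norm_sub_rev, ← e] at h4
    have hσ'' : ‖B σ'‖ < ‖B σ‖ + 1 := hσ'
    linarith
  simp [zoneAmp, hz]

theorem zoneAmp_eventually (hB : ContDiff ℝ ∞ B) (q : PhSpace n × PhSpace n) :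
    ∃ δ > 0, ∀ t : ℝ × ℝ, |t.1| < δ → |t.2| < δ →
      zoneAmp c B r ρ t =ᶠ[nhds q] zoneAmp c B r ρ 0 := by
  obtain ⟨δ, hδ, h⟩ := regul_eventually_one (zoneMap B r ρ q)
  have hcont : Filter.Tendsto (zoneMap B r ρ) (nhds q) (nhds (zoneMap B r ρ q)) :=
    (contDiff_zoneMap (r := r) (ρ := ρ) hB).continuous.continuousAt
  refine ⟨δ, hδ, fun t h1 h2 => ?_⟩
  filter_upwards [hcont.eventually (h t h1 h2),
    hcont.eventually (h 0 (by simpa using hδ) (by simpa using hδ))] with q' e1 e2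
  rw [zoneAmp, zoneAmp, e1, e2]

/-- The regularised integrand of the composition, with the phase normalised at the critical
point. -/
def compInt (a b : PhSpace n → ℝ) (t : ℝ × ℝ) (z w : PhSpace n) : ℂ :=
  Complex.exp (Complex.I * ((statPh a b (z, w) - sharpPert a b z : ℝ) : ℂ)) * (regul t w : ℂ)

/-- For positive t the regulariser has compact support, so the integrations by parts have no
boundary terms; then the affine coordinates are undone, the amplitude containing the Jacobian. -/
theorem integral_zone {L L' : Type} [Fintype L] [Fintype L'] {e : L → PhSpace n}
    {e' : L' → PhSpace n} {M M' : ℕ} (ha : SmallPert a) (hb : SmallPert b) (hc : ContDiff ℝ ∞ c)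
    (hB : ContDiff ℝ ∞ B) (hr : 0 < r) (hρ : 0 < ρ) (h1 : 0 < t.1) (h2 : 0 < t.2) (σ : PhSpace n) :
    ∫ v, oscInt (zonePh a b z B r ρ) e e' M M' (zoneAmp c B r ρ t) (σ, v) =
      ∫ w, (c w : ℂ) * compInt a b t (chart z σ) w := by
  rw [integral_oscInt (contDiff_zonePh ha hb hB) (contDiff_zoneAmp hc hB)
    (locCompactSupp_zoneAmp hB hr hρ h1 h2 σ)]
  refine Eq.trans ?_ (integral_comp_scal (B σ) hr hρ _)
  refine integral_congr_ae (Filter.Eventually.of_forall fun v => ?_)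
  simp only [zoneAmp, compInt, zonePh, zoneMap, Complex.real_smul]
  push_cast
  ring

end Zones

/-! ### The gradient of the phase in zone coordinates -/

section ZonePhase
variable {n : ℕ} {a b : PhSpace n → ℝ} {z : PhSpace n} {B : PhSpace n → PhSpace n} {r ρ : ℝ}

theorem phG_zonePh (ha : SmallPert a) (hb : SmallPert b) (hB : ContDiff ℝ ∞ B)
    (u : PhSpace n) (q : PhSpace n × PhSpace n) : phG (zonePh a b z B r ρ) u q =
      r * inner ℝ (critMap a b (chart z q.1, zoneMap B r ρ q) - zoneMap B r ρ q).2 u.1 +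
      ρ * inner ℝ (critMap a b (chart z q.1, zoneMap B r ρ q) - zoneMap B r ρ q).1 u.2 := by
  have h1 : HasFDerivAt (fun v : PhSpace n => (chart z q.1, scal (B q.1) r ρ v))
      ((0 : PhSpace n →L[ℝ] PhSpace n).prod (scalL n r ρ)) q.2 :=
    (hasFDerivAt_const _ _).prodMk (hasFDerivAt_scal _ _ _ _)
  have h2 := ((contDiff_statPh ha.smooth hb.smooth).differentiable (by simp)
    (chart z q.1, zoneMap B r ρ q)).hasFDerivAt
  have h3 : HasFDerivAt (fun v => zonePh a b z B r ρ (q.1, v)) _ q.2 :=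
    (HasFDerivAt.comp (g := statPh a b)
      (f := fun v : PhSpace n => (chart z q.1, scal (B q.1) r ρ v)) q.2 h2 h1).sub_const
      (sharpPert a b (chart z q.1))
  have h4 := fderiv_snd_section (contDiff_zonePh (z := z) (r := r) (ρ := ρ) ha hb hB) q.1 q.2 u
  rw [phG, ← h4, h3.fderiv, ContinuousLinearMap.comp_apply,
    hasFDerivAt_statPh ha.smooth hb.smooth]
  simp [scalL, inner_smul_right]

/-- The coordinate vectors in the first variable. -/
def vecX (n : ℕ) (i : Fin n) : PhSpace n := (EuclideanSpace.single i 1, 0)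

/-- The coordinate vectors in the second variable. -/
def vecXi (n : ℕ) (i : Fin n) : PhSpace n := (0, EuclideanSpace.single i 1)

theorem phG_zonePh_vecX (ha : SmallPert a) (hb : SmallPert b) (hB : ContDiff ℝ ∞ B) (i : Fin n)
    (q : PhSpace n × PhSpace n) : phG (zonePh a b z B r ρ) (vecX n i) q =
      r * (critMap a b (chart z q.1, zoneMap B r ρ q) - zoneMap B r ρ q).2 i := by
  rw [phG_zonePh ha hb hB]
  simp [vecX, EuclideanSpace.inner_single_right]

theorem phG_zonePh_vecXi (ha : SmallPert a) (hb : SmallPert b) (hB : ContDiff ℝ ∞ B) (i : Fin n)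
    (q : PhSpace n × PhSpace n) : phG (zonePh a b z B r ρ) (vecXi n i) q =
      ρ * (critMap a b (chart z q.1, zoneMap B r ρ q) - zoneMap B r ρ q).1 i := by
  rw [phG_zonePh ha hb hB]
  simp [vecXi, EuclideanSpace.inner_single_right]

theorem phQ_zonePh_vecX (ha : SmallPert a) (hb : SmallPert b) (hB : ContDiff ℝ ∞ B)
    (q : PhSpace n × PhSpace n) : phQ (zonePh a b z B r ρ) (vecX n) q =
      1 + (r * ‖(critMap a b (chart z q.1, zoneMap B r ρ q) - zoneMap B r ρ q).2‖) ^ 2 := by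
  rw [phQ, mul_pow, EuclideanSpace.real_norm_sq_eq, Finset.mul_sum]
  congr 1
  refine Finset.sum_congr rfl fun i _ => ?_
  rw [phG_zonePh_vecX ha hb hB]
  ring

theorem phQ_zonePh_vecXi (ha : SmallPert a) (hb : SmallPert b) (hB : ContDiff ℝ ∞ B)
    (q : PhSpace n × PhSpace n) : phQ (zonePh a b z B r ρ) (vecXi n) q =
      1 + (ρ * ‖(critMap a b (chart z q.1, zoneMap B r ρ q) - zoneMap B r ρ q).1‖) ^ 2 := by
  rw [phQ, mul_pow, EuclideanSpace.real_norm_sq_eq, Finset.mul_sum]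
  congr 1
  refine Finset.sum_congr rfl fun i _ => ?_
  rw [phG_zonePh_vecXi ha hb hB]
  ring

end ZonePhase

/-! ### Partition of unity into four zones -/

section ZoneCutoffs
variable {n : ℕ}

/-- The near (`true`) and far (`false`) cutoff. -/
def nearFar (n : ℕ) (k : Bool) (x : SGSpace n) : ℝ := if k then cutBump n x else 1 - cutBump n x

/-- The support of the near and far cutoffs. -/
def NearFar (k : Bool) (x : SGSpace n) : Prop := if k then ‖x‖ ≤ 1 / 4 else 1 / 8 ≤ ‖x‖

theorem contDiff_nearFar (k : Bool) : ContDiff ℝ ∞ (nearFar n k) := by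
  have h : ContDiff ℝ ∞ (cutBump n) := (cutBump n).contDiff
  cases k
  · exact contDiff_const.sub h
  · exact h

theorem sb_nearFar {J : Type*} (k : Bool) (K : ℕ) (pt : J → SGSpace n) :
    SB K (fun _ => 1) pt (fun _ => nearFar n k) := by
  have hc : ContDiff ℝ ∞ (cutBump n) := (cutBump n).contDiff
  have h := SB.of_hasCompactSupport hc (cutBump n).hasCompactSupport K pt
  cases k
  · exact SB.sub (f := fun _ _ => (1 : ℝ)) (fun _ => contDiff_const) (fun _ => hc)
      (SB.const zero_le_one (fun _ => zero_le_one) (fun _ => by simp)) h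
  · exact h

theorem nearFar_eventually_zero {k : Bool} {x : SGSpace n} (h : ¬ NearFar k x) :
    nearFar n k =ᶠ[nhds x] fun _ => 0 := by
  cases k
  · have h1 : ‖x‖ < 1 / 8 := by simpa [NearFar] using h
    filter_upwards [continuous_norm.continuousAt.eventually_lt continuousAt_const h1] with y hy
    have : cutBump n y = 1 := (cutBump n).one_of_mem_closedBall (mem_closedBall_zero_iff.2 hy.le)
    simp [nearFar, this]
  · have h1 : 1 / 4 < ‖x‖ := by simpa [NearFar] using h
    filter_upwards [continuousAt_const.eventually_lt continuous_norm.continuousAt h1] with y hy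
    have : cutBump n y = 0 := (cutBump n).zero_of_le_dist (by rw [dist_zero_right]; exact hy.le)
    simp [nearFar, this]

theorem nearFar_add (x : SGSpace n) : nearFar n true x + nearFar n false x = 1 := by
  simp [nearFar]

/-- The cutoff of a zone, in the chart around `z`. -/
def zoneCut (k₁ k₂ : Bool) (z w : PhSpace n) : ℝ :=
  nearFar n k₁ (chartInv z w).1 * nearFar n k₂ (chartInv z w).2

theorem contDiff_zoneCut (k₁ k₂ : Bool) (z : PhSpace n) : ContDiff ℝ ∞ (zoneCut k₁ k₂ z) :=
  ((contDiff_nearFar k₁).comp (contDiff_fst.comp (contDiff_chartInv z))).mul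
    ((contDiff_nearFar k₂).comp (contDiff_snd.comp (contDiff_chartInv z)))

theorem zoneCut_sum (z w : PhSpace n) : zoneCut true true z w + zoneCut true false z w +
    zoneCut false true z w + zoneCut false false z w = 1 := by
  have h1 := nearFar_add (chartInv z w).1
  have h2 := nearFar_add (chartInv z w).2
  simp only [zoneCut]
  linear_combination (nearFar n true (chartInv z w).2 + nearFar n false (chartInv z w).2) * h1 + h2

theorem zoneCut_eventually_zero {k₁ k₂ : Bool} {z w : PhSpace n}
    (h : ¬ (NearFar k₁ (chartInv z w).1 ∧ NearFar k₂ (chartInv z w).2)) :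
    zoneCut k₁ k₂ z =ᶠ[nhds w] fun _ => 0 := by
  have hc := (contDiff_chartInv z).continuous
  rcases not_and_or.1 h with h | h
  · have h1 : Filter.Tendsto (fun w => (chartInv z w).1) (nhds w) (nhds (chartInv z w).1) :=
      (continuous_fst.comp hc).continuousAt
    filter_upwards [h1.eventually (nearFar_eventually_zero h)] with w' hw'
    rw [zoneCut, hw', zero_mul]
  · have h1 : Filter.Tendsto (fun w => (chartInv z w).2) (nhds w) (nhds (chartInv z w).2) :=
      (continuous_snd.comp hc).continuousAt
    filter_upwards [h1.eventually (nearFar_eventually_zero h)] with w' hw'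
    rw [zoneCut, hw', mul_zero]

theorem zoneAmp_eventually_zero {k₁ k₂ : Bool} {z : PhSpace n} {B : PhSpace n → PhSpace n}
    {r ρ : ℝ} {t : ℝ × ℝ} (hB : ContDiff ℝ ∞ B) {q : PhSpace n × PhSpace n}
    (h : ¬ (NearFar k₁ (chartInv z (zoneMap B r ρ q)).1 ∧
      NearFar k₂ (chartInv z (zoneMap B r ρ q)).2)) :
    zoneAmp (zoneCut k₁ k₂ z) B r ρ t =ᶠ[nhds q] fun _ => 0 := by
  have hcont : Filter.Tendsto (zoneMap B r ρ) (nhds q) (nhds (zoneMap B r ρ q)) :=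
    (contDiff_zoneMap (r := r) (ρ := ρ) hB).continuous.continuousAt
  filter_upwards [hcont.eventually (zoneCut_eventually_zero h)] with q' hq'
  simp [zoneAmp, hq']

end ZoneCutoffs

/-! ### Size of the phase away from the critical point -/

section FarZones
variable {n : ℕ} {ι J : Type*} {a b : ι → PhSpace n → ℝ}

/-- Data of a family of points in the coordinates used away from the critical point. -/
structure FarPts (z pt1 pt2 : J → PhSpace n) (r ρ : J → ℝ) : Prop where
  hσ : ∀ j, ‖pt1 j‖ ≤ 1 / 32
  hr0 : ∀ j, 0 < r j
  hρ0 : ∀ j, 0 < ρ j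
  hrX : ∀ j, r j ≤ japaneseBracket (z j).1
  hρX : ∀ j, ρ j ≤ japaneseBracket (z j).2
  hr : ∀ j, r j ≤ 4 / 3 * japaneseBracket ((z j).1 + r j • (pt2 j).1)
  hρ : ∀ j, ρ j ≤ 4 / 3 * japaneseBracket ((z j).2 + ρ j • (pt2 j).2)

/-- The weight of the first integration variable away from the critical point. -/
def farV (z pt2 : PhSpace n) (r : ℝ) : ℝ := japaneseBracket z.1 + ‖r • pt2.1‖

/-- The weight of the second integration variable away from the critical point. -/
def farW (z pt2 : PhSpace n) (ρ : ℝ) : ℝ := japaneseBracket z.2 + ‖ρ • pt2.2‖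

theorem one_le_farV (z pt2 : PhSpace n) (r : ℝ) : 1 ≤ farV z pt2 r := by
  have h := one_le_jb z.1
  have h2 := norm_nonneg (r • pt2.1)
  rw [farV]; linarith

theorem one_le_farW (z pt2 : PhSpace n) (r : ℝ) : 1 ≤ farW z pt2 r := by
  have h := one_le_jb z.2
  have h2 := norm_nonneg (r • pt2.2)
  rw [farW]; linarith

theorem jb_add_le_norm (x y : SGSpace n) : japaneseBracket (x + y) ≤ japaneseBracket x + ‖y‖ := by
  have := jb_le_add (x + y) x
  rwa [add_sub_cancel_left] at this

theorem norm_jb_smul_le {x s : SGSpace n} (hs : ‖s‖ ≤ 1 / 32) :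
    ‖japaneseBracket x • s‖ ≤ japaneseBracket x / 32 := by
  rw [norm_smul, Real.norm_of_nonneg (jb_pos x).le]
  have := mul_le_mul_of_nonneg_left hs (jb_pos x).le
  linarith

theorem jb_chart_le {x s : SGSpace n} (hs : ‖s‖ ≤ 1 / 32) :
    japaneseBracket (x + japaneseBracket x • s) ≤ 2 * japaneseBracket x := by
  have h1 := jb_add_le_norm x (japaneseBracket x • s)
  have h2 := norm_jb_smul_le (x := x) hs
  linarith [jb_pos x]

theorem le_jb_chart {x s : SGSpace n} (hs : ‖s‖ ≤ 1 / 32) :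
    japaneseBracket x ≤ 4 / 3 * japaneseBracket (x + japaneseBracket x • s) := by
  have h1 := le_jb_add_smul x s
  have h2 : japaneseBracket x * (1 - 1 / 32) ≤ japaneseBracket x * (1 - ‖s‖) :=
    mul_le_mul_of_nonneg_left (by linarith) (jb_pos x).le
  linarith [jb_pos x]

variable {s : J → ι} {z pt1 pt2 : J → PhSpace n} {r ρ : J → ℝ}

/-- `a` is evaluated at the outer variable x and the inner variable η, and in `sb_in` the function
`b` at y and ξ. In each slot the scale is at most a multiple of the bracket at the evaluation point,
as `sb_scal` requires. -/
theorem FarPts.sb_out {F : Type} [NormedAddCommGroup F] [NormedSpace ℝ F]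
    (H : FarPts z pt1 pt2 r ρ) (K : ℕ) {f : ι → PhSpace n → F} {m μ : ℝ}
    (hf : SGBoundedFamily m μ f) :
    SB K (fun j => japaneseBracket ((z j).1 + japaneseBracket (z j).1 • (pt1 j).1) ^ m *
      japaneseBracket ((z j).2 + ρ j • (pt2 j).2) ^ μ) (fun j => (pt1 j, pt2 j))
      (fun j q => f (s j) ((chart (z j) q.1).1, (zoneMap (fun _ => z j) (r j) (ρ j) q).2)) := by
  have hX : ∀ j, japaneseBracket (z j).1 ≤
      4 / 3 * japaneseBracket ((z j).1 + japaneseBracket (z j).1 • (pt1 j).1) := fun j =>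
    le_jb_chart ((norm_fst_le _).trans (H.hσ j))
  have h := hf.sb_scal K s z (fun j => japaneseBracket (z j).1) ρ
    (fun j => ((pt1 j).1, (pt2 j).2)) (A := 4 / 3) (fun j => (jb_pos _).le)
    (fun j => (H.hρ0 j).le) hX H.hρ
  have h2 := SB.comp_clm (pt := fun j => (pt1 j, pt2 j)) (projOut n)
    (fun j => (hf.smooth (s j)).comp (contDiff_scal (z j) (japaneseBracket (z j).1) (ρ j))) h
  exact h2

theorem FarPts.sb_in {F : Type} [NormedAddCommGroup F] [NormedSpace ℝ F]
    (H : FarPts z pt1 pt2 r ρ) (K : ℕ) {f : ι → PhSpace n → F} {m μ : ℝ}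
    (hf : SGBoundedFamily m μ f) :
    SB K (fun j => japaneseBracket ((z j).1 + r j • (pt2 j).1) ^ m *
      japaneseBracket ((z j).2 + japaneseBracket (z j).2 • (pt1 j).2) ^ μ)
      (fun j => (pt1 j, pt2 j))
      (fun j q => f (s j) ((zoneMap (fun _ => z j) (r j) (ρ j) q).1, (chart (z j) q.1).2)) := by
  have hX : ∀ j, japaneseBracket (z j).2 ≤
      4 / 3 * japaneseBracket ((z j).2 + japaneseBracket (z j).2 • (pt1 j).2) := fun j =>
    le_jb_chart ((norm_snd_le _).trans (H.hσ j))
  have h := hf.sb_scal K s z r (fun j => japaneseBracket (z j).2)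
    (fun j => ((pt2 j).1, (pt1 j).2)) (A := 4 / 3) (fun j => (H.hr0 j).le)
    (fun j => (jb_pos _).le) H.hr hX
  have h2 := SB.comp_clm (pt := fun j => (pt1 j, pt2 j)) (projIn n)
    (fun j => (hf.smooth (s j)).comp (contDiff_scal (z j) (r j) (japaneseBracket (z j).2))) h
  exact h2

/-- The linear map `((x, ξ), (y, η)) ↦ r y - l x`. -/
def subMapX (n : ℕ) (r l : ℝ) : PhSpace n × PhSpace n →L[ℝ] SGSpace n :=
  r • ((ContinuousLinearMap.fst ℝ (SGSpace n) (SGSpace n)).comp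
    (ContinuousLinearMap.snd ℝ (PhSpace n) (PhSpace n))) -
  l • ((ContinuousLinearMap.fst ℝ (SGSpace n) (SGSpace n)).comp
    (ContinuousLinearMap.fst ℝ (PhSpace n) (PhSpace n)))

/-- The linear map `((x, ξ), (y, η)) ↦ ρ η - l ξ`. -/
def subMapXi (n : ℕ) (ρ l : ℝ) : PhSpace n × PhSpace n →L[ℝ] SGSpace n :=
  ρ • ((ContinuousLinearMap.snd ℝ (SGSpace n) (SGSpace n)).comp
    (ContinuousLinearMap.snd ℝ (PhSpace n) (PhSpace n))) -
  l • ((ContinuousLinearMap.snd ℝ (SGSpace n) (SGSpace n)).comp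
    (ContinuousLinearMap.fst ℝ (PhSpace n) (PhSpace n)))

theorem FarPts.sb_sub_fst (H : FarPts z pt1 pt2 r ρ) (K : ℕ) :
    SB K (fun j => farV (z j) (pt2 j) (r j)) (fun j => (pt1 j, pt2 j))
      (fun j q => (zoneMap (fun _ => z j) (r j) (ρ j) q).1 - (chart (z j) q.1).1) := by
  have hF : ∀ j, 0 ≤ farV (z j) (pt2 j) (r j) := fun j => zero_le_one.trans (one_le_farV _ _ _)
  refine SB.affine (A := 2)
    (fun j => subMapX n (r j) (japaneseBracket (z j).1))
    zero_le_two hF (fun j q => ?_) (fun j => ?_) (fun j => ?_)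
  · have e : (fun q : PhSpace n × PhSpace n =>
        (zoneMap (fun _ => z j) (r j) (ρ j) q).1 - (chart (z j) q.1).1) =
        ⇑(subMapX n (r j) (japaneseBracket (z j).1)) := by
      funext q; simp [zoneMap, chart, scal, subMapX]
    rw [e]
    exact ContinuousLinearMap.hasFDerivAt _
  · have e : (zoneMap (fun _ => z j) (r j) (ρ j) (pt1 j, pt2 j)).1 - (chart (z j) (pt1 j)).1 =
      r j • (pt2 j).1 - japaneseBracket (z j).1 • (pt1 j).1 := by simp [zoneMap, chart, scal]
    rw [e, farV]
    have h1 := norm_sub_le (r j • (pt2 j).1) (japaneseBracket (z j).1 • (pt1 j).1)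
    have h2 := norm_jb_smul_le (x := (z j).1) ((norm_fst_le (pt1 j)).trans (H.hσ j))
    have h3 := norm_nonneg (r j • (pt2 j).1)
    linarith [jb_pos (z j).1]
  · refine ContinuousLinearMap.opNorm_le_bound _ (by linarith [hF j]) fun q => ?_
    have e1 : ‖q.2.1‖ ≤ ‖q‖ := (norm_fst_le _).trans (norm_snd_le _)
    have e2 : ‖q.1.1‖ ≤ ‖q‖ := (norm_fst_le _).trans (norm_fst_le _)
    have h1 := norm_sub_le (r j • q.2.1) (japaneseBracket (z j).1 • q.1.1)
    rw [norm_smul, norm_smul, Real.norm_of_nonneg (H.hr0 j).le,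
      Real.norm_of_nonneg (jb_pos _).le] at h1
    have h2 : r j * ‖q.2.1‖ ≤ japaneseBracket (z j).1 * ‖q‖ :=
      mul_le_mul (H.hrX j) e1 (norm_nonneg _) (jb_pos _).le
    have h3 : japaneseBracket (z j).1 * ‖q.1.1‖ ≤ japaneseBracket (z j).1 * ‖q‖ :=
      mul_le_mul_of_nonneg_left e2 (jb_pos _).le
    have h4 : japaneseBracket (z j).1 * ‖q‖ ≤ farV (z j) (pt2 j) (r j) * ‖q‖ :=
      mul_le_mul_of_nonneg_right (by rw [farV]; linarith [norm_nonneg (r j • (pt2 j).1)])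
        (norm_nonneg _)
    refine h1.trans ?_
    linarith

theorem FarPts.sb_sub_snd (H : FarPts z pt1 pt2 r ρ) (K : ℕ) :
    SB K (fun j => farW (z j) (pt2 j) (ρ j)) (fun j => (pt1 j, pt2 j))
      (fun j q => (zoneMap (fun _ => z j) (r j) (ρ j) q).2 - (chart (z j) q.1).2) := by
  have hF : ∀ j, 0 ≤ farW (z j) (pt2 j) (ρ j) := fun j => zero_le_one.trans (one_le_farW _ _ _)
  refine SB.affine (A := 2)
    (fun j => subMapXi n (ρ j) (japaneseBracket (z j).2))
    zero_le_two hF (fun j q => ?_) (fun j => ?_) (fun j => ?_)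
  · have e : (fun q : PhSpace n × PhSpace n =>
        (zoneMap (fun _ => z j) (r j) (ρ j) q).2 - (chart (z j) q.1).2) =
        ⇑(subMapXi n (ρ j) (japaneseBracket (z j).2)) := by
      funext q; simp [zoneMap, chart, scal, subMapXi]
    rw [e]
    exact ContinuousLinearMap.hasFDerivAt _
  · have e : (zoneMap (fun _ => z j) (r j) (ρ j) (pt1 j, pt2 j)).2 - (chart (z j) (pt1 j)).2 =
      ρ j • (pt2 j).2 - japaneseBracket (z j).2 • (pt1 j).2 := by simp [zoneMap, chart, scal]
    rw [e, farW]
    have h1 := norm_sub_le (ρ j • (pt2 j).2) (japaneseBracket (z j).2 • (pt1 j).2)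
    have h2 := norm_jb_smul_le (x := (z j).2) ((norm_snd_le (pt1 j)).trans (H.hσ j))
    have h3 := norm_nonneg (ρ j • (pt2 j).2)
    linarith [jb_pos (z j).2]
  · refine ContinuousLinearMap.opNorm_le_bound _ (by linarith [hF j]) fun q => ?_
    have e1 : ‖q.2.2‖ ≤ ‖q‖ := (norm_snd_le _).trans (norm_snd_le _)
    have e2 : ‖q.1.2‖ ≤ ‖q‖ := (norm_snd_le _).trans (norm_fst_le _)
    have h1 := norm_sub_le (ρ j • q.2.2) (japaneseBracket (z j).2 • q.1.2)
    rw [norm_smul, norm_smul, Real.norm_of_nonneg (H.hρ0 j).le,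
      Real.norm_of_nonneg (jb_pos _).le] at h1
    have h2 : ρ j * ‖q.2.2‖ ≤ japaneseBracket (z j).2 * ‖q‖ :=
      mul_le_mul (H.hρX j) e1 (norm_nonneg _) (jb_pos _).le
    have h3 : japaneseBracket (z j).2 * ‖q.1.2‖ ≤ japaneseBracket (z j).2 * ‖q‖ :=
      mul_le_mul_of_nonneg_left e2 (jb_pos _).le
    have h4 : japaneseBracket (z j).2 * ‖q‖ ≤ farW (z j) (pt2 j) (ρ j) * ‖q‖ :=
      mul_le_mul_of_nonneg_right (by rw [farW]; linarith [norm_nonneg (ρ j • (pt2 j).2)])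
        (norm_nonneg _)
    refine h1.trans ?_
    linarith

theorem contDiff_zone_sub (z : PhSpace n) (r ρ : ℝ) :
    ContDiff ℝ ∞ (fun q : PhSpace n × PhSpace n => zoneMap (fun _ => z) r ρ q - chart z q.1) :=
  (contDiff_zoneMap contDiff_const).sub ((contDiff_chart z).comp contDiff_fst)

theorem contDiff_out (z : PhSpace n) (r ρ : ℝ) : ContDiff ℝ ∞ (fun q : PhSpace n × PhSpace n =>
    ((chart z q.1).1, (zoneMap (fun _ => z) r ρ q).2)) :=
  (contDiff_fst.comp ((contDiff_chart z).comp contDiff_fst)).prodMk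
    (contDiff_snd.comp (contDiff_zoneMap contDiff_const))

theorem contDiff_in (z : PhSpace n) (r ρ : ℝ) : ContDiff ℝ ∞ (fun q : PhSpace n × PhSpace n =>
    ((zoneMap (fun _ => z) r ρ q).1, (chart z q.1).2)) :=
  (contDiff_fst.comp (contDiff_zoneMap contDiff_const)).prodMk
    (contDiff_snd.comp ((contDiff_chart z).comp contDiff_fst))

/-- With V = `farV` and W = `farW`, the four parts of the phase are of size ⟨x⟩W, V⟨ξ⟩, VW and
⟨x⟩⟨ξ⟩ up to constants, and ⟨x⟩ ≤ V, ⟨ξ⟩ ≤ W. -/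
theorem FarPts.sb_zonePh (H : FarPts z pt1 pt2 r ρ) (ha : ∀ i, SmallPert (a i))
    (hb : ∀ i, SmallPert (b i)) (Ba : SGBoundedFamily 1 1 a) (Bb : SGBoundedFamily 1 1 b) (K : ℕ) :
    SB K (fun j => farV (z j) (pt2 j) (r j) * farW (z j) (pt2 j) (ρ j))
      (fun j => (pt1 j, pt2 j))
      (fun j => zonePh (a (s j)) (b (s j)) (z j) (fun _ => z j) (r j) (ρ j)) := by
  have hV : ∀ j, 0 ≤ farV (z j) (pt2 j) (r j) := fun j => zero_le_one.trans (one_le_farV _ _ _)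
  have hW : ∀ j, 0 ≤ farW (z j) (pt2 j) (ρ j) := fun j => zero_le_one.trans (one_le_farW _ _ _)
  have hXV : ∀ j, japaneseBracket (z j).1 ≤ farV (z j) (pt2 j) (r j) := fun j =>
    le_add_of_nonneg_right (norm_nonneg _)
  have hXW : ∀ j, japaneseBracket (z j).2 ≤ farW (z j) (pt2 j) (ρ j) := fun j =>
    le_add_of_nonneg_right (norm_nonneg _)
  have hVW : ∀ j, 0 ≤ farV (z j) (pt2 j) (r j) * farW (z j) (pt2 j) (ρ j) := fun j =>
    mul_nonneg (hV j) (hW j)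
  have s1 : ∀ j, ‖(pt1 j).1‖ ≤ 1 / 32 := fun j => (norm_fst_le _).trans (H.hσ j)
  have s2 : ∀ j, ‖(pt1 j).2‖ ≤ 1 / 32 := fun j => (norm_snd_le _).trans (H.hσ j)
  have h1 := (H.sb_out (s := s) (r := r) K Ba).mono_weight hVW 2 zero_le_two fun j => by
    simp only [Real.rpow_one]
    calc _ ≤ (2 * japaneseBracket (z j).1) * farW (z j) (pt2 j) (ρ j) :=
          mul_le_mul (jb_chart_le (s1 j)) (jb_add_le_norm _ _) (jb_pos _).le
            (by linarith [jb_pos (z j).1])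
      _ ≤ 2 * (farV (z j) (pt2 j) (r j) * farW (z j) (pt2 j) (ρ j)) := by
          rw [← mul_assoc]
          exact mul_le_mul_of_nonneg_right (by linarith [hXV j]) (hW j)
  have h2 := (H.sb_in (s := s) (ρ := ρ) K Bb).mono_weight hVW 2 zero_le_two fun j => by
    simp only [Real.rpow_one]
    calc _ ≤ farV (z j) (pt2 j) (r j) * (2 * japaneseBracket (z j).2) :=
          mul_le_mul (jb_add_le_norm _ _) (jb_chart_le (s2 j)) (jb_pos _).le (hV j)
      _ ≤ 2 * (farV (z j) (pt2 j) (r j) * farW (z j) (pt2 j) (ρ j)) := by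
          rw [mul_left_comm, ← mul_assoc, ← mul_assoc]
          exact mul_le_mul_of_nonneg_left (hXW j) (by linarith [hV j])
  have h3 := SB.comp_clm (E := PhSpace n × PhSpace n) (pt := fun j => (pt1 j, pt2 j))
    (ContinuousLinearMap.fst ℝ (PhSpace n) (PhSpace n))
    (fun j => (contDiff_sharpPert (ha (s j)) (hb (s j))).comp (contDiff_chart (z j)))
    ((sgBoundedFamily_sharpPert ha hb Ba Bb).sb_scal K s z (fun j => japaneseBracket (z j).1)
      (fun j => japaneseBracket (z j).2) pt1 (A := 4 / 3) (fun j => (jb_pos _).le)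
      (fun j => (jb_pos _).le) (fun j => le_jb_chart (s1 j)) (fun j => le_jb_chart (s2 j)))
  have h3' := h3.mono_weight hVW 4 (by norm_num) fun j => by
    simp only [Real.rpow_one]
    calc _ ≤ (2 * japaneseBracket (z j).1) * (2 * japaneseBracket (z j).2) :=
          mul_le_mul (jb_chart_le (s1 j)) (jb_chart_le (s2 j)) (jb_pos _).le
            (by linarith [jb_pos (z j).1])
      _ ≤ (2 * farV (z j) (pt2 j) (r j)) * (2 * farW (z j) (pt2 j) (ρ j)) :=
          mul_le_mul (by linarith [hXV j]) (by linarith [hXW j]) (by linarith [jb_pos (z j).2])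
            (by linarith [hV j])
      _ = _ := by ring
  have c4 := fun j => contDiff_zone_sub (z j) (r j) (ρ j)
  have h4 := (H.sb_sub_fst (ρ := ρ) K).bilin (innerSL ℝ) (fun j => contDiff_fst.comp (c4 j))
    (fun j => contDiff_snd.comp (c4 j)) (H.sb_sub_snd (r := r) K)
  have c1 := fun j => ((ha (s j)).smooth).comp (contDiff_out (z j) (r j) (ρ j))
  have c2 := fun j => ((hb (s j)).smooth).comp (contDiff_in (z j) (r j) (ρ j))
  have c3 : ∀ j, ContDiff ℝ ∞ (fun q : PhSpace n × PhSpace n =>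
      sharpPert (a (s j)) (b (s j)) (chart (z j) q.1)) := fun j =>
    (contDiff_sharpPert (ha _) (hb _)).comp ((contDiff_chart _).comp contDiff_fst)
  have c5 : ∀ j, ContDiff ℝ ∞ (fun q : PhSpace n × PhSpace n => (innerSL ℝ
      ((zoneMap (fun _ => z j) (r j) (ρ j) q).1 - (chart (z j) q.1).1))
      ((zoneMap (fun _ => z j) (r j) (ρ j) q).2 - (chart (z j) q.1).2)) := fun j =>
    ContDiff.inner ℝ (contDiff_fst.comp (c4 j)) (contDiff_snd.comp (c4 j))
  exact SB.sub (fun j => ((c1 j).add (c2 j)).sub (c5 j)) c3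
    (SB.sub (fun j => (c1 j).add (c2 j)) c5 (h1.add c1 c2 h2) h4) h3'

end FarZones

/-! ### Gradient and amplitude bounds in the far zones -/

section FarZoneBounds
variable {n : ℕ} {ι J : Type*} {a b : ι → PhSpace n → ℝ}
  {s : J → ι} {z pt1 pt2 : J → PhSpace n} {r ρ : J → ℝ}

/-- The y-derivative is r times the entry of the x-gradient of `b` minus η − ξ; the first is of
order (0, 1) at (y, ξ), so of size ⟨ξ⟩, and both are dominated by `farW`. -/
theorem FarPts.sb_phG_vecX (H : FarPts z pt1 pt2 r ρ) (ha : ∀ i, SmallPert (a i))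
    (hb : ∀ i, SmallPert (b i)) (Bb : SGBoundedFamily 1 1 b) (K : ℕ) (l : Fin n) :
    SB K (fun j => r j * farW (z j) (pt2 j) (ρ j)) (fun j => (pt1 j, pt2 j))
      (fun j => phG (zonePh (a (s j)) (b (s j)) (z j) (fun _ => z j) (r j) (ρ j)) (vecX n l)) := by
  have hW : ∀ j, 0 ≤ farW (z j) (pt2 j) (ρ j) := fun j => zero_le_one.trans (one_le_farW _ _ _)
  have e : (fun j => phG (zonePh (a (s j)) (b (s j)) (z j) (fun _ => z j) (r j) (ρ j))
      (vecX n l)) = fun j q => r j * (dirD (coordVec n (Sum.inl l)) (b (s j))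
        ((zoneMap (fun _ => z j) (r j) (ρ j) q).1, (chart (z j) q.1).2) -
        EuclideanSpace.proj (𝕜 := ℝ) l
          ((zoneMap (fun _ => z j) (r j) (ρ j) q).2 - (chart (z j) q.1).2)) := by
    funext j q
    have hproj : ∀ x : SGSpace n, EuclideanSpace.proj (𝕜 := ℝ) l x = x l := fun _ => rfl
    rw [phG_zonePh_vecX (ha _) (hb _) contDiff_const]
    simp only [critMap, Prod.snd_sub, PiLp.sub_apply, PiLp.add_apply, gr1_apply, hproj]
    ring
  have hd := Bb.dirD (Sum.inl l)
  have h1 := (H.sb_in (s := s) (ρ := ρ) K hd).mono_weight hW 2 zero_le_two fun j => by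
    have h2 : ‖(pt1 j).2‖ ≤ 1 / 32 := (norm_snd_le _).trans (H.hσ j)
    simp only [cntX, cntXi]
    have h3 := jb_chart_le (x := (z j).2) h2
    have h4 : japaneseBracket (z j).2 ≤ farW (z j) (pt2 j) (ρ j) :=
      le_add_of_nonneg_right (norm_nonneg _)
    have e1 : (1 : ℝ) - ((List.countP Sum.isLeft [(Sum.inl l : Fin n ⊕ Fin n)] : ℕ) : ℝ) = 0 := by
      simp
    have e2 : (1 : ℝ) - ((List.countP Sum.isRight [(Sum.inl l : Fin n ⊕ Fin n)] : ℕ) : ℝ) = 1 := by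
      simp
    rw [e1, e2, Real.rpow_zero, Real.rpow_one, one_mul]
    linarith
  have c4 := fun j => contDiff_snd.comp (contDiff_zone_sub (z j) (r j) (ρ j))
  have h2 := (H.sb_sub_snd (r := r) K).clm' (EuclideanSpace.proj (𝕜 := ℝ) l) c4
  have c1 := fun j => (hd.smooth (s j)).comp (contDiff_in (z j) (r j) (ρ j))
  have c2 := fun j => (EuclideanSpace.proj (𝕜 := ℝ) l).contDiff.comp (c4 j)
  rw [e]
  exact (h1.sub c1 c2 h2).const_mul (fun j => (c1 j).sub (c2 j))
    fun j => (abs_of_pos (H.hr0 j)).le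

theorem FarPts.sb_phG_vecXi (H : FarPts z pt1 pt2 r ρ) (ha : ∀ i, SmallPert (a i))
    (hb : ∀ i, SmallPert (b i)) (Ba : SGBoundedFamily 1 1 a) (K : ℕ) (l : Fin n) :
    SB K (fun j => ρ j * farV (z j) (pt2 j) (r j)) (fun j => (pt1 j, pt2 j))
      (fun j => phG (zonePh (a (s j)) (b (s j)) (z j) (fun _ => z j) (r j) (ρ j)) (vecXi n l)) := by
  have hV : ∀ j, 0 ≤ farV (z j) (pt2 j) (r j) := fun j => zero_le_one.trans (one_le_farV _ _ _)
  have e : (fun j => phG (zonePh (a (s j)) (b (s j)) (z j) (fun _ => z j) (r j) (ρ j))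
      (vecXi n l)) = fun j q => ρ j * (dirD (coordVec n (Sum.inr l)) (a (s j))
        ((chart (z j) q.1).1, (zoneMap (fun _ => z j) (r j) (ρ j) q).2) -
        EuclideanSpace.proj (𝕜 := ℝ) l
          ((zoneMap (fun _ => z j) (r j) (ρ j) q).1 - (chart (z j) q.1).1)) := by
    funext j q
    have hproj : ∀ x : SGSpace n, EuclideanSpace.proj (𝕜 := ℝ) l x = x l := fun _ => rfl
    rw [phG_zonePh_vecXi (ha _) (hb _) contDiff_const]
    simp only [critMap, Prod.fst_sub, PiLp.sub_apply, PiLp.add_apply, gr2_apply, hproj]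
    ring
  have hd := Ba.dirD (Sum.inr l)
  have h1 := (H.sb_out (s := s) (r := r) K hd).mono_weight hV 2 zero_le_two fun j => by
    have h2 : ‖(pt1 j).1‖ ≤ 1 / 32 := (norm_fst_le _).trans (H.hσ j)
    simp only [cntX, cntXi]
    have h3 := jb_chart_le (x := (z j).1) h2
    have h4 : japaneseBracket (z j).1 ≤ farV (z j) (pt2 j) (r j) :=
      le_add_of_nonneg_right (norm_nonneg _)
    have e1 : (1 : ℝ) - ((List.countP Sum.isLeft [(Sum.inr l : Fin n ⊕ Fin n)] : ℕ) : ℝ) = 1 := by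
      simp
    have e2 : (1 : ℝ) - ((List.countP Sum.isRight [(Sum.inr l : Fin n ⊕ Fin n)] : ℕ) : ℝ) = 0 := by
      simp
    rw [e1, e2, Real.rpow_zero, Real.rpow_one, mul_one]
    linarith
  have c4 := fun j => contDiff_fst.comp (contDiff_zone_sub (z j) (r j) (ρ j))
  have h2 := (H.sb_sub_fst (ρ := ρ) K).clm' (EuclideanSpace.proj (𝕜 := ℝ) l) c4
  have c1 := fun j => (hd.smooth (s j)).comp (contDiff_out (z j) (r j) (ρ j))
  have c2 := fun j => (EuclideanSpace.proj (𝕜 := ℝ) l).contDiff.comp (c4 j)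
  rw [e]
  exact (h1.sub c1 c2 h2).const_mul (fun j => (c1 j).sub (c2 j))
    fun j => (abs_of_pos (H.hρ0 j)).le

theorem le_phQ_vecX {a b : PhSpace n → ℝ} (ha : SmallPert a) (hb : SmallPert b)
    {z σ v : PhSpace n} {r ρ : ℝ} (hσ : ‖σ‖ ≤ 1 / 32) (hr : 0 ≤ r)
    (hv : japaneseBracket z.2 / 8 ≤ ‖ρ • v.2‖) : 1 / 324 * (r * farW z v ρ) ^ 2 ≤
      phQ (zonePh a b z (fun _ => z) r ρ) (vecX n) (σ, v) := by
  rw [phQ_zonePh_vecX ha hb contDiff_const]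
  have hs : ‖σ.2‖ ≤ 1 / 32 := (norm_snd_le _).trans hσ
  have e : (critMap a b (chart z σ, zoneMap (fun _ => z) r ρ (σ, v)) -
      zoneMap (fun _ => z) r ρ (σ, v)).2 = (japaneseBracket z.2 • σ.2 +
        gr1 b ((zoneMap (fun _ => z) r ρ (σ, v)).1, (chart z σ).2)) - ρ • v.2 := by
    simp only [critMap, Prod.snd_sub]
    simp only [zoneMap, chart, scal]
    abel
  have h1 := norm_jb_smul_le (x := z.2) hs
  have h2 := hb.d1 ((zoneMap (fun _ => z) r ρ (σ, v)).1, (chart z σ).2)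
  have h3 : japaneseBracket (chart z σ).2 ≤ 2 * japaneseBracket z.2 := jb_chart_le hs
  have h4 := norm_add_le (japaneseBracket z.2 • σ.2)
    (gr1 b ((zoneMap (fun _ => z) r ρ (σ, v)).1, (chart z σ).2))
  have h5 := norm_sub_norm_le (ρ • v.2) (japaneseBracket z.2 • σ.2 +
        gr1 b ((zoneMap (fun _ => z) r ρ (σ, v)).1, (chart z σ).2))
  rw [norm_sub_rev] at h5
  simp only at h2
  rw [e]
  set A := ‖(japaneseBracket z.2 • σ.2 +
        gr1 b ((zoneMap (fun _ => z) r ρ (σ, v)).1, (chart z σ).2)) - ρ • v.2‖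
  -- The two other terms together are at most ⟨ξ⟩/16, half of the lower bound ⟨ξ⟩/8 for |ρv₂|; hence
  -- |ρv₂| ≤ 2A, and `farW` is at most 9|ρv₂|. The constant 324 is 18².
  have h6 : farW z v ρ ≤ 18 * A := by rw [farW]; linarith [jb_pos z.2]
  have h7 := one_le_farW z v ρ
  have h8 : r * farW z v ρ ≤ 18 * (r * A) := by nlinarith
  have h9 : 0 ≤ r * farW z v ρ := mul_nonneg hr (by linarith)
  nlinarith

theorem le_phQ_vecXi {a b : PhSpace n → ℝ} (ha : SmallPert a) (hb : SmallPert b)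
    {z σ v : PhSpace n} {r ρ : ℝ} (hσ : ‖σ‖ ≤ 1 / 32) (hρ : 0 ≤ ρ)
    (hv : japaneseBracket z.1 / 8 ≤ ‖r • v.1‖) : 1 / 324 * (ρ * farV z v r) ^ 2 ≤
      phQ (zonePh a b z (fun _ => z) r ρ) (vecXi n) (σ, v) := by
  rw [phQ_zonePh_vecXi ha hb contDiff_const]
  have hs : ‖σ.1‖ ≤ 1 / 32 := (norm_fst_le _).trans hσ
  have e : (critMap a b (chart z σ, zoneMap (fun _ => z) r ρ (σ, v)) -
      zoneMap (fun _ => z) r ρ (σ, v)).1 = (japaneseBracket z.1 • σ.1 +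
        gr2 a ((chart z σ).1, (zoneMap (fun _ => z) r ρ (σ, v)).2)) - r • v.1 := by
    simp only [critMap, Prod.fst_sub]
    simp only [zoneMap, chart, scal]
    abel
  have h1 := norm_jb_smul_le (x := z.1) hs
  have h2 := ha.d2 ((chart z σ).1, (zoneMap (fun _ => z) r ρ (σ, v)).2)
  have h3 : japaneseBracket (chart z σ).1 ≤ 2 * japaneseBracket z.1 := jb_chart_le hs
  have h4 := norm_add_le (japaneseBracket z.1 • σ.1)
    (gr2 a ((chart z σ).1, (zoneMap (fun _ => z) r ρ (σ, v)).2))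
  have h5 := norm_sub_norm_le (r • v.1) (japaneseBracket z.1 • σ.1 +
        gr2 a ((chart z σ).1, (zoneMap (fun _ => z) r ρ (σ, v)).2))
  rw [norm_sub_rev] at h5
  simp only at h2
  rw [e]
  set A := ‖(japaneseBracket z.1 • σ.1 +
        gr2 a ((chart z σ).1, (zoneMap (fun _ => z) r ρ (σ, v)).2)) - r • v.1‖
  have h6 : farV z v r ≤ 18 * A := by rw [farV]; linarith [jb_pos z.1]
  have h7 := one_le_farV z v r
  have h8 : ρ * farV z v r ≤ 18 * (ρ * A) := by nlinarith
  have h9 : 0 ≤ ρ * farV z v r := mul_nonneg hρ (by linarith)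
  nlinarith

theorem chartInv_zoneMap_const (z : PhSpace n) (r ρ : ℝ) (q : PhSpace n × PhSpace n) :
    chartInv z (zoneMap (fun _ => z) r ρ q) =
      (((japaneseBracket z.1)⁻¹ * r) • q.2.1, ((japaneseBracket z.2)⁻¹ * ρ) • q.2.2) := by
  simp [chartInv, zoneMap, scal, mul_smul]

theorem FarPts.sb_zoneAmp (H : FarPts z pt1 pt2 r ρ) (t : J → Set.Icc (0 : ℝ × ℝ) 1)
    (k₁ k₂ : Bool) (K : ℕ) :
    SB K (fun j => (r j * ρ j) ^ n) (fun j => (pt1 j, pt2 j))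
      (fun j => zoneAmp (zoneCut k₁ k₂ (z j)) (fun _ => z j) (r j) (ρ j) (t j)) := by
  have hX : ∀ (l X : ℝ), 0 < l → l ≤ X → |X⁻¹ * l| ≤ 1 := fun l X h0 h => by
    rw [abs_of_pos (mul_pos (inv_pos.2 (h0.trans_le h)) h0), inv_mul_le_iff₀ (h0.trans_le h)]
    linarith
  let P1 : PhSpace n × PhSpace n →L[ℝ] SGSpace n :=
    (ContinuousLinearMap.fst ℝ (SGSpace n) (SGSpace n)).comp
      (ContinuousLinearMap.snd ℝ (PhSpace n) (PhSpace n))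
  let P2 : PhSpace n × PhSpace n →L[ℝ] SGSpace n :=
    (ContinuousLinearMap.snd ℝ (SGSpace n) (SGSpace n)).comp
      (ContinuousLinearMap.snd ℝ (PhSpace n) (PhSpace n))
  have h1 : SB K (fun _ => 1) (fun j => (pt1 j, pt2 j))
      (fun j q => nearFar n k₁ (((japaneseBracket (z j).1)⁻¹ * r j) • P1 q)) :=
    SB.comp_affine (f := fun _ => nearFar n k₁)
      (g := fun j q => ((japaneseBracket (z j).1)⁻¹ * r j) • P1 q)
      (L := fun j => ((japaneseBracket (z j).1)⁻¹ * r j) • P1) (A := ‖P1‖)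
      (fun _ => contDiff_nearFar k₁) (sb_nearFar k₁ K _)
      (fun j _ => (((japaneseBracket (z j).1)⁻¹ * r j) • P1).hasFDerivAt) fun j => by
        rw [norm_smul, Real.norm_eq_abs]
        exact mul_le_of_le_one_left (norm_nonneg _) (hX _ _ (H.hr0 j) (H.hrX j))
  have h2 : SB K (fun _ => 1) (fun j => (pt1 j, pt2 j))
      (fun j q => nearFar n k₂ (((japaneseBracket (z j).2)⁻¹ * ρ j) • P2 q)) :=
    SB.comp_affine (f := fun _ => nearFar n k₂)
      (g := fun j q => ((japaneseBracket (z j).2)⁻¹ * ρ j) • P2 q)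
      (L := fun j => ((japaneseBracket (z j).2)⁻¹ * ρ j) • P2) (A := ‖P2‖)
      (fun _ => contDiff_nearFar k₂) (sb_nearFar k₂ K _)
      (fun j _ => (((japaneseBracket (z j).2)⁻¹ * ρ j) • P2).hasFDerivAt) fun j => by
        rw [norm_smul, Real.norm_eq_abs]
        exact mul_le_of_le_one_left (norm_nonneg _) (hX _ _ (H.hρ0 j) (H.hρX j))
  have h3 := SB.comp_clm (pt := fun j => (pt1 j, pt2 j))
    (ContinuousLinearMap.snd ℝ (PhSpace n) (PhSpace n))
    (fun j => (contDiff_regul (t j).1).comp (contDiff_scal (z j) (r j) (ρ j)))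
    ((sgBoundedFamily_regul n).sb_scal K t z r ρ pt2 (fun j => (H.hr0 j).le)
      (fun j => (H.hρ0 j).le) H.hr H.hρ)
  simp only [Real.rpow_zero, mul_one] at h3
  have c1 : ∀ j, ContDiff ℝ ∞
      (fun q => nearFar n k₁ (((japaneseBracket (z j).1)⁻¹ * r j) • P1 q)) := fun j =>
    (contDiff_nearFar k₁).comp (((japaneseBracket (z j).1)⁻¹ * r j) • P1).contDiff
  have c2 : ∀ j, ContDiff ℝ ∞
      (fun q => nearFar n k₂ (((japaneseBracket (z j).2)⁻¹ * ρ j) • P2 q)) := fun j =>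
    (contDiff_nearFar k₂).comp (((japaneseBracket (z j).2)⁻¹ * ρ j) • P2).contDiff
  have c3 := fun j => ((contDiff_regul (t j).1).comp (contDiff_scal (z j) (r j) (ρ j))).comp
    (ContinuousLinearMap.snd ℝ (PhSpace n) (PhSpace n)).contDiff
  have h4 := (((h1.mul c1 c2 h2).mul (fun j => (c1 j).mul (c2 j)) c3 h3).const_mul
    (c := fun j => (r j * ρ j) ^ n) (w' := fun j => (r j * ρ j) ^ n)
    (fun j => ((c1 j).mul (c2 j)).mul (c3 j))
    (fun j => (abs_of_pos (pow_pos (mul_pos (H.hr0 j) (H.hρ0 j)) n)).le)).clm'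
    Complex.ofRealCLM (fun j => contDiff_const.mul (((c1 j).mul (c2 j)).mul (c3 j)))
  simp only [mul_one] at h4
  have e : ∀ j, zoneAmp (zoneCut k₁ k₂ (z j)) (fun _ => z j) (r j) (ρ j) (t j) = fun q =>
      Complex.ofRealCLM ((r j * ρ j) ^ n *
        (nearFar n k₁ (((japaneseBracket (z j).1)⁻¹ * r j) • P1 q) *
          nearFar n k₂ (((japaneseBracket (z j).2)⁻¹ * ρ j) • P2 q) *
        regul (t j) (scal (z j) (r j) (ρ j) q.2))) := fun j => by
    funext q
    simp only [zoneAmp, zoneCut, chartInv_zoneMap_const]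
    rfl
  simp only [e]
  exact h4

end FarZoneBounds

/-! ### Absolutely convergent representations in the zones -/

section ZoneRep
variable {n : ℕ} {ι : Type*} {a b : ι → PhSpace n → ℝ}

/-- The index set of family members, base points, regularisation parameters and evaluation
points. -/
structure ZoneIdx (n : ℕ) (ι : Type*) where
  /-- the member of the family -/
  s : ι
  /-- the base point -/
  z : PhSpace n
  /-- the regularisation parameters -/
  t : Set.Icc (0 : ℝ × ℝ) 1
  /-- the parameter -/
  σ : PhSpace n
  /-- the integration variable -/
  v : PhSpace n
  hσ : ‖σ‖ ≤ 1 / 32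

/-- An integrable weight on phase space. -/
def domW {n : ℕ} (v : PhSpace n) : ℝ := ((1 + ‖v‖) ^ (2 * n + 1))⁻¹

theorem domW_pos (v : PhSpace n) : 0 < domW v := by
  have := norm_nonneg v
  unfold domW
  positivity

theorem integrable_domW (n : ℕ) : Integrable (domW (n := n)) := by
  have h := integrable_one_add_norm (E := PhSpace n) (μ := volume) (r := (2 * n + 1 : ℕ)) (by
    rw [Module.finrank_prod, finrank_euclideanSpace_fin]
    push_cast
    linarith)
  refine h.congr (Filter.Eventually.of_forall fun v => ?_)
  simp only
  rw [Real.rpow_neg (by positivity), Real.rpow_natCast]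
  rfl

/-- A representation of the part of the regularised composition integral cut off by `c` by an
absolutely convergent integral with uniform bounds. -/
structure IsZoneRep (a b : ι → PhSpace n → ℝ) (K : ℕ) (c : PhSpace n → PhSpace n → ℝ)
    (f : ι → PhSpace n → ℝ × ℝ → PhSpace n × PhSpace n → ℂ) : Prop where
  smooth : ∀ s z t, ContDiff ℝ ∞ (f s z t)
  bound : SB K (fun p : ZoneIdx n ι => domW p.v) (fun p => (p.σ, p.v)) (fun p => f p.s p.z p.t)
  integral : ∀ s z (t : ℝ × ℝ) σ, t ∈ Set.Icc 0 1 → ‖σ‖ ≤ 1 / 32 → 0 < t.1 → 0 < t.2 →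
    ∫ v, f s z t (σ, v) = ∫ w, (c z w : ℂ) * compInt (a s) (b s) t (chart z σ) w
  stable : ∀ s z q, ∃ δ > 0, ∀ t : ℝ × ℝ, |t.1| < δ → |t.2| < δ → f s z t q = f s z 0 q

theorem isZoneRep_oscInt {L L' : Type} [Fintype L] [Fintype L'] (ha : ∀ i, SmallPert (a i))
    (hb : ∀ i, SmallPert (b i)) {K : ℕ} {c : PhSpace n → PhSpace n → ℝ}
    (hc : ∀ z, ContDiff ℝ ∞ (c z)) {B : ι → PhSpace n → PhSpace n → PhSpace n}
    (hB : ∀ s z, ContDiff ℝ ∞ (B s z)) {r ρ : PhSpace n → ℝ} (hr : ∀ z, 0 < r z)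
    (hρ : ∀ z, 0 < ρ z) (e : L → PhSpace n) (e' : L' → PhSpace n) (M M' : ℕ)
    (hbd : SB K (fun p : ZoneIdx n ι => domW p.v) (fun p => (p.σ, p.v)) fun p =>
      oscInt (zonePh (a p.s) (b p.s) p.z (B p.s p.z) (r p.z) (ρ p.z)) e e' M M'
        (zoneAmp (c p.z) (B p.s p.z) (r p.z) (ρ p.z) p.t)) :
    IsZoneRep a b K c fun s z t => oscInt (zonePh (a s) (b s) z (B s z) (r z) (ρ z)) e e' M M'
      (zoneAmp (c z) (B s z) (r z) (ρ z) t) where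
  smooth s z t := contDiff_oscInt (contDiff_zonePh (ha s) (hb s) (hB s z))
    (contDiff_zoneAmp (hc z) (hB s z))
  bound := hbd
  integral s z t σ _ _ h1 h2 := integral_zone (ha s) (hb s) (hc z) (hB s z) (hr z) (hρ z) h1 h2 σ
  stable s z q := by
    obtain ⟨δ, hδ, h⟩ := zoneAmp_eventually (c := c z) (r := r z) (ρ := ρ z) (hB s z) q
    exact ⟨δ, hδ, fun t h1 h2 => (oscInt_congr (h t h1 h2)).eq_of_nhds⟩

/-- The length scale of a near or far zone. -/
def zoneScale (k : Bool) (x : SGSpace n) : ℝ := if k then japaneseBracket x else 1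

theorem zoneScale_pos (k : Bool) (x : SGSpace n) : 0 < zoneScale k x := by
  cases k
  · exact one_pos
  · exact jb_pos x

theorem one_le_zoneScale (k : Bool) (x : SGSpace n) : 1 ≤ zoneScale k x := by
  cases k
  · exact le_rfl
  · exact one_le_jb x

theorem zoneScale_le (k : Bool) (x : SGSpace n) : zoneScale k x ≤ japaneseBracket x := by
  cases k
  · exact one_le_jb x
  · exact le_rfl

theorem zoneScale_le_jb {k : Bool} {x v : SGSpace n}
    (h : NearFar k (((japaneseBracket x)⁻¹ * zoneScale k x) • v)) :
    zoneScale k x ≤ 4 / 3 * japaneseBracket (x + zoneScale k x • v) := by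
  cases k
  · have : (1 : ℝ) ≤ japaneseBracket (x + (1 : ℝ) • v) := one_le_jb _
    simp only [zoneScale, Bool.false_eq_true, if_false]
    linarith
  · have h1 : ‖v‖ ≤ 1 / 4 := by
      simpa [NearFar, zoneScale, (jb_pos x).ne'] using h
    have h2 := le_jb_add_smul x v
    have h3 : japaneseBracket x * (1 - 1 / 4) ≤ japaneseBracket x * (1 - ‖v‖) :=
      mul_le_mul_of_nonneg_left (by linarith) (jb_pos x).le
    simp only [zoneScale, if_true]
    linarith

theorem le_norm_of_far {x v : SGSpace n}
    (h : NearFar false (((japaneseBracket x)⁻¹ * zoneScale false x) • v)) :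
    japaneseBracket x / 8 ≤ ‖zoneScale false x • v‖ := by
  have h1 : 1 / 8 ≤ (japaneseBracket x)⁻¹ * ‖v‖ := by
    simpa [NearFar, zoneScale, norm_smul, abs_of_pos (jb_pos x)] using h
  rw [le_inv_mul_iff₀ (jb_pos x)] at h1
  simp only [zoneScale, Bool.false_eq_true, if_false, one_smul]
  linarith

theorem norm_le_of_near {x v : SGSpace n}
    (h : NearFar true (((japaneseBracket x)⁻¹ * zoneScale true x) • v)) : ‖v‖ ≤ 1 / 4 := by
  simpa [NearFar, zoneScale, (jb_pos x).ne'] using h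

/-- The support of the cutoff of a zone. -/
def ZoneSupp (k₁ k₂ : Bool) (p : ZoneIdx n ι) : Prop :=
  NearFar k₁ (((japaneseBracket p.z.1)⁻¹ * zoneScale k₁ p.z.1) • p.v.1) ∧
    NearFar k₂ (((japaneseBracket p.z.2)⁻¹ * zoneScale k₂ p.z.2) • p.v.2)

theorem farPts_of_zone (k₁ k₂ : Bool) : FarPts (J := {p : ZoneIdx n ι // ZoneSupp k₁ k₂ p})
    (fun p => p.1.z) (fun p => p.1.σ) (fun p => p.1.v) (fun p => zoneScale k₁ p.1.z.1)
    (fun p => zoneScale k₂ p.1.z.2) where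
  hσ p := p.1.hσ
  hr0 _ := zoneScale_pos _ _
  hρ0 _ := zoneScale_pos _ _
  hrX _ := zoneScale_le _ _
  hρX _ := zoneScale_le _ _
  hr p := zoneScale_le_jb p.2.1
  hρ p := zoneScale_le_jb p.2.2

/-- The phase in the coordinates of a zone away from the critical point. -/
def farPh (a b : ι → PhSpace n → ℝ) (k₁ k₂ : Bool) (p : ZoneIdx n ι) :
    PhSpace n × PhSpace n → ℝ :=
  zonePh (a p.s) (b p.s) p.z (fun _ => p.z) (zoneScale k₁ p.z.1) (zoneScale k₂ p.z.2)

/-- The amplitude in the coordinates of a zone away from the critical point. -/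
def farAmp (k₁ k₂ : Bool) (p : ZoneIdx n ι) : PhSpace n × PhSpace n → ℂ :=
  zoneAmp (zoneCut k₁ k₂ p.z) (fun _ => p.z) (zoneScale k₁ p.z.1) (zoneScale k₂ p.z.2) p.t

/-- The weight of the first variable in a zone away from the critical point. -/
def wV (k₁ : Bool) (p : ZoneIdx n ι) : ℝ := farV p.z p.v (zoneScale k₁ p.z.1)

/-- The weight of the second variable in a zone away from the critical point. -/
def wW (k₂ : Bool) (p : ZoneIdx n ι) : ℝ := farW p.z p.v (zoneScale k₂ p.z.2)

theorem one_le_wV (k : Bool) (p : ZoneIdx n ι) : 1 ≤ wV k p := one_le_farV _ _ _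

theorem one_le_wW (k : Bool) (p : ZoneIdx n ι) : 1 ≤ wW k p := one_le_farW _ _ _

theorem sb_farPh_oscInt {L L' : Type} [Fintype L] [Fintype L'] (ha : ∀ i, SmallPert (a i))
    (hb : ∀ i, SmallPert (b i)) (Ba : SGBoundedFamily 1 1 a) (Bb : SGBoundedFamily 1 1 b)
    (k₁ k₂ : Bool) (K M M' : ℕ) {e : L → PhSpace n} {e' : L' → PhSpace n}
    {g g' : ZoneIdx n ι → ℝ} (hg1 : ∀ p, 1 ≤ g p) (hg1' : ∀ p, 1 ≤ g' p) {c c' A : ℝ}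
    (hc : 0 < c) (hc' : 0 < c') (hA : 0 ≤ A)
    (hQ : ∀ p, ZoneSupp k₁ k₂ p → c * g p ^ 2 ≤ phQ (farPh a b k₁ k₂ p) e (p.σ, p.v))
    (hQ' : ∀ p, ZoneSupp k₁ k₂ p → c' * g' p ^ 2 ≤ phQ (farPh a b k₁ k₂ p) e' (p.σ, p.v))
    (hG : ∀ K l, SB K (fun p : {p : ZoneIdx n ι // ZoneSupp k₁ k₂ p} => g p)
      (fun p => (p.1.σ, p.1.v)) (fun p => phG (farPh a b k₁ k₂ p.1) (e l)))
    (hG' : ∀ K l, SB K (fun p : {p : ZoneIdx n ι // ZoneSupp k₁ k₂ p} => g' p)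
      (fun p => (p.1.σ, p.1.v)) (fun p => phG (farPh a b k₁ k₂ p.1) (e' l)))
    (hw : ∀ p : ZoneIdx n ι, ZoneSupp k₁ k₂ p → (wV k₁ p * wW k₂ p) ^ K *
      ((zoneScale k₁ p.z.1 * zoneScale k₂ p.z.2) ^ n / g p ^ M / g' p ^ M') ≤ A * domW p.v) :
    SB K (fun p : ZoneIdx n ι => domW p.v) (fun p => (p.σ, p.v)) fun p =>
      oscInt (farPh a b k₁ k₂ p) e e' M M' (farAmp k₁ k₂ p) := by
  have H := farPts_of_zone (n := n) (ι := ι) k₁ k₂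
  have h1 : ∀ K, SB K (fun p : {p : ZoneIdx n ι // ZoneSupp k₁ k₂ p} =>
      (zoneScale k₁ p.1.z.1 * zoneScale k₂ p.1.z.2) ^ n)
      (fun p => (p.1.σ, p.1.v)) (fun p => farAmp k₁ k₂ p.1) := fun K =>
    H.sb_zoneAmp (fun p => p.1.t) k₁ k₂ K
  have h2 : SB K (fun p : {p : ZoneIdx n ι // ZoneSupp k₁ k₂ p} => wV k₁ p.1 * wW k₂ p.1)
      (fun p => (p.1.σ, p.1.v)) (fun p => farPh a b k₁ k₂ p.1) := by
    have h := H.sb_zonePh (s := fun p => p.1.s) ha hb Ba Bb K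
    unfold farPh wV wW
    exact h
  have c1 : ∀ p : ZoneIdx n ι, ContDiff ℝ ∞ (farPh a b k₁ k₂ p) := fun _ =>
    contDiff_zonePh (ha _) (hb _) contDiff_const
  have c2 : ∀ p : ZoneIdx n ι, ContDiff ℝ ∞ (farAmp k₁ k₂ p) := fun _ =>
    contDiff_zoneAmp (contDiff_zoneCut _ _ _) contDiff_const
  have h3 : ∀ p : ZoneIdx n ι, ¬ ZoneSupp k₁ k₂ p →
      farAmp k₁ k₂ p =ᶠ[nhds (p.σ, p.v)] fun _ => 0 := fun p hp =>
    zoneAmp_eventually_zero contDiff_const (by rwa [chartInv_zoneMap_const])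
  have h4 : ∀ p : ZoneIdx n ι, ZoneSupp k₁ k₂ p → 1 ≤ wV k₁ p * wW k₂ p := fun p _ =>
    one_le_mul_of_one_le_of_one_le (one_le_wV _ _) (one_le_wW _ _)
  exact SB.oscInt (Θ := farPh a b k₁ k₂) (b := farAmp k₁ k₂) (w := fun p => domW p.v)
    (pt := fun p => (p.σ, p.v)) (e := e) (e' := e')
    (m := fun p => (zoneScale k₁ p.z.1 * zoneScale k₂ p.z.2) ^ n) (g := g) (g' := g')
    (h := fun p => wV k₁ p * wW k₂ p) (ZoneSupp k₁ k₂) M M' K c1 c2 (fun p => (domW_pos _).le) h3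
    (fun p _ => hg1 p) (fun p _ => hg1' p) h4 hc hc' hA hQ hQ' hG hG' h1 h2 hw

theorem isZoneRep_far {L L' : Type} [Fintype L] [Fintype L'] (ha : ∀ i, SmallPert (a i))
    (hb : ∀ i, SmallPert (b i)) (k₁ k₂ : Bool) {K M M' : ℕ} {e : L → PhSpace n}
    {e' : L' → PhSpace n}
    (h : SB K (fun p : ZoneIdx n ι => domW p.v) (fun p => (p.σ, p.v)) fun p =>
      oscInt (farPh a b k₁ k₂ p) e e' M M' (farAmp k₁ k₂ p)) :
    ∃ f, IsZoneRep a b K (zoneCut k₁ k₂) f :=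
  ⟨_, isZoneRep_oscInt ha hb (fun z => contDiff_zoneCut k₁ k₂ z)
    (B := fun _ z _ => z) (fun _ _ => contDiff_const) (r := fun z => zoneScale k₁ z.1)
    (ρ := fun z => zoneScale k₂ z.2) (fun _ => zoneScale_pos _ _) (fun _ => zoneScale_pos _ _)
    e e' M M' h⟩

theorem domW_lower {v : PhSpace n} {A : ℝ} (hA : 1 + ‖v‖ ≤ 2 * A) :
    (A ^ (2 * n + 1))⁻¹ ≤ 2 ^ (2 * n + 1) * domW v := by
  have h0 := norm_nonneg v
  have hA0 : 0 < A := by linarith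
  rw [domW, ← div_eq_mul_inv, inv_eq_one_div, div_le_div_iff₀ (by positivity) (by positivity),
    one_mul, ← mul_pow]
  exact pow_le_pow_left₀ (by positivity) hA _

/-- Bookkeeping of the weights in the mixed zones. -/
theorem mixed_weight_le {X W V : ℝ} (hX : 1 ≤ X) (hW : 1 ≤ W) (hV0 : 0 ≤ V) (hV : V ≤ 2 * X)
    {v : PhSpace n} (hv : 1 + ‖v‖ ≤ 2 * W) (K : ℕ) :
    (V * W) ^ K * (X ^ n / (X * W) ^ (K + n + (2 * n + 1)) / 1 ^ 0) ≤
      2 ^ K * 2 ^ (2 * n + 1) * domW v := by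
  have hX0 : 0 < X := by linarith
  have hW0 : 0 < W := by linarith
  have h1 : (V * W) ^ K ≤ (2 * X * W) ^ K := by gcongr
  calc (V * W) ^ K * (X ^ n / (X * W) ^ (K + n + (2 * n + 1)) / 1 ^ 0)
      ≤ (2 * X * W) ^ K * (X ^ n / (X * W) ^ (K + n + (2 * n + 1)) / 1 ^ 0) := by gcongr
    _ = 2 ^ K * ((W ^ n * X ^ (2 * n + 1))⁻¹ * (W ^ (2 * n + 1))⁻¹) := by
        rw [pow_zero, div_one, pow_add, pow_add, mul_pow, mul_pow, mul_pow, mul_pow, mul_pow]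
        field_simp
    _ ≤ 2 ^ K * (1 * (2 ^ (2 * n + 1) * domW v)) := by
        have h2 : (W ^ n * X ^ (2 * n + 1))⁻¹ ≤ 1 := inv_le_one_of_one_le₀
          (one_le_mul_of_one_le_of_one_le (one_le_pow₀ hW) (one_le_pow₀ hX))
        have h3 := domW_lower hv
        gcongr
    _ = _ := by ring

/-- Here y is near x, at scale ⟨x⟩, and η is far, at scale 1. Integrating by parts in y, each step
gains ⟨x⟩W, where W = ⟨ξ⟩ + |η − ξ|. -/
theorem exists_isZoneRep_near_far (ha : ∀ i, SmallPert (a i)) (hb : ∀ i, SmallPert (b i))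
    (Ba : SGBoundedFamily 1 1 a) (Bb : SGBoundedFamily 1 1 b) (K : ℕ) :
    ∃ f, IsZoneRep a b K (zoneCut true false) f := by
  have H := farPts_of_zone (n := n) (ι := ι) true false
  have hG : ∀ K l, SB K (fun p : {p : ZoneIdx n ι // ZoneSupp true false p} =>
      zoneScale true p.1.z.1 * wW false p.1)
      (fun p => (p.1.σ, p.1.v)) (fun p => phG (farPh a b true false p.1) (vecX n l)) :=
    fun K l => by
      have h := H.sb_phG_vecX (s := fun p => p.1.s) ha hb Bb K l
      unfold farPh wW
      exact h
  -- Of the powers of ⟨x⟩W, `K` pay for derivatives of the exponential, `n` for the Jacobian ⟨x⟩^n,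
  -- and `2 * n + 1` for integrability in 2n dimensions. No second set of directions is needed,
  -- hence the empty index type.
  refine isZoneRep_far ha hb true false (M := K + n + (2 * n + 1)) (M' := 0) (e := vecX n)
    (e' := Empty.elim) (sb_farPh_oscInt ha hb Ba Bb true false K _ _
    (g := fun p => zoneScale true p.z.1 * wW false p) (g' := fun _ => 1) (c := 1 / 324) (c' := 1)
    (A := 2 ^ K * 2 ^ (2 * n + 1))
    (fun p => one_le_mul_of_one_le_of_one_le (one_le_zoneScale _ _) (one_le_wW _ _))
    (fun _ => le_rfl) (by norm_num) one_pos (by positivity)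
    (fun p hp => le_phQ_vecX (ha _) (hb _) p.hσ (zoneScale_pos _ _).le (le_norm_of_far hp.2))
    (fun p _ => by simpa using one_le_phQ _ _ _) hG (fun _ l => l.elim) fun p hp => ?_)
  have h1 := norm_le_of_near hp.1
  have e : zoneScale false p.z.2 = 1 := rfl
  have e' : zoneScale true p.z.1 = japaneseBracket p.z.1 := rfl
  simp only [wV, wW, e, e', mul_one]
  refine mixed_weight_le (one_le_jb _) (one_le_farW _ _ _)
    (zero_le_one.trans (one_le_farV _ _ _)) ?_ ?_ K
  · rw [farV, norm_smul, Real.norm_of_nonneg (jb_pos _).le]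
    nlinarith [jb_pos p.z.1]
  · have h2 : ‖p.v‖ ≤ 1 / 4 + ‖p.v.2‖ := by
      rw [Prod.norm_def]
      exact max_le (by linarith [norm_nonneg p.v.2]) (by linarith)
    rw [farW, one_smul]
    linarith [one_le_jb p.z.2, norm_nonneg p.v.2]

theorem exists_isZoneRep_far_near (ha : ∀ i, SmallPert (a i)) (hb : ∀ i, SmallPert (b i))
    (Ba : SGBoundedFamily 1 1 a) (Bb : SGBoundedFamily 1 1 b) (K : ℕ) :
    ∃ f, IsZoneRep a b K (zoneCut false true) f := by
  have H := farPts_of_zone (n := n) (ι := ι) false true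
  have hG : ∀ K l, SB K (fun p : {p : ZoneIdx n ι // ZoneSupp false true p} =>
      zoneScale true p.1.z.2 * wV false p.1)
      (fun p => (p.1.σ, p.1.v)) (fun p => phG (farPh a b false true p.1) (vecXi n l)) :=
    fun K l => by
      have h := H.sb_phG_vecXi (s := fun p => p.1.s) ha hb Ba K l
      unfold farPh wV
      exact h
  -- The mirror image: integration by parts in η, with gain ⟨ξ⟩(⟨x⟩ + |y − x|) and Jacobian ⟨ξ⟩^n.
  refine isZoneRep_far ha hb false true (M := K + n + (2 * n + 1)) (M' := 0) (e := vecXi n)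
    (e' := Empty.elim) (sb_farPh_oscInt ha hb Ba Bb false true K _ _
    (g := fun p => zoneScale true p.z.2 * wV false p) (g' := fun _ => 1) (c := 1 / 324) (c' := 1)
    (A := 2 ^ K * 2 ^ (2 * n + 1))
    (fun p => one_le_mul_of_one_le_of_one_le (one_le_zoneScale _ _) (one_le_wV _ _))
    (fun _ => le_rfl) (by norm_num) one_pos (by positivity)
    (fun p hp => le_phQ_vecXi (ha _) (hb _) p.hσ (zoneScale_pos _ _).le (le_norm_of_far hp.1))
    (fun p _ => by simpa using one_le_phQ _ _ _) hG (fun _ l => l.elim) fun p hp => ?_)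
  have h1 := norm_le_of_near hp.2
  have e : zoneScale false p.z.1 = 1 := rfl
  have e' : zoneScale true p.z.2 = japaneseBracket p.z.2 := rfl
  simp only [wV, wW, e, e', one_mul]
  rw [mul_comm (farV _ _ _)]
  refine mixed_weight_le (one_le_jb _) (one_le_farV _ _ _)
    (zero_le_one.trans (one_le_farW _ _ _)) ?_ ?_ K
  · rw [farW, norm_smul, Real.norm_of_nonneg (jb_pos _).le]
    nlinarith [jb_pos p.z.2]
  · have h2 : ‖p.v‖ ≤ 1 / 4 + ‖p.v.1‖ := by
      rw [Prod.norm_def]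
      exact max_le (by linarith) (by linarith [norm_nonneg p.v.1])
    rw [farV, one_smul]
    linarith [one_le_jb p.z.1, norm_nonneg p.v.1]

/-- With both variables far, y-integrations gain W = ⟨ξ⟩ + |η − ξ| and η-integrations gain V = ⟨x⟩ +
|y − x|. Both are needed, since differentiating the exponential costs powers of VW and integrability
is needed in both variables. -/
theorem exists_isZoneRep_far_far (ha : ∀ i, SmallPert (a i)) (hb : ∀ i, SmallPert (b i))
    (Ba : SGBoundedFamily 1 1 a) (Bb : SGBoundedFamily 1 1 b) (K : ℕ) :
    ∃ f, IsZoneRep a b K (zoneCut false false) f := by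
  have H := farPts_of_zone (n := n) (ι := ι) false false
  have hG : ∀ K l, SB K (fun p : {p : ZoneIdx n ι // ZoneSupp false false p} =>
      zoneScale false p.1.z.1 * wW false p.1)
      (fun p => (p.1.σ, p.1.v)) (fun p => phG (farPh a b false false p.1) (vecX n l)) :=
    fun K l => by
      have h := H.sb_phG_vecX (s := fun p => p.1.s) ha hb Bb K l
      unfold farPh wW
      exact h
  have hG' : ∀ K l, SB K (fun p : {p : ZoneIdx n ι // ZoneSupp false false p} =>
      zoneScale false p.1.z.2 * wV false p.1)
      (fun p => (p.1.σ, p.1.v)) (fun p => phG (farPh a b false false p.1) (vecXi n l)) :=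
    fun K l => by
      have h := H.sb_phG_vecXi (s := fun p => p.1.s) ha hb Ba K l
      unfold farPh wV
      exact h
  refine isZoneRep_far ha hb false false (M := K + (2 * n + 1)) (M' := K + (2 * n + 1))
    (e := vecX n) (e' := vecXi n) (sb_farPh_oscInt ha hb Ba Bb false false K _ _
    (g := fun p => zoneScale false p.z.1 * wW false p)
    (g' := fun p => zoneScale false p.z.2 * wV false p) (c := 1 / 324) (c' := 1 / 324)
    (A := 2 ^ (2 * n + 1))
    (fun p => one_le_mul_of_one_le_of_one_le (one_le_zoneScale _ _) (one_le_wW _ _))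
    (fun p => one_le_mul_of_one_le_of_one_le (one_le_zoneScale _ _) (one_le_wV _ _))
    (by norm_num) (by norm_num) (by positivity)
    (fun p hp => le_phQ_vecX (ha _) (hb _) p.hσ (zoneScale_pos _ _).le (le_norm_of_far hp.2))
    (fun p hp => le_phQ_vecXi (ha _) (hb _) p.hσ (zoneScale_pos _ _).le (le_norm_of_far hp.1))
    hG hG' fun p hp => ?_)
  have e : ∀ x : SGSpace n, zoneScale false x = 1 := fun _ => rfl
  simp only [wV, wW, e, one_mul, one_pow]
  have hV := one_le_farV p.z p.v 1
  have hW := one_le_farW p.z p.v 1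
  have hV0 : 0 < farV p.z p.v 1 := by linarith
  have hW0 : 0 < farW p.z p.v 1 := by linarith
  -- Each surviving factor (VW)^{-1} thus decays in the full variable v; `2 * n + 1` of them remain.
  have h2 : 1 + ‖p.v‖ ≤ 2 * (farV p.z p.v 1 * farW p.z p.v 1) := by
    have h3 : ‖p.v‖ ≤ ‖p.v.1‖ + ‖p.v.2‖ := by
      rw [Prod.norm_def]
      exact max_le (by linarith [norm_nonneg p.v.2]) (by linarith [norm_nonneg p.v.1])
    have h4 : 1 + ‖p.v.1‖ ≤ farV p.z p.v 1 := by
      rw [farV, one_smul]; linarith [one_le_jb p.z.1]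
    have h5 : 1 + ‖p.v.2‖ ≤ farW p.z p.v 1 := by
      rw [farW, one_smul]; linarith [one_le_jb p.z.2]
    nlinarith [norm_nonneg p.v.1, norm_nonneg p.v.2]
  refine le_trans (le_of_eq ?_) (domW_lower h2)
  rw [mul_pow, mul_pow, pow_add, pow_add]
  field_simp
  rw [← pow_add]

end ZoneRep

/-! ### The zone of the critical point -/

section NearZone
variable {n : ℕ}

/-- The reciprocal of the square root of the weight `⟨x⟩⟨ξ⟩`. -/
def lamRoot (z : PhSpace n) : ℝ := (Real.sqrt (lam z))⁻¹

theorem lamRoot_pos (z : PhSpace n) : 0 < lamRoot z := inv_pos.2 (Real.sqrt_pos.2 (lam_pos z))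

theorem lamRoot_le_one (z : PhSpace n) : lamRoot z ≤ 1 :=
  inv_le_one_of_one_le₀ (Real.one_le_sqrt.2 (one_le_lam z))

theorem lam_mul_lamRoot (z : PhSpace n) : lam z * lamRoot z = (lamRoot z)⁻¹ := by
  have h := Real.mul_self_sqrt (lam_pos z).le
  have h1 := (Real.sqrt_pos.2 (lam_pos z)).ne'
  rw [lamRoot, inv_inv]
  nth_rw 1 [← h]
  field_simp

theorem lam_mul_lamRoot_sq (z : PhSpace n) : lam z * lamRoot z * lamRoot z = 1 := by
  rw [lam_mul_lamRoot, inv_mul_cancel₀ (lamRoot_pos z).ne']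

section Single
variable {a b : PhSpace n → ℝ} {z : PhSpace n}

/-- The integration variable near the critical point, in the chart around `z`. -/
def nearPt (a b : PhSpace n → ℝ) (z : PhSpace n) (q : PhSpace n × PhSpace n) : PhSpace n :=
  critChart a b z q.1 + lamRoot z • q.2

/-- The phase in coordinates centred at the critical point. -/
def nearPh (a b : PhSpace n → ℝ) (z : PhSpace n) : PhSpace n × PhSpace n → ℝ :=
  zonePh a b z (fun σ => critPt a b (chart z σ)) (japaneseBracket z.1 * lamRoot z)
    (japaneseBracket z.2 * lamRoot z)

/-- The amplitude in coordinates centred at the critical point. -/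
def nearAmp (a b : PhSpace n → ℝ) (z : PhSpace n) (t : ℝ × ℝ) : PhSpace n × PhSpace n → ℂ :=
  zoneAmp (zoneCut true true z) (fun σ => critPt a b (chart z σ))
    (japaneseBracket z.1 * lamRoot z) (japaneseBracket z.2 * lamRoot z) t

/-- The defect of the rescaled critical point system. -/
def critDefect (a b : PhSpace n → ℝ) (z : PhSpace n) (q : PhSpace n × PhSpace n) : PhSpace n :=
  critMap (resc a z) (resc b z) q - q.2

theorem contDiff_critDefect (ha : SmallPert a) (hb : SmallPert b) (z : PhSpace n) :
    ContDiff ℝ ∞ (critDefect a b z) :=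
  (contDiff_critMap (ha.smooth.resc z) (hb.smooth.resc z)).sub contDiff_snd

theorem contDiff_const_smul_of {E F : Type} [NormedAddCommGroup E] [NormedSpace ℝ E]
    [NormedAddCommGroup F] [NormedSpace ℝ F] {f : E → F} (hf : ContDiff ℝ ∞ f) (c : ℝ) :
    ContDiff ℝ ∞ (fun x => c • f x) := by fun_prop

/-- The rescaled gradient of the phase in coordinates centred at the critical point. -/
def nearGrad (a b : PhSpace n → ℝ) (z : PhSpace n) (q : PhSpace n × PhSpace n) : PhSpace n :=
  (lamRoot z)⁻¹ • critDefect a b z (q.1, nearPt a b z q)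

theorem contDiff_nearPt (ha : SmallPert a) (hb : SmallPert b) (z : PhSpace n) :
    ContDiff ℝ ∞ (nearPt a b z) :=
  ((contDiff_critChart ha hb z).comp contDiff_fst).add (by fun_prop)

theorem contDiff_critPt_chart (ha : SmallPert a) (hb : SmallPert b) (z : PhSpace n) :
    ContDiff ℝ ∞ (fun σ => critPt a b (chart z σ)) :=
  (contDiff_critPt ha hb).comp (contDiff_chart z)

theorem contDiff_nearPh (ha : SmallPert a) (hb : SmallPert b) (z : PhSpace n) :
    ContDiff ℝ ∞ (nearPh a b z) :=
  contDiff_zonePh ha hb (contDiff_critPt_chart ha hb z)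

theorem contDiff_nearGrad (ha : SmallPert a) (hb : SmallPert b) (z : PhSpace n) :
    ContDiff ℝ ∞ (nearGrad a b z) :=
  contDiff_const_smul_of ((contDiff_critDefect ha hb z).comp
    (contDiff_fst.prodMk (contDiff_nearPt ha hb z))) _

/-- The factor λ^{1/2} in front of the defect cancels the λ^{-1/2} from the chain rule. So
v-derivatives of the rescaled gradient are bounded uniformly in λ. -/
theorem dirD_nearGrad (ha : SmallPert a) (hb : SmallPert b) (z u : PhSpace n)
    (q : PhSpace n × PhSpace n) : dirD (0, u) (nearGrad a b z) q =
      dirD (0, u) (critDefect a b z) (q.1, nearPt a b z q) := by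
  have d1 : HasFDerivAt (fun v : PhSpace n => (q.1, critChart a b z q.1 + lamRoot z • v)) _ q.2 :=
    (hasFDerivAt_const q.1 q.2).prodMk ((lamRoot z • ContinuousLinearMap.id ℝ (PhSpace n)).hasFDerivAt.const_add _)
  have d2 := ((contDiff_critDefect ha hb z).differentiable (by simp)
    (q.1, nearPt a b z q)).hasFDerivAt
  have d3 : HasFDerivAt (fun v => nearGrad a b z (q.1, v)) _ q.2 :=
    (HasFDerivAt.comp (g := critDefect a b z) (f := fun v : PhSpace n =>
      (q.1, critChart a b z q.1 + lamRoot z • v)) q.2 d2 d1).const_smul (lamRoot z)⁻¹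
  have h4 := fderiv_snd_section (contDiff_nearGrad ha hb z) q.1 q.2 u
  rw [d3.fderiv] at h4
  have e : ((0 : PhSpace n), lamRoot z • u) = lamRoot z • ((0 : PhSpace n), u) := by simp
  refine h4.symm.trans ?_
  rw [FunLike.coe_smul, Pi.smul_apply, ContinuousLinearMap.comp_apply,
    ContinuousLinearMap.prod_apply, zero_apply, FunLike.coe_smul,
    Pi.smul_apply, ContinuousLinearMap.id_apply, e, map_smul, smul_smul,
    inv_mul_cancel₀ (lamRoot_pos z).ne', one_smul]
  rfl

theorem zoneMap_near (a b : PhSpace n → ℝ) (z : PhSpace n) (q : PhSpace n × PhSpace n) :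
    zoneMap (fun σ => critPt a b (chart z σ)) (japaneseBracket z.1 * lamRoot z)
      (japaneseBracket z.2 * lamRoot z) q = chart z (nearPt a b z q) := by
  rw [zoneMap, ← chart_critChart]
  simp [scal, chart, nearPt, smul_add, mul_smul, add_assoc]

theorem nearGrad_zero (ha : SmallPert a) (hb : SmallPert b) (z σ : PhSpace n) :
    nearGrad a b z (σ, 0) = 0 := by
  simp only [nearGrad, critDefect, nearPt, smul_zero, add_zero]
  rw [← critChart_spec ha hb z σ, sub_self, smul_zero]

theorem nearPh_zero (a b : PhSpace n → ℝ) (z σ : PhSpace n) : nearPh a b z (σ, 0) = 0 := by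
  rw [nearPh, zonePh, zoneMap_near]
  simp only [nearPt, smul_zero, add_zero]
  rw [chart_critChart, sharpPert, sub_self]

theorem phG_nearPh_inl (ha : SmallPert a) (hb : SmallPert b) (i : Fin n)
    (q : PhSpace n × PhSpace n) :
    phG (nearPh a b z) (coordVec n (Sum.inl i)) q = (nearGrad a b z q).2 i := by
  have h := phG_zonePh_vecX (z := z) (r := japaneseBracket z.1 * lamRoot z)
    (ρ := japaneseBracket z.2 * lamRoot z) ha hb (contDiff_critPt_chart ha hb z) i q
  rw [zoneMap_near, critMap_chart ha.smooth hb.smooth] at h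
  refine h.trans ?_
  have e := lam_mul_lamRoot z
  simp only [nearGrad, critDefect, chart, scal, Prod.snd_sub, Prod.smul_snd, PiLp.smul_apply, PiLp.sub_apply,
    PiLp.add_apply, smul_eq_mul]
  rw [← e, lam]
  ring

theorem phG_nearPh_inr (ha : SmallPert a) (hb : SmallPert b) (i : Fin n)
    (q : PhSpace n × PhSpace n) :
    phG (nearPh a b z) (coordVec n (Sum.inr i)) q = (nearGrad a b z q).1 i := by
  have h := phG_zonePh_vecXi (z := z) (r := japaneseBracket z.1 * lamRoot z)
    (ρ := japaneseBracket z.2 * lamRoot z) ha hb (contDiff_critPt_chart ha hb z) i q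
  rw [zoneMap_near, critMap_chart ha.smooth hb.smooth] at h
  refine h.trans ?_
  have e := lam_mul_lamRoot z
  simp only [nearGrad, critDefect, chart, scal, Prod.fst_sub, Prod.smul_fst, PiLp.smul_apply, PiLp.sub_apply,
    PiLp.add_apply, smul_eq_mul]
  rw [← e, lam]
  ring

/-- The centre is a fixed point of a 1/16-contraction, so the defect at another point is at least
15/16 of the displacement λ^{-1/2}|v|. This takes the place of a nondegeneracy assumption on the
Hessian. -/
theorem le_norm_nearGrad (ha : SmallPert a) (hb : SmallPert b) {σ v : PhSpace n}
    (hσ : ‖σ‖ ≤ 1 / 32) (hv : ‖nearPt a b z (σ, v)‖ ≤ 1 / 4) :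
    15 / 16 * ‖v‖ ≤ ‖nearGrad a b z (σ, v)‖ := by
  have h1 := (ha.nearPair hb z).lip (σ := σ) (by linarith) hv
    ((norm_critChart_le ha hb z hσ).trans (by norm_num))
  rw [← critChart_spec ha hb z σ] at h1
  have e : nearPt a b z (σ, v) - critChart a b z σ = lamRoot z • v := by simp [nearPt]
  have h0 := lamRoot_pos z
  rw [e, norm_smul, Real.norm_of_nonneg h0.le] at h1
  rw [nearGrad, critDefect, norm_smul, norm_inv, Real.norm_of_nonneg h0.le, le_inv_mul_iff₀ h0]
  have h2 := norm_sub_norm_le (nearPt a b z (σ, v) - critChart a b z σ)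
    (critMap (resc a z) (resc b z) (σ, nearPt a b z (σ, v)) - critChart a b z σ)
  rw [sub_sub_sub_cancel_right, norm_sub_rev (nearPt a b z (σ, v)) (critMap _ _ _), e, norm_smul,
    Real.norm_of_nonneg h0.le] at h2
  simp only
  linarith

theorem le_phQ_nearPh (ha : SmallPert a) (hb : SmallPert b) {σ v : PhSpace n}
    (hσ : ‖σ‖ ≤ 1 / 32) (hv : ‖nearPt a b z (σ, v)‖ ≤ 1 / 4) :
    1 / 4 * (1 + ‖v‖) ^ 2 ≤ phQ (nearPh a b z) (coordVec n) (σ, v) := by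
  have h1 := le_norm_nearGrad ha hb hσ hv
  have e : phQ (nearPh a b z) (coordVec n) (σ, v) =
      1 + (‖(nearGrad a b z (σ, v)).2‖ ^ 2 + ‖(nearGrad a b z (σ, v)).1‖ ^ 2) := by
    rw [phQ, Fintype.sum_sum_type, EuclideanSpace.real_norm_sq_eq, EuclideanSpace.real_norm_sq_eq]
    simp only [phG_nearPh_inl ha hb, phG_nearPh_inr ha hb, pow_two]
  have h2 : ‖nearGrad a b z (σ, v)‖ ^ 2 ≤
      ‖(nearGrad a b z (σ, v)).2‖ ^ 2 + ‖(nearGrad a b z (σ, v)).1‖ ^ 2 := by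
    rw [Prod.norm_def]
    rcases max_cases ‖(nearGrad a b z (σ, v)).1‖ ‖(nearGrad a b z (σ, v)).2‖ with h | h <;>
      rw [h.1] <;> nlinarith [sq_nonneg ‖(nearGrad a b z (σ, v)).1‖,
        sq_nonneg ‖(nearGrad a b z (σ, v)).2‖]
  rw [e]
  nlinarith [norm_nonneg v, sq_nonneg (‖v‖ - 1)]

end Single

variable {ι J : Type*} {a b : ι → PhSpace n → ℝ} {s : J → ι} {z pt1 pt2 : J → PhSpace n}

/-- Points near the critical point. -/
structure NearPts (a b : ι → PhSpace n → ℝ) (s : J → ι) (z pt1 pt2 : J → PhSpace n) : Prop where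
  hσ : ∀ j, ‖pt1 j‖ ≤ 1 / 32
  hv : ∀ j, ‖nearPt (a (s j)) (b (s j)) (z j) (pt1 j, pt2 j)‖ ≤ 1 / 4

/-- `SB.of_dirD_snd` needs estimates on the whole segment from the critical point; both ends lie in
the ball of radius 1/4, which is convex. -/
theorem NearPts.segment (H : NearPts a b s z pt1 pt2) (ha : ∀ i, SmallPert (a i))
    (hb : ∀ i, SmallPert (b i)) :
    NearPts a b (fun j : J × Set.Icc (0 : ℝ) 1 => s j.1) (fun j => z j.1) (fun j => pt1 j.1)
      (fun j => (j.2 : ℝ) • pt2 j.1) where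
  hσ j := H.hσ j.1
  hv j := by
    have h1 := (norm_critChart_le (ha (s j.1)) (hb (s j.1)) (z j.1) (H.hσ j.1)).trans
      (by norm_num : (1 / 16 : ℝ) ≤ 1 / 4)
    have hc := convex_closedBall (0 : PhSpace n) (1 / 4) (mem_closedBall_zero_iff.2 h1)
      (mem_closedBall_zero_iff.2 (H.hv j.1)) (sub_nonneg.2 j.2.2.2) j.2.2.1
      (sub_add_cancel (1 : ℝ) j.2)
    have e : (1 - (j.2 : ℝ)) • critChart (a (s j.1)) (b (s j.1)) (z j.1) (pt1 j.1) +
        (j.2 : ℝ) • nearPt (a (s j.1)) (b (s j.1)) (z j.1) (pt1 j.1, pt2 j.1) =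
        nearPt (a (s j.1)) (b (s j.1)) (z j.1) (pt1 j.1, (j.2 : ℝ) • pt2 j.1) := by
      simp only [nearPt]
      module
    rw [e] at hc
    exact mem_closedBall_zero_iff.1 hc

theorem NearPts.sb_nearPt (H : NearPts a b s z pt1 pt2) (ha : ∀ i, SmallPert (a i))
    (hb : ∀ i, SmallPert (b i)) (Ba : SGBoundedFamily 1 1 a) (Bb : SGBoundedFamily 1 1 b) (K : ℕ) :
    SB K (fun _ => 1) (fun j => (pt1 j, pt2 j))
      (fun j => nearPt (a (s j)) (b (s j)) (z j)) := by
  have h1 := SB.comp_clm (pt := fun j => (pt1 j, pt2 j))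
    (ContinuousLinearMap.fst ℝ (PhSpace n) (PhSpace n))
    (fun j => contDiff_critChart (ha (s j)) (hb (s j)) (z j))
    (sb_critChart ha hb Ba Bb s z (pt := pt1) H.hσ K)
  have h2 : SB K (fun _ => 1) (fun j => (pt1 j, pt2 j))
      (fun j (q : PhSpace n × PhSpace n) => lamRoot (z j) • q.2) := by
    refine SB.affine (A := 1) (fun j => lamRoot (z j) •
      ContinuousLinearMap.snd ℝ (PhSpace n) (PhSpace n)) zero_le_one (fun _ => zero_le_one)
      (fun _ _ => (lamRoot _ • ContinuousLinearMap.snd ℝ (PhSpace n) (PhSpace n)).hasFDerivAt)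
      (fun j => ?_) fun j => ?_
    · have e : lamRoot (z j) • pt2 j = nearPt (a (s j)) (b (s j)) (z j) (pt1 j, pt2 j) -
        critChart (a (s j)) (b (s j)) (z j) (pt1 j) := by simp [nearPt]
      simp only [e]
      have h3 := norm_sub_le (nearPt (a (s j)) (b (s j)) (z j) (pt1 j, pt2 j))
        (critChart (a (s j)) (b (s j)) (z j) (pt1 j))
      have h4 := norm_critChart_le (ha (s j)) (hb (s j)) (z j) (H.hσ j)
      have h5 := H.hv j
      linarith
    · rw [norm_smul, Real.norm_of_nonneg (lamRoot_pos _).le, mul_one]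
      exact mul_le_one₀ (lamRoot_le_one _) (norm_nonneg _)
        (ContinuousLinearMap.norm_snd_le ℝ (PhSpace n) (PhSpace n))
  exact h1.add (fun j => (contDiff_critChart (ha (s j)) (hb (s j)) (z j)).comp contDiff_fst)
    (fun j => contDiff_const_smul_of contDiff_snd _) h2

theorem NearPts.sb_graph (H : NearPts a b s z pt1 pt2) (ha : ∀ i, SmallPert (a i))
    (hb : ∀ i, SmallPert (b i)) (Ba : SGBoundedFamily 1 1 a) (Bb : SGBoundedFamily 1 1 b) (K : ℕ) :
    SB K (fun _ => 1) (fun j => (pt1 j, pt2 j))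
      (fun j (q : PhSpace n × PhSpace n) => (q.1, nearPt (a (s j)) (b (s j)) (z j) q)) := by
  have h1 := SB.comp_clm (pt := fun j => (pt1 j, pt2 j)) (f := fun _ : J => fun x : PhSpace n => x)
    (ContinuousLinearMap.fst ℝ (PhSpace n) (PhSpace n)) (fun _ => contDiff_id)
    (SB.clm_of_bounded (K := K) (ContinuousLinearMap.id ℝ (PhSpace n)) (pt := pt1) H.hσ)
  exact h1.prodMk (fun _ => contDiff_fst) (fun j => contDiff_nearPt (ha _) (hb _) _)
    (H.sb_nearPt ha hb Ba Bb K)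

theorem sb_critDefect (ha : ∀ i, SmallPert (a i)) (hb : ∀ i, SmallPert (b i))
    (Ba : SGBoundedFamily 1 1 a) (Bb : SGBoundedFamily 1 1 b) (K : ℕ) (s : J → ι)
    (z : J → PhSpace n) {pt : J → PhSpace n × PhSpace n} (hpt : ∀ j, ‖pt j‖ ≤ 1 / 4) :
    SB K (fun _ => 1) pt (fun j => critDefect (a (s j)) (b (s j)) (z j)) :=
  (sb_critMap_resc Ba Bb K s z hpt).sub
    (fun _ => contDiff_critMap ((ha _).smooth.resc _) ((hb _).smooth.resc _))
    (fun _ => contDiff_snd)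
    (SB.clm_of_bounded (ContinuousLinearMap.snd ℝ (PhSpace n) (PhSpace n)) hpt)

theorem NearPts.sb_dirD_nearGrad (H : NearPts a b s z pt1 pt2) (ha : ∀ i, SmallPert (a i))
    (hb : ∀ i, SmallPert (b i)) (Ba : SGBoundedFamily 1 1 a) (Bb : SGBoundedFamily 1 1 b) (K : ℕ)
    (u : PhSpace n) :
    SB K (fun _ => 1) (fun j => (pt1 j, pt2 j))
      (fun j => dirD ((0, u) : PhSpace n × PhSpace n) (nearGrad (a (s j)) (b (s j)) (z j))) := by
  have hg : ∀ j, ‖(pt1 j, nearPt (a (s j)) (b (s j)) (z j) (pt1 j, pt2 j))‖ ≤ 1 / 4 := fun j =>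
    norm_pair_le ((H.hσ j).trans (by norm_num)) (H.hv j)
  have hP := sb_critDefect ha hb Ba Bb (K + 1) s z hg
  have cP : ∀ j, ContDiff ℝ ∞ (critDefect (a (s j)) (b (s j)) (z j)) := fun j =>
    contDiff_critDefect (ha _) (hb _) _
  have h2 := SB.comp_bounded (f := fun j => dirD ((0, u) : PhSpace n × PhSpace n)
      (critDefect (a (s j)) (b (s j)) (z j)))
    (g := fun j (q : PhSpace n × PhSpace n) => (q.1, nearPt (a (s j)) (b (s j)) (z j) q))
    (pt := fun j => (pt1 j, pt2 j)) (w := fun _ => 1) (fun j => (cP j).dirD _)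
    (fun j => contDiff_fst.prodMk (contDiff_nearPt (ha (s j)) (hb (s j)) (z j)))
    (hP.dirD cP (0, u)) (H.sb_graph ha hb Ba Bb K)
  exact h2.congr_eventually fun j => Filter.Eventually.of_forall fun q =>
    (dirD_nearGrad (ha _) (hb _) _ _ q).symm

/-- The rescaled gradient vanishes at v = 0 and has bounded v-derivatives, hence grows at most
linearly, together with its derivatives. -/
theorem NearPts.sb_nearGrad (H : NearPts a b s z pt1 pt2) (ha : ∀ i, SmallPert (a i))
    (hb : ∀ i, SmallPert (b i)) (Ba : SGBoundedFamily 1 1 a) (Bb : SGBoundedFamily 1 1 b) (K : ℕ) :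
    SB K (fun j => 1 + ‖pt2 j‖) (fun j => (pt1 j, pt2 j))
      (fun j => nearGrad (a (s j)) (b (s j)) (z j)) := by
  have h := SB.of_dirD_snd (coordBasis n) (coordBasis n) (K := K) (w := fun _ => 1)
    (pt := fun j => (pt1 j, pt2 j)) (f := fun j => nearGrad (a (s j)) (b (s j)) (z j))
    (fun _ => zero_le_one) (fun j => contDiff_nearGrad (ha _) (hb _) _)
    (fun j σ => nearGrad_zero (ha _) (hb _) _ _) fun l =>
      (H.segment ha hb).sb_dirD_nearGrad ha hb Ba Bb K _
  simpa only [one_mul] using h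

theorem NearPts.sb_phG (H : NearPts a b s z pt1 pt2) (ha : ∀ i, SmallPert (a i))
    (hb : ∀ i, SmallPert (b i)) (Ba : SGBoundedFamily 1 1 a) (Bb : SGBoundedFamily 1 1 b) (K : ℕ)
    (l : Fin n ⊕ Fin n) :
    SB K (fun j => 1 + ‖pt2 j‖) (fun j => (pt1 j, pt2 j))
      (fun j => phG (nearPh (a (s j)) (b (s j)) (z j)) (coordVec n l)) := by
  have h := H.sb_nearGrad ha hb Ba Bb K
  have c := fun j => contDiff_nearGrad (ha (s j)) (hb (s j)) (z j)
  rcases l with i | i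
  · refine (h.clm' ((EuclideanSpace.proj (𝕜 := ℝ) i).comp
      (ContinuousLinearMap.snd ℝ (SGSpace n) (SGSpace n))) c).congr_eventually fun j =>
      Filter.Eventually.of_forall fun q => ?_
    rw [phG_nearPh_inl (ha _) (hb _)]
    rfl
  · refine (h.clm' ((EuclideanSpace.proj (𝕜 := ℝ) i).comp
      (ContinuousLinearMap.fst ℝ (SGSpace n) (SGSpace n))) c).congr_eventually fun j =>
      Filter.Eventually.of_forall fun q => ?_
    rw [phG_nearPh_inr (ha _) (hb _)]
    rfl

/-- The same argument once more: the phase vanishes at v = 0 and its v-derivatives grow linearly, so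
it grows quadratically. -/
theorem NearPts.sb_nearPh (H : NearPts a b s z pt1 pt2) (ha : ∀ i, SmallPert (a i))
    (hb : ∀ i, SmallPert (b i)) (Ba : SGBoundedFamily 1 1 a) (Bb : SGBoundedFamily 1 1 b) (K : ℕ) :
    SB K (fun j => (1 + ‖pt2 j‖) ^ 2) (fun j => (pt1 j, pt2 j))
      (fun j => nearPh (a (s j)) (b (s j)) (z j)) := by
  have h := SB.of_dirD_snd (coordBasis n) (coordBasis n) (K := K) (w := fun j => 1 + ‖pt2 j‖)
    (pt := fun j => (pt1 j, pt2 j)) (f := fun j => nearPh (a (s j)) (b (s j)) (z j))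
    (fun j => by positivity) (fun j => contDiff_nearPh (ha _) (hb _) _)
    (fun j σ => nearPh_zero _ _ _ _) fun l => ?_
  · simpa only [pow_two] using h
  have h2 := ((H.segment ha hb).sb_phG ha hb Ba Bb K l).mono_weight
    (w' := fun j => 1 + ‖pt2 j.1‖) (fun j => by positivity) 1 zero_le_one fun j => by
      rw [one_mul, norm_smul, Real.norm_of_nonneg j.2.2.1]
      have := mul_le_of_le_one_left (norm_nonneg (pt2 j.1)) j.2.2.2
      linarith
  rw [coordBasis_apply]
  exact h2

theorem NearPts.sb_nearAmp (H : NearPts a b s z pt1 pt2) (ha : ∀ i, SmallPert (a i))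
    (hb : ∀ i, SmallPert (b i)) (Ba : SGBoundedFamily 1 1 a) (Bb : SGBoundedFamily 1 1 b)
    (t : J → Set.Icc (0 : ℝ × ℝ) 1) (K : ℕ) :
    SB K (fun _ => 1) (fun j => (pt1 j, pt2 j))
      (fun j => nearAmp (a (s j)) (b (s j)) (z j) (t j)) := by
  let p : J → PhSpace n := fun j => nearPt (a (s j)) (b (s j)) (z j) (pt1 j, pt2 j)
  have hx : ∀ x u : SGSpace n, ‖u‖ ≤ 1 / 4 →
      japaneseBracket x ≤ 4 / 3 * japaneseBracket (x + japaneseBracket x • u) := fun x u hu => by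
    have h1 := le_jb_add_smul x u
    have h2 : japaneseBracket x * (1 - 1 / 4) ≤ japaneseBracket x * (1 - ‖u‖) :=
      mul_le_mul_of_nonneg_left (by linarith) (jb_pos x).le
    linarith
  have h3 := (sgBoundedFamily_regul n).sb_scal K t z (fun j => japaneseBracket (z j).1)
    (fun j => japaneseBracket (z j).2) p (A := 4 / 3) (fun j => (jb_pos _).le)
    (fun j => (jb_pos _).le) (fun j => hx _ _ ((norm_fst_le _).trans (H.hv j)))
    (fun j => hx _ _ ((norm_snd_le _).trans (H.hv j)))
  simp only [Real.rpow_zero, mul_one] at h3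
  have c3 := fun j => (contDiff_regul (n := n) (t j).1).comp (contDiff_chart (z j))
  have h1 := SB.comp_clm (pt := p) (ContinuousLinearMap.fst ℝ (SGSpace n) (SGSpace n))
    (fun _ => contDiff_nearFar true) (sb_nearFar (n := n) true K _)
  have h2 := SB.comp_clm (pt := p) (ContinuousLinearMap.snd ℝ (SGSpace n) (SGSpace n))
    (fun _ => contDiff_nearFar true) (sb_nearFar (n := n) true K _)
  have c1 : ContDiff ℝ ∞ (fun w : PhSpace n => nearFar n true w.1) :=
    (contDiff_nearFar true).comp contDiff_fst
  have c2 : ContDiff ℝ ∞ (fun w : PhSpace n => nearFar n true w.2) :=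
    (contDiff_nearFar true).comp contDiff_snd
  have h4 := (h1.mul (fun _ => c1) (fun _ => c2) h2).mul (fun _ => c1.mul c2) c3 h3
  have h5 := SB.comp_bounded (fun j => (c1.mul c2).mul (c3 j))
    (fun j => contDiff_nearPt (ha (s j)) (hb (s j)) (z j)) h4 (H.sb_nearPt ha hb Ba Bb K)
  have h6 := h5.clm' Complex.ofRealCLM
    (fun j => ((c1.mul c2).mul (c3 j)).comp (contDiff_nearPt (ha (s j)) (hb (s j)) (z j)))
  simp only [mul_one] at h6
  refine h6.congr_eventually fun j => Filter.Eventually.of_forall fun q => ?_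
  -- The Jacobian is ⟨x⟩⟨ξ⟩ times λ^{-1}, that is, one; so the amplitude has size one.
  have e : japaneseBracket (z j).1 * lamRoot (z j) * (japaneseBracket (z j).2 * lamRoot (z j)) = 1 :=
    by rw [← lam_mul_lamRoot_sq (z j), lam]; ring
  rw [nearAmp, zoneAmp, zoneMap_near, zoneCut, chartInv_chart, e, one_pow, one_mul]
  rfl

theorem exists_isZoneRep_near_near (ha : ∀ i, SmallPert (a i)) (hb : ∀ i, SmallPert (b i))
    (Ba : SGBoundedFamily 1 1 a) (Bb : SGBoundedFamily 1 1 b) (K : ℕ) :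
    ∃ f, IsZoneRep a b K (zoneCut true true) f := by
  let D : ZoneIdx n ι → Prop := fun p => ‖nearPt (a p.s) (b p.s) p.z (p.σ, p.v)‖ ≤ 1 / 4
  have H : NearPts a b (fun p : {p // D p} => p.1.s) (fun p => p.1.z) (fun p => p.1.σ)
    (fun p => p.1.v) := ⟨fun p => p.1.hσ, fun p => p.2⟩
  have hB : ∀ s z, ContDiff ℝ ∞ (fun σ => critPt (a s) (b s) (chart z σ)) := fun s z =>
    contDiff_critPt_chart (ha s) (hb s) z
  have c1 : ∀ p : ZoneIdx n ι, ContDiff ℝ ∞ (nearPh (a p.s) (b p.s) p.z) := fun p =>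
    contDiff_nearPh (ha _) (hb _) _
  have c2 : ∀ p : ZoneIdx n ι, ContDiff ℝ ∞ (nearAmp (a p.s) (b p.s) p.z p.t) := fun p =>
    contDiff_zoneAmp (contDiff_zoneCut _ _ _) (hB _ _)
  have hoff : ∀ p : ZoneIdx n ι, ¬ D p →
      nearAmp (a p.s) (b p.s) p.z p.t =ᶠ[nhds (p.σ, p.v)] fun _ => 0 := fun p hp =>
    zoneAmp_eventually_zero (hB _ _) fun h => hp (by
      rw [zoneMap_near, chartInv_chart] at h
      exact norm_pair_le h.1 h.2)
  refine ⟨_, isZoneRep_oscInt ha hb (fun z => contDiff_zoneCut true true z) hB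
    (r := fun z => japaneseBracket z.1 * lamRoot z) (ρ := fun z => japaneseBracket z.2 * lamRoot z)
    (fun z => mul_pos (jb_pos _) (lamRoot_pos z)) (fun z => mul_pos (jb_pos _) (lamRoot_pos z))
    -- All 2n directions are used at once, with gain 1 + |v|. Derivatives of the quadratic phase
    -- cost (1 + |v|)^{2K}, and `2 * n + 1` powers remain for integrability.
    (coordVec n) Empty.elim (2 * K + (2 * n + 1)) 0 ?_⟩
  exact SB.oscInt (Θ := fun p : ZoneIdx n ι => nearPh (a p.s) (b p.s) p.z)
    (b := fun p => nearAmp (a p.s) (b p.s) p.z p.t) (w := fun p => domW p.v)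
    (pt := fun p => (p.σ, p.v)) (e := coordVec n) (e' := Empty.elim) (m := fun _ => 1)
    (g := fun p => 1 + ‖p.v‖) (g' := fun _ => 1) (h := fun p => (1 + ‖p.v‖) ^ 2) (c := 1 / 4)
    (c' := 1) (A := 1) D _ 0 K c1 c2 (fun p => (domW_pos _).le) hoff
    (fun p _ => by linarith [norm_nonneg p.v]) (fun _ _ => le_rfl)
    (fun p _ => one_le_pow₀ (by linarith [norm_nonneg p.v])) (by norm_num) one_pos zero_le_one
    (fun p hp => le_phQ_nearPh (ha _) (hb _) p.hσ hp) (fun p _ => by simpa using one_le_phQ _ _ _)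
    (fun K l => H.sb_phG ha hb Ba Bb K l) (fun _ l => l.elim)
    (fun K => H.sb_nearAmp ha hb Ba Bb (fun p => p.1.t) K) (H.sb_nearPh ha hb Ba Bb K)
    fun p _ => by
      have h0 : 0 < 1 + ‖p.v‖ := by linarith [norm_nonneg p.v]
      rw [domW, one_mul, pow_zero, div_one, ← pow_mul, pow_add]
      field_simp
      exact le_rfl

end NearZone

/-! ### Removing the regularisation; the symbol of the composition -/

section CompositionSymbol
variable {n : ℕ}

/-- The filter along which the regularisation is removed. -/
def regFilter : Filter (ℝ × ℝ) := nhdsWithin 0 {t | 0 < t.1 ∧ 0 < t.2}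

theorem eventually_regFilter_pos : ∀ᶠ t in regFilter, 0 < t.1 ∧ 0 < t.2 :=
  eventually_mem_nhdsWithin

theorem eventually_regFilter_lt {δ : ℝ} (hδ : 0 < δ) :
    ∀ᶠ t in regFilter, |t.1| < δ ∧ |t.2| < δ := by
  refine nhdsWithin_le_nhds ?_
  have h1 : ContinuousAt (fun t : ℝ × ℝ => |t.1|) 0 := by fun_prop
  have h2 : ContinuousAt (fun t : ℝ × ℝ => |t.2|) 0 := by fun_prop
  exact (h1.eventually (gt_mem_nhds (by simpa using hδ))).and
    (h2.eventually (gt_mem_nhds (by simpa using hδ)))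

theorem eventually_regFilter_mem : ∀ᶠ t in regFilter, t ∈ Set.Icc (0 : ℝ × ℝ) 1 := by
  filter_upwards [eventually_regFilter_pos, eventually_regFilter_lt one_pos] with t h1 h2
  exact ⟨⟨h1.1.le, h1.2.le⟩, ⟨(lt_of_abs_lt h2.1).le, (lt_of_abs_lt h2.2).le⟩⟩

instance : regFilter.NeBot := by
  refine mem_closure_iff_nhdsWithin_neBot.1 ?_
  have h : {t : ℝ × ℝ | 0 < t.1 ∧ 0 < t.2} = Set.Ioi 0 ×ˢ Set.Ioi 0 := rfl
  rw [h, closure_prod_eq, closure_Ioi]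
  exact Set.mk_mem_prod Set.self_mem_Ici Set.self_mem_Ici

instance : regFilter.IsCountablyGenerated := by
  unfold regFilter; infer_instance

/-- The symbol of the composition, up to a power of `2π`. -/
def compSymbol (a b : PhSpace n → ℝ) (z : PhSpace n) : ℂ :=
  Filter.limUnder regFilter fun t => ∫ w, compInt a b t z w

theorem continuous_compInt {a b : PhSpace n → ℝ} (ha : SmallPert a) (hb : SmallPert b)
    (t : ℝ × ℝ) (z : PhSpace n) : Continuous (compInt a b t z) := by
  have h1 := (contDiff_statPh ha.smooth hb.smooth).continuous
  have h2 := (contDiff_regul (n := n) t).continuous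
  unfold compInt
  fun_prop

theorem integrable_mul_compInt {a b : PhSpace n → ℝ} (ha : SmallPert a) (hb : SmallPert b)
    {c : PhSpace n → ℝ} (hc : Continuous c) {t : ℝ × ℝ} (h1 : 0 < t.1) (h2 : 0 < t.2)
    (z : PhSpace n) : Integrable (fun w => (c w : ℂ) * compInt a b t z w) := by
  refine Continuous.integrable_of_hasCompactSupport
    ((Complex.continuous_ofReal.comp hc).mul (continuous_compInt ha hb t z)) ?_
  refine HasCompactSupport.intro (isCompact_closedBall (0 : PhSpace n) (2 / t.1 + 2 / t.2))
    fun w hw => ?_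
  rw [mem_closedBall_zero_iff, not_le] at hw
  simp [compInt, regul_eq_zero h1 h2 hw.le]

variable {ι : Type*} {a b : ι → PhSpace n → ℝ} {K : ℕ} {c c' : PhSpace n → PhSpace n → ℝ}
  {f f' : ι → PhSpace n → ℝ × ℝ → PhSpace n × PhSpace n → ℂ}

theorem IsZoneRep.exists_bound (h : IsZoneRep a b K c f) : ∃ C, 0 ≤ C ∧
    ∀ s z t σ v, t ∈ Set.Icc 0 1 → ‖σ‖ ≤ 1 / 32 → ∀ k ≤ K,
      ‖iteratedFDeriv ℝ k (f s z t) (σ, v)‖ ≤ C * domW v := by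
  obtain ⟨-, C, hC, hb⟩ := h.bound
  exact ⟨C, hC, fun s z t σ v ht hσ k hk => hb ⟨s, z, ⟨t, ht⟩, σ, v, hσ⟩ k hk⟩

theorem IsZoneRep.integrable (h : IsZoneRep a b K c f) (s : ι) (z : PhSpace n) {t : ℝ × ℝ}
    (ht : t ∈ Set.Icc 0 1) {σ : PhSpace n} (hσ : ‖σ‖ ≤ 1 / 32) :
    Integrable (fun v => f s z t (σ, v)) := by
  obtain ⟨C, -, hb⟩ := h.exists_bound
  refine ((integrable_domW n).const_mul C).mono' ?_ (Filter.Eventually.of_forall fun v => ?_)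
  · exact ((h.smooth s z t).continuous.comp (by fun_prop)).aestronglyMeasurable
  · simpa using hb s z t σ v ht hσ 0 (Nat.zero_le _)

theorem IsZoneRep.add (ha : ∀ i, SmallPert (a i)) (hb : ∀ i, SmallPert (b i))
    (hc : ∀ z, Continuous (c z)) (hc' : ∀ z, Continuous (c' z)) (h : IsZoneRep a b K c f)
    (h' : IsZoneRep a b K c' f') : IsZoneRep a b K (fun z w => c z w + c' z w)
      (fun s z t q => f s z t q + f' s z t q) where
  smooth s z t := (h.smooth s z t).add (h'.smooth s z t)
  bound := h.bound.add (fun _ => h.smooth _ _ _) (fun _ => h'.smooth _ _ _) h'.bound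
  integral s z t σ ht hσ h1 h2 := by
    rw [integral_add (h.integrable s z ht hσ) (h'.integrable s z ht hσ),
      h.integral s z t σ ht hσ h1 h2, h'.integral s z t σ ht hσ h1 h2,
      ← integral_add (integrable_mul_compInt (ha s) (hb s) (hc z) h1 h2 _)
        (integrable_mul_compInt (ha s) (hb s) (hc' z) h1 h2 _)]
    refine integral_congr_ae (Filter.Eventually.of_forall fun w => ?_)
    simp only
    push_cast
    ring
  stable s z q := by
    obtain ⟨δ, hδ, e⟩ := h.stable s z q
    obtain ⟨δ', hδ', e'⟩ := h'.stable s z q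
    exact ⟨min δ δ', lt_min hδ hδ', fun t h1 h2 => by
      rw [e t (h1.trans_le (min_le_left _ _)) (h2.trans_le (min_le_left _ _)),
        e' t (h1.trans_le (min_le_right _ _)) (h2.trans_le (min_le_right _ _))]⟩

theorem exists_isZoneRep (ha : ∀ i, SmallPert (a i)) (hb : ∀ i, SmallPert (b i))
    (Ba : SGBoundedFamily 1 1 a) (Bb : SGBoundedFamily 1 1 b) (K : ℕ) :
    ∃ f, IsZoneRep a b K (fun _ _ => 1) f := by
  obtain ⟨f₁, h₁⟩ := exists_isZoneRep_near_near ha hb Ba Bb K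
  obtain ⟨f₂, h₂⟩ := exists_isZoneRep_near_far ha hb Ba Bb K
  obtain ⟨f₃, h₃⟩ := exists_isZoneRep_far_near ha hb Ba Bb K
  obtain ⟨f₄, h₄⟩ := exists_isZoneRep_far_far ha hb Ba Bb K
  have hc : ∀ k₁ k₂ (z : PhSpace n), Continuous (zoneCut k₁ k₂ z) := fun k₁ k₂ z =>
    (contDiff_zoneCut k₁ k₂ z).continuous
  have h := ((h₁.add ha hb (hc _ _) (hc _ _) h₂).add ha hb
    (fun z => (hc _ _ z).add (hc _ _ z)) (hc _ _) h₃).add ha hb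
    (fun z => ((hc _ _ z).add (hc _ _ z)).add (hc _ _ z)) (hc _ _) h₄
  have e : (fun z w : PhSpace n => zoneCut true true z w + zoneCut true false z w +
      zoneCut false true z w + zoneCut false false z w) = fun _ _ => 1 :=
    funext fun z => funext fun w => zoneCut_sum z w
  rw [← e]
  exact ⟨_, h⟩

/-- Dominated convergence: the representing integrands share the dominating function `domW`, and at
each point they are independent of t for small t. -/
theorem IsZoneRep.tendsto (h : IsZoneRep a b K (fun _ _ => 1) f) (s : ι) (z : PhSpace n)
    {σ : PhSpace n} (hσ : ‖σ‖ ≤ 1 / 32) :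
    Filter.Tendsto (fun t => ∫ w, compInt (a s) (b s) t (chart z σ) w) regFilter
      (nhds (∫ v, f s z 0 (σ, v))) := by
  obtain ⟨C, -, hC⟩ := h.exists_bound
  have h1 : Filter.Tendsto (fun t => ∫ v, f s z t (σ, v)) regFilter
      (nhds (∫ v, f s z 0 (σ, v))) := by
    refine tendsto_integral_filter_of_dominated_convergence (fun v => C * domW v)
      (Filter.Eventually.of_forall fun t =>
        ((h.smooth s z t).continuous.comp (by fun_prop)).aestronglyMeasurable) ?_
      ((integrable_domW n).const_mul C) (Filter.Eventually.of_forall fun v => ?_)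
    · filter_upwards [eventually_regFilter_mem] with t ht
      exact Filter.Eventually.of_forall fun v => by
        simpa using hC s z t σ v ht hσ 0 (Nat.zero_le _)
    · obtain ⟨δ, hδ, e⟩ := h.stable s z (σ, v)
      refine tendsto_const_nhds.congr' ?_
      filter_upwards [eventually_regFilter_lt hδ] with t ht
      exact (e t ht.1 ht.2).symm
  refine h1.congr' ?_
  filter_upwards [eventually_regFilter_mem, eventually_regFilter_pos] with t ht h0
  rw [h.integral s z t σ ht hσ h0.1 h0.2]
  simp

theorem IsZoneRep.compSymbol_eq (h : IsZoneRep a b K (fun _ _ => 1) f) (s : ι) (z : PhSpace n)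
    {σ : PhSpace n} (hσ : ‖σ‖ ≤ 1 / 32) :
    compSymbol (a s) (b s) (chart z σ) = ∫ v, f s z 0 (σ, v) := (h.tendsto s z hσ).limUnder_eq

theorem tendsto_compSymbol (ha : ∀ i, SmallPert (a i)) (hb : ∀ i, SmallPert (b i))
    (Ba : SGBoundedFamily 1 1 a) (Bb : SGBoundedFamily 1 1 b) (s : ι) (z : PhSpace n) :
    Filter.Tendsto (fun t => ∫ w, compInt (a s) (b s) t z w) regFilter
      (nhds (compSymbol (a s) (b s) z)) := by
  obtain ⟨f, h⟩ := exists_isZoneRep ha hb Ba Bb 0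
  have h0 : ‖(0 : PhSpace n)‖ ≤ 1 / 32 := by simp
  have h1 := h.tendsto s z h0
  rwa [← h.compSymbol_eq s z h0, chart_zero] at h1

/-- The bound is uniform in the regularisation and in z; it supplies the dominating function when
the limit is taken under a further integral in ξ. -/
theorem norm_integral_compInt_le (ha : ∀ i, SmallPert (a i)) (hb : ∀ i, SmallPert (b i))
    (Ba : SGBoundedFamily 1 1 a) (Bb : SGBoundedFamily 1 1 b) : ∃ C, ∀ s z (t : ℝ × ℝ),
      t ∈ Set.Icc 0 1 → 0 < t.1 → 0 < t.2 → ‖∫ w, compInt (a s) (b s) t z w‖ ≤ C := by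
  obtain ⟨f, h⟩ := exists_isZoneRep ha hb Ba Bb 0
  have h0 : ‖(0 : PhSpace n)‖ ≤ 1 / 32 := by simp
  obtain ⟨C, -, hC⟩ := h.exists_bound
  refine ⟨∫ v : PhSpace n, C * domW v, fun s z t ht h1 h2 => ?_⟩
  have e := h.integral s z t 0 ht h0 h1 h2
  simp only [Complex.ofReal_one, one_mul, chart_zero] at e
  rw [← e]
  refine norm_integral_le_of_norm_le ((integrable_domW n).const_mul C)
    (Filter.Eventually.of_forall fun v => ?_)
  simpa using hC s z t 0 v ht h0 0 le_rfl

/-- The representation depends on `K`, because the number of integrations by parts does. The symbol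
is defined as a limit without reference to it, so the representations for all `K` describe one
function. -/
theorem compSymbol_local (ha : ∀ i, SmallPert (a i)) (hb : ∀ i, SmallPert (b i))
    (Ba : SGBoundedFamily 1 1 a) (Bb : SGBoundedFamily 1 1 b) (K : ℕ) :
    ∃ C, 0 ≤ C ∧ ∀ s z, ContDiffAt ℝ K (fun σ => compSymbol (a s) (b s) (chart z σ)) 0 ∧
      ∀ k ≤ K, ‖iteratedFDeriv ℝ k (fun σ => compSymbol (a s) (b s) (chart z σ)) 0‖ ≤ C := by
  obtain ⟨f, h⟩ := exists_isZoneRep ha hb Ba Bb K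
  obtain ⟨C, hC0, hC⟩ := h.exists_bound
  have h01 : (0 : ℝ × ℝ) ∈ Set.Icc (0 : ℝ × ℝ) 1 := ⟨le_rfl, zero_le_one⟩
  have hdom : ∀ v : PhSpace n, 0 ≤ C * domW v := fun v => mul_nonneg hC0 (domW_pos v).le
  refine ⟨∫ v : PhSpace n, C * domW v, integral_nonneg hdom, fun s z => ?_⟩
  have hU : Metric.ball (0 : PhSpace n) (1 / 32) ∈ nhds 0 := Metric.ball_mem_nhds _ (by norm_num)
  obtain ⟨h1, h2⟩ := param_integral (volume : Measure (PhSpace n))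
    (Metric.isOpen_ball (x := (0 : PhSpace n)) (ε := 1 / 32)) ((integrable_domW n).const_mul C) K
    (h.smooth s z 0) fun k hk σ hσ v => hC s z 0 σ v h01 (mem_ball_zero_iff.1 hσ).le k hk
  have e : (fun σ => compSymbol (a s) (b s) (chart z σ)) =ᶠ[nhds 0]
      fun σ => ∫ v, f s z 0 (σ, v) := by
    filter_upwards [hU] with σ hσ
    exact h.compSymbol_eq s z (mem_ball_zero_iff.1 hσ).le
  refine ⟨(h1.contDiffAt hU).congr_of_eventuallyEq e, fun k hk => ?_⟩
  rw [(e.iteratedFDeriv ℝ k).eq_of_nhds]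
  exact h2 k hk 0 (mem_of_mem_nhds hU)

theorem sgBoundedFamily_compSymbol (ha : ∀ i, SmallPert (a i)) (hb : ∀ i, SmallPert (b i))
    (Ba : SGBoundedFamily 1 1 a) (Bb : SGBoundedFamily 1 1 b) :
    SGBoundedFamily 0 0 (fun s => compSymbol (a s) (b s)) := by
  refine sgBoundedFamily_iff.2 ⟨fun s => contDiff_infty.2 fun K => ?_, fun K => ?_⟩
  · obtain ⟨C, -, hC⟩ := compSymbol_local ha hb Ba Bb K
    refine contDiff_iff_contDiffAt.2 fun z => ?_
    have e : compSymbol (a s) (b s) =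
        fun w => compSymbol (a s) (b s) (chart z (chartInv z w)) := by
      funext w; rw [chart_chartInv]
    have h0 : chartInv z z = 0 := by simp [chartInv]
    rw [e]
    exact ContDiffAt.comp (g := fun σ => compSymbol (a s) (b s) (chart z σ)) z
      (by rw [h0]; exact (hC s z).1)
      ((contDiff_chartInv z).of_le (by exact_mod_cast le_top)).contDiffAt
  · obtain ⟨C, hC0, hC⟩ := compSymbol_local ha hb Ba Bb K
    simp only [Real.rpow_zero, mul_one]
    exact ⟨fun _ => zero_le_one, C, hC0, fun j k hk => by
      rw [mul_one]
      exact (hC j.1 j.2).2 k hk⟩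

end CompositionSymbol

/-! ### Oscillatory integrals with Schwartz amplitudes -/

section SchwartzOscillatory
variable {n : ℕ}

theorem SGSymbol.sb_self {F : Type} [NormedAddCommGroup F] [NormedSpace ℝ F] {m μ : ℝ}
    {f : PhSpace n → F} (h : SGSymbol m μ f) (K : ℕ) :
    SB K (fun z : PhSpace n => japaneseBracket z.1 ^ m * japaneseBracket z.2 ^ μ) (fun z => z)
      (fun _ => f) := by
  have h1 := (h.sgBoundedFamily Unit).sb_scal (J := PhSpace n) K (fun _ => ()) (fun _ => 0)
    (fun _ => 1) (fun _ => 1) (fun z => z) (A := 1) (fun _ => zero_le_one) (fun _ => zero_le_one)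
    (fun _ => by rw [one_mul]; exact one_le_jb _) (fun _ => by rw [one_mul]; exact one_le_jb _)
  simpa [scal] using h1

theorem SGSymbol.swap {F : Type} [NormedAddCommGroup F] [NormedSpace ℝ F] {m μ : ℝ}
    {f : PhSpace n → F} (h : SGSymbol m μ f) : SGSymbol μ m (fun z => f z.swap) := by
  have h1 := sgBoundedFamily_iff.1 (h.sgBoundedFamily Unit)
  let T : PhSpace n →L[ℝ] PhSpace n := (ContinuousLinearEquiv.prodComm ℝ _ _).toContinuousLinearMap
  refine (sgBoundedFamily_iff (ι := Unit) (a := fun _ z => f z.swap).2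
    ⟨fun _ => h.smooth.comp T.contDiff, fun K => ?_⟩).sgSymbol ()
  have h2 := (h1.2 K).reindex (fun j : Unit × PhSpace n => (j.1, j.2.swap))
  have h3 := SB.comp_clm (pt := fun _ : Unit × PhSpace n => (0 : PhSpace n))
    (f := fun j σ => f (chart j.2.swap σ)) T
    (fun j => h.smooth.comp (contDiff_chart j.2.swap)) (by simpa using h2)
  refine (h3.mono_weight' fun j => le_of_eq ?_).congr_eventually fun j =>
    Filter.Eventually.of_forall fun σ => rfl
  exact mul_comm _ _

theorem SchwartzMap.sb_snd (g : 𝓢(SGSpace n, ℂ)) (L K : ℕ) :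
    SB K (fun z : PhSpace n => ((1 + ‖z.2‖) ^ L)⁻¹) (fun z => z) (fun _ z => g z.2) := by
  have h1 : SB K (fun z : PhSpace n => ((1 + ‖z.2‖) ^ L)⁻¹) (fun z => z.2)
      (fun _ => (g : SGSpace n → ℂ)) := by
    refine ⟨fun z => by positivity, 2 ^ L * (Finset.Iic (L, K)).sup
      (fun m => SchwartzMap.seminorm ℝ m.1 m.2) g, by positivity, fun z k hk => ?_⟩
    have h := SchwartzMap.one_add_le_sup_seminorm_apply (𝕜 := ℝ) (m := (L, K)) le_rfl hk g z.2
    rw [← div_eq_mul_inv, le_div_iff₀ (by positivity), mul_comm]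
    exact h
  exact SB.comp_clm (ContinuousLinearMap.snd ℝ (SGSpace n) (SGSpace n)) (fun _ => g.smooth') h1

theorem integrable_one_add_norm_pow (n : ℕ) :
    Integrable (fun ξ : SGSpace n => ((1 + ‖ξ‖) ^ (n + 1))⁻¹) := by
  have h := integrable_one_add_norm (E := SGSpace n) (μ := volume) (r := (n + 1 : ℕ)) (by
    rw [finrank_euclideanSpace_fin]
    push_cast
    linarith)
  refine h.congr (Filter.Eventually.of_forall fun v => ?_)
  simp only
  rw [Real.rpow_neg (by positivity), Real.rpow_natCast]

/-- The phase of an oscillatory integral operator which preserves the Schwartz space. -/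
structure DecayPhase (Φ : PhSpace n → ℝ) : Prop where
  symbol : SGSymbol 1 1 Φ
  lower : ∃ c : ℝ, 0 < c ∧ ∀ z, c * japaneseBracket z.1 ^ 2 ≤ 1 + ‖gr2 Φ z‖ ^ 2

/-- The coordinate vectors of the base space. -/
def stdVec (n : ℕ) (i : Fin n) : SGSpace n := EuclideanSpace.single i 1

theorem phQ_stdVec (Φ : PhSpace n → ℝ) (z : PhSpace n) :
    phQ Φ (stdVec n) z = 1 + ‖gr2 Φ z‖ ^ 2 := by
  rw [phQ, EuclideanSpace.real_norm_sq_eq]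
  simp only [gr2_apply, pow_two]
  rfl

variable {Φ : PhSpace n → ℝ} {a : PhSpace n → ℂ}

theorem DecayPhase.sb_phG (h : DecayPhase Φ) (K : ℕ) (l : Fin n) :
    SB K (fun z : PhSpace n => japaneseBracket z.1) (fun z => z)
      (fun _ => phG Φ (stdVec n l)) := by
  have h1 := (((h.symbol.sgBoundedFamily Unit).dirD (Sum.inr l)).sgSymbol ()).sb_self K
  refine h1.mono_weight' fun z => le_of_eq ?_
  simp only [cntX, cntXi]
  have e1 : (1 : ℝ) - ((List.countP Sum.isLeft [(Sum.inr l : Fin n ⊕ Fin n)] : ℕ) : ℝ) = 1 := by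
    simp
  have e2 : (1 : ℝ) - ((List.countP Sum.isRight [(Sum.inr l : Fin n ⊕ Fin n)] : ℕ) : ℝ) = 0 := by
    simp
  rw [e1, e2, Real.rpow_zero, Real.rpow_one, mul_one]

theorem sb_amplitude (ha : SGSymbol 0 0 a) (g : 𝓢(SGSpace n, ℂ)) (L K : ℕ) :
    SB K (fun z : PhSpace n => ((1 + ‖z.2‖) ^ L)⁻¹) (fun z => z) (fun _ z => a z * g z.2) := by
  have h := SB.mul (g := fun _ (z : PhSpace n) => g z.2) (fun _ => ha.smooth)
    (fun _ => g.smooth'.comp contDiff_snd) (ha.sb_self K) (g.sb_snd L K)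
  simpa only [Real.rpow_zero, one_mul] using h

theorem DecayPhase.sb_oscLT (h : DecayPhase Φ) (ha : SGSymbol 0 0 a) (g : 𝓢(SGSpace n, ℂ))
    (L M K : ℕ) :
    SB K (fun z : PhSpace n => ((1 + ‖z.2‖) ^ L)⁻¹ / japaneseBracket z.1 ^ M) (fun z => z)
      (fun _ => (oscLT Φ (stdVec n))^[M] fun z => a z * g z.2) := by
  obtain ⟨c, hc, hl⟩ := h.lower
  exact SB.oscLT_iterate (Θ := fun _ => Φ) (pt := fun z : PhSpace n => z)
    (fun _ => h.symbol.smooth) (fun _ => ha.smooth.mul (g.smooth'.comp contDiff_snd))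
    (fun z => one_le_jb z.1) hc (fun z => by rw [phQ_stdVec]; exact hl z)
    (fun K l => h.sb_phG K l) (fun K => sb_amplitude ha g L K) M K

theorem integrable_of_sb {f : PhSpace n → ℂ} (hf : ContDiff ℝ ∞ f) {w : PhSpace n → ℝ}
    (h : SB 0 w (fun z => z) (fun _ => f)) (hw : ∀ z, w z ≤ ((1 + ‖z.2‖) ^ (n + 1))⁻¹)
    (x : SGSpace n) : Integrable (fun ξ => f (x, ξ)) := by
  obtain ⟨-, C, hC, hb⟩ := SB.zero_iff.1 h
  refine ((integrable_one_add_norm_pow n).const_mul C).mono'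
    (hf.continuous.comp (by fun_prop)).aestronglyMeasurable
    (Filter.Eventually.of_forall fun ξ => ?_)
  exact (hb (x, ξ)).trans (mul_le_mul_of_nonneg_left (hw _) hC)

theorem div_jb_pow_le (z : PhSpace n) (M : ℕ) :
    ((1 + ‖z.2‖) ^ (n + 1))⁻¹ / japaneseBracket z.1 ^ M ≤ ((1 + ‖z.2‖) ^ (n + 1))⁻¹ :=
  div_le_self (by positivity) (one_le_pow₀ (one_le_jb _))

/-- The amplitude lacks compact support in ξ; its decay, which the transposed operator preserves,
gives the integrability that integration by parts needs. -/
theorem DecayPhase.integral_oscLT (h : DecayPhase Φ) (ha : SGSymbol 0 0 a)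
    (g : 𝓢(SGSpace n, ℂ)) (M : ℕ) (x : SGSpace n) :
    ∫ ξ, Complex.exp (Complex.I * (Φ (x, ξ) : ℂ)) * (a (x, ξ) * g ξ) =
      ∫ ξ, Complex.exp (Complex.I * (Φ (x, ξ) : ℂ)) *
        (oscLT Φ (stdVec n))^[M] (fun z => a z * g z.2) (x, ξ) := by
  have hb : ContDiff ℝ ∞ (fun z : PhSpace n => a z * g z.2) :=
    ha.smooth.mul (g.smooth'.comp contDiff_snd)
  obtain ⟨c, hc, hl⟩ := h.lower
  induction M with
  | zero => rfl
  | succ M ih =>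
    have hbM := contDiff_oscLT_iterate (e := stdVec n) h.symbol.smooth hb M
    rw [ih, Function.iterate_succ_apply']
    refine _root_.integral_oscLT h.symbol.smooth hbM x
      (integrable_of_sb hbM (h.sb_oscLT ha g (n + 1) M 0) (fun z => div_jb_pow_le z M) x) fun l => ?_
    refine integrable_of_sb ((contDiff_phGQ h.symbol.smooth hbM l).dirD _)
      (SB.dirD (fun _ => contDiff_phGQ h.symbol.smooth hbM l)
        (SB.phGQ (Θ := fun _ => Φ) (pt := fun z : PhSpace n => z)
        (fun _ => h.symbol.smooth) (fun _ => hbM) (fun z => one_le_jb z.1) hc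
        (fun z => by rw [phQ_stdVec]; exact hl z) (fun l => h.sb_phG 1 l)
        (h.sb_oscLT ha g (n + 1) M 1) l) _) (fun z => ?_) x
    exact (div_le_self (by have := jb_pos z.1; positivity) (one_le_jb _)).trans (div_jb_pow_le z M)

/-- The integrand after integrations by parts. -/
def decayInt (Φ : PhSpace n → ℝ) (a : PhSpace n → ℂ) (g : SGSpace n → ℂ) (M : ℕ)
    (z : PhSpace n) : ℂ :=
  Complex.exp (Complex.I * (Φ z : ℂ)) * (oscLT Φ (stdVec n))^[M] (fun z => a z * g z.2) z

theorem DecayPhase.contDiff_decayInt (h : DecayPhase Φ) (ha : SGSymbol 0 0 a)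
    (g : 𝓢(SGSpace n, ℂ)) (M : ℕ) : ContDiff ℝ ∞ (decayInt Φ a g M) :=
  (contDiff_cexp h.symbol.smooth).mul (contDiff_oscLT_iterate h.symbol.smooth
    (ha.smooth.mul (g.smooth'.comp contDiff_snd)) M)

theorem decay_weight_eq {X W : ℝ} (hX : X ≠ 0) (hW : W ≠ 0) (N K n : ℕ) :
    (X * W) ^ K * ((W ^ (K + (n + 1)))⁻¹ / X ^ (K + N)) = (X ^ N)⁻¹ * (W ^ (n + 1))⁻¹ := by
  rw [mul_pow, pow_add W, pow_add X]
  field_simp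

/-- Each integration by parts in ξ gains ⟨x⟩^{-1}: `N` of them give the decay and `K` compensate the
factor (⟨x⟩(1 + |ξ|))^K from differentiating the exponential. The powers of 1 + |ξ| are taken from
the decay of `g`. -/
theorem DecayPhase.sb_decayInt (h : DecayPhase Φ) (ha : SGSymbol 0 0 a) (g : 𝓢(SGSpace n, ℂ))
    (N K : ℕ) :
    SB K (fun z : PhSpace n => (japaneseBracket z.1 ^ N)⁻¹ * ((1 + ‖z.2‖) ^ (n + 1))⁻¹)
      (fun z => z) (fun _ => decayInt Φ a g (K + N)) := by
  have hΦ : SB K (fun z : PhSpace n => japaneseBracket z.1 * (1 + ‖z.2‖)) (fun z => z)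
      (fun _ => Φ) := by
    refine (h.symbol.sb_self K).mono_weight' fun z => ?_
    rw [Real.rpow_one, Real.rpow_one]
    exact mul_le_mul_of_nonneg_left (jb_le _) (jb_pos _).le
  have h1 := SB.cexp (Θ := fun _ : PhSpace n => Φ) (pt := fun z => z)
    (h := fun z : PhSpace n => japaneseBracket z.1 * (1 + ‖z.2‖)) (fun _ => h.symbol.smooth)
    (fun z => one_le_mul_of_one_le_of_one_le (one_le_jb z.1) (by linarith [norm_nonneg z.2])) hΦ
  have h2 := h.sb_oscLT ha g (K + (n + 1)) (K + N) K
  have c2 : ContDiff ℝ ∞ ((oscLT Φ (stdVec n))^[K + N] fun z : PhSpace n => a z * g z.2) :=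
    contDiff_oscLT_iterate h.symbol.smooth (ha.smooth.mul (g.smooth'.comp contDiff_snd)) _
  have h3 := SB.mul (f := fun (_ : PhSpace n) z => Complex.exp (Complex.I * (Φ z : ℂ)))
    (g := fun (_ : PhSpace n) => (oscLT Φ (stdVec n))^[K + N] fun z : PhSpace n => a z * g z.2)
    (fun _ => contDiff_cexp h.symbol.smooth) (fun _ => c2) h1 h2
  unfold decayInt
  refine h3.mono_weight' fun z => le_of_eq ?_
  exact decay_weight_eq (jb_pos z.1).ne' (by positivity) N K n

theorem DecayPhase.exists_schwartz (h : DecayPhase Φ) (ha : SGSymbol 0 0 a)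
    (g : 𝓢(SGSpace n, ℂ)) : ∃ v : 𝓢(SGSpace n, ℂ), ∀ x,
      v x = ∫ ξ, Complex.exp (Complex.I * (Φ (x, ξ) : ℂ)) * (a (x, ξ) * g ξ) := by
  let T : SGSpace n → ℂ := fun x =>
    ∫ ξ, Complex.exp (Complex.I * (Φ (x, ξ) : ℂ)) * (a (x, ξ) * g ξ)
  have key : ∀ N K : ℕ, ∃ C, ∀ x, ContDiffAt ℝ K T x ∧
      ∀ k ≤ K, japaneseBracket x ^ N * ‖iteratedFDeriv ℝ k T x‖ ≤ C := fun N K => by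
    obtain ⟨-, C, hC, hb⟩ := h.sb_decayInt ha g N K
    let I := ∫ ξ : SGSpace n, ((1 + ‖ξ‖) ^ (n + 1))⁻¹
    refine ⟨C * 2 ^ N * I, fun x => ?_⟩
    have hx := jb_pos x
    -- An open set around x on which ⟨y⟩ > ⟨x⟩/2, so a single dominating function serves for it;
    -- this costs the factor 2^N.
    let U : Set (SGSpace n) := {y | japaneseBracket x / 2 < japaneseBracket y}
    have hcont : Continuous (japaneseBracket (n := n)) := by unfold japaneseBracket; fun_prop
    have hU : IsOpen U := isOpen_lt continuous_const hcont
    have hxU : x ∈ U := half_lt_self hx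
    obtain ⟨h1, h2⟩ := param_integral (volume : Measure (SGSpace n)) hU
      ((integrable_one_add_norm_pow n).const_mul (C * ((japaneseBracket x / 2) ^ N)⁻¹)) K
      (h.contDiff_decayInt ha g (K + N)) fun k hk y hy ξ => by
        refine (hb (y, ξ) k hk).trans ?_
        rw [mul_assoc]
        have hy' : japaneseBracket x / 2 ≤ japaneseBracket y := le_of_lt hy
        beta_reduce
        gcongr
    have e : T = fun x => ∫ ξ, decayInt Φ a g (K + N) (x, ξ) :=
      funext fun x => h.integral_oscLT ha g (K + N) x
    rw [← e] at h1 h2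
    refine ⟨h1.contDiffAt (hU.mem_nhds hxU), fun k hk => ?_⟩
    have h3 := h2 k hk x hxU
    rw [integral_const_mul] at h3
    calc _ ≤ japaneseBracket x ^ N * (C * ((japaneseBracket x / 2) ^ N)⁻¹ * I) := by gcongr
      _ = _ := by
        rw [div_pow]
        field_simp
  refine ⟨⟨T, contDiff_infty.2 fun K => contDiff_iff_contDiffAt.2 fun x => ?_, fun N k => ?_⟩,
    fun x => rfl⟩
  · obtain ⟨C, hC⟩ := key 0 K
    exact (hC x).1
  · obtain ⟨C, hC⟩ := key N k
    refine ⟨C, fun x => le_trans ?_ ((hC x).2 k le_rfl)⟩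
    gcongr
    exact norm_le_jb x

end SchwartzOscillatory

/-! ### Phases close to x·ξ -/

section TamePhases
variable {n : ℕ}

/-- A phase with gradient close to that of `x · ξ`. -/
structure TamePhase (φ : PhSpace n → ℝ) : Prop where
  symbol : SGSymbol 1 1 φ
  near1 : ∀ z, ‖gr1 φ z - z.2‖ ≤ japaneseBracket z.2 / 16
  near2 : ∀ z, ‖gr2 φ z - z.1‖ ≤ japaneseBracket z.1 / 16

theorem fderiv_inner_add {ψ : PhSpace n → ℝ} (hψ : ContDiff ℝ ∞ ψ) (z v : PhSpace n) :
    fderiv ℝ (fun z : PhSpace n => (inner ℝ z.1 z.2 : ℝ) + ψ z) z v =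
      (inner ℝ z.1 v.2 : ℝ) + inner ℝ z.2 v.1 + fderiv ℝ ψ z v := by
  have d1 : HasFDerivAt (fun z : PhSpace n => (inner ℝ z.1 z.2 : ℝ)) _ z :=
    hasFDerivAt_fst.inner ℝ hasFDerivAt_snd
  have d := d1.add (hψ.differentiable (by simp) z).hasFDerivAt
  refine (congrArg (fun T : PhSpace n →L[ℝ] ℝ => T v) d.fderiv).trans ?_
  simp [fderivInnerCLM_apply, real_inner_comm]

theorem gr1_inner_add {ψ : PhSpace n → ℝ} (hψ : ContDiff ℝ ∞ ψ) (z : PhSpace n) :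
    gr1 (fun z : PhSpace n => (inner ℝ z.1 z.2 : ℝ) + ψ z) z = z.2 + gr1 ψ z := by
  refine ext_inner_right ℝ fun v => ?_
  rw [inner_gr1, fderiv_inner_add hψ, inner_add_left, inner_gr1]
  simp

theorem gr2_inner_add {ψ : PhSpace n → ℝ} (hψ : ContDiff ℝ ∞ ψ) (z : PhSpace n) :
    gr2 (fun z : PhSpace n => (inner ℝ z.1 z.2 : ℝ) + ψ z) z = z.1 + gr2 ψ z := by
  refine ext_inner_right ℝ fun v => ?_
  rw [inner_gr2, fderiv_inner_add hψ, inner_add_left, inner_gr2]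
  simp

theorem TamePhase.of_inner_add {φ ψ : PhSpace n → ℝ} (hφ : SGSymbol 1 1 φ) (hψ : ContDiff ℝ ∞ ψ)
    (e : ∀ z : PhSpace n, φ z = (inner ℝ z.1 z.2 : ℝ) + ψ z)
    (h1 : ∀ z, ‖gr1 ψ z‖ ≤ japaneseBracket z.2 / 16)
    (h2 : ∀ z, ‖gr2 ψ z‖ ≤ japaneseBracket z.1 / 16) : TamePhase φ := by
  obtain rfl : φ = fun z : PhSpace n => (inner ℝ z.1 z.2 : ℝ) + ψ z := funext e
  refine ⟨hφ, fun z => ?_, fun z => ?_⟩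
  · rw [gr1_inner_add hψ, add_sub_cancel_left]; exact h1 z
  · rw [gr2_inner_add hψ, add_sub_cancel_left]; exact h2 z

theorem SGSymbol.tamePhase {φ : PhSpace n → ℝ} (hφ : SGSymbol 1 1 φ)
    (h : SmallPert (_root_.phasePerturbation φ)) : TamePhase φ :=
  TamePhase.of_inner_add hφ h.smooth (fun z => by rw [_root_.phasePerturbation]; ring)
    (fun z => (h.d1 z).trans (by linarith [jb_pos z.2]))
    (fun z => (h.d2 z).trans (by linarith [jb_pos z.1]))

theorem tamePhase_sharp {φ₁ φ₂ : PhSpace n → ℝ} (s1 : SmallPert (phasePerturbation φ₁))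
    (s2 : SmallPert (phasePerturbation φ₂)) (h1 : SGSymbol 1 1 φ₁) (h2 : SGSymbol 1 1 φ₂) :
    TamePhase (sharp φ₁ φ₂) :=
  TamePhase.of_inner_add (sgPhase_sharp s1 s2 h1 h2).2.symbol (contDiff_sharpPert s1 s2)
    (fun z => sharp_eq h1.smooth h2.smooth z) (norm_gr1_sharpPert_le s1 s2)
    (norm_gr2_sharpPert_le s1 s2)

theorem tamePhase_inner (n : ℕ) : TamePhase (fun z : PhSpace n => (inner ℝ z.1 z.2 : ℝ)) := by
  have e1 : ∀ z, gr1 (fun _ : PhSpace n => (0 : ℝ)) z = 0 := fun z => by simp [gr1, dirD]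
  have e2 : ∀ z, gr2 (fun _ : PhSpace n => (0 : ℝ)) z = 0 := fun z => by simp [gr2, dirD]
  exact TamePhase.of_inner_add ((sgBoundedFamily_inner n Unit).sgSymbol ()) contDiff_const
    (ψ := fun _ => 0) (fun z => by rw [add_zero])
    (fun z => by rw [e1, norm_zero]; linarith [jb_pos z.2])
    (fun z => by rw [e2, norm_zero]; linarith [jb_pos z.1])

theorem quarter_jb_sq_le {x y : SGSpace n} (h : ‖y - x‖ ≤ japaneseBracket x / 16) :
    1 / 4 * japaneseBracket x ^ 2 ≤ 1 + ‖y‖ ^ 2 := by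
  have h1 := jb_le x
  have h2 := norm_sub_norm_le x y
  rw [norm_sub_rev] at h2
  have h3 : 15 / 16 * japaneseBracket x ≤ 1 + ‖y‖ := by linarith
  nlinarith [jb_pos x, norm_nonneg y, sq_nonneg (‖y‖ - 1)]

variable {φ : PhSpace n → ℝ}

theorem TamePhase.decayPhase (h : TamePhase φ) : DecayPhase φ :=
  ⟨h.symbol, 1 / 4, by norm_num, fun z => quarter_jb_sq_le (h.near2 z)⟩

theorem gr2_neg_swap (hφ : ContDiff ℝ ∞ φ) (z : PhSpace n) :
    gr2 (fun z => -φ z.swap) z = -gr1 φ z.swap := by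
  refine ext_inner_right ℝ fun v => ?_
  let T : PhSpace n →L[ℝ] PhSpace n := (ContinuousLinearEquiv.prodComm ℝ _ _).toContinuousLinearMap
  have d : HasFDerivAt (fun z : PhSpace n => -φ z.swap) _ z :=
    (HasFDerivAt.comp (g := φ) (f := T) z
      (hφ.differentiable (by simp) (T z)).hasFDerivAt T.hasFDerivAt).neg
  rw [inner_gr2, inner_neg_left, inner_gr1, d.fderiv]
  rfl

/-- For the inner integral of type II operators, which is over y with phase −φ(y, ξ): here ξ is the
parameter in which decay is obtained, and the x-gradient of φ provides it. -/
theorem TamePhase.decayPhase_swap (h : TamePhase φ) : DecayPhase (fun z => -φ z.swap) := by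
  refine ⟨((h.symbol.swap.sgBoundedFamily Unit).neg).sgSymbol (), 1 / 4, by norm_num, fun z => ?_⟩
  rw [gr2_neg_swap h.symbol.smooth, norm_neg]
  exact quarter_jb_sq_le (h.near1 z.swap)

end TamePhases

/-! ### The Fourier transform on Schwartz space -/

section FourierOnSchwartz
variable {n : ℕ}

theorem sgSymbol_one (n : ℕ) : SGSymbol 0 0 (fun _ : PhSpace n => (1 : ℂ)) := by
  refine (sgBoundedFamily_iff (ι := Unit) (a := fun _ _ => (1 : ℂ)).2
    ⟨fun _ => contDiff_const, fun K => ?_⟩).sgSymbol ()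
  simp only [Real.rpow_zero, mul_one]
  exact SB.const zero_le_one (fun _ => zero_le_one) fun _ => by simp

theorem SGSymbol.conj {m μ : ℝ} {a : PhSpace n → ℂ} (h : SGSymbol m μ a) :
    SGSymbol m μ (fun z => (starRingEnd ℂ) (a z)) := by
  have h1 := sgBoundedFamily_iff.1 (h.sgBoundedFamily Unit)
  exact (sgBoundedFamily_iff (ι := Unit) (a := fun _ z => (starRingEnd ℂ) (a z)).2
    ⟨fun _ => Complex.conjCLE.toContinuousLinearMap.contDiff.comp h.smooth, fun K =>
    (h1.2 K).clm' Complex.conjCLE.toContinuousLinearMap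
      fun j => h.smooth.comp (contDiff_chart _)⟩).sgSymbol ()

theorem exists_schwartz_fourierHat (u : 𝓢(SGSpace n, ℂ)) :
    ∃ v : 𝓢(SGSpace n, ℂ), ∀ ξ, v ξ = fourierHat u ξ := by
  obtain ⟨v, hv⟩ := (tamePhase_inner n).decayPhase_swap.exists_schwartz (sgSymbol_one n) u
  refine ⟨v, fun ξ => (hv ξ).trans (integral_congr_ae (Filter.Eventually.of_forall fun x => ?_))⟩
  simp

/-- With w the inverse transform of g in the normalisation with 2π in the exponent, u(x) = (2π)^{-n}
w(x/2π) has the required transform. -/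
theorem exists_fourierHat_eq (g : 𝓢(SGSpace n, ℂ)) :
    ∃ u : 𝓢(SGSpace n, ℂ), ∀ ξ, fourierHat u ξ = g ξ := by
  have h2 : (2 * Real.pi : ℝ) ≠ 0 := by positivity
  let e : SGSpace n ≃L[ℝ] SGSpace n :=
    ContinuousLinearEquiv.smulLeft (Units.mk0 (2 * Real.pi : ℝ) h2)⁻¹
  have he : ∀ x, e x = (2 * Real.pi : ℝ)⁻¹ • x := fun x => rfl
  let w : 𝓢(SGSpace n, ℂ) := FourierTransformInv.fourierInv g
  refine ⟨((2 * Real.pi : ℝ)⁻¹ ^ n) • SchwartzMap.compCLMOfContinuousLinearEquiv ℝ e w,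
    fun ξ => ?_⟩
  have hg : FourierTransform.fourier w = g := FourierTransform.fourier_fourierInv_eq g
  have h3 : g ξ = FourierTransform.fourier (w : SGSpace n → ℂ) ξ := by
    rw [← SchwartzMap.fourier_coe, hg]
  rw [h3, Real.fourier_eq']
  have h4 := Measure.integral_comp_inv_smul_of_nonneg (volume : Measure (SGSpace n))
    (fun v => Complex.exp (((-2 * Real.pi * inner ℝ v ξ : ℝ) : ℂ) * Complex.I) • w v)
    (R := 2 * Real.pi) (by positivity)
  rw [finrank_euclideanSpace_fin] at h4
  have h5 : ∀ r : ℂ, r = ((2 * Real.pi : ℝ)⁻¹ ^ n) • ((2 * Real.pi : ℝ) ^ n • r) := fun r => by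
    rw [smul_smul, ← mul_pow, inv_mul_cancel₀ h2, one_pow, one_smul]
  rw [h5 (∫ v, _), ← h4, ← integral_smul]
  refine integral_congr_ae (Filter.Eventually.of_forall fun x => ?_)
  simp only [smul_apply, SchwartzMap.compCLMOfContinuousLinearEquiv_apply,
    Function.comp_apply, he, inner_smul_left, smul_eq_mul, Complex.real_smul]
  have h6 : -2 * Real.pi * ((starRingEnd ℝ) (2 * Real.pi)⁻¹ * inner ℝ x ξ) = - inner ℝ x ξ := by
    simp only [conj_trivial]
    field_simp
  rw [h6]
  push_cast
  ring_nf

end FourierOnSchwartz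

/-! ### Type I and type II operators preserve Schwartz space -/

section Operators
variable {n : ℕ} {φ : PhSpace n → ℝ} {a : PhSpace n → ℂ}

theorem TamePhase.exists_fioI (h : TamePhase φ) (ha : SGSymbol 0 0 a) (u : 𝓢(SGSpace n, ℂ)) :
    ∃ v : 𝓢(SGSpace n, ℂ), (v : SGSpace n → ℂ) = fioI φ a u := by
  obtain ⟨g, hg⟩ := exists_schwartz_fourierHat u
  obtain ⟨v, hv⟩ := h.decayPhase.exists_schwartz ha g
  refine ⟨(((2 * Real.pi : ℝ) : ℂ)⁻¹ ^ n) • v, funext fun x => ?_⟩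
  simp only [smul_apply, smul_eq_mul, hv, hg, fioI, mul_assoc]

/-- The Fourier side of the type II operator. -/
theorem TamePhase.exists_dual (h : TamePhase φ) (ha : SGSymbol 0 0 a) (u : 𝓢(SGSpace n, ℂ)) :
    ∃ g : 𝓢(SGSpace n, ℂ),
      (∀ ξ, g ξ = ∫ y, Complex.exp (-(Complex.I * (φ (y, ξ) : ℂ))) *
        ((starRingEnd ℂ) (a (y, ξ)) * u y)) ∧
      ∀ x, fioII φ a u x = ((2 * Real.pi : ℝ) : ℂ)⁻¹ ^ n *
        ∫ ξ, Complex.exp (Complex.I * ((inner ℝ x ξ : ℝ) : ℂ)) * g ξ := by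
  obtain ⟨g, hg⟩ := h.decayPhase_swap.exists_schwartz ha.conj.swap u
  have hg' : ∀ ξ, g ξ = ∫ y, Complex.exp (-(Complex.I * (φ (y, ξ) : ℂ))) *
      ((starRingEnd ℂ) (a (y, ξ)) * u y) := fun ξ => (hg ξ).trans
    (integral_congr_ae (Filter.Eventually.of_forall fun y => by simp))
  refine ⟨g, hg', fun x => ?_⟩
  rw [fioII]
  congr 1
  refine integral_congr_ae (Filter.Eventually.of_forall fun ξ => ?_)
  simp only
  rw [hg', ← integral_const_mul]
  refine integral_congr_ae (Filter.Eventually.of_forall fun y => ?_)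
  simp only
  rw [Complex.ofReal_sub, mul_sub, sub_eq_add_neg, Complex.exp_add]
  ring

theorem TamePhase.exists_fioII (h : TamePhase φ) (ha : SGSymbol 0 0 a) (u : 𝓢(SGSpace n, ℂ)) :
    ∃ v : 𝓢(SGSpace n, ℂ), (v : SGSpace n → ℂ) = fioII φ a u := by
  obtain ⟨g, -, hg⟩ := h.exists_dual ha u
  obtain ⟨v, hv⟩ := (tamePhase_inner n).decayPhase.exists_schwartz (sgSymbol_one n) g
  refine ⟨(((2 * Real.pi : ℝ) : ℂ)⁻¹ ^ n) • v, funext fun x => ?_⟩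
  simp only [smul_apply, smul_eq_mul, hv, hg, one_mul]

end Operators

/-! ### From the regularised integral to the iterated integral -/

section TypeOne
variable {n : ℕ}

theorem integrable_of_norm_le_mul {α β : Type*} [TopologicalSpace α] [TopologicalSpace β]
    [MeasurableSpace α] [MeasurableSpace β] [SecondCountableTopologyEither α β]
    [OpensMeasurableSpace α] [OpensMeasurableSpace β] {μ : Measure α} {ν : Measure β}
    [SFinite μ] [SFinite ν] [SecondCountableTopology (α × β)]
    {f : α × β → ℂ} (hf : Continuous f) {A : α → ℝ} {B : β → ℝ} (hA : Integrable A μ)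
    (hB : Integrable B ν) (h : ∀ p, ‖f p‖ ≤ A p.1 * B p.2) : Integrable f (μ.prod ν) :=
  (hA.mul_prod hB).mono' hf.aestronglyMeasurable (Filter.Eventually.of_forall h)

theorem regFilter_eq : regFilter = nhdsWithin (0 : ℝ) (Set.Ioi 0) ×ˢ nhdsWithin 0 (Set.Ioi 0) := by
  rw [← nhdsWithin_prod_eq]
  rfl

/-- For small s all values f(r, s) with r small lie in a closed ball around the joint limit;
closedness carries this to the inner limit and then to the outer one. -/
theorem eq_of_tendsto_iterated {f : ℝ × ℝ → ℂ} {h : ℝ → ℂ} {L M : ℂ}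
    (hL : Filter.Tendsto f regFilter (nhds L))
    (h1 : ∀ s, 0 < s → Filter.Tendsto (fun r => f (r, s)) (nhdsWithin 0 (Set.Ioi 0)) (nhds (h s)))
    (hM : Filter.Tendsto h (nhdsWithin 0 (Set.Ioi 0)) (nhds M)) : L = M := by
  refine (eq_of_forall_dist_le fun ε hε => ?_).symm
  have e1 := hL.eventually (Metric.closedBall_mem_nhds L hε)
  rw [regFilter_eq] at e1
  rw [Filter.prod_comm, Filter.eventually_map] at e1
  have e2 := e1.curry
  have e3 : ∀ᶠ s in nhdsWithin (0 : ℝ) (Set.Ioi 0), h s ∈ Metric.closedBall L ε := by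
    filter_upwards [e2, eventually_mem_nhdsWithin] with s hs hs0
    exact Metric.isClosed_closedBall.mem_of_tendsto (h1 s hs0) hs
  exact Metric.isClosed_closedBall.mem_of_tendsto hM e3

theorem continuous_regBump (n : ℕ) : Continuous (regBump n) :=
  (regBump n).contDiff (n := 0).continuous

theorem tendsto_regBump_smul (x : SGSpace n) :
    Filter.Tendsto (fun s : ℝ => (regBump n (s • x) : ℂ)) (nhdsWithin 0 (Set.Ioi 0)) (nhds 1) := by
  have hc : Continuous (fun s : ℝ => (regBump n (s • x) : ℂ)) :=
    Complex.continuous_ofReal.comp ((continuous_regBump n).comp (by fun_prop))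
  have h := hc.tendsto 0
  rw [zero_smul, (regBump n).one_of_mem_closedBall (Metric.mem_closedBall_self (regBump n).rIn_pos.le),
    Complex.ofReal_one] at h
  exact h.mono_left nhdsWithin_le_nhds

theorem norm_regBump_le (x : SGSpace n) : ‖(regBump n x : ℂ)‖ ≤ 1 := by
  rw [Complex.norm_real, Real.norm_of_nonneg (regBump n).nonneg]
  exact (regBump n).le_one

theorem integrable_regBump_smul {s : ℝ} (hs : 0 < s) :
    Integrable (fun x : SGSpace n => ‖(regBump n (s • x) : ℂ)‖) := by
  have h : Integrable (fun x : SGSpace n => (regBump n x : ℂ)) :=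
    (Complex.continuous_ofReal.comp (continuous_regBump n)).integrable_of_hasCompactSupport
      ((regBump n).hasCompactSupport.comp_left (g := fun r : ℝ => (r : ℂ)) Complex.ofReal_zero)
  exact (h.comp_smul hs.ne').norm

theorem norm_exp_neg_I_mul (r : ℝ) : ‖Complex.exp (-(Complex.I * (r : ℂ)))‖ = 1 := by
  rw [← mul_neg, ← Complex.ofReal_neg, norm_cexp_I_mul]

/-- Removing the regularisation from an iterated oscillatory integral. -/
theorem tendsto_iterated_regularised {θ : SGSpace n → ℝ} (hθ : Continuous θ)
    (w W : 𝓢(SGSpace n, ℂ)) (hW : ∀ η, W η = fourierHat w η) {L : ℂ}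
    (hL : Filter.Tendsto (fun t : ℝ × ℝ => ∫ η, Complex.exp (Complex.I * (θ η : ℂ)) *
      (regBump n (t.2 • η) : ℂ) * ∫ y, Complex.exp (-(Complex.I * ((inner ℝ y η : ℝ) : ℂ))) *
        ((regBump n (t.1 • y) : ℂ) * w y)) regFilter (nhds L)) :
    L = ∫ η, Complex.exp (Complex.I * (θ η : ℂ)) * W η := by
  have hb := continuous_regBump n
  have hin : ∀ η, Filter.Tendsto (fun r : ℝ => ∫ y,
      Complex.exp (-(Complex.I * ((inner ℝ y η : ℝ) : ℂ))) * ((regBump n (r • y) : ℂ) * w y))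
      (nhdsWithin 0 (Set.Ioi 0)) (nhds (W η)) := fun η => by
    rw [hW, fourierHat]
    refine tendsto_integral_filter_of_dominated_convergence (fun y => ‖w y‖)
      (Filter.Eventually.of_forall fun r => ?_) (Filter.Eventually.of_forall fun r =>
        Filter.Eventually.of_forall fun y => ?_) w.integrable.norm
      (Filter.Eventually.of_forall fun y => ?_)
    · have := w.continuous
      exact Continuous.aestronglyMeasurable (by fun_prop)
    · rw [norm_mul, norm_exp_neg_I_mul, one_mul, norm_mul]
      exact mul_le_of_le_one_left (norm_nonneg _) (norm_regBump_le _)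
    · have h := (tendsto_regBump_smul y).mul_const (w y)
      rw [one_mul] at h
      exact h.const_mul _
  have hbd : ∀ (r : ℝ) η, ‖∫ y, Complex.exp (-(Complex.I * ((inner ℝ y η : ℝ) : ℂ))) *
      ((regBump n (r • y) : ℂ) * w y)‖ ≤ ∫ y, ‖w y‖ := fun r η => by
    refine norm_integral_le_of_norm_le w.integrable.norm (Filter.Eventually.of_forall fun y => ?_)
    rw [norm_mul, norm_exp_neg_I_mul, one_mul, norm_mul]
    exact mul_le_of_le_one_left (norm_nonneg _) (norm_regBump_le _)
  have hmeas : ∀ r : ℝ, AEStronglyMeasurable (fun η => ∫ y,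
      Complex.exp (-(Complex.I * ((inner ℝ y η : ℝ) : ℂ))) * ((regBump n (r • y) : ℂ) * w y)) := by
    intro r
    have := w.continuous
    have hc : Continuous (fun p : SGSpace n × SGSpace n =>
        Complex.exp (-(Complex.I * ((inner ℝ p.2 p.1 : ℝ) : ℂ))) *
          ((regBump n (r • p.2) : ℂ) * w p.2)) := by fun_prop
    exact (hc.aestronglyMeasurable (μ := volume.prod volume)).integral_prod_right'
  -- The cutoff in y is removed first, while the cutoff in η still provides an integrable bound;
  -- then the cutoff in η is removed, with `W` as the bound.
  refine eq_of_tendsto_iterated (h := fun s => ∫ η, Complex.exp (Complex.I * (θ η : ℂ)) *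
    (regBump n (s • η) : ℂ) * W η) hL (fun s hs => ?_) ?_
  · refine tendsto_integral_filter_of_dominated_convergence
      (fun η => ‖(regBump n (s • η) : ℂ)‖ * ∫ y, ‖w y‖)
      (Filter.Eventually.of_forall fun r => ?_) (Filter.Eventually.of_forall fun r =>
        Filter.Eventually.of_forall fun η => ?_) ((integrable_regBump_smul hs).mul_const _)
      (Filter.Eventually.of_forall fun η => (hin η).const_mul _)
    · exact AEStronglyMeasurable.mul (Continuous.aestronglyMeasurable (by fun_prop)) (hmeas r)
    · rw [norm_mul, norm_mul, norm_cexp_I_mul, one_mul]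
      exact mul_le_mul_of_nonneg_left (hbd r η) (norm_nonneg _)
  · refine tendsto_integral_filter_of_dominated_convergence (fun η => ‖W η‖)
      (Filter.Eventually.of_forall fun s => ?_) (Filter.Eventually.of_forall fun s =>
        Filter.Eventually.of_forall fun η => ?_) W.integrable.norm
      (Filter.Eventually.of_forall fun η => ?_)
    · have := W.continuous
      exact Continuous.aestronglyMeasurable (by fun_prop)
    · rw [norm_mul, norm_mul, norm_cexp_I_mul, one_mul]
      exact mul_le_of_le_one_left (norm_nonneg _) (norm_regBump_le _)
    · have h := ((tendsto_regBump_smul η).const_mul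
        (Complex.exp (Complex.I * (θ η : ℂ)))).mul_const (W η)
      rwa [mul_one] at h

end TypeOne

/-! ### Composition of type I operators -/

section Composition
variable {n : ℕ} {φ₁ φ₂ : PhSpace n → ℝ}

/-- The regularised composition kernel. -/
def compKernel (φ₁ φ₂ : PhSpace n → ℝ) (g : SGSpace n → ℂ) (t : ℝ × ℝ) (x : SGSpace n)
    (q : SGSpace n × PhSpace n) : ℂ :=
  Complex.exp (Complex.I * ((φ₁ (x, q.2.2) - inner ℝ q.2.1 q.2.2 + φ₂ (q.2.1, q.1) : ℝ) : ℂ)) *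
    (regul t q.2 : ℂ) * g q.1

theorem phase_add_statPh (h1 : ContDiff ℝ ∞ φ₁) (h2 : ContDiff ℝ ∞ φ₂) (x ξ : SGSpace n)
    (w : PhSpace n) :
    sharp φ₁ φ₂ (x, ξ) + (statPh (phasePerturbation φ₁) (phasePerturbation φ₂) ((x, ξ), w) -
      sharpPert (phasePerturbation φ₁) (phasePerturbation φ₂) (x, ξ)) =
    φ₁ (x, w.2) - inner ℝ w.1 w.2 + φ₂ (w.1, ξ) := by
  rw [sharp_eq h1 h2]
  simp only [statPh, phasePerturbation, inner_sub_left, inner_sub_right]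
  ring

theorem exp_mul_compInt (h1 : ContDiff ℝ ∞ φ₁) (h2 : ContDiff ℝ ∞ φ₂) (g : SGSpace n → ℂ)
    (t : ℝ × ℝ) (x ξ : SGSpace n) (w : PhSpace n) :
    Complex.exp (Complex.I * (sharp φ₁ φ₂ (x, ξ) : ℂ)) * g ξ *
      compInt (phasePerturbation φ₁) (phasePerturbation φ₂) t (x, ξ) w =
    compKernel φ₁ φ₂ g t x (ξ, w) := by
  rw [compKernel, ← phase_add_statPh h1 h2 x ξ w, Complex.ofReal_add, mul_add, Complex.exp_add,
    compInt]
  ring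

theorem integrable_regul {t : ℝ × ℝ} (h1 : 0 < t.1) (h2 : 0 < t.2) :
    Integrable (fun w : PhSpace n => ‖(regul t w : ℂ)‖) := by
  have hc : Continuous (regul (n := n) t) := (contDiff_regul t).continuous
  refine Integrable.norm (Continuous.integrable_of_hasCompactSupport
    (Complex.continuous_ofReal.comp hc) (HasCompactSupport.intro
      (isCompact_closedBall (0 : PhSpace n) (2 / t.1 + 2 / t.2)) fun w hw => ?_))
  rw [mem_closedBall_zero_iff, not_le] at hw
  simp [regul_eq_zero h1 h2 hw.le]

theorem integrable_compKernel (h1 : Continuous φ₁) (h2 : Continuous φ₂) (g : 𝓢(SGSpace n, ℂ))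
    {t : ℝ × ℝ} (t1 : 0 < t.1) (t2 : 0 < t.2) (x : SGSpace n) :
    Integrable (compKernel φ₁ φ₂ g t x) (volume.prod volume) := by
  have hg := g.continuous
  have hc : Continuous (regul (n := n) t) := (contDiff_regul t).continuous
  refine integrable_of_norm_le_mul (A := fun ξ => ‖g ξ‖) (by unfold compKernel; fun_prop)
    g.integrable.norm (integrable_regul t1 t2) fun q => le_of_eq ?_
  rw [compKernel, norm_mul, norm_mul, norm_cexp_I_mul, one_mul, mul_comm]

/-- With the regulariser present the kernel is absolutely integrable in (ξ, y, η), so Fubini's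
theorem permits integrating in ξ first. -/
theorem integral_compInt_eq_iterated (h1 : ContDiff ℝ ∞ φ₁) (h2 : ContDiff ℝ ∞ φ₂)
    (g w : 𝓢(SGSpace n, ℂ))
    (hw : ∀ y, w y = ∫ ξ, Complex.exp (Complex.I * (φ₂ (y, ξ) : ℂ)) * g ξ)
    {t : ℝ × ℝ} (t1 : 0 < t.1) (t2 : 0 < t.2) (x : SGSpace n) :
    ∫ ξ, Complex.exp (Complex.I * (sharp φ₁ φ₂ (x, ξ) : ℂ)) * g ξ *
        ∫ w, compInt (phasePerturbation φ₁) (phasePerturbation φ₂) t (x, ξ) w =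
      ∫ η, Complex.exp (Complex.I * (φ₁ (x, η) : ℂ)) * (regBump n (t.2 • η) : ℂ) *
        ∫ y, Complex.exp (-(Complex.I * ((inner ℝ y η : ℝ) : ℂ))) *
          ((regBump n (t.1 • y) : ℂ) * w y) := by
  have hi := integrable_compKernel h1.continuous h2.continuous g t1 t2 x
  have e : ∀ p : PhSpace n, ∫ ξ, compKernel φ₁ φ₂ g t x (ξ, p) =
      Complex.exp (Complex.I * (φ₁ (x, p.2) : ℂ)) * (regBump n (t.2 • p.2) : ℂ) *
        (Complex.exp (-(Complex.I * ((inner ℝ p.1 p.2 : ℝ) : ℂ))) *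
          ((regBump n (t.1 • p.1) : ℂ) * w p.1)) := fun p => by
    rw [hw, ← integral_const_mul, ← integral_const_mul, ← integral_const_mul]
    refine integral_congr_ae (Filter.Eventually.of_forall fun ξ => ?_)
    simp only [compKernel, regul]
    push_cast
    rw [mul_add, mul_sub, Complex.exp_add, sub_eq_add_neg, Complex.exp_add]
    ring
  have hF := hi.integral_prod_right
  calc _ = ∫ ξ, ∫ p, compKernel φ₁ φ₂ g t x (ξ, p) := by
        refine integral_congr_ae (Filter.Eventually.of_forall fun ξ => ?_)
        simp only
        rw [← integral_const_mul]
        exact integral_congr_ae (Filter.Eventually.of_forall fun p => exp_mul_compInt h1 h2 g t x ξ p)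
    _ = ∫ p, ∫ ξ, compKernel φ₁ φ₂ g t x (ξ, p) :=
        integral_integral_swap (f := fun ξ p => compKernel φ₁ φ₂ g t x (ξ, p)) hi
    _ = ∫ η, ∫ y, ∫ ξ, compKernel φ₁ φ₂ g t x (ξ, (y, η)) := integral_prod_symm _ hF
    _ = _ := by
        refine integral_congr_ae (Filter.Eventually.of_forall fun η => ?_)
        simp only [e]
        rw [integral_const_mul]

theorem aestronglyMeasurable_integral_compKernel (h1 : Continuous φ₁) (h2 : Continuous φ₂)
    (g : 𝓢(SGSpace n, ℂ)) (t : ℝ × ℝ) (x : SGSpace n) :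
    AEStronglyMeasurable (fun ξ => ∫ p, compKernel φ₁ φ₂ g t x (ξ, p)) := by
  have hg := g.continuous
  have hr : Continuous (regul (n := n) t) := (contDiff_regul t).continuous
  have hc : Continuous (compKernel φ₁ φ₂ g t x) := by unfold compKernel; fun_prop
  exact (hc.aestronglyMeasurable (μ := volume.prod volume)).integral_prod_right'

theorem tendsto_integral_compInt (s1 : SmallPert (phasePerturbation φ₁))
    (s2 : SmallPert (phasePerturbation φ₂)) (h1 : SGSymbol 1 1 φ₁) (h2 : SGSymbol 1 1 φ₂)
    (g : 𝓢(SGSpace n, ℂ)) (x : SGSpace n) :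
    Filter.Tendsto (fun t => ∫ ξ, Complex.exp (Complex.I * (sharp φ₁ φ₂ (x, ξ) : ℂ)) * g ξ *
        ∫ w, compInt (phasePerturbation φ₁) (phasePerturbation φ₂) t (x, ξ) w) regFilter
      (nhds (∫ ξ, Complex.exp (Complex.I * (sharp φ₁ φ₂ (x, ξ) : ℂ)) * g ξ *
        compSymbol (phasePerturbation φ₁) (phasePerturbation φ₂) (x, ξ))) := by
  have B1 := h1.phasePerturbation.sgBoundedFamily Unit
  have B2 := h2.phasePerturbation.sgBoundedFamily Unit
  obtain ⟨C, hC⟩ := norm_integral_compInt_le (fun _ => s1) (fun _ => s2) B1 B2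
  refine tendsto_integral_filter_of_dominated_convergence (fun ξ => ‖g ξ‖ * C)
    (Filter.Eventually.of_forall fun t => ?_) ?_ (g.integrable.norm.mul_const C)
    (Filter.Eventually.of_forall fun ξ =>
      (tendsto_compSymbol (fun _ => s1) (fun _ => s2) B1 B2 () (x, ξ)).const_mul _)
  · refine (aestronglyMeasurable_integral_compKernel h1.smooth.continuous h2.smooth.continuous
      g t x).congr (Filter.Eventually.of_forall fun ξ => ?_)
    simp only [← exp_mul_compInt h1.smooth h2.smooth]
    rw [integral_const_mul]
  · filter_upwards [eventually_regFilter_pos, eventually_regFilter_mem] with t ht ht'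
    refine Filter.Eventually.of_forall fun ξ => ?_
    rw [norm_mul, norm_mul, norm_cexp_I_mul, one_mul]
    exact mul_le_mul_of_nonneg_left (hC () _ t ht' ht.1 ht.2) (norm_nonneg _)

/-- The symbol of the composition. -/
def multiSymbol (φ₁ φ₂ : PhSpace n → ℝ) (z : PhSpace n) : ℂ :=
  ((2 * Real.pi : ℝ) : ℂ)⁻¹ ^ n * compSymbol (phasePerturbation φ₁) (phasePerturbation φ₂) z

/-- One regularised integral, evaluated in two orders: with ξ outermost it tends to the operator
with phase φ₁ # φ₂ and symbol `compSymbol`; with ξ innermost it tends to the iterated integral of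
the composition. Two factors (2π)^{-n} occur, and one of them goes into the symbol. -/
theorem fioOneI_comp (s1 : SmallPert (phasePerturbation φ₁))
    (s2 : SmallPert (phasePerturbation φ₂)) (h1 : SGSymbol 1 1 φ₁) (h2 : SGSymbol 1 1 φ₂)
    (u : 𝓢(SGSpace n, ℂ)) :
    fioOneI φ₁ (fioOneI φ₂ u) = fioI (sharp φ₁ φ₂) (multiSymbol φ₁ φ₂) u := by
  obtain ⟨g, hg⟩ := exists_schwartz_fourierHat u
  obtain ⟨w, hw⟩ := (h2.tamePhase s2).decayPhase.exists_schwartz (sgSymbol_one n) g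
  simp only [one_mul] at hw
  obtain ⟨W, hW⟩ := exists_schwartz_fourierHat w
  have e1 : fioOneI φ₂ u = fun y => ((2 * Real.pi : ℝ) : ℂ)⁻¹ ^ n * w y := by
    funext y
    simp only [fioOneI, fioI, hw, mul_one, hg]
  have e2 : ∀ η, fourierHat (fioOneI φ₂ u) η = ((2 * Real.pi : ℝ) : ℂ)⁻¹ ^ n * W η := fun η => by
    rw [hW, e1, fourierHat, fourierHat, ← integral_const_mul]
    exact integral_congr_ae (Filter.Eventually.of_forall fun y => by ring)
  funext x
  have key := tendsto_iterated_regularised (θ := fun η => φ₁ (x, η))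
    (h1.smooth.continuous.comp (by fun_prop)) w W hW
    ((tendsto_integral_compInt s1 s2 h1 h2 g x).congr' (by
      filter_upwards [eventually_regFilter_pos] with t ht
      exact integral_compInt_eq_iterated h1.smooth h2.smooth g w hw ht.1 ht.2 x))
  rw [fioOneI, fioI, fioI]
  congr 1
  simp only [e2, mul_one, multiSymbol, ← hg]
  calc _ = ((2 * Real.pi : ℝ) : ℂ)⁻¹ ^ n *
        ∫ η, Complex.exp (Complex.I * (φ₁ (x, η) : ℂ)) * W η := by
        rw [← integral_const_mul]
        exact integral_congr_ae (Filter.Eventually.of_forall fun y => by ring)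
    _ = _ := by
        rw [← key, ← integral_const_mul]
        exact integral_congr_ae (Filter.Eventually.of_forall fun y => by ring)

end Composition

/-! ### Adjoints and uniqueness of the symbol -/

section Duality
variable {n : ℕ} {φ : PhSpace n → ℝ} {a : PhSpace n → ℂ}

theorem integral_kernel_swap {K : PhSpace n → ℂ} (hK : Continuous K) {C : ℝ}
    (hC : ∀ z, ‖K z‖ ≤ C) {f g : SGSpace n → ℂ} (hf : Continuous f) (hg : Continuous g)
    (hfi : Integrable f) (hgi : Integrable g) :
    ∫ x, (∫ ξ, K (x, ξ) * f ξ) * g x = ∫ ξ, f ξ * ∫ x, K (x, ξ) * g x := by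
  have hi : Integrable (fun p : PhSpace n => K p * f p.2 * g p.1) (volume.prod volume) := by
    refine integrable_of_norm_le_mul (A := fun x => ‖g x‖) (B := fun ξ => C * ‖f ξ‖) (by fun_prop)
      hgi.norm (hfi.norm.const_mul C) fun p => ?_
    rw [norm_mul, norm_mul, mul_comm]
    gcongr
    exact hC p
  calc _ = ∫ x, ∫ ξ, K (x, ξ) * f ξ * g x := by simp only [integral_mul_const]
    _ = ∫ ξ, ∫ x, K (x, ξ) * f ξ * g x :=
        integral_integral_swap (f := fun x ξ => K (x, ξ) * f ξ * g x) hi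
    _ = _ := by
        refine integral_congr_ae (Filter.Eventually.of_forall fun ξ => ?_)
        simp only
        rw [← integral_const_mul]
        exact integral_congr_ae (Filter.Eventually.of_forall fun x => by ring)

theorem SGSymbol.exists_norm_le (ha : SGSymbol 0 0 a) : ∃ C, ∀ z, ‖a z‖ ≤ C := by
  obtain ⟨-, C, -, hb⟩ := SB.zero_iff.1 (ha.sb_self 0)
  exact ⟨C, fun z => by simpa using hb z⟩

theorem conj_two_pi_inv_pow (n : ℕ) : (starRingEnd ℂ) (((2 * Real.pi : ℝ) : ℂ)⁻¹ ^ n) =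
    ((2 * Real.pi : ℝ) : ℂ)⁻¹ ^ n := by
  rw [map_pow, map_inv₀, Complex.conj_ofReal]

theorem conj_exp_I_mul (r : ℝ) : (starRingEnd ℂ) (Complex.exp (Complex.I * (r : ℂ))) =
    Complex.exp (-(Complex.I * (r : ℂ))) := by
  rw [← Complex.exp_conj, map_mul, Complex.conj_I, Complex.conj_ofReal, neg_mul]

theorem conj_exp_neg_I_mul (r : ℝ) : (starRingEnd ℂ) (Complex.exp (-(Complex.I * (r : ℂ)))) =
    Complex.exp (Complex.I * (r : ℂ)) := by
  rw [← conj_exp_I_mul, Complex.conj_conj]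

/-- The type I and type II operators are adjoint to each other. -/
theorem TamePhase.integral_fioII_mul_conj (h : TamePhase φ) (ha : SGSymbol 0 0 a)
    (u g : 𝓢(SGSpace n, ℂ)) :
    ∫ x, fioII φ a u x * (starRingEnd ℂ) (g x) = ∫ x, u x * (starRingEnd ℂ) (fioI φ a g x) := by
  obtain ⟨v, hv, hII⟩ := h.exists_dual ha u
  obtain ⟨G, hG⟩ := exists_schwartz_fourierHat g
  obtain ⟨C, hC⟩ := ha.exists_norm_le
  have cφ := h.symbol.smooth.continuous
  have ca := ha.smooth.continuous
  have cg := g.continuous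
  have cG := G.continuous
  have e1 : ∀ ξ, ∫ x, Complex.exp (Complex.I * ((inner ℝ x ξ : ℝ) : ℂ)) *
      (starRingEnd ℂ) (g x) = (starRingEnd ℂ) (G ξ) := fun ξ => by
    rw [hG, fourierHat, ← integral_conj]
    refine integral_congr_ae (Filter.Eventually.of_forall fun x => ?_)
    simp only [map_mul, conj_exp_neg_I_mul]
  have e2 : ∀ y, (starRingEnd ℂ) (fioI φ a g y) = ((2 * Real.pi : ℝ) : ℂ)⁻¹ ^ n *
      ∫ ξ, Complex.exp (-(Complex.I * (φ (y, ξ) : ℂ))) * (starRingEnd ℂ) (a (y, ξ)) *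
        (starRingEnd ℂ) (G ξ) := fun y => by
    rw [fioI, map_mul, conj_two_pi_inv_pow, ← integral_conj]
    congr 1
    refine integral_congr_ae (Filter.Eventually.of_forall fun x => ?_)
    simp only [map_mul, conj_exp_I_mul, hG]
  have i1 := integral_kernel_swap
    (K := fun z : PhSpace n => Complex.exp (Complex.I * ((inner ℝ z.1 z.2 : ℝ) : ℂ)))
    (by fun_prop) (fun z => (norm_cexp_I_mul _).le) v.continuous
    (g := fun x => (starRingEnd ℂ) (g x)) (Complex.continuous_conj.comp cg) v.integrable
    (Complex.conjCLE.toContinuousLinearMap.integrable_comp g.integrable)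
  have i2 := integral_kernel_swap
    (K := fun z : PhSpace n => Complex.exp (-(Complex.I * (φ z : ℂ))) * (starRingEnd ℂ) (a z))
    (Continuous.mul (by fun_prop) (Complex.continuous_conj.comp ca)) (C := C)
    (fun z => by rw [norm_mul, norm_exp_neg_I_mul, one_mul, RCLike.norm_conj]; exact hC z)
    (f := fun ξ => (starRingEnd ℂ) (G ξ)) (Complex.continuous_conj.comp cG) u.continuous
    (Complex.conjCLE.toContinuousLinearMap.integrable_comp G.integrable) u.integrable
  simp only [e1] at i1
  simp only [hII, e2, mul_assoc]
  rw [integral_const_mul, i1]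
  calc _ = ((2 * Real.pi : ℝ) : ℂ)⁻¹ ^ n * ∫ ξ, (starRingEnd ℂ) (G ξ) *
        ∫ y, Complex.exp (-(Complex.I * (φ (y, ξ) : ℂ))) * (starRingEnd ℂ) (a (y, ξ)) * u y := by
        congr 1
        refine integral_congr_ae (Filter.Eventually.of_forall fun ξ => ?_)
        simp only [hv, mul_assoc]
        ring
    _ = _ := by
        rw [← i2, ← integral_const_mul]
        refine integral_congr_ae (Filter.Eventually.of_forall fun y => ?_)
        simp only [mul_assoc]
        ring

theorem eq_of_integral_schwartz_mul_eq {f g : SGSpace n → ℂ} (hf : Continuous f)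
    (hg : Continuous g)
    (h : ∀ u : 𝓢(SGSpace n, ℂ), ∫ x, f x * u x = ∫ x, g x * u x) : f = g := by
  refine (hf.ae_eq_iff_eq (μ := volume) hg).1 (ae_eq_of_integral_contDiff_smul_eq
    hf.locallyIntegrable hg.locallyIntegrable fun ψ hψ hs => ?_)
  have h1 : HasCompactSupport fun x => (ψ x : ℂ) :=
    hs.comp_left (g := fun r : ℝ => (r : ℂ)) Complex.ofReal_zero
  have h2 : ContDiff ℝ ∞ fun x => (ψ x : ℂ) := Complex.ofRealCLM.contDiff.comp hψ
  have h3 := h (h1.toSchwartzMap h2)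
  have e : ∀ f : SGSpace n → ℂ, ∫ x, ψ x • f x = ∫ x, f x * h1.toSchwartzMap h2 x := fun f =>
    integral_congr_ae (Filter.Eventually.of_forall fun x => by
      change ψ x • f x = f x * (ψ x : ℂ)
      rw [Complex.real_smul, mul_comm])
  rw [e, e, h3]

theorem eq_of_integral_mul_conj_eq {f g : SGSpace n → ℂ} (hf : Continuous f)
    (hg : Continuous g) (h : ∀ u : 𝓢(SGSpace n, ℂ),
      ∫ x, f x * (starRingEnd ℂ) (u x) = ∫ x, g x * (starRingEnd ℂ) (u x)) : f = g := by
  refine eq_of_integral_schwartz_mul_eq hf hg fun u => ?_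
  have h1 := h (SchwartzMap.postcompCLM (𝕜 := ℝ) Complex.conjCLE.toContinuousLinearMap u)
  simpa using h1

/-- By adjointness, ⟨I*_{φ₂}I*_{φ₁}u, g⟩ = ⟨u, I_{φ₁}I_{φ₂}g⟩ = ⟨u, Op_ψ(p)g⟩ = ⟨Op*_ψ(p)u, g⟩ for
every Schwartz function g. All functions involved are Schwartz, so each pairing converges. -/
theorem fioOneII_comp {φ₁ φ₂ ψ : PhSpace n → ℝ} (h1 : TamePhase φ₁) (h2 : TamePhase φ₂)
    (hψ : TamePhase ψ) {p : PhSpace n → ℂ} (hp : SGSymbol 0 0 p)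
    (hI : ∀ u : 𝓢(SGSpace n, ℂ), fioOneI φ₁ (fioOneI φ₂ u) = fioI ψ p u) (u : 𝓢(SGSpace n, ℂ)) :
    fioOneII φ₂ (fioOneII φ₁ u) = fioII ψ p u := by
  obtain ⟨v, hv⟩ := h1.exists_fioII (sgSymbol_one n) u
  obtain ⟨w, hw⟩ := h2.exists_fioII (sgSymbol_one n) v
  obtain ⟨w', hw'⟩ := hψ.exists_fioII hp u
  have e : fioOneII φ₂ (fioOneII φ₁ u) = w := by rw [fioOneII, fioOneII, ← hv, hw]
  rw [e, ← hw']
  refine eq_of_integral_mul_conj_eq w.continuous w'.continuous fun g => ?_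
  obtain ⟨k, hk⟩ := h2.exists_fioI (sgSymbol_one n) g
  have e2 := hI g
  rw [fioOneI, fioOneI, ← hk] at e2
  rw [hw, hw', h2.integral_fioII_mul_conj (sgSymbol_one n), hψ.integral_fioII_mul_conj hp,
    ← e2, hv, ← hk, h1.integral_fioII_mul_conj (sgSymbol_one n)]

/-- For fixed x the transform û runs through all Schwartz functions, so e^{iφ(x,·)}p(x, ·) and
e^{iφ(x,·)}q(x, ·) agree as distributions, hence as continuous functions. -/
theorem symbol_eq_of_fioI_eq {p q : PhSpace n → ℂ} (hφ : Continuous φ) (hp : Continuous p)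
    (hq : Continuous q) (h : ∀ u : 𝓢(SGSpace n, ℂ), fioI φ p u = fioI φ q u) : p = q := by
  have hc : ((2 * Real.pi : ℝ) : ℂ)⁻¹ ^ n ≠ 0 :=
    pow_ne_zero _ (inv_ne_zero (Complex.ofReal_ne_zero.2 (by positivity)))
  funext ⟨x, ξ⟩
  have key : (fun ξ => Complex.exp (Complex.I * (φ (x, ξ) : ℂ)) * p (x, ξ)) =
      fun ξ => Complex.exp (Complex.I * (φ (x, ξ) : ℂ)) * q (x, ξ) := by
    refine eq_of_integral_schwartz_mul_eq (by fun_prop) (by fun_prop) fun g => ?_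
    obtain ⟨u, hu⟩ := exists_fourierHat_eq g
    have e := congrFun (h u) x
    simp only [fioI, hu] at e
    exact mul_left_cancel₀ hc e
  exact mul_left_cancel₀ (Complex.exp_ne_zero _) (congrFun key ξ)

end Duality

/-! ### The composition symbol and its bounds -/

section Multiproduct
variable {n : ℕ}

theorem sgBoundedFamily_multiSymbol {ι : Type*} {φ₁ φ₂ : ι → PhSpace n → ℝ}
    (s1 : ∀ s, SmallPert (phasePerturbation (φ₁ s)))
    (s2 : ∀ s, SmallPert (phasePerturbation (φ₂ s)))
    (B1 : SGBoundedFamily 1 1 fun s => phasePerturbation (φ₁ s))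
    (B2 : SGBoundedFamily 1 1 fun s => phasePerturbation (φ₂ s)) :
    SGBoundedFamily 0 0 fun s => multiSymbol (φ₁ s) (φ₂ s) := by
  have h := sgBoundedFamily_iff.1 (sgBoundedFamily_compSymbol s1 s2 B1 B2)
  let T : ℂ →L[ℝ] ℂ := ContinuousLinearMap.mul ℝ ℂ (((2 * Real.pi : ℝ) : ℂ)⁻¹ ^ n)
  exact (sgBoundedFamily_iff (a := fun s => multiSymbol (φ₁ s) (φ₂ s))).2
    ⟨fun s => T.contDiff.comp (h.1 s), fun K =>
      (h.2 K).clm' T fun j => (h.1 _).comp (contDiff_chart _)⟩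

theorem isCompositionSymbol_multiSymbol {φ₁ φ₂ : PhSpace n → ℝ}
    (s1 : SmallPert (phasePerturbation φ₁)) (s2 : SmallPert (phasePerturbation φ₂))
    (h1 : SGSymbol 1 1 φ₁) (h2 : SGSymbol 1 1 φ₂) :
    IsCompositionSymbol φ₁ φ₂ (multiSymbol φ₁ φ₂) := by
  have hp : SGSymbol 0 0 (multiSymbol φ₁ φ₂) :=
    (sgBoundedFamily_multiSymbol (ι := Unit) (φ₁ := fun _ => φ₁) (φ₂ := fun _ => φ₂)
      (fun _ => s1) (fun _ => s2) (h1.phasePerturbation.sgBoundedFamily Unit)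
      (h2.phasePerturbation.sgBoundedFamily Unit)).sgSymbol ()
  exact ⟨hp, fioOneI_comp s1 s2 h1 h2, fioOneII_comp (h1.tamePhase s1) (h2.tamePhase s2)
    (tamePhase_sharp s1 s2 h1 h2) hp (fioOneI_comp s1 s2 h1 h2)⟩

theorem IsCompositionSymbol.unique {φ₁ φ₂ : PhSpace n → ℝ} {p q : PhSpace n → ℂ}
    (hs : Continuous (sharp φ₁ φ₂)) (hp : IsCompositionSymbol φ₁ φ₂ p)
    (hq : IsCompositionSymbol φ₁ φ₂ q) : p = q :=
  symbol_eq_of_fioI_eq hs hp.symbol.smooth.continuous hq.symbol.smooth.continuous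
    fun u => (hp.typeI u).symm.trans (hq.typeI u)

end Multiproduct

end

theorem theorem4p2 (n : ℕ) :
    ∃ τ : ℝ, 0 < τ ∧ τ ≤ 1 / 4 ∧
      (∀ (r : ℝ), 0 < r → ∀ (τ₁ τ₂ : ℝ), 0 ≤ τ₁ → 0 ≤ τ₂ → τ₁ + τ₂ ≤ τ →
        ∀ φ₁ φ₂ : SGSpace n × SGSpace n → ℝ,
          SGRegularPhase r τ₁ φ₁ → SGRegularPhase r τ₂ φ₂ →
            (SharpWellDefined φ₁ φ₂ ∧ SGPhase (sharp φ₁ φ₂)) ∧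
            (MapsSchwartz (fioOneI φ₁) ∧ MapsSchwartz (fioOneI φ₂) ∧
              MapsSchwartz (fioOneII φ₁) ∧ MapsSchwartz (fioOneII φ₂)) ∧
            ∃ p : SGSpace n × SGSpace n → ℂ, IsCompositionSymbol φ₁ φ₂ p) ∧
      (∀ (r : ℝ), 0 < r → ∀ (ι : Type*) (τ₁ τ₂ : ι → ℝ),
        (∀ s, 0 ≤ τ₁ s) → (∀ s, 0 ≤ τ₂ s) → (∀ s, τ₁ s + τ₂ s ≤ τ) →
        ∀ φ₁ φ₂ : ι → SGSpace n × SGSpace n → ℝ,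
          (∀ s, SGRegularPhase r (τ₁ s) (φ₁ s)) → (∀ s, SGRegularPhase r (τ₂ s) (φ₂ s)) →
          SGBoundedFamily 1 1 (fun s => phasePerturbation (φ₁ s)) →
          SGBoundedFamily 1 1 (fun s => phasePerturbation (φ₂ s)) →
          ∀ p : ι → SGSpace n × SGSpace n → ℂ,
            (∀ s, IsCompositionSymbol (φ₁ s) (φ₂ s) (p s)) → SGBoundedFamily 0 0 p) := by
  have hτ : (0 : ℝ) < 1 / (64 * (n + 1) ^ 2) := by positivity
  -- The threshold of `SmallPert.of_sgBound`. As τ₁ and τ₂ are nonnegative, each is below it when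
  -- their sum is.
  refine ⟨1 / (64 * (n + 1) ^ 2), hτ, ?_, ?_, ?_⟩
  · refine one_div_le_one_div_of_le (by norm_num) ?_
    have : (0 : ℝ) ≤ n := Nat.cast_nonneg n
    nlinarith
  · intro r _ τ₁ τ₂ p1 p2 hs φ₁ φ₂ h1 h2
    have s1 := h1.smallPert (by linarith)
    have s2 := h2.smallPert (by linarith)
    have y1 := h1.phase.symbol
    have y2 := h2.phase.symbol
    exact ⟨sgPhase_sharp s1 s2 y1 y2,
      ⟨(y1.tamePhase s1).exists_fioI (sgSymbol_one n), (y2.tamePhase s2).exists_fioI (sgSymbol_one n),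
        (y1.tamePhase s1).exists_fioII (sgSymbol_one n),
        (y2.tamePhase s2).exists_fioII (sgSymbol_one n)⟩,
      multiSymbol φ₁ φ₂, isCompositionSymbol_multiSymbol s1 s2 y1 y2⟩
  · intro r _ ι τ₁ τ₂ p1 p2 hs φ₁ φ₂ h1 h2 B1 B2 p hp
    have s1 := fun s => (h1 s).smallPert (by linarith [p2 s, hs s])
    have s2 := fun s => (h2 s).smallPert (by linarith [p1 s, hs s])
    have y1 := fun s => (h1 s).phase.symbol
    have y2 := fun s => (h2 s).phase.symbol
    -- By uniqueness of the symbol, an arbitrary family satisfying the identities is the constructed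
    -- one.
    obtain rfl : p = fun s => multiSymbol (φ₁ s) (φ₂ s) := funext fun s =>
      (hp s).unique (sgPhase_sharp (s1 s) (s2 s) (y1 s) (y2 s)).2.symbol.smooth.continuous
        (isCompositionSymbol_multiSymbol (s1 s) (s2 s) (y1 s) (y2 s))
    exact sgBoundedFamily_multiSymbol s1 s2 B1 B2
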